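/- **Notation.** Let $d,r\in\mathbb N=\{1,2,\dots\}$, $m\in\mathbb N_0$. An $s\times t$ filter is a finitely supported $u:\mathbb Z^d\to\mathbb C^{s\times t}$, with $\widehat u(\xi)=\sum_k u(k)e^{-ik\cdot\xi}$; convolution of sequences is $[v*w](k)=\sum_z v(k-z)w(z)$; $\delta$ is the Kronecker delta at $0$. For smooth $f,g$, "$f(\xi)=g(\xi)+O(\|\xi\|^n)$, $\xi\to0$" means $\partial^\mu f(0)=\partial^\mu g(0)$ for all $|\mu|<n$ (entrywise for matrices). For an $r\times r$ filter $a$ let $[S_av](k)=2^d\sum_{z\in\mathbb Z^d}v(z)a(k-2z)$. A $1\times r$ filter $y$ is an *order $n$ matching filter* of $a$ if $\widehat y(0)\neq0$ and $\widehat y(2\xi)\widehat a(\xi+2\pi\omega)=\delta(\omega)\widehat y(\xi)+O(\|\xi\|^n)$ for all $\omega\in\{0,\tfrac12\}^d$; if one exists, $a$ has *order $n$ sum rules* with respect to $2I_d$. For such $y$ put $$\rho_n(a,y)=\sup\Big\{\limsup_{N\to\infty}\big\|[S_a^N(\delta I_r)]*w\big\|_{\infty}^{1/N}:\ w \text{ an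 } r\times1\text{ filter},\ \widehat y(\xi)\widehat w(\xi)=O(\|\xi\|^n)\Big\},$$ where $\|\cdot\|_\infty$ is the sum over the entries of their sup norms on $\mathbb Z^d$. Let $\rho(a)$ be the infimum of $\rho_n(a,y)$ over all $n\in\mathbb N_0$ and all order $n$ matching filters $y$ of $a$, and let $\mathrm{sm}_\infty(a)=-\log_2\rho(a)$ ($=+\infty$ if $\rho(a)=0$). Let $\Lambda=(\nu^1,\dots,\nu^r)$ with $\nu^l\in\mathbb N_0^d$, $|\nu^l|\le m$, $\nu^1=0$, and let $\mathfrak m=\max_l|\nu^l|$. The *generalized Hermite subdivision scheme of type $\Lambda$ with filter $a$ is convergent with limit functions in $C^m(\mathbb R^d)$* if for every $1\times r$ filter $v$ there is $\eta_v\in C^m(\mathbb R^d)$ with $$\lim_{n\to\infty}\ \sup_{k\in\mathbb Z^d}\big|2^{|\nu^l|n}\big([S_a^nv](k)\big)_l-\partial^{\nu^l}\eta_v(2^{-n}k)\big|=0,\qquad l=1,\dots,r.$$ **Theorem.** Suppose that $1$ is a simple eigenvalue of $\widehat a(0)$, that $2^n$ is not an eigenvalue of $\widehat a(0)$ for any $n\in\mathbb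 N$, that $a$ has order $\mathfrak m+1$ sum rules with respect to $2I_d$, and that $\upsilon_a$ is an order $\mathfrak m+1$ matching filter of $a$. Then there is a unique vector $\phi=(\phi_1,\dots,\phi_r)^{\mathsf T}$ of compactly supported distributions on $\mathbb R^d$ with $\widehat\phi(2\xi)=\widehat a(\xi)\widehat\phi(\xi)$ for all $\xi\in\mathbb R^d$ and $\widehat{\upsilon_a}(0)\widehat\phi(0)=1$, and the following hold. (1) If the generalized Hermite subdivision scheme of type $\Lambda$ with filter $a$ is convergent with limit functions in $C^m(\mathbb R^d)$, then $\mathrm{sm}_\infty(a)>0$, $\phi\in(C^m(\mathbb R^d))^{r}$ and, up to multiplying $\upsilon_a$ by a nonzero constant, $$\widehat{\upsilon_a}(\xi)=\big[(i\xi)^{\nu^1}+O(\|\xi\|^{|\nu^1|+1}),\ \dots,\ (i\xi)^{\nu^r}+O(\|\xi\|^{|\nu^r|+1})\big],\quad \xi\to0.\tag{H}$$ If, in addition, $\phi$ has stable integer shifts, i.e. $\mathrm{span}\{\widehat\phi(\xi+2\pi k):k\in\mathbb Z^d\}=\mathbb C^{r}$ for every $\xi\in\mathbb R^d$, then $\mathrm{sm}_\infty(a)>m$.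 (2) If $\mathrm{sm}_\infty(a)>\mathfrak m$, $\phi\in(C^m(\mathbb R^d))^{r}$ and $\upsilon_a$ satisfies (H), then the generalized Hermite subdivision scheme of type $\Lambda$ with filter $a$ is convergent with limit functions in $C^m(\mathbb R^d)$. -/

import Mathlib

open Filter Topology MeasureTheory
open scoped ENNReal ContDiff Matrix

noncomputable section

namespace GHSD

/-! ### Partial derivatives and the order notation -/

/-- The order `|μ| = μ₁ + ⋯ + μ_d` of a multi-index. -/
def order {d : ℕ} (μ : Fin d → ℕ) : ℕ := ∑ j, μ j

/-- The partial derivative `∂_j f`. -/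
def pd {d : ℕ} (j : Fin d) (f : (Fin d → ℝ) → ℂ) : (Fin d → ℝ) → ℂ :=
  fun x => fderiv ℝ f x (Pi.single j 1)

/-- The operator `∂^μ = ∂₁^{μ₁} ⋯ ∂_d^{μ_d}`. -/
def partialDeriv {d : ℕ} (μ : Fin d → ℕ) (f : (Fin d → ℝ) → ℂ) : (Fin d → ℝ) → ℂ :=
  (List.finRange d).foldr (fun j g => (pd j)^[μ j] g) f

/-- `f(ξ) = g(ξ) + O(‖ξ‖^n)` as `ξ → 0`, for smooth `f` and `g`: all partial derivatives of
order less than `n` agree at the origin. -/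
def EqOrder {d : ℕ} (n : ℕ) (f g : (Fin d → ℝ) → ℂ) : Prop :=
  ∀ μ : Fin d → ℕ, order μ < n → partialDeriv μ f 0 = partialDeriv μ g 0

/-- Entrywise version of `EqOrder` for matrices of smooth functions. -/
def MatEqOrder {d s t : ℕ} (n : ℕ) (F G : (Fin d → ℝ) → Matrix (Fin s) (Fin t) ℂ) : Prop :=
  ∀ i j, EqOrder n (fun ξ => F ξ i j) (fun ξ => G ξ i j)

/-! ### Filters, Fourier series, subdivision -/

/-- `s × t` matrix-valued `d`-dimensional filters: finitely supported sequences on `ℤ^d`. -/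
abbrev MFilter (d s t : ℕ) : Type := (Fin d → ℤ) →₀ Matrix (Fin s) (Fin t) ℂ

/-- The Fourier series `û(ξ) = ∑ₖ u(k) e^{-i k·ξ}`. -/
def symbol {d s t : ℕ} (u : MFilter d s t) (ξ : Fin d → ℝ) : Matrix (Fin s) (Fin t) ℂ :=
  u.sum fun k U => Complex.exp (-Complex.I * ((∑ j, (k j : ℝ) * ξ j : ℝ) : ℂ)) • U

/-- The subdivision operator `[S_{a,2I_d} v](k) = 2^d ∑_z v(z) a(k - 2z)`. Since `a` is finitely
supported, the sum has only finitely many nonzero terms. -/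
def subdiv {d r s : ℕ} (a : MFilter d r r) (v : (Fin d → ℤ) → Matrix (Fin s) (Fin r) ℂ) :
    (Fin d → ℤ) → Matrix (Fin s) (Fin r) ℂ :=
  fun k => (2 : ℂ) ^ d • ∑ᶠ z : Fin d → ℤ, v z * a (k - 2 • z)

/-- The convolution `[v * w](k) = ∑_z v(k - z) w(z)` with a filter `w`. -/
def conv {d s r t : ℕ} (v : (Fin d → ℤ) → Matrix (Fin s) (Fin r) ℂ) (w : MFilter d r t) :
    (Fin d → ℤ) → Matrix (Fin s) (Fin t) ℂ :=
  fun k => w.sum fun z W => v (k - z) * W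

/-- The sequence `δ I_r`. -/
def deltaI (d r : ℕ) : (Fin d → ℤ) → Matrix (Fin r) (Fin r) ℂ := Pi.single 0 1

/-- The norm of `(l_∞(ℤ^d))^{s × t}`: the sum of the sup norms of the entries. -/
def normInf {d s t : ℕ} (v : (Fin d → ℤ) → Matrix (Fin s) (Fin t) ℂ) : ℝ≥0∞ :=
  ∑ i, ∑ j, ⨆ k, ‖v k i j‖ₑ

/-! ### Sum rules and the `L_∞`-smoothness exponent -/

/-- `y` is an order `n` matching filter of `a`, i.e. `a` has order `n` sum rules with respect to
`2 I_d` with `y`: `ŷ(0) ≠ 0` and, for all `w ∈ {0, 1/2}^d`,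
`ŷ(2ξ) â(ξ + 2πw) = δ(w) ŷ(ξ) + O(‖ξ‖^n)` as `ξ → 0`. -/
def IsMatchingFilter {d r : ℕ} (a : MFilter d r r) (n : ℕ) (y : MFilter d 1 r) : Prop :=
  symbol y 0 ≠ 0 ∧
    ∀ w : Fin d → ℝ, (∀ j, w j = 0 ∨ w j = 1 / 2) →
      MatEqOrder n
        (fun ξ => symbol y ((2 : ℝ) • ξ) * symbol a (ξ + (2 * Real.pi) • w))
        (fun ξ => if w = 0 then symbol y ξ else 0)

/-- The set `V_{n-1,y}` of all `w` with `ŷ(ξ) ŵ(ξ) = O(‖ξ‖^n)`; for `n = 0` there is no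
condition on `w`. -/
def vanishSet {d r : ℕ} (n : ℕ) (y : MFilter d 1 r) : Set (MFilter d r 1) :=
  {w | MatEqOrder n (fun ξ => symbol y ξ * symbol w ξ) (fun _ => 0)}

/-- `ρ_n(a, 2I_d, y)_∞`. -/
def rhoAux {d r : ℕ} (a : MFilter d r r) (n : ℕ) (y : MFilter d 1 r) : ℝ≥0∞ :=
  ⨆ w ∈ vanishSet n y,
    limsup (fun N : ℕ => normInf (conv ((subdiv a)^[N] (deltaI d r)) w) ^ (1 / (N : ℝ))) atTop

/-- `ρ(a, 2I_d)_∞`, the infimum of `ρ_n(a, 2I_d, y)_∞` over all orders `n` of sum rules of `a`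
and all order `n` matching filters `y` (such an `n` never exceeds the largest order of sum rules
of `a`). -/
def rho {d r : ℕ} (a : MFilter d r r) : ℝ≥0∞ :=
  ⨅ (n : ℕ) (y : MFilter d 1 r) (_ : IsMatchingFilter a n y), rhoAux a n y

/-- The `L_∞`-smoothness exponent `sm_∞(a, 2I_d) = - log₂ ρ(a, 2I_d)_∞`
(equal to `+∞` if `ρ(a, 2I_d)_∞ = 0`). -/
def smInf {d r : ℕ} (a : MFilter d r r) : EReal :=
  -(ENNReal.log (rho a) / ((Real.log 2 : ℝ) : EReal))

/-! ### Compactly supported distributions -/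

/-- The space `C^∞(ℝ^d)` of complex-valued smooth functions. -/
def smoothFns (d : ℕ) : Submodule ℂ ((Fin d → ℝ) → ℂ) where
  carrier := {f | ContDiff ℝ ∞ f}
  add_mem' {f g} (hf : ContDiff ℝ ∞ f) (hg : ContDiff ℝ ∞ g) := ContDiff.add hf hg
  zero_mem' := (contDiff_const : ContDiff ℝ ∞ fun _ : Fin d → ℝ => (0 : ℂ))
  smul_mem' c f (hf : ContDiff ℝ ∞ f) := ContDiff.const_smul c hf

/-- Compactly supported distributions on `ℝ^d`, as the continuous dual of `C^∞(ℝ^d)` with its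
usual Fréchet topology: linear functionals bounded by finitely many derivatives on a ball. -/
@[ext]
structure CSDist (d : ℕ) where
  /-- the action on smooth functions -/
  toLin : smoothFns d →ₗ[ℂ] ℂ
  bounded : ∃ (C R : ℝ) (N : ℕ), ∀ (f : smoothFns d) (M : ℝ),
    (∀ j ≤ N, ∀ x : Fin d → ℝ, ‖x‖ ≤ R → ‖iteratedFDeriv ℝ j (f : (Fin d → ℝ) → ℂ) x‖ ≤ M) →
      ‖toLin f‖ ≤ C * M

/-- The smooth function `x ↦ e^{-i x·ξ}`. -/
def expFn {d : ℕ} (ξ : Fin d → ℝ) : smoothFns d :=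
  ⟨fun x => Complex.exp (-Complex.I * ((∑ j, x j * ξ j : ℝ) : ℂ)), by
    change ContDiff ℝ ∞ _
    have h0 : ContDiff ℝ ∞ fun x : Fin d → ℝ => ∑ j, x j * ξ j :=
      ContDiff.sum fun j _ => (contDiff_apply ℝ ℝ j).mul contDiff_const
    have h : ContDiff ℝ ∞ fun x : Fin d → ℝ => ((∑ j, x j * ξ j : ℝ) : ℂ) :=
      Complex.ofRealCLM.contDiff.comp h0
    exact (contDiff_const.mul h).cexp⟩

/-- The Fourier transform `φ̂(ξ) = ⟨φ, e^{-i x·ξ}⟩` of a vector of compactly supported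
distributions. -/
def fourierVec {d r : ℕ} (φ : Fin r → CSDist d) (ξ : Fin d → ℝ) : Fin r → ℂ :=
  fun i => (φ i).toLin (expFn ξ)

/-- `T` is (given by integration against) a compactly supported `C^m` function. -/
def CSDist.IsCm {d : ℕ} (m : ℕ) (T : CSDist d) : Prop :=
  ∃ g : (Fin d → ℝ) → ℂ, ContDiff ℝ m g ∧ HasCompactSupport g ∧
    ∀ f : smoothFns d, T.toLin f = ∫ x, (f : (Fin d → ℝ) → ℂ) x * g x

/-- `φ̂(2ξ) = â(ξ) φ̂(ξ)` for all `ξ`, and `υ̂(0) φ̂(0) = 1`. -/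
def IsStdRefinable {d r : ℕ} (a : MFilter d r r) (υ : MFilter d 1 r) (φ : Fin r → CSDist d) :
    Prop :=
  (∀ ξ : Fin d → ℝ, fourierVec φ ((2 : ℝ) • ξ) = symbol a ξ *ᵥ fourierVec φ ξ) ∧
    symbol υ 0 *ᵥ fourierVec φ 0 = 1

/-- `φ` has stable integer shifts: the vectors `φ̂(ξ + 2πk)`, `k ∈ ℤ^d`, span `ℂ^r` for
every `ξ`. -/
def HasStableShifts {d r : ℕ} (φ : Fin r → CSDist d) : Prop :=
  ∀ ξ : Fin d → ℝ, Submodule.span ℂ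
    (Set.range fun k : Fin d → ℤ => fourierVec φ (ξ + fun j => 2 * Real.pi * (k j : ℝ))) = ⊤

/-! ### Generalized Hermite subdivision schemes -/

/-- The generalized Hermite subdivision scheme of type `ν = (ν¹, …, ν^r)` with filter `a` is
convergent with limit functions in `C^m(ℝ^d)`. -/
def HermiteConvergent {d r : ℕ} (m : ℕ) (ν : Fin r → Fin d → ℕ) (a : MFilter d r r) : Prop :=
  ∀ v : MFilter d 1 r, ∃ η : (Fin d → ℝ) → ℂ, ContDiff ℝ m η ∧
    ∀ l : Fin r, Tendsto
      (fun n : ℕ => ⨆ k : Fin d → ℤ,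
        ‖(2 : ℂ) ^ (order (ν l) * n) * ((subdiv a)^[n] v) k 0 l
          - partialDeriv (ν l) η (fun j => (k j : ℝ) / 2 ^ n)‖ₑ)
      atTop (𝓝 0)

/-- `υ̂(ξ) = [(iξ)^{ν¹} + O(‖ξ‖^{|ν¹|+1}), …, (iξ)^{ν^r} + O(‖ξ‖^{|ν^r|+1})]` as `ξ → 0`. -/
def HasHermiteForm {d r : ℕ} (ν : Fin r → Fin d → ℕ) (υ : MFilter d 1 r) : Prop :=
  ∀ l : Fin r, EqOrder (order (ν l) + 1) (fun ξ => symbol υ ξ 0 l)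
    (fun ξ => ∏ j, (Complex.I * (ξ j : ℂ)) ^ ν l j)

/-- `𝔪 = max {|ν¹|, …, |ν^r|}`. -/
def maxOrder {d r : ℕ} (ν : Fin r → Fin d → ℕ) : ℕ := Finset.univ.sup fun l => order (ν l)

end GHSD

end

open GHSD

noncomputable section

namespace GHSD

/-! ### Lattice points -/

/-! The argument works with polynomials instead of symbols. Derivatives of a trigonometric
polynomial at the origin are moments of its coefficients, so every relation modulo O(‖ξ‖^n) is an
identity tested on polynomials of degree less than n (`eqOrder_expSum_iff`). In this language, sum
rules of order n with matching filter y say that subdivision sends the sequence p * y to p(·/2) * y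
whenever deg p < n (`isMatchingFilter_iff`), and (H) says that the l-th entry of p * υ at 0 is
∂^{ν_l} p(0) whenever deg p ≤ |ν_l| (`hasHermiteForm_iff`).

Existence and uniqueness of φ. As a functional, φ is a fixed point of L ↦ ∑ a(k) L(f((· + k)/2)). In
degree D the dilation acts as 2^{-D} modulo lower degree. Since 2^D is not an eigenvalue of â(0) for
D ≥ 1, a fixed functional on polynomials is determined by its value at 1. On functionals killing all
polynomials of degree below n, the operator is a contraction once n is large. Iterating from a
combination of point evaluations that is already fixed on polynomials gives existence
(`exists_refineOp_fixed`), and the same contraction gives uniqueness (`refineOp_fixed_eq_zero`). The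
Fourier form of the equation is equivalent to the functional form because a compactly supported
distribution with zero Fourier transform vanishes (`CSDist.eq_zero_of_fourier`).

The exponent. Subdivision is dual to the transition operator `trans`, which preserves V_{n,y} and
after many steps moves all supports into one fixed ball. By finite dimensionality, decay o(2^{-sN})
on V_{n,y} improves to a geometric rate strictly better than 2^{-s} (`exists_uniform_decay`). Thus s
< sm_∞(a) exactly when o(2^{-sN}) decay holds on some V_{n,y} (`lt_smInf_of_decays`,
`exists_decays_of_lt_smInf`).

Part (2). Refinable functions reproduce polynomials (`synth_polyConv`). The limit function for data
v is ∑ v(k) φ(· - k), and the error in the l-th component is the convolution of S_a^N v with one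
fixed filter. By (H) and reproduction this filter annihilates p * υ for deg p ≤ |ν_l|. The decay is
known on V_{n,y} for some other matching filter y of unrelated order n; y agrees with υ up to a
constant where both apply (`exists_polyConv_eq_smul`), and decay passes from V_n to larger V_i at a
slower rate (`decays_of_mem_vanishSub`).

Part (1). The limits of the data δe_i form a compactly supported C^m refinable vector G, a nonzero
multiple of φ. Running the scheme on p * υ and comparing sum rules with the limit yields (H)
(`MaskLimit.polyConv_apply`); decay of order 0 yields sm_∞(a) > 0. For stable shifts the Gram matrix
is invertible on the torus, so the masks can be recovered from G_i with control of polynomial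
growth. They are then locally Taylor polynomials of G_i convolved with a dual filter y, up to
o(2^{-mN}) (`eventually_mask_approx`). This forces y to be a matching filter of order m + 1 and
gives decay o(2^{-mN}) on its V_{m+1,y}. -/

/-- A lattice point regarded as a point of `ℝ^d`. -/
def castVec {d : ℕ} (k : Fin d → ℤ) : Fin d → ℝ := fun j => (k j : ℝ)

@[simp] lemma castVec_apply {d : ℕ} (k : Fin d → ℤ) (j : Fin d) : castVec k j = (k j : ℝ) := rfl
lemma castVec_add {d : ℕ} (k l : Fin d → ℤ) : castVec (k + l) = castVec k + castVec l := by
  ext j; simp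
lemma castVec_sub {d : ℕ} (k l : Fin d → ℤ) : castVec (k - l) = castVec k - castVec l := by
  ext j; simp
lemma castVec_neg {d : ℕ} (k : Fin d → ℤ) : castVec (-k) = -castVec k := by
  ext j; simp
@[simp] lemma castVec_zero {d : ℕ} : castVec (0 : Fin d → ℤ) = 0 := by
  ext j; simp
lemma castVec_two_pow_smul {d : ℕ} (N : ℕ) (k : Fin d → ℤ) :
    castVec (2 ^ N • k) = (2 : ℝ) ^ N • castVec k := by
  ext j; simp
lemma castVec_two_smul {d : ℕ} (k : Fin d → ℤ) : castVec (2 • k) = (2 : ℝ) • castVec k := by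
  ext j; simp

lemma norm_castVec {d : ℕ} (k : Fin d → ℤ) : ‖castVec k‖ = ‖k‖ := by
  simp [Pi.norm_def, castVec]; rfl

/-- The lattice points of sup norm at most `n`. -/
def box (d n : ℕ) : Finset (Fin d → ℤ) := Finset.Icc (fun _ => -(n : ℤ)) (fun _ => (n : ℤ))

lemma mem_box {d n : ℕ} {k : Fin d → ℤ} : k ∈ box d n ↔ ‖k‖ ≤ n := by
  rw [pi_norm_le_iff_of_nonneg (Nat.cast_nonneg n), box, Finset.mem_Icc, Pi.le_def, Pi.le_def,
    ← forall_and]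
  refine forall_congr' fun j => ?_
  rw [Int.norm_eq_abs, abs_le]
  norm_cast

lemma card_box (d n : ℕ) : (box d n).card = (2 * n + 1) ^ d := by
  rw [box, Pi.card_Icc]
  simp only [Int.card_Icc, Finset.prod_const, Finset.card_univ, Fintype.card_fin]
  congr 1; omega

lemma norm_two_pow_smul {d : ℕ} (N : ℕ) (k : Fin d → ℤ) :
    ‖(2 ^ N • k : Fin d → ℤ)‖ = 2 ^ N * ‖k‖ := by
  rw [← norm_castVec, castVec_two_pow_smul, norm_smul, norm_castVec]; simp

lemma norm_le_of_norm_sub_le {d : ℕ} {N : ℕ} {k z : Fin d → ℤ} {C D : ℝ} (h : ‖k - 2 ^ N • z‖ ≤ 2 ^ N * D) (hk : ‖k‖ ≤ 2 ^ N * C) : ‖z‖ ≤ C + D := by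
  have h1 : ‖(2 ^ N • z : Fin d → ℤ)‖ ≤ ‖k‖ + ‖k - 2 ^ N • z‖ := by
    have := norm_sub_le k (k - 2 ^ N • z)
    simpa using this
  rw [norm_two_pow_smul] at h1
  have : (0 : ℝ) < 2 ^ N := by positivity
  have h2 : (2 : ℝ) ^ N * ‖z‖ ≤ 2 ^ N * (C + D) := by linarith
  exact le_of_mul_le_mul_left h2 this

/-- Division with remainder by `2^N` in `ℤ^d`. -/
lemma exists_eq_two_pow_smul_add {d : ℕ} (N : ℕ) (k : Fin d → ℤ) :
    ∃ q ε : Fin d → ℤ, k = 2 ^ N • q + ε ∧ ∀ j, 0 ≤ ε j ∧ ε j < 2 ^ N := by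
  refine ⟨fun j => k j / 2 ^ N, fun j => k j % 2 ^ N, ?_, fun j =>
    ⟨Int.emod_nonneg _ (by positivity), Int.emod_lt_of_pos _ (by positivity)⟩⟩
  ext j
  simp [Int.mul_ediv_add_emod]

lemma norm_le_of_lt_two_pow {d N : ℕ} {ε : Fin d → ℤ} (h : ∀ j, 0 ≤ ε j ∧ ε j < 2 ^ N) :
    ‖ε‖ ≤ 2 ^ N := by
  rw [pi_norm_le_iff_of_nonneg (by positivity)]
  intro j
  rw [Int.norm_eq_abs, abs_of_nonneg (by exact_mod_cast (h j).1)]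
  exact_mod_cast (h j).2.le

/-! ### Support radius of a filter -/

/-- A radius of a ball containing the support of `u`. -/
def radius {d s t : ℕ} (u : MFilter d s t) : ℕ := u.support.sup fun k => ⌈‖k‖⌉₊

lemma norm_le_radius {d s t : ℕ} {u : MFilter d s t} {k : Fin d → ℤ} (h : u k ≠ 0) :
    ‖k‖ ≤ radius u := by
  have h1 : ⌈‖k‖⌉₊ ≤ radius u :=
    Finset.le_sup (f := fun k : Fin d → ℤ => ⌈‖k‖⌉₊) (Finsupp.mem_support_iff.2 h)
  exact (Nat.le_ceil _).trans (by exact_mod_cast h1)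

/-! ### Subdivision -/

section Subdivision
variable {d r s t : ℕ}

lemma subdiv_eq_sum (a : MFilter d r r) (v : (Fin d → ℤ) → Matrix (Fin s) (Fin r) ℂ)
    {k : Fin d → ℤ} {B : Finset (Fin d → ℤ)} (hB : ∀ z, a (k - 2 • z) ≠ 0 → z ∈ B) :
    subdiv a v k = (2 : ℂ) ^ d • ∑ z ∈ B, v z * a (k - 2 • z) := by
  rw [subdiv, finsum_eq_sum_of_support_subset]
  intro z hz
  refine hB z fun h => hz ?_
  beta_reduce
  rw [h, Matrix.mul_zero]

lemma mem_box_of_mask_one {a : MFilter d r r} {k z : Fin d → ℤ} {n : ℕ} (hk : ‖k‖ ≤ n)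
    (h : a (k - 2 • z) ≠ 0) : z ∈ box d (n + radius a) := by
  rw [mem_box]
  have h1 := norm_le_radius h
  have h2 : ‖(2 • z : Fin d → ℤ)‖ ≤ ‖k‖ + ‖k - 2 • z‖ := by
    have := norm_sub_le k (k - 2 • z); simpa using this
  have h3 := norm_two_pow_smul 1 z
  simp only [pow_one] at h3
  rw [h3] at h2
  push_cast
  have := norm_nonneg z
  linarith

/-- The `N`-th iterated mask `S_a^N (δ I_r)`. -/
def mask (a : MFilter d r r) (N : ℕ) : (Fin d → ℤ) → Matrix (Fin r) (Fin r) ℂ :=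
  (subdiv a)^[N] (deltaI d r)

lemma mask_succ (a : MFilter d r r) (N : ℕ) : mask a (N + 1) = subdiv a (mask a N) := by
  rw [mask, Function.iterate_succ_apply', ← mask]

/-- The factor 2^N - 1, rather than 2^N, is what the recursion ρ_{N+1} = 2ρ_N + radius produces and
what makes the induction close. -/
lemma norm_le_of_mask_ne_zero' (a : MFilter d r r) (N : ℕ) (k : Fin d → ℤ) (h : mask a N k ≠ 0) :
    ‖k‖ ≤ (2 ^ N - 1) * radius a := by
  induction N generalizing k with
  | zero =>
    have : k = 0 := by
      by_contra hk
      exact h (by simp [mask, deltaI, hk])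
    simp [this]
  | succ N ih =>
    have : ∃ z, mask a N z ≠ 0 ∧ a (k - 2 • z) ≠ 0 := by
      by_contra! hc
      apply h
      rw [mask_succ, subdiv, finsum_eq_zero_of_forall_eq_zero, smul_zero]
      intro z
      by_cases hz : mask a N z = 0
      · rw [hz, Matrix.zero_mul]
      · rw [hc z hz, Matrix.mul_zero]
    obtain ⟨z, hz, haz⟩ := this
    have h1 := ih z hz
    have h2 := norm_le_radius haz
    have h3 : ‖k‖ ≤ ‖k - 2 • z‖ + ‖(2 • z : Fin d → ℤ)‖ := by
      have := norm_add_le (k - 2 • z) (2 • z); simpa using this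
    have h4 := norm_two_pow_smul 1 z
    simp only [pow_one] at h4
    rw [h4] at h3
    rw [pow_succ]
    linarith

lemma norm_le_of_mask_ne_zero {a : MFilter d r r} {N : ℕ} {k : Fin d → ℤ} (h : mask a N k ≠ 0) :
    ‖k‖ ≤ 2 ^ N * radius a := by
  refine (norm_le_of_mask_ne_zero' a N k h).trans ?_
  have : (0 : ℝ) ≤ radius a := Nat.cast_nonneg _
  nlinarith

lemma mem_box_of_mask {a : MFilter d r r} {N n : ℕ} {k z : Fin d → ℤ} (hk : ‖k‖ ≤ 2 ^ N * n)
    (h : mask a N (k - 2 ^ N • z) ≠ 0) : z ∈ box d (n + radius a) := by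
  rw [mem_box]
  push_cast
  exact norm_le_of_norm_sub_le (norm_le_of_mask_ne_zero h) hk

lemma exists_norm_le_two_pow_mul (N : ℕ) (k : Fin d → ℤ) : ∃ n : ℕ, ‖k‖ ≤ 2 ^ N * n := by
  obtain ⟨n, hn⟩ := exists_nat_ge ‖k‖
  refine ⟨n, hn.trans ?_⟩
  have : (1 : ℝ) ≤ 2 ^ N := one_le_pow₀ (by norm_num)
  have h0 : (0 : ℝ) ≤ n := Nat.cast_nonneg _
  nlinarith

/-- Subdivision is linear and turns a shift by z into a shift by 2z, so all iterates are governed by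
the masks. The finite set `B` is arbitrary, so that each use can choose one that is uniform in its
other variables. -/
lemma iterate_subdiv_eq_sum (a : MFilter d r r) (v : (Fin d → ℤ) → Matrix (Fin s) (Fin r) ℂ)
    (N : ℕ) {k : Fin d → ℤ} {B : Finset (Fin d → ℤ)}
    (hB : ∀ z, mask a N (k - 2 ^ N • z) ≠ 0 → z ∈ B) :
    (subdiv a)^[N] v k = ∑ z ∈ B, v z * mask a N (k - 2 ^ N • z) := by
  induction N generalizing k B with
  | zero =>
    -- For r = 0 the identity matrix is zero and the hypothesis cannot place k in B; there are then
    -- no entries to compare.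
    by_cases hr : r = 0
    · subst hr
      ext i j
      exact j.elim0
    · have hk : k ∈ B := hB k (by
        have : NeZero r := ⟨hr⟩
        simp [mask, deltaI])
      rw [Finset.sum_eq_single_of_mem k hk]
      · simp [mask, deltaI]
      · intro z _ hz
        have : k - z ≠ 0 := sub_ne_zero.2 hz.symm
        simp [mask, deltaI, this]
  | succ N ih =>
    obtain ⟨n, hn⟩ := exists_nat_ge ‖k‖
    have hB1 : ∀ z, a (k - 2 • z) ≠ 0 → z ∈ box d (n + radius a) :=
      fun z hz => mem_box_of_mask_one hn hz
    rw [Function.iterate_succ_apply', subdiv_eq_sum a _ hB1]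
    set m := n + radius a with hm
    have hin : ∀ z ∈ box d m, (subdiv a)^[N] v z
        = ∑ q ∈ B ∪ box d (m + radius a), v q * mask a N (z - 2 ^ N • q) := by
      intro z hz
      apply ih
      intro q hq
      refine Finset.mem_union_right _ (mem_box_of_mask ?_ hq)
      have h1 := mem_box.1 hz
      have : (1 : ℝ) ≤ 2 ^ N := one_le_pow₀ (by norm_num)
      have h0 : (0 : ℝ) ≤ m := Nat.cast_nonneg _
      nlinarith
    rw [Finset.sum_congr rfl fun z hz => by rw [hin z hz]]
    simp_rw [Matrix.sum_mul, Matrix.mul_assoc]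
    rw [Finset.sum_comm, Finset.smul_sum]
    have hsub := Finset.subset_union_left (s₁ := B) (s₂ := box d (m + radius a))
    -- Substituting z ↦ z - 2^N q turns the inner sum into one subdivision step applied to the N-th
    -- mask.
    have hterm : ∀ q, (2 : ℂ) ^ d • ∑ z ∈ box d m, v q * (mask a N (z - 2 ^ N • q) * a (k - 2 • z))
        = v q * mask a (N + 1) (k - 2 ^ (N + 1) • q) := by
      intro q
      rw [mask_succ, subdiv_eq_sum a (mask a N) (B := (box d m).image fun z => z - 2 ^ N • q)]
      · rw [Finset.sum_image (by intro x _ y _ h; simpa using h), ← Matrix.mul_sum, Matrix.mul_smul]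
        congr 2
        refine Finset.sum_congr rfl fun z _ => ?_
        congr 2
        rw [pow_succ]; ext j; simp; ring
      · intro z hz
        refine Finset.mem_image.2 ⟨z + 2 ^ N • q, hB1 _ ?_, by simp⟩
        convert hz using 2
        rw [pow_succ]; ext j; simp; ring
    simp_rw [hterm]
    symm
    refine Finset.sum_subset hsub ?_
    intro z _ hz
    have hz' : mask a (N + 1) (k - 2 ^ (N + 1) • z) = 0 := by
      by_contra h; exact hz (hB z h)
    rw [hz', Matrix.mul_zero]

lemma mask_add (a : MFilter d r r) (M N : ℕ) : mask a (M + N) = (subdiv a)^[N] (mask a M) := by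
  rw [mask, add_comm, Function.iterate_add_apply, mask]

/-! ### Convolution -/

lemma conv_eq_sum (v : (Fin d → ℤ) → Matrix (Fin s) (Fin r) ℂ) (w : MFilter d r t)
    (k : Fin d → ℤ) {B : Finset (Fin d → ℤ)} (hB : ∀ z, w z ≠ 0 → z ∈ B) :
    conv v w k = ∑ z ∈ B, v (k - z) * w z := by
  rw [conv, Finsupp.sum_of_support_subset]
  · intro z hz; exact hB z (Finsupp.mem_support_iff.1 hz)
  · simp

lemma conv_eq_sum' (v : (Fin d → ℤ) → Matrix (Fin s) (Fin r) ℂ) (w : MFilter d r t)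
    (k : Fin d → ℤ) {B : Finset (Fin d → ℤ)} (hB : ∀ q, w (k - q) ≠ 0 → q ∈ B) :
    conv v w k = ∑ q ∈ B, v q * w (k - q) := by
  rw [conv_eq_sum v w k (B := B.image fun q => k - q)]
  · rw [Finset.sum_image (by intro x _ y _ h; simpa using h)]
    simp
  · intro z hz
    exact Finset.mem_image.2 ⟨k - z, hB _ (by simpa using hz), by simp⟩

lemma conv_add (v : (Fin d → ℤ) → Matrix (Fin s) (Fin r) ℂ) (w w' : MFilter d r t) :
    conv v (w + w') = conv v w + conv v w' := by
  ext k : 1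
  rw [Pi.add_apply, conv, conv, conv, Finsupp.sum_add_index'] <;> simp [Matrix.mul_add]

lemma conv_smul (v : (Fin d → ℤ) → Matrix (Fin s) (Fin r) ℂ) (c : ℂ) (w : MFilter d r t) :
    conv v (c • w) = c • conv v w := by
  ext k : 1
  rw [Pi.smul_apply, conv, conv, Finsupp.sum_smul_index' (by simp), Finsupp.smul_sum]
  simp

lemma conv_zero (v : (Fin d → ℤ) → Matrix (Fin s) (Fin r) ℂ) :
    conv v (0 : MFilter d r t) = 0 := by
  ext k : 1
  simp [conv]

lemma conv_sub (v : (Fin d → ℤ) → Matrix (Fin s) (Fin r) ℂ) (w w' : MFilter d r t) :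
    conv v (w - w') = conv v w - conv v w' := by
  rw [sub_eq_add_neg, ← neg_one_smul ℂ w', conv_add, conv_smul, neg_one_smul, sub_eq_add_neg]

lemma conv_single (v : (Fin d → ℤ) → Matrix (Fin s) (Fin r) ℂ) (z : Fin d → ℤ)
    (W : Matrix (Fin r) (Fin t) ℂ) (k : Fin d → ℤ) :
    conv v (Finsupp.single z W) k = v (k - z) * W := by
  rw [conv, Finsupp.sum_single_index (by simp)]

/-- Convolution with a fixed sequence, as a linear map in the filter. -/
def convLin (v : (Fin d → ℤ) → Matrix (Fin s) (Fin r) ℂ) (k : Fin d → ℤ) :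
    MFilter d r t →ₗ[ℂ] Matrix (Fin s) (Fin t) ℂ where
  toFun w := conv v w k
  map_add' w w' := by rw [conv_add]; rfl
  map_smul' c w := by rw [conv_smul]; rfl

lemma norm_le_of_conv_mask_ne_zero {a : MFilter d r r} {N : ℕ} {w : MFilter d r t}
    {k : Fin d → ℤ} (h : conv (mask a N) w k ≠ 0) : ‖k‖ ≤ 2 ^ N * radius a + radius w := by
  have : ∃ z, mask a N (k - z) ≠ 0 ∧ w z ≠ 0 := by
    by_contra! hc
    apply h
    rw [conv]
    refine Finset.sum_eq_zero fun z hz => ?_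
    by_cases hm : mask a N (k - z) = 0
    · simp [hm]
    · exact absurd (hc z hm) (Finsupp.mem_support_iff.1 hz)
  obtain ⟨z, h1, h2⟩ := this
  have h3 := norm_le_of_mask_ne_zero h1
  have h4 := norm_le_radius h2
  have : ‖k‖ ≤ ‖k - z‖ + ‖z‖ := by
    have := norm_add_le (k - z) z; simpa using this
  linarith

/-- After division by 2^N, a filter with radius w ≤ 2^N and a residue with ‖ε‖ ≤ 2^N give a support
inside the ball of radius `radius a + 2`, whatever w was. This compactness reduces decay to a
finite-dimensional question. -/
lemma trans_support_bound {a : MFilter d r r} {N : ℕ} {ε : Fin d → ℤ} {w : MFilter d r t}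
    {k : Fin d → ℤ} (h : conv (mask a N) w (2 ^ N • k + ε) ≠ 0) :
    2 ^ N * ‖k‖ ≤ 2 ^ N * radius a + radius w + ‖ε‖ := by
  have h1 := norm_le_of_conv_mask_ne_zero h
  have h2 : ‖(2 ^ N • k : Fin d → ℤ)‖ ≤ ‖2 ^ N • k + ε‖ + ‖ε‖ := by
    have := norm_sub_le (2 ^ N • k + ε) ε; simpa using this
  rw [norm_two_pow_smul] at h2
  linarith

lemma trans_support_finite (a : MFilter d r r) (N : ℕ) (ε : Fin d → ℤ) (w : MFilter d r t) :
    (Function.support fun k : Fin d → ℤ => conv (mask a N) w (2 ^ N • k + ε)).Finite := by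
  obtain ⟨n, hn⟩ := exists_nat_ge (2 ^ N * radius a + radius w + ‖ε‖ : ℝ)
  refine (box d n).finite_toSet.subset fun k hk => ?_
  have h1 := trans_support_bound hk
  refine mem_box.2 (le_trans ?_ hn)
  refine le_trans ?_ h1
  have : (1 : ℝ) ≤ 2 ^ N := one_le_pow₀ (by norm_num)
  have h0 := norm_nonneg k
  nlinarith

/-- The transition operator: the subsampled sequence `k ↦ [S_a^N(δ I_r) * w](2^N k + ε)`. -/
def trans (a : MFilter d r r) (N : ℕ) (ε : Fin d → ℤ) (w : MFilter d r t) : MFilter d r t :=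
  Finsupp.ofSupportFinite _ (trans_support_finite a N ε w)

lemma trans_apply (a : MFilter d r r) (N : ℕ) (ε : Fin d → ℤ) (w : MFilter d r t)
    (k : Fin d → ℤ) : trans a N ε w k = conv (mask a N) w (2 ^ N • k + ε) := rfl

/-- Duality: on one coset of 2^N ℤ^d, the N subdivision steps applied to v can be moved onto the
filter w, where they become the transition operator. -/
lemma conv_iterate_subdiv (a : MFilter d r r) (v : (Fin d → ℤ) → Matrix (Fin s) (Fin r) ℂ)
    (N : ℕ) (ε : Fin d → ℤ) (w : MFilter d r t) (k : Fin d → ℤ) :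
    conv ((subdiv a)^[N] v) w (2 ^ N • k + ε) = conv v (trans a N ε w) k := by
  obtain ⟨n, hn⟩ := exists_nat_ge (‖2 ^ N • k + ε‖ + radius w)
  have hn' : ∀ z, w z ≠ 0 → ‖2 ^ N • k + ε - z‖ ≤ 2 ^ N * n := by
    intro z hz
    refine (norm_sub_le _ _).trans ?_
    have h1 := norm_le_radius hz
    have : (1 : ℝ) ≤ 2 ^ N := one_le_pow₀ (by norm_num)
    have h0 : (0 : ℝ) ≤ n := Nat.cast_nonneg _
    nlinarith
  have hq : ∀ q, trans a N ε w (k - q) ≠ 0 → q ∈ box d (n + radius a) := by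
    intro q hq
    rw [trans_apply] at hq
    have : ∃ z, mask a N (2 ^ N • (k - q) + ε - z) ≠ 0 ∧ w z ≠ 0 := by
      by_contra! hc
      apply hq
      rw [conv]
      refine Finset.sum_eq_zero fun z hz => ?_
      by_cases hm : mask a N (2 ^ N • (k - q) + ε - z) = 0
      · beta_reduce
        rw [hm, Matrix.zero_mul]
      · exact absurd (hc z hm) (Finsupp.mem_support_iff.1 hz)
    obtain ⟨z, h1, h2⟩ := this
    refine mem_box_of_mask (hn' z h2) (N := N) (a := a) ?_
    convert h1 using 2
    rw [smul_sub]; abel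
  rw [conv_eq_sum' v _ k hq, conv]
  have h1 : (w.sum fun z W => (subdiv a)^[N] v (2 ^ N • k + ε - z) * W)
      = w.sum fun z W => ∑ q ∈ box d (n + radius a),
        v q * (mask a N (2 ^ N • (k - q) + ε - z) * W) := by
    refine Finset.sum_congr rfl fun z hz => ?_
    beta_reduce
    rw [iterate_subdiv_eq_sum a v N (fun q hq =>
      mem_box_of_mask (hn' z (Finsupp.mem_support_iff.1 hz)) hq), Matrix.sum_mul]
    refine Finset.sum_congr rfl fun q _ => ?_
    rw [Matrix.mul_assoc, smul_sub]
    congr 3; abel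
  rw [h1, Finsupp.sum, Finset.sum_comm]
  refine Finset.sum_congr rfl fun q _ => ?_
  rw [trans_apply, conv, Finsupp.sum, Matrix.mul_sum]

lemma conv_mask_add (a : MFilter d r r) (M N : ℕ) (ε : Fin d → ℤ) (w : MFilter d r t)
    (k : Fin d → ℤ) :
    conv (mask a (M + N)) w (2 ^ N • k + ε) = conv (mask a M) (trans a N ε w) k := by
  rw [mask_add, conv_iterate_subdiv]

lemma iterate_subdiv_filter (a : MFilter d r r) (v : MFilter d s r) (N : ℕ) (k : Fin d → ℤ) :
    (subdiv a)^[N] v k = ∑ z ∈ v.support, v z * mask a N (k - 2 ^ N • z) := by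
  obtain ⟨n, hn⟩ := exists_norm_le_two_pow_mul N k
  rw [iterate_subdiv_eq_sum a v N
    (B := v.support ∪ box d (n + radius a))
    (fun z hz => Finset.mem_union_right _ (mem_box_of_mask hn hz))]
  symm
  refine Finset.sum_subset Finset.subset_union_left fun z _ hz => ?_
  rw [Finsupp.notMem_support_iff.1 hz, Matrix.zero_mul]

lemma conv_iterate_filter (a : MFilter d r r) (v : MFilter d s r) (N : ℕ) (w : MFilter d r t)
    (k : Fin d → ℤ) : conv ((subdiv a)^[N] v) w k
      = ∑ z ∈ v.support, v z * conv (mask a N) w (k - 2 ^ N • z) := by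
  rw [conv]
  simp_rw [iterate_subdiv_filter, Matrix.sum_mul]
  rw [Finsupp.sum, Finset.sum_comm]
  refine Finset.sum_congr rfl fun z _ => ?_
  rw [conv, Finsupp.sum, Matrix.mul_sum]
  refine Finset.sum_congr rfl fun q _ => ?_
  rw [Matrix.mul_assoc]
  congr 3; abel

end Subdivision

/-! ### Polynomial functions of bounded degree -/

section Polynomials
variable {d : ℕ}

/-- The monomial `x ↦ x^μ`. -/
def mono (μ : Fin d → ℕ) : (Fin d → ℝ) → ℂ := fun x => ∏ j, (x j : ℂ) ^ μ j

/-- The polynomial functions on `ℝ^d` of degree less than `n`. -/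
def Pl (d n : ℕ) : Submodule ℂ ((Fin d → ℝ) → ℂ) :=
  Submodule.span ℂ (mono '' {μ | order μ < n})

lemma mono_mem_Pl {μ : Fin d → ℕ} {n : ℕ} (h : order μ < n) : mono μ ∈ Pl d n :=
  Submodule.subset_span ⟨μ, h, rfl⟩

lemma Pl_le {m n : ℕ} (h : m ≤ n) : Pl d m ≤ Pl d n :=
  Submodule.span_mono (Set.image_mono fun _ hμ => lt_of_lt_of_le hμ h)

lemma Pl_zero : Pl d 0 = ⊥ := by
  simp [Pl]

lemma finite_order_lt (n : ℕ) : {μ : Fin d → ℕ | order μ < n}.Finite := by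
  refine (Set.finite_Iic (fun _ => n : Fin d → ℕ)).subset fun μ hμ j => ?_
  exact (Finset.single_le_sum (f := μ) (fun _ _ => Nat.zero_le _) (Finset.mem_univ j)).trans
    (le_of_lt hμ)

instance (n : ℕ) : FiniteDimensional ℂ (Pl d n) :=
  FiniteDimensional.span_of_finite ℂ ((finite_order_lt n).image _)

/-- To prove a linear property of polynomials it suffices to check monomials. -/
lemma Pl_induction {n : ℕ} {P : ((Fin d → ℝ) → ℂ) → Prop}
    (mem : ∀ μ : Fin d → ℕ, order μ < n → P (mono μ)) (zero : P 0)
    (add : ∀ f g, P f → P g → P (f + g)) (smul : ∀ (c : ℂ) f, P f → P (c • f))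
    {p : (Fin d → ℝ) → ℂ} (hp : p ∈ Pl d n) : P p := by
  induction hp using Submodule.span_induction with
  | mem x h => obtain ⟨μ, hμ, rfl⟩ := h; exact mem μ hμ
  | zero => exact zero
  | add f g _ _ hf hg => exact add f g hf hg
  | smul c f _ hf => exact smul c f hf

lemma mono_zero : mono (0 : Fin d → ℕ) = 1 := by
  ext x; simp [mono]

lemma order_add (μ ν : Fin d → ℕ) : order (μ + ν) = order μ + order ν := by
  simp [order, Finset.sum_add_distrib]

lemma mono_add (μ ν : Fin d → ℕ) : mono (μ + ν) = mono μ * mono ν := by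
  ext x; simp [mono, pow_add, Finset.prod_mul_distrib]

lemma order_single (j : Fin d) (n : ℕ) : order (Pi.single j n) = n := by
  simp [order]

lemma one_mem_Pl {n : ℕ} (hn : 0 < n) : (1 : (Fin d → ℝ) → ℂ) ∈ Pl d n := by
  rw [← mono_zero]; exact mono_mem_Pl (by simpa [order] using hn)

lemma mono_single_one (j : Fin d) : mono (Pi.single j 1) = fun x => (x j : ℂ) := by
  ext x
  rw [mono, Finset.prod_eq_single j] <;> simp +contextual

/-- The asymmetric bounds read deg f ≤ a and deg g < b; with b = 0 the second factor is zero. -/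
lemma mul_mem_Pl {a b : ℕ} {f g : (Fin d → ℝ) → ℂ} (hf : f ∈ Pl d (a + 1)) (hg : g ∈ Pl d b) :
    f * g ∈ Pl d (a + b) := by
  refine Pl_induction (P := fun f => f * g ∈ Pl d (a + b)) ?_ ?_ ?_ ?_ hf
  · intro μ hμ
    refine Pl_induction (P := fun g => mono μ * g ∈ Pl d (a + b)) ?_ ?_ ?_ ?_ hg
    · intro ν hν
      rw [← mono_add]
      exact mono_mem_Pl (by rw [order_add]; omega)
    · simp
    · intro f g hf hg; rw [mul_add]; exact add_mem hf hg
    · intro c f hf; rw [mul_smul_comm]; exact Submodule.smul_mem _ _ hf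
  · simp
  · intro f g hf hg; rw [add_mul]; exact add_mem hf hg
  · intro c f hf; rw [smul_mul_assoc]; exact Submodule.smul_mem _ _ hf

/-! ### Leading parts of polynomials under affine substitutions -/

/-- `f` has degree at most `D` and `f(cx + b)` has the same degree `D` part as `c^D f(x)`. -/
def HasLead (c : ℝ) (b : Fin d → ℝ) (D : ℕ) (f : (Fin d → ℝ) → ℂ) : Prop :=
  f ∈ Pl d (D + 1) ∧ (fun x => f (c • x + b)) - (c : ℂ) ^ D • f ∈ Pl d D

lemma HasLead.mul {c : ℝ} {b : Fin d → ℝ} {D E : ℕ} {f g : (Fin d → ℝ) → ℂ}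
    (hf : HasLead c b D f) (hg : HasLead c b E g) : HasLead c b (D + E) (f * g) := by
  refine ⟨mul_mem_Pl (a := D) (b := E + 1) hf.1 hg.1, ?_⟩
  have e : (fun x => (f * g) (c • x + b)) - (c : ℂ) ^ (D + E) • (f * g)
      = ((c : ℂ) ^ D • f) * ((fun x => g (c • x + b)) - (c : ℂ) ^ E • g)
        + (((fun x => g (c • x + b)) - (c : ℂ) ^ E • g) + (c : ℂ) ^ E • g)
          * ((fun x => f (c • x + b)) - (c : ℂ) ^ D • f) := by
    ext x; simp; ring
  rw [e]
  refine add_mem (mul_mem_Pl (Submodule.smul_mem _ _ hf.1) hg.2) ?_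
  rw [add_comm D E]
  exact mul_mem_Pl (add_mem (Pl_le (Nat.le_succ E) hg.2) (Submodule.smul_mem _ _ hg.1)) hf.2

lemma hasLead_one (c : ℝ) (b : Fin d → ℝ) : HasLead c b 0 1 :=
  ⟨one_mem_Pl (by norm_num), by
    have : (fun x => (1 : (Fin d → ℝ) → ℂ) (c • x + b)) - (c : ℂ) ^ 0 • 1 = 0 := by ext x; simp
    rw [this]; exact zero_mem _⟩

lemma hasLead_coord (c : ℝ) (b : Fin d → ℝ) (j : Fin d) :
    HasLead c b 1 (fun x => (x j : ℂ)) := by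
  refine ⟨?_, ?_⟩
  · rw [← mono_single_one]; exact mono_mem_Pl (by simp [order_single])
  · have : (fun x : Fin d → ℝ => (((c • x + b) j : ℝ) : ℂ)) - (c : ℂ) ^ 1 • (fun x => (x j : ℂ))
        = (b j : ℂ) • 1 := by
      ext x; simp
    rw [this]
    exact Submodule.smul_mem _ _ (one_mem_Pl (by norm_num))

lemma hasLead_mono (c : ℝ) (b : Fin d → ℝ) (μ : Fin d → ℕ) : HasLead c b (order μ) (mono μ) := by
  have hpow : ∀ (j : Fin d) (n : ℕ), HasLead c b n (fun x => (x j : ℂ) ^ n) := by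
    intro j n
    induction n with
    | zero => simp only [pow_zero]; exact hasLead_one c b
    | succ n ih => simp only [pow_succ]; exact ih.mul (hasLead_coord c b j)
  have : ∀ s : Finset (Fin d), HasLead c b (∑ j ∈ s, μ j) (fun x => ∏ j ∈ s, (x j : ℂ) ^ μ j) := by
    intro s
    induction s using Finset.induction_on with
    | empty => simp only [Finset.sum_empty, Finset.prod_empty]; exact hasLead_one c b
    | insert j s hj ih =>
      simp only [Finset.sum_insert hj, Finset.prod_insert hj]
      exact (hpow j (μ j)).mul ih
  exact this Finset.univ

/-- The engine of the degree inductions. With c = 1 it says that differences lower the degree; with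
c = 1/2 it says that halving the variable acts as 2^{-D} modulo lower degree. -/
lemma lead_mem_Pl {D : ℕ} {f : (Fin d → ℝ) → ℂ} (hf : f ∈ Pl d (D + 1)) (c : ℝ)
    (b : Fin d → ℝ) : (fun x => f (c • x + b)) - (c : ℂ) ^ D • f ∈ Pl d D := by
  refine Pl_induction
    (P := fun f => (fun x => f (c • x + b)) - (c : ℂ) ^ D • f ∈ Pl d D) ?_ ?_ ?_ ?_ hf
  · intro μ hμ
    have h := hasLead_mono c b μ
    rcases Nat.lt_succ_iff_lt_or_eq.1 hμ with h1 | h1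
    · have h2 : mono μ ∈ Pl d D := mono_mem_Pl h1
      have h3 : (fun x => mono μ (c • x + b)) ∈ Pl d D := by
        have := add_mem (Pl_le h1.le h.2) (Submodule.smul_mem _ ((c : ℂ) ^ order μ) h2)
        simpa using this
      exact sub_mem h3 (Submodule.smul_mem _ _ h2)
    · rw [← h1]; exact h.2
  · convert zero_mem (Pl d D) using 1
    ext x; simp
  · intro f g hf hg
    convert add_mem hf hg using 1
    ext x; simp; ring
  · intro e f hf
    convert Submodule.smul_mem _ e hf using 1
    ext x; simp; ring

lemma affine_mem_Pl {n : ℕ} {f : (Fin d → ℝ) → ℂ} (hf : f ∈ Pl d n) (c : ℝ)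
    (b : Fin d → ℝ) : (fun x => f (c • x + b)) ∈ Pl d n := by
  cases n with
  | zero =>
    rw [Pl_zero, Submodule.mem_bot] at hf ⊢
    subst hf; rfl
  | succ D =>
    have := add_mem (Pl_le (Nat.le_succ D) (lead_mem_Pl hf c b)) (Submodule.smul_mem _ ((c : ℂ) ^ D) hf)
    simpa using this

lemma translate_mem_Pl {n : ℕ} {f : (Fin d → ℝ) → ℂ} (hf : f ∈ Pl d n) (b : Fin d → ℝ) :
    (fun x => f (x + b)) ∈ Pl d n := by
  simpa using affine_mem_Pl hf 1 b

lemma scale_mem_Pl {n : ℕ} {f : (Fin d → ℝ) → ℂ} (hf : f ∈ Pl d n) (c : ℝ) :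
    (fun x => f (c • x)) ∈ Pl d n := by
  simpa using affine_mem_Pl hf c 0

lemma neg_mem_Pl {n : ℕ} {f : (Fin d → ℝ) → ℂ} (hf : f ∈ Pl d n) :
    (fun x => f (-x)) ∈ Pl d n := by
  simpa using affine_mem_Pl hf (-1) 0

lemma Pl_one_apply {f : (Fin d → ℝ) → ℂ} (hf : f ∈ Pl d 1) : f = f 0 • (1 : (Fin d → ℝ) → ℂ) := by
  refine Pl_induction (P := fun f => f = f 0 • (1 : (Fin d → ℝ) → ℂ)) ?_ ?_ ?_ ?_ hf
  · intro μ hμ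
    have : μ = 0 := by
      ext j
      have := Finset.single_le_sum (f := μ) (fun _ _ => Nat.zero_le _) (Finset.mem_univ j)
      simp only [order] at hμ
      simp only [Pi.zero_apply]; omega
    subst this
    rw [mono_zero]; simp
  · simp
  · intro f g hf hg
    nth_rewrite 1 [hf, hg]
    ext x; simp
  · intro c f hf
    nth_rewrite 1 [hf]
    ext x; simp

lemma eq_eval_of_mem_Pl {n : ℕ} {f : (Fin d → ℝ) → ℂ} (hf : f ∈ Pl d n) :
    ∃ P : MvPolynomial (Fin d) ℂ, ∀ x, f x = MvPolynomial.eval (fun j => (x j : ℂ)) P := by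
  refine Pl_induction (P := fun f => ∃ P : MvPolynomial (Fin d) ℂ,
    ∀ x, f x = MvPolynomial.eval (fun j => (x j : ℂ)) P) ?_ ?_ ?_ ?_ hf
  · intro μ _
    exact ⟨∏ j, MvPolynomial.X j ^ μ j, fun x => by simp [mono]⟩
  · exact ⟨0, by simp⟩
  · rintro f g ⟨P, hP⟩ ⟨Q, hQ⟩
    exact ⟨P + Q, fun x => by simp [hP, hQ]⟩
  · rintro c f ⟨P, hP⟩
    exact ⟨MvPolynomial.C c * P, fun x => by simp [hP]⟩

/-- A polynomial that vanishes on a product of infinite sets is zero. -/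
lemma Pl_eq_zero_of_lattice {n : ℕ} {f : (Fin d → ℝ) → ℂ} (hf : f ∈ Pl d n)
    (h : ∀ k : Fin d → ℤ, f (castVec k) = 0) : f = 0 := by
  obtain ⟨P, hP⟩ := eq_eval_of_mem_Pl hf
  have : P = 0 := by
    refine MvPolynomial.funext_set (fun _ => Set.range ((↑) : ℤ → ℂ))
      (fun _ => Set.infinite_range_of_injective Int.cast_injective) fun x hx => ?_
    choose k hk using fun j => hx j (Set.mem_univ j)
    have := h k
    rw [hP] at this
    have hx' : x = fun j => ((castVec k j : ℝ) : ℂ) := by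
      ext j; simp [← hk]
    rw [hx', this, map_zero]
  ext x
  rw [hP, this]; simp

lemma norm_mono_le (μ : Fin d → ℕ) (x : Fin d → ℝ) : ‖mono μ x‖ ≤ ‖x‖ ^ order μ := by
  rw [mono, norm_prod, order, ← Finset.prod_pow_eq_pow_sum]
  refine Finset.prod_le_prod (fun _ _ => norm_nonneg _) fun j _ => ?_
  rw [norm_pow, Complex.norm_real]
  exact pow_le_pow_left₀ (norm_nonneg _) (norm_le_pi_norm x j) _

lemma exists_growth_bound {n : ℕ} {f : (Fin d → ℝ) → ℂ} (hf : f ∈ Pl d n) :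
    ∃ C : ℝ, 0 ≤ C ∧ ∀ x, ‖f x‖ ≤ C * (1 + ‖x‖) ^ n := by
  refine Pl_induction (P := fun f => ∃ C : ℝ, 0 ≤ C ∧ ∀ x, ‖f x‖ ≤ C * (1 + ‖x‖) ^ n)
    ?_ ?_ ?_ ?_ hf
  · intro μ hμ
    refine ⟨1, zero_le_one, fun x => (norm_mono_le μ x).trans ?_⟩
    rw [one_mul]
    have h0 := norm_nonneg x
    exact (pow_le_pow_left₀ h0 (by linarith) _).trans
      (pow_le_pow_right₀ (by linarith) (le_of_lt hμ))
  · exact ⟨0, le_rfl, by simp⟩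
  · rintro f g ⟨C, hC, hf⟩ ⟨D, hD, hg⟩
    refine ⟨C + D, by positivity, fun x => (norm_add_le _ _).trans ?_⟩
    rw [add_mul]; exact add_le_add (hf x) (hg x)
  · rintro c f ⟨C, hC, hf⟩
    refine ⟨‖c‖ * C, by positivity, fun x => ?_⟩
    rw [Pi.smul_apply, norm_smul, mul_assoc]
    exact mul_le_mul_of_nonneg_left (hf x) (norm_nonneg _)

lemma contDiff_mono (μ : Fin d → ℕ) : ContDiff ℝ ∞ (mono μ) := by
  refine contDiff_prod fun j _ => ContDiff.pow ?_ _
  exact Complex.ofRealCLM.contDiff.comp (contDiff_apply ℝ ℝ j)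

lemma contDiff_of_mem_Pl {n : ℕ} {f : (Fin d → ℝ) → ℂ} (hf : f ∈ Pl d n) : ContDiff ℝ ∞ f :=
  Pl_induction (P := fun f => ContDiff ℝ ∞ f) (fun μ _ => contDiff_mono μ) contDiff_const
    (fun _ _ hf hg => hf.add hg) (fun c _ hf => hf.const_smul c) hf

/-- Every linear functional on polynomials of bounded degree is a finite combination of
evaluations at lattice points. -/
lemma exists_lattice_functional {n : ℕ} (l : Pl d n →ₗ[ℂ] ℂ) :
    ∃ u : (Fin d → ℤ) →₀ ℂ, ∀ p : Pl d n,
      l p = u.sum fun k c => c * (p : (Fin d → ℝ) → ℂ) (castVec k) := by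
  let ev : (Fin d → ℤ) → Module.Dual ℂ (Pl d n) := fun k =>
    { toFun := fun p => (p : (Fin d → ℝ) → ℂ) (castVec k)
      map_add' := fun _ _ => rfl
      map_smul' := fun _ _ => rfl }
  -- The evaluations have trivial common kernel, since a polynomial is determined on the lattice; in
  -- finite dimension they therefore span the dual.
  have htop : Submodule.span ℂ (Set.range ev) = ⊤ := by
    rw [← Subspace.dualCoannihilator_dualAnnihilator_eq (W := Submodule.span ℂ (Set.range ev))]
    have : (Submodule.span ℂ (Set.range ev)).dualCoannihilator = ⊥ := by
      rw [eq_bot_iff]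
      intro p hp
      rw [Submodule.mem_dualCoannihilator] at hp
      rw [Submodule.mem_bot, Subtype.ext_iff]
      exact Pl_eq_zero_of_lattice p.2 fun k => hp (ev k) (Submodule.subset_span ⟨k, rfl⟩)
    rw [this, Submodule.dualAnnihilator_bot]
  have hl : l ∈ Submodule.span ℂ (Set.range ev) := by rw [htop]; trivial
  rw [Finsupp.mem_span_range_iff_exists_finsupp] at hl
  obtain ⟨u, hu⟩ := hl
  refine ⟨u, fun p => ?_⟩
  rw [← hu, Finsupp.sum, Finsupp.sum, LinearMap.sum_apply]
  rfl

end Polynomials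

/-! ### Exponential sums and moments -/

section ExpSum
variable {d : ℕ} {ι : Type*}

/-- The exponential sum `∑ₛ cₛ e^{-i xₛ·ξ}`. -/
def expSum (S : Finset ι) (c : ι → ℂ) (x : ι → Fin d → ℝ) (ξ : Fin d → ℝ) : ℂ :=
  ∑ s ∈ S, c s * Complex.exp (-Complex.I * ((∑ j, x s j * ξ j : ℝ) : ℂ))

lemma hasFDerivAt_exp_phase (y ξ : Fin d → ℝ) (j : Fin d) :
    DifferentiableAt ℝ
      (fun ξ : Fin d → ℝ => Complex.exp (-Complex.I * ((∑ j, y j * ξ j : ℝ) : ℂ))) ξ ∧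
    fderiv ℝ (fun ξ : Fin d → ℝ => Complex.exp (-Complex.I * ((∑ j, y j * ξ j : ℝ) : ℂ))) ξ
      (Pi.single j 1) = (-Complex.I * (y j : ℂ))
        * Complex.exp (-Complex.I * ((∑ j, y j * ξ j : ℝ) : ℂ)) := by
  let M : (Fin d → ℝ) →L[ℝ] ℂ := (-Complex.I) • Complex.ofRealCLM.comp
    (∑ j, y j • (ContinuousLinearMap.proj j : (Fin d → ℝ) →L[ℝ] ℝ))
  have hM : ∀ ξ, M ξ = -Complex.I * ((∑ j, y j * ξ j : ℝ) : ℂ) := by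
    intro ξ
    simp [M]
  have h1 : (fun ξ : Fin d → ℝ => Complex.exp (-Complex.I * ((∑ j, y j * ξ j : ℝ) : ℂ)))
      = fun ξ => Complex.exp (M ξ) := by
    ext ξ; rw [hM]
  have h2 : HasFDerivAt (fun ξ => Complex.exp (M ξ)) (Complex.exp (M ξ) • M) ξ :=
    M.hasFDerivAt.cexp
  rw [h1]
  refine ⟨h2.differentiableAt, ?_⟩
  rw [h2.fderiv, smul_apply, hM, hM, smul_eq_mul, mul_comm]
  congr 2
  simp [Pi.single_apply]

lemma pd_expSum (S : Finset ι) (c : ι → ℂ) (x : ι → Fin d → ℝ) (j : Fin d) :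
    pd j (expSum S c x) = expSum S (fun s => c s * (-Complex.I * (x s j : ℂ))) x := by
  ext ξ
  unfold pd expSum
  have h : HasFDerivAt (fun ξ : Fin d → ℝ =>
      ∑ s ∈ S, c s * Complex.exp (-Complex.I * ((∑ j, x s j * ξ j : ℝ) : ℂ)))
      (∑ s ∈ S, c s • fderiv ℝ (fun ξ : Fin d → ℝ =>
        Complex.exp (-Complex.I * ((∑ j, x s j * ξ j : ℝ) : ℂ))) ξ) ξ :=
    HasFDerivAt.fun_sum fun s _ => ((hasFDerivAt_exp_phase (x s) ξ j).1.hasFDerivAt).const_mul (c s)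
  rw [h.fderiv, sum_apply]
  refine Finset.sum_congr rfl fun s _ => ?_
  rw [smul_apply, (hasFDerivAt_exp_phase (x s) ξ j).2, smul_eq_mul, ← mul_assoc]

lemma iterate_pd_expSum (S : Finset ι) (c : ι → ℂ) (x : ι → Fin d → ℝ) (j : Fin d) (n : ℕ) :
    (pd j)^[n] (expSum S c x) = expSum S (fun s => c s * (-Complex.I * (x s j : ℂ)) ^ n) x := by
  induction n with
  | zero => simp
  | succ n ih =>
    rw [Function.iterate_succ_apply', ih, pd_expSum]
    congr 1
    ext s
    rw [pow_succ, mul_assoc]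

lemma partialDeriv_expSum (S : Finset ι) (c : ι → ℂ) (x : ι → Fin d → ℝ) (μ : Fin d → ℕ) :
    partialDeriv μ (expSum S c x)
      = expSum S (fun s => c s * ∏ j, (-Complex.I * (x s j : ℂ)) ^ μ j) x := by
  have : ∀ L : List (Fin d), L.foldr (fun j g => (pd j)^[μ j] g) (expSum S c x)
      = expSum S (fun s => c s * (L.map fun j => (-Complex.I * (x s j : ℂ)) ^ μ j).prod) x := by
    intro L
    induction L with
    | nil => simp
    | cons j L ih =>
      rw [List.foldr_cons, ih, iterate_pd_expSum]
      congr 1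
      ext s
      rw [List.map_cons, List.prod_cons]; ring
  rw [partialDeriv, this]
  simp_rw [Fin.prod_univ_def]

lemma partialDeriv_expSum_zero (S : Finset ι) (c : ι → ℂ) (x : ι → Fin d → ℝ) (μ : Fin d → ℕ) :
    partialDeriv μ (expSum S c x) 0
      = (-Complex.I) ^ order μ * ∑ s ∈ S, c s * mono μ (x s) := by
  rw [partialDeriv_expSum, expSum, Finset.mul_sum]
  refine Finset.sum_congr rfl fun s _ => ?_
  simp only [Pi.zero_apply, mul_zero, Finset.sum_const_zero, Complex.ofReal_zero, Complex.exp_zero,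
    mul_one, mul_pow, Finset.prod_mul_distrib, mono, order, Finset.prod_pow_eq_pow_sum]
  ring

/-- The derivative ∂^μ at the origin is (-i)^{|μ|} times the moment against x^μ. Agreement to order
n is thus equality of all moments of degree below n, which turns every O(‖ξ‖^n) condition into
linear algebra on `Pl d n`. -/
lemma eqOrder_expSum_iff {κ : Type*} (n : ℕ) (S : Finset ι) (c : ι → ℂ) (x : ι → Fin d → ℝ)
    (T : Finset κ) (e : κ → ℂ) (y : κ → Fin d → ℝ) :
    EqOrder n (expSum S c x) (expSum T e y)
      ↔ ∀ p ∈ Pl d n, ∑ s ∈ S, c s * p (x s) = ∑ t ∈ T, e t * p (y t) := by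
  constructor
  · intro h p hp
    refine Pl_induction (P := fun p => ∑ s ∈ S, c s * p (x s) = ∑ t ∈ T, e t * p (y t))
      ?_ ?_ ?_ ?_ hp
    · intro μ hμ
      have := h μ hμ
      rw [partialDeriv_expSum_zero, partialDeriv_expSum_zero] at this
      exact mul_left_cancel₀ (pow_ne_zero _ (neg_ne_zero.2 Complex.I_ne_zero)) this
    · simp
    · intro f g hf hg
      simp only [Pi.add_apply, mul_add, Finset.sum_add_distrib, hf, hg]
    · intro a f hf
      simp only [Pi.smul_apply, smul_eq_mul, mul_left_comm _ a, ← Finset.mul_sum, hf]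
  · intro h μ hμ
    rw [partialDeriv_expSum_zero, partialDeriv_expSum_zero, h _ (mono_mem_Pl hμ)]

end ExpSum

/-! ### Symbols as exponential sums -/

section Symbols
variable {d r s t : ℕ}

lemma symbol_apply (u : MFilter d s t) (ξ : Fin d → ℝ) (i : Fin s) (j : Fin t) :
    symbol u ξ i j = expSum u.support (fun k => u k i j) castVec ξ := by
  rw [symbol, Finsupp.sum, Matrix.sum_apply, expSum]
  refine Finset.sum_congr rfl fun k _ => ?_
  rw [Matrix.smul_apply, smul_eq_mul, mul_comm]; rfl

lemma symbol_zero_apply (u : MFilter d s t) (i : Fin s) (j : Fin t) :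
    symbol u 0 i j = ∑ k ∈ u.support, u k i j := by
  rw [symbol_apply, expSum]; simp

lemma symbol_zero (u : MFilter d s t) : symbol u 0 = ∑ k ∈ u.support, u k := by
  ext i j
  rw [symbol_zero_apply, Matrix.sum_apply]

/-- The sequence `k ↦ ∑_z p(k - z) y(z)`, the convolution of a function `p` with a filter `y`. -/
def polyConv (y : MFilter d s t) (p : (Fin d → ℝ) → ℂ) :
    (Fin d → ℤ) → Matrix (Fin s) (Fin t) ℂ :=
  fun k => ∑ z ∈ y.support, p (castVec (k - z)) • y z

lemma polyConv_apply (y : MFilter d s t) (p : (Fin d → ℝ) → ℂ) (k : Fin d → ℤ) (i : Fin s)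
    (j : Fin t) : polyConv y p k i j = ∑ z ∈ y.support, p (castVec (k - z)) * y z i j := by
  rw [polyConv, Matrix.sum_apply]; rfl

lemma polyConv_add (y : MFilter d s t) (p q : (Fin d → ℝ) → ℂ) :
    polyConv y (p + q) = polyConv y p + polyConv y q := by
  ext k : 1
  simp [polyConv, add_smul, Finset.sum_add_distrib]

lemma polyConv_smul (y : MFilter d s t) (c : ℂ) (p : (Fin d → ℝ) → ℂ) :
    polyConv y (c • p) = c • polyConv y p := by
  ext k : 1
  simp [polyConv, Finset.smul_sum, smul_smul]

lemma polyConv_sub (y : MFilter d s t) (p q : (Fin d → ℝ) → ℂ) :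
    polyConv y (p - q) = polyConv y p - polyConv y q := by
  rw [sub_eq_add_neg, ← neg_one_smul ℂ q, polyConv_add, polyConv_smul, neg_one_smul,
    sub_eq_add_neg]

lemma polyConv_translate (y : MFilter d s t) (p : (Fin d → ℝ) → ℂ) (k l : Fin d → ℤ) :
    polyConv y (fun x => p (x + castVec l)) k = polyConv y p (k + l) := by
  simp only [polyConv]
  refine Finset.sum_congr rfl fun z _ => ?_
  rw [← castVec_add]
  congr 3; abel

lemma polyConv_one (y : MFilter d s t) (k : Fin d → ℤ) : polyConv y 1 k = symbol y 0 := by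
  simp [polyConv, symbol_zero]

/-- `ŷ(ξ) ŵ(ξ) = O(‖ξ‖^n)` expressed through moments. -/
lemma mem_vanishSet_iff {n : ℕ} {y : MFilter d 1 r} {w : MFilter d r 1} :
    w ∈ vanishSet n y ↔ ∀ p ∈ Pl d n, conv (polyConv y p) w 0 0 0 = 0 := by
  have h0 : ∀ ξ, (symbol y ξ * symbol w ξ) 0 0 = expSum
      ((Finset.univ : Finset (Fin r)) ×ˢ y.support ×ˢ w.support)
      (fun q => y q.2.1 0 q.1 * w q.2.2 q.1 0) (fun q => castVec (q.2.1 + q.2.2)) ξ := by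
    intro ξ
    rw [Matrix.mul_apply, expSum, Finset.sum_product]
    refine Finset.sum_congr rfl fun l _ => ?_
    rw [Finset.sum_product, symbol_apply, symbol_apply, expSum, expSum, Finset.sum_mul_sum]
    refine Finset.sum_congr rfl fun k _ => Finset.sum_congr rfl fun z _ => ?_
    rw [mul_mul_mul_comm, ← Complex.exp_add]
    congr 2
    simp only [castVec_add, Pi.add_apply, add_mul, Finset.sum_add_distrib]
    push_cast; ring
  have h1 : w ∈ vanishSet n y ↔ EqOrder n (expSum
      ((Finset.univ : Finset (Fin r)) ×ˢ y.support ×ˢ w.support)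
      (fun q => y q.2.1 0 q.1 * w q.2.2 q.1 0) (fun q => castVec (q.2.1 + q.2.2)))
      (expSum (∅ : Finset Unit) (fun _ => 0) (fun _ => 0)) := by
    rw [vanishSet, Set.mem_ofPred_eq, MatEqOrder]
    have e1 : (fun ξ => (symbol y ξ * symbol w ξ) 0 0) = _ := funext h0
    have e2 : (fun _ : Fin d → ℝ => (0 : Matrix (Fin 1) (Fin 1) ℂ) 0 0)
        = expSum (∅ : Finset Unit) (fun _ => 0) (fun _ => 0) := by
      ext ξ; simp [expSum]
    rw [← e1, ← e2]
    constructor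
    · intro h; exact h 0 0
    · intro h i j
      rw [Subsingleton.elim i 0, Subsingleton.elim j 0]; exact h
  -- The reflection appears because the convolution at 0 evaluates its polynomial at -(k + z),
  -- whereas the product of symbols has frequencies k + z.
  have h2 : ∀ p : (Fin d → ℝ) → ℂ, conv (polyConv y fun x => p (-x)) w 0 0 0
      = ∑ q ∈ (Finset.univ : Finset (Fin r)) ×ˢ y.support ×ˢ w.support,
        y q.2.1 0 q.1 * w q.2.2 q.1 0 * p (castVec (q.2.1 + q.2.2)) := by
    intro p
    rw [conv, Finsupp.sum, Matrix.sum_apply, Finset.sum_product]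
    simp_rw [Matrix.mul_apply]
    rw [Finset.sum_comm]
    refine Finset.sum_congr rfl fun l _ => ?_
    rw [Finset.sum_product, Finset.sum_comm]
    refine Finset.sum_congr rfl fun z _ => ?_
    rw [polyConv_apply, Finset.sum_mul]
    refine Finset.sum_congr rfl fun k _ => ?_
    rw [← castVec_neg]
    have : -(0 - z - k) = k + z := by abel
    rw [this]; ring
  rw [h1, eqOrder_expSum_iff]
  constructor
  · intro h p hp
    have := h _ (neg_mem_Pl hp)
    rw [← h2 fun x => p (-x)] at this
    simpa using this
  · intro h p hp
    rw [← h2, h _ (neg_mem_Pl hp)]; simp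

end Symbols

/-! ### Fourier analysis on `(ℤ/2)^d` -/

section Parity
variable {d : ℕ}

/-- The character `κ ↦ ∏_{j ∈ τ} (-1)^{κ_j}` of `ℤ^d`. -/
def parityChar (τ : Finset (Fin d)) (κ : Fin d → ℤ) : ℂ := ∏ j ∈ τ, (-1 : ℂ) ^ κ j

/-- Expanding ∏_j (1 + (-1)^{κ_j}) over subsets; each factor is 2 or 0. -/
lemma sum_parityChar (κ : Fin d → ℤ) [Decidable (∀ j, Even (κ j))] :
    ∑ τ : Finset (Fin d), parityChar τ κ = if ∀ j, Even (κ j) then 2 ^ d else 0 := by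
  have h := Finset.prod_one_add (f := fun j => (-1 : ℂ) ^ κ j) Finset.univ
  rw [Finset.powerset_univ] at h
  unfold parityChar
  rw [← h]
  split_ifs with hk
  · rw [Finset.prod_congr rfl fun j _ => by rw [(hk j).neg_one_zpow]]
    norm_num
  · push Not at hk
    obtain ⟨j, hj⟩ := hk
    refine Finset.prod_eq_zero (Finset.mem_univ j) ?_
    rw [(Int.not_even_iff_odd.1 hj).neg_one_zpow]; norm_num

/-- The indicator of a set of coordinates, as a lattice point. -/
def indic (G : Finset (Fin d)) : Fin d → ℤ := fun j => if j ∈ G then 1 else 0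

lemma parityChar_indic_symm (τ G : Finset (Fin d)) :
    parityChar τ (indic G) = parityChar G (indic τ) := by
  have h : ∀ τ G : Finset (Fin d), parityChar τ (indic G)
      = ∏ j, if j ∈ τ ∧ j ∈ G then (-1 : ℂ) else 1 := by
    intro τ G
    rw [parityChar, ← Finset.prod_filter_mul_prod_filter_not Finset.univ (· ∈ τ)
      (fun j => if j ∈ τ ∧ j ∈ G then (-1 : ℂ) else 1)]
    rw [Finset.prod_congr (s₁ := Finset.univ.filter (· ∉ τ)) rfl (g := fun _ => 1)]
    · simp only [Finset.prod_const_one, mul_one, Finset.filter_mem_eq_inter, Finset.univ_inter]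
      refine Finset.prod_congr rfl fun j hj => ?_
      by_cases hG : j ∈ G <;> simp [hj, hG, indic]
    · intro j hj
      simp [(Finset.mem_filter.1 hj).2]
  rw [h, h]
  refine Finset.prod_congr rfl fun j _ => ?_
  simp only [and_comm]

lemma parityChar_add (τ : Finset (Fin d)) (κ γ : Fin d → ℤ) :
    parityChar τ (κ + γ) = parityChar τ κ * parityChar τ γ := by
  rw [parityChar, parityChar, parityChar, ← Finset.prod_mul_distrib]
  refine Finset.prod_congr rfl fun j _ => ?_
  rw [Pi.add_apply, zpow_add₀ (by norm_num)]

lemma parityChar_sq (τ : Finset (Fin d)) (κ : Fin d → ℤ) :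
    parityChar τ κ * parityChar τ κ = 1 := by
  rw [← parityChar_add, parityChar]
  refine Finset.prod_eq_one fun j _ => ?_
  exact (Even.neg_one_zpow ⟨κ j, rfl⟩)

-- Fourier inversion on (ℤ/2)^d: only the trivial character has a nonzero sum exactly when the mass
-- is equally distributed over the 2^d cosets of 2ℤ^d. It translates conditions at all frequencies
-- 2πω into conditions on subsampled sums.
open Classical in
lemma parity_fourier (S : Finset (Fin d → ℤ)) (B : (Fin d → ℤ) → ℂ) (R : ℂ) :
    (∀ τ : Finset (Fin d), ∑ κ ∈ S, parityChar τ κ * B κ = if τ = ∅ then R else 0) ↔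
    ∀ γ : Fin d → ℤ, (2 : ℂ) ^ d * (∑ κ ∈ S with ∀ j, Even ((κ + γ) j), B κ) = R := by
  constructor
  · intro h γ
    rw [Finset.sum_filter, Finset.mul_sum]
    have e1 : ∀ κ, (2 : ℂ) ^ d * (if ∀ j, Even ((κ + γ) j) then B κ else 0)
        = ∑ τ : Finset (Fin d), parityChar τ γ * (parityChar τ κ * B κ) := by
      intro κ
      simp_rw [← mul_assoc]
      rw [← Finset.sum_mul]
      simp_rw [mul_comm (parityChar _ γ), ← parityChar_add]
      rw [sum_parityChar]
      split_ifs <;> simp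
    simp_rw [e1]
    rw [Finset.sum_comm]
    simp_rw [← Finset.mul_sum, h]
    simp [parityChar]
  · intro h τ
    have hpar : ∀ κ : Fin d → ℤ, ∀ G : Finset (Fin d),
        (∀ j, Even ((κ + indic G) j)) ↔ G = Finset.univ.filter (fun j => ¬ Even (κ j)) := by
      intro κ G
      rw [Finset.ext_iff]
      refine forall_congr' fun j => ?_
      by_cases hG : j ∈ G <;> simp [indic, hG]
    have e1 : ∀ κ, parityChar τ κ * B κ = ∑ G : Finset (Fin d),
        parityChar τ (indic G) * (if ∀ j, Even ((κ + indic G) j) then B κ else 0) := by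
      intro κ
      rw [Finset.sum_eq_single (Finset.univ.filter (fun j => ¬ Even (κ j)))]
      · rw [if_pos ((hpar κ _).2 rfl)]
        congr 1
        have h2 : parityChar τ (κ + indic (Finset.univ.filter (fun j => ¬ Even (κ j)))) = 1 :=
          Finset.prod_eq_one fun j _ => ((hpar κ _).2 rfl j).neg_one_zpow
        rw [parityChar_add] at h2
        have h3 := parityChar_sq τ (indic (Finset.univ.filter (fun j => ¬ Even (κ j))))
        calc parityChar τ κ = parityChar τ κ * (parityChar τ _ * parityChar τ _) := by rw [h3, mul_one]
          _ = _ := by rw [← mul_assoc, h2, one_mul]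
      · intro G _ hG
        rw [if_neg (fun hh => hG ((hpar κ G).1 hh)), mul_zero]
      · simp
    simp_rw [e1]
    rw [Finset.sum_comm]
    simp_rw [← Finset.mul_sum, ← Finset.sum_filter]
    have h2 : ∀ G : Finset (Fin d), ∑ κ ∈ S with ∀ j, Even ((κ + indic G) j), B κ
        = R / 2 ^ d := by
      intro G
      rw [eq_div_iff (pow_ne_zero _ two_ne_zero), mul_comm]; exact h _
    simp_rw [h2, parityChar_indic_symm τ]
    rw [← Finset.sum_mul, sum_parityChar]
    have h3 : (∀ j, Even (indic τ j)) ↔ τ = ∅ := by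
      rw [Finset.eq_empty_iff_forall_notMem]
      refine forall_congr' fun j => ?_
      by_cases hj : j ∈ τ <;> simp [indic, hj]
    simp_rw [h3]
    split_ifs
    · exact mul_div_cancel₀ _ (pow_ne_zero _ two_ne_zero)
    · simp

end Parity

/-! ### Sum rules as reproduction of polynomial sequences -/

section SumRules
variable {d r : ℕ}

lemma exp_half_phase (τ : Finset (Fin d)) (κ : Fin d → ℤ) :
    Complex.exp (-Complex.I * ((∑ j, (κ j : ℝ) *
      ((2 * Real.pi) * (if j ∈ τ then (1 / 2 : ℝ) else 0)) : ℝ) : ℂ)) = parityChar τ κ := by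
  have h : (-Complex.I * ((∑ j, (κ j : ℝ) *
      ((2 * Real.pi) * (if j ∈ τ then (1 / 2 : ℝ) else 0)) : ℝ) : ℂ))
      = ∑ j ∈ τ, (κ j : ℂ) * (-(Real.pi * Complex.I)) := by
    rw [← Finset.sum_filter_add_sum_filter_not Finset.univ (· ∈ τ),
      Finset.sum_congr (s₁ := Finset.univ.filter (· ∉ τ)) rfl (g := fun _ => 0)]
    · simp only [Finset.sum_const_zero, add_zero, Finset.filter_mem_eq_inter, Finset.univ_inter]
      rw [Complex.ofReal_sum, Finset.mul_sum]
      refine Finset.sum_congr rfl fun j hj => ?_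
      rw [if_pos hj]; push_cast; ring
    · intro j hj
      rw [if_neg (Finset.mem_filter.1 hj).2]; simp
  rw [h, Complex.exp_sum, parityChar]
  refine Finset.prod_congr rfl fun j _ => ?_
  rw [Complex.exp_int_mul, Complex.exp_neg, Complex.exp_pi_mul_I]
  norm_num

lemma nsmul_two_apply (z : Fin d → ℤ) (i : Fin d) : (2 • z) i = 2 * z i := by
  simp

/-- The moment of order `p` of `ŷ(2ξ) â(ξ)` restricted to a single index of `a`. -/
def ruleMoment (a : MFilter d r r) (y : MFilter d 1 r) (j : Fin r) (p : (Fin d → ℝ) → ℂ)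
    (κ : Fin d → ℤ) : ℂ :=
  ∑ l, ∑ k ∈ y.support, y k 0 l * a κ l j * p (castVec (2 • k + κ))

lemma symbol_mul_half (a : MFilter d r r) (y : MFilter d 1 r) (τ : Finset (Fin d)) (j : Fin r)
    (ξ : Fin d → ℝ) :
    (symbol y ((2 : ℝ) • ξ) * symbol a (ξ + (2 * Real.pi) •
      fun j => if j ∈ τ then (1 / 2 : ℝ) else 0)) 0 j
    = expSum (a.support ×ˢ (Finset.univ : Finset (Fin r)) ×ˢ y.support)
      (fun q => parityChar τ q.1 * (y q.2.2 0 q.2.1 * a q.1 q.2.1 j))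
      (fun q => castVec (2 • q.2.2 + q.1)) ξ := by
  rw [Matrix.mul_apply, expSum, Finset.sum_product_right, Finset.sum_product]
  refine Finset.sum_congr rfl fun l _ => ?_
  rw [symbol_apply, symbol_apply, expSum, expSum, Finset.sum_mul_sum]
  refine Finset.sum_congr rfl fun k _ => Finset.sum_congr rfl fun κ _ => ?_
  have e : Complex.exp (-Complex.I * ((∑ i, castVec κ i * (ξ + (2 * Real.pi) •
      fun j => if j ∈ τ then (1 / 2 : ℝ) else 0) i : ℝ) : ℂ))
      = parityChar τ κ * Complex.exp (-Complex.I * ((∑ i, castVec κ i * ξ i : ℝ) : ℂ)) := by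
    rw [← exp_half_phase, ← Complex.exp_add]
    congr 1
    rw [← mul_add, ← Complex.ofReal_add, ← Finset.sum_add_distrib]
    congr 2
    refine Finset.sum_congr rfl fun i _ => ?_
    simp only [Pi.add_apply, Pi.smul_apply, smul_eq_mul, castVec_apply]; ring
  have e2 : Complex.exp (-Complex.I * ((∑ i, castVec (2 • k + κ) i * ξ i : ℝ) : ℂ))
      = Complex.exp (-Complex.I * ((∑ i, castVec k i * ((2 : ℝ) • ξ) i : ℝ) : ℂ))
        * Complex.exp (-Complex.I * ((∑ i, castVec κ i * ξ i : ℝ) : ℂ)) := by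
    rw [← Complex.exp_add]
    congr 1
    rw [← mul_add, ← Complex.ofReal_add, ← Finset.sum_add_distrib]
    congr 2
    refine Finset.sum_congr rfl fun i _ => ?_
    simp only [castVec_add, castVec_two_smul, Pi.add_apply, Pi.smul_apply, smul_eq_mul]; ring
  rw [e, e2]; ring

/-- A frequency ω ∈ {0, 1/2}^d is encoded by τ = {j : ω_j ≠ 0}; shifting the argument of â by 2πω
multiplies the coefficient at κ by the character of τ. -/
lemma matching_cond_iff_moments (a : MFilter d r r) (n : ℕ) (y : MFilter d 1 r) :
    (∀ w : Fin d → ℝ, (∀ j, w j = 0 ∨ w j = 1 / 2) →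
      MatEqOrder n
        (fun ξ => symbol y ((2 : ℝ) • ξ) * symbol a (ξ + (2 * Real.pi) • w))
        (fun ξ => if w = 0 then symbol y ξ else 0)) ↔
    ∀ (j : Fin r), ∀ p ∈ Pl d n, ∀ τ : Finset (Fin d),
      ∑ κ ∈ a.support, parityChar τ κ * ruleMoment a y j p κ
        = if τ = ∅ then ∑ k ∈ y.support, y k 0 j * p (castVec k) else 0 := by
  have key : ∀ (τ : Finset (Fin d)) (j : Fin r),
      EqOrder n (fun ξ => (symbol y ((2 : ℝ) • ξ) * symbol a (ξ + (2 * Real.pi) •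
        fun j => if j ∈ τ then (1 / 2 : ℝ) else 0)) 0 j)
        (fun ξ => (if τ = ∅ then symbol y ξ else 0) 0 j) ↔
      ∀ p ∈ Pl d n, ∑ κ ∈ a.support, parityChar τ κ * ruleMoment a y j p κ
        = if τ = ∅ then ∑ k ∈ y.support, y k 0 j * p (castVec k) else 0 := by
    intro τ j
    have e1 : (fun ξ => (symbol y ((2 : ℝ) • ξ) * symbol a (ξ + (2 * Real.pi) •
        fun j => if j ∈ τ then (1 / 2 : ℝ) else 0)) 0 j) = _ :=
      funext fun ξ => symbol_mul_half a y τ j ξ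
    have e2 : (fun ξ => (if τ = ∅ then symbol y ξ else 0) 0 j)
        = expSum y.support (fun k => if τ = ∅ then y k 0 j else 0) castVec := by
      ext ξ
      split_ifs
      · rw [symbol_apply]
      · simp [expSum]
    rw [e1, e2, eqOrder_expSum_iff]
    refine forall₂_congr fun p _ => ?_
    have e3 : ∑ q ∈ a.support ×ˢ (Finset.univ : Finset (Fin r)) ×ˢ y.support,
        parityChar τ q.1 * (y q.2.2 0 q.2.1 * a q.1 q.2.1 j) * p (castVec (2 • q.2.2 + q.1))
        = ∑ κ ∈ a.support, parityChar τ κ * ruleMoment a y j p κ := by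
      rw [Finset.sum_product]
      refine Finset.sum_congr rfl fun κ _ => ?_
      rw [Finset.sum_product, ruleMoment, Finset.mul_sum]
      refine Finset.sum_congr rfl fun l _ => ?_
      rw [Finset.mul_sum]
      refine Finset.sum_congr rfl fun k _ => ?_
      ring
    have e4 : ∑ k ∈ y.support, (if τ = ∅ then y k 0 j else 0) * p (castVec k)
        = if τ = ∅ then ∑ k ∈ y.support, y k 0 j * p (castVec k) else 0 := by
      split_ifs <;> simp
    rw [e3, e4]
  constructor
  · intro h j p hp τ
    refine (key τ j).1 ?_ p hp
    have := h (fun j => if j ∈ τ then (1 / 2 : ℝ) else 0)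
      (fun j => by by_cases hj : j ∈ τ <;> simp [hj]) 0 j
    have h0 : (fun j => if j ∈ τ then (1 / 2 : ℝ) else 0) = 0 ↔ τ = ∅ := by
      rw [funext_iff, Finset.eq_empty_iff_forall_notMem]
      refine forall_congr' fun j => ?_
      by_cases hj : j ∈ τ <;> simp [hj]
    simpa only [h0] using this
  · intro h w hw i j
    rw [Subsingleton.elim i 0]
    set τ : Finset (Fin d) := Finset.univ.filter (fun j => w j ≠ 0) with hτ
    have hwτ : w = fun j => if j ∈ τ then (1 / 2 : ℝ) else 0 := by
      ext j
      rcases hw j with h1 | h1 <;> simp [hτ, h1]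
    have h0 : w = 0 ↔ τ = ∅ := by
      rw [funext_iff, Finset.eq_empty_iff_forall_notMem]
      refine forall_congr' fun j => ?_
      simp [hτ]
    have := (key τ j).2 (fun p hp => h j p hp τ)
    rw [← hwτ] at this
    simpa only [h0] using this

-- The argument γ - 2x is chosen so that every term of the subdivided sequence at γ evaluates p at
-- 2k + κ, where κ = γ - 2z runs over the coset of γ modulo 2. These are the points that occur in
-- ŷ(2ξ)â(ξ).
open Classical in
lemma subdiv_polyConv_apply (a : MFilter d r r) (y : MFilter d 1 r) (p : (Fin d → ℝ) → ℂ)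
    (γ : Fin d → ℤ) (j : Fin r) :
    subdiv a (polyConv y fun x => p (castVec γ - (2 : ℝ) • x)) γ 0 j
      = (2 : ℂ) ^ d * ∑ κ ∈ a.support with (∀ j, Even ((κ + γ) j)), ruleMoment a y j p κ := by
  obtain ⟨n, hn⟩ := exists_nat_ge ‖γ‖
  rw [subdiv_eq_sum a _ (k := γ) (B := box d (n + radius a))
    (fun z hz => mem_box_of_mask_one hn hz), Matrix.smul_apply, smul_eq_mul, Matrix.sum_apply]
  congr 1
  have hz : ∀ z, (polyConv y (fun x => p (castVec γ - (2 : ℝ) • x)) z * a (γ - 2 • z)) 0 j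
      = ruleMoment a y j p (γ - 2 • z) := by
    intro z
    rw [Matrix.mul_apply, ruleMoment]
    refine Finset.sum_congr rfl fun l _ => ?_
    rw [polyConv_apply, Finset.sum_mul]
    refine Finset.sum_congr rfl fun k _ => ?_
    have : castVec γ - (2 : ℝ) • castVec (z - k) = castVec (2 • k + (γ - 2 • z)) := by
      ext i; simp; ring
    rw [this]; ring
  simp_rw [hz]
  have hinj : Set.InjOn (fun z : Fin d → ℤ => γ - 2 • z) (box d (n + radius a)) := by
    intro z _ z' _ h
    ext i
    have := congrFun h i
    simp at this
    omega
  rw [← Finset.sum_image (f := fun κ => ruleMoment a y j p κ) hinj]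
  symm
  refine Finset.sum_subset_zero_on_sdiff ?_ ?_ (fun _ _ => rfl)
  · intro κ hκ
    rw [Finset.mem_filter] at hκ
    obtain ⟨h1, h2⟩ := hκ
    have h3 : γ - 2 • (fun i => (γ i - κ i) / 2) = κ := by
      ext i
      have := h2 i
      rw [Pi.add_apply, Int.even_iff] at this
      rw [Pi.sub_apply, nsmul_two_apply]
      omega
    refine Finset.mem_image.2 ⟨fun i => (γ i - κ i) / 2, ?_, h3⟩
    refine mem_box_of_mask_one hn ?_
    rw [h3]; exact Finsupp.mem_support_iff.1 h1
  · intro κ hκ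
    rw [Finset.mem_sdiff, Finset.mem_image, Finset.mem_filter] at hκ
    obtain ⟨⟨z, _, rfl⟩, h2⟩ := hκ
    have : a (γ - 2 • z) = 0 := by
      by_contra h
      refine h2 ⟨Finsupp.mem_support_iff.2 h, fun i => ?_⟩
      rw [Int.even_iff]
      rw [Pi.add_apply, Pi.sub_apply, nsmul_two_apply]
      omega
    simp only [ruleMoment, this, Matrix.zero_apply, mul_zero, zero_mul, Finset.sum_const_zero]

/-- Sum rules of order `n` hold exactly when the subdivision operator reproduces the polynomial
sequences `p * y` with `deg p < n`. -/
theorem isMatchingFilter_iff (a : MFilter d r r) (n : ℕ) (y : MFilter d 1 r) :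
    IsMatchingFilter a n y ↔ symbol y 0 ≠ 0 ∧
      ∀ p ∈ Pl d n, subdiv a (polyConv y p) = polyConv y (fun x => p ((1 / 2 : ℝ) • x)) := by
  classical
  rw [IsMatchingFilter, matching_cond_iff_moments]
  refine and_congr_right fun _ => ?_
  have hr : ∀ (p : (Fin d → ℝ) → ℂ) (γ : Fin d → ℤ) (j : Fin r),
      polyConv y (fun x => p (castVec γ - (2 : ℝ) • ((1 / 2 : ℝ) • x))) γ 0 j
        = ∑ k ∈ y.support, y k 0 j * p (castVec k) := by
    intro p γ j
    rw [polyConv_apply]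
    refine Finset.sum_congr rfl fun k _ => ?_
    rw [mul_comm]
    congr 2
    ext i; simp
  constructor
  · intro h p hp
    ext γ i j
    rw [Subsingleton.elim i 0]
    -- The inverse substitution, so that p(x) = q(γ - 2x); it depends on the point γ at which the
    -- sequences are compared.
    set q : (Fin d → ℝ) → ℂ := fun x => p ((-(1 / 2) : ℝ) • x + (1 / 2 : ℝ) • castVec γ) with hq
    have hqP : q ∈ Pl d n := affine_mem_Pl hp _ _
    have hpq : p = fun x => q (castVec γ - (2 : ℝ) • x) := by
      ext x; simp only [hq]; congr 1; ext i; simp; ring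
    have h1 := (parity_fourier a.support (ruleMoment a y j q) _).1 (h j q hqP) γ
    rw [← subdiv_polyConv_apply, ← hr q γ j, ← hpq] at h1
    rw [h1, hpq]
  · intro h j p hp
    refine (parity_fourier a.support (ruleMoment a y j p) _).2 fun γ => ?_
    rw [← subdiv_polyConv_apply, ← hr p γ j, h]
    have := affine_mem_Pl hp (-2) (castVec γ)
    convert this using 3
    ext i; simp; ring

end SumRules

/-! ### Calculus of partial derivatives -/

section Calculus
variable {d : ℕ}

lemma contDiff_nat_of_le {m n : ℕ} {f : (Fin d → ℝ) → ℂ} (h : ContDiff ℝ n f) (hmn : m ≤ n) :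
    ContDiff ℝ m f := h.of_le (by exact_mod_cast hmn)

lemma contDiff_pd {n : ℕ} {f : (Fin d → ℝ) → ℂ} (hf : ContDiff ℝ (n + 1 : ℕ) f) (j : Fin d) :
    ContDiff ℝ n (pd j f) :=
  (hf.fderiv_right (m := n) (by push_cast; exact le_rfl)).clm_apply contDiff_const

lemma differentiable_of_contDiff_succ {n : ℕ} {f : (Fin d → ℝ) → ℂ}
    (hf : ContDiff ℝ (n + 1 : ℕ) f) : Differentiable ℝ f :=
  hf.differentiable (by exact_mod_cast (Nat.succ_ne_zero n))

lemma contDiff_iterate_pd {n k : ℕ} {f : (Fin d → ℝ) → ℂ} (hf : ContDiff ℝ (n + k : ℕ) f)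
    (j : Fin d) : ContDiff ℝ n ((pd j)^[k] f) := by
  induction k generalizing f with
  | zero => simpa using hf
  | succ k ih =>
    rw [Function.iterate_succ_apply]
    exact ih (contDiff_pd (by rwa [add_assoc]) j)

lemma contDiff_foldr_pd (L : List (Fin d)) (μ : Fin d → ℕ) {n : ℕ} {f : (Fin d → ℝ) → ℂ}
    (hf : ContDiff ℝ (n + (L.map μ).sum : ℕ) f) :
    ContDiff ℝ n (L.foldr (fun j g => (pd j)^[μ j] g) f) := by
  induction L generalizing n with
  | nil => simpa using hf
  | cons j L ih =>
    rw [List.foldr_cons]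
    refine contDiff_iterate_pd (ih ?_) j
    rwa [List.map_cons, List.sum_cons, ← add_assoc] at hf

lemma sum_map_finRange (μ : Fin d → ℕ) : ((List.finRange d).map μ).sum = order μ := by
  rw [order, Fin.sum_univ_def]

lemma contDiff_partialDeriv {n : ℕ} {μ : Fin d → ℕ} {f : (Fin d → ℝ) → ℂ}
    (hf : ContDiff ℝ (n + order μ : ℕ) f) : ContDiff ℝ n (partialDeriv μ f) :=
  contDiff_foldr_pd _ μ (by rwa [sum_map_finRange])

lemma continuous_partialDeriv {μ : Fin d → ℕ} {f : (Fin d → ℝ) → ℂ}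
    (hf : ContDiff ℝ (order μ) f) : Continuous (partialDeriv μ f) :=
  (contDiff_partialDeriv (n := 0) (by simpa using hf)).continuous

lemma pd_comm {f : (Fin d → ℝ) → ℂ} (hf : ContDiff ℝ (2 : ℕ) f) (i j : Fin d) :
    pd i (pd j f) = pd j (pd i f) := by
  ext x
  have hd : DifferentiableAt ℝ (fderiv ℝ f) x :=
    ((hf.fderiv_right (m := 1) (by norm_num)).differentiable one_ne_zero).differentiableAt
  have h : ∀ i j : Fin d, pd i (pd j f) x
      = fderiv ℝ (fderiv ℝ f) x (Pi.single i 1) (Pi.single j 1) := by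
    intro i j
    have : HasFDerivAt (fun y => fderiv ℝ f y (Pi.single j 1))
        ((ContinuousLinearMap.apply ℝ ℂ (Pi.single j 1 : Fin d → ℝ)).comp
          (fderiv ℝ (fderiv ℝ f) x)) x :=
      (ContinuousLinearMap.apply ℝ ℂ (Pi.single j 1 : Fin d → ℝ)).hasFDerivAt.comp x hd.hasFDerivAt
    rw [pd]
    unfold pd
    rw [this.fderiv]; rfl
  rw [h, h]
  exact (hf.contDiffAt.isSymmSndFDerivAt
    (by rw [minSmoothness_of_isRCLikeNormedField]; norm_num)) _ _

lemma iterate_pd_comm {k : ℕ} {f : (Fin d → ℝ) → ℂ} (hf : ContDiff ℝ (k + 1 : ℕ) f)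
    (i j : Fin d) : (pd i)^[k] (pd j f) = pd j ((pd i)^[k] f) := by
  induction k generalizing f with
  | zero => rfl
  | succ k ih =>
    rw [Function.iterate_succ_apply, pd_comm (contDiff_nat_of_le hf (by omega)),
      ih (contDiff_pd hf i), Function.iterate_succ_apply]

lemma foldr_pd_comm (L : List (Fin d)) (μ : Fin d → ℕ) {f : (Fin d → ℝ) → ℂ} (j : Fin d)
    (hf : ContDiff ℝ ((L.map μ).sum + 1 : ℕ) f) :
    L.foldr (fun i g => (pd i)^[μ i] g) (pd j f)
      = pd j (L.foldr (fun i g => (pd i)^[μ i] g) f) := by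
  induction L with
  | nil => rfl
  | cons i L ih =>
    rw [List.map_cons, List.sum_cons] at hf
    rw [List.foldr_cons, List.foldr_cons, ih (contDiff_nat_of_le hf (by omega)), iterate_pd_comm]
    exact contDiff_foldr_pd L μ (contDiff_nat_of_le hf (by omega))

lemma partialDeriv_pd_comm {μ : Fin d → ℕ} {f : (Fin d → ℝ) → ℂ}
    (hf : ContDiff ℝ (order μ + 1 : ℕ) f) (j : Fin d) :
    partialDeriv μ (pd j f) = pd j (partialDeriv μ f) :=
  foldr_pd_comm _ μ j (by rwa [sum_map_finRange])

lemma foldr_pd_congr (L : List (Fin d)) {μ ν : Fin d → ℕ} (h : ∀ i ∈ L, μ i = ν i)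
    (f : (Fin d → ℝ) → ℂ) : L.foldr (fun i g => (pd i)^[μ i] g) f
      = L.foldr (fun i g => (pd i)^[ν i] g) f := by
  induction L with
  | nil => rfl
  | cons i L ih =>
    rw [List.foldr_cons, List.foldr_cons, ih fun k hk => h k (List.mem_cons_of_mem _ hk),
      h i List.mem_cons_self]

/-- `partialDeriv` applies the coordinate derivatives in a fixed order, so an additional ∂_j has to
be commuted past the later coordinates before it acts first. All inductions on multi-indices rest on
this. -/
lemma foldr_pd_add_single (L : List (Fin d)) (hL : L.Nodup) (μ : Fin d → ℕ)
    {f : (Fin d → ℝ) → ℂ} (j : Fin d) (hj : j ∈ L)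
    (hf : ContDiff ℝ ((L.map μ).sum + 1 : ℕ) f) :
    L.foldr (fun i g => (pd i)^[(μ + Pi.single j 1 : Fin d → ℕ) i] g) f
      = L.foldr (fun i g => (pd i)^[μ i] g) (pd j f) := by
  induction L with
  | nil => simp at hj
  | cons i L ih =>
    rw [List.nodup_cons] at hL
    rw [List.map_cons, List.sum_cons] at hf
    rw [List.foldr_cons, List.foldr_cons]
    by_cases hij : j = i
    · subst hij
      rw [foldr_pd_congr L (ν := μ), foldr_pd_comm L μ j (contDiff_nat_of_le hf (by omega)),
        Pi.add_apply, Pi.single_eq_same, Function.iterate_succ_apply]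
      intro k hk
      have : k ≠ j := fun h => hL.1 (h ▸ hk)
      simp [this]
    · have hjL : j ∈ L := by
        rcases List.mem_cons.1 hj with h | h
        · exact absurd h hij
        · exact h
      rw [ih hL.2 hjL (contDiff_nat_of_le hf (by omega))]
      have : (μ + Pi.single j 1 : Fin d → ℕ) i = μ i := by simp [Ne.symm hij]
      rw [this]

lemma partialDeriv_add_single {μ : Fin d → ℕ} {f : (Fin d → ℝ) → ℂ}
    (hf : ContDiff ℝ (order μ + 1 : ℕ) f) (j : Fin d) :
    partialDeriv (μ + Pi.single j 1) f = partialDeriv μ (pd j f) :=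
  foldr_pd_add_single _ (List.nodup_finRange d) μ j (List.mem_finRange j)
    (by rwa [sum_map_finRange])

@[simp] lemma partialDeriv_zero_index (f : (Fin d → ℝ) → ℂ) : partialDeriv 0 f = f := by
  have : ∀ L : List (Fin d), L.foldr (fun j g => (pd j)^[(0 : Fin d → ℕ) j] g) f = f := by
    intro L
    induction L with
    | nil => rfl
    | cons i L ih => rw [List.foldr_cons, ih]; rfl
  exact this _

lemma order_add_single (μ : Fin d → ℕ) (j : Fin d) : order (μ + Pi.single j 1) = order μ + 1 := by
  rw [order_add, order_single]

lemma exists_eq_add_single {μ : Fin d → ℕ} (h : μ ≠ 0) :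
    ∃ (ν : Fin d → ℕ) (j : Fin d), μ = ν + Pi.single j 1 := by
  obtain ⟨j, hj⟩ := Function.ne_iff.1 h
  rw [Pi.zero_apply] at hj
  refine ⟨μ - Pi.single j 1, j, ?_⟩
  ext i
  by_cases hij : i = j
  · subst hij; simp; omega
  · simp [hij]

/-- Induction on multi-indices. -/
lemma multiIndex_induction {P : (Fin d → ℕ) → Prop} (zero : P 0)
    (succ : ∀ μ j, P μ → P (μ + Pi.single j 1)) (μ : Fin d → ℕ) : P μ := by
  induction h : order μ generalizing μ with
  | zero =>
    have : μ = 0 := by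
      ext j
      have := Finset.single_le_sum (f := μ) (fun _ _ => Nat.zero_le _) (Finset.mem_univ j)
      simp only [order] at h
      simp only [Pi.zero_apply]; omega
    rw [this]; exact zero
  | succ n ih =>
    have : μ ≠ 0 := by rintro rfl; simp [order] at h
    obtain ⟨ν, j, rfl⟩ := exists_eq_add_single this
    rw [order_add_single] at h
    exact succ ν j (ih ν (by omega))

lemma pd_add {f g : (Fin d → ℝ) → ℂ} (hf : Differentiable ℝ f) (hg : Differentiable ℝ g)
    (j : Fin d) : pd j (f + g) = pd j f + pd j g := by
  ext x
  simp only [pd, Pi.add_apply]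
  rw [fderiv_add (hf x) (hg x)]; rfl

lemma pd_smul {f : (Fin d → ℝ) → ℂ} (hf : Differentiable ℝ f) (c : ℂ) (j : Fin d) :
    pd j (c • f) = c • pd j f := by
  ext x
  simp only [pd, Pi.smul_apply]
  rw [fderiv_const_smul (hf x)]; rfl

lemma pd_affine {f : (Fin d → ℝ) → ℂ} (hf : Differentiable ℝ f) (c : ℝ) (b : Fin d → ℝ)
    (j : Fin d) : pd j (fun x => f (c • x + b)) = (c : ℂ) • fun x => pd j f (c • x + b) := by
  ext x
  have h1 : HasFDerivAt (fun x : Fin d → ℝ => c • x + b)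
      (c • ContinuousLinearMap.id ℝ (Fin d → ℝ)) x :=
    ((hasFDerivAt_id x).const_smul c).add_const b
  have h2 := (hf (c • x + b)).hasFDerivAt.comp x h1
  have h3 : fderiv ℝ (fun x => f (c • x + b)) x = _ := h2.fderiv
  simp only [pd, Pi.smul_apply]
  rw [h3]
  simp

lemma partialDeriv_add {μ : Fin d → ℕ} {f g : (Fin d → ℝ) → ℂ} (hf : ContDiff ℝ (order μ) f)
    (hg : ContDiff ℝ (order μ) g) :
    partialDeriv μ (f + g) = partialDeriv μ f + partialDeriv μ g := by
  induction μ using multiIndex_induction generalizing f g with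
  | zero => simp
  | succ μ j ih =>
    rw [order_add_single] at hf hg
    rw [partialDeriv_add_single hf, partialDeriv_add_single hg,
      partialDeriv_add_single (f := f + g) (hf.add hg),
      pd_add (differentiable_of_contDiff_succ hf) (differentiable_of_contDiff_succ hg),
      ih (contDiff_pd hf j) (contDiff_pd hg j)]

lemma partialDeriv_smul {μ : Fin d → ℕ} {f : (Fin d → ℝ) → ℂ} (hf : ContDiff ℝ (order μ) f)
    (c : ℂ) : partialDeriv μ (c • f) = c • partialDeriv μ f := by
  induction μ using multiIndex_induction generalizing f with
  | zero => simp
  | succ μ j ih =>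
    rw [order_add_single] at hf
    rw [partialDeriv_add_single hf, partialDeriv_add_single (f := c • f) (hf.const_smul c),
      pd_smul (differentiable_of_contDiff_succ hf), ih (contDiff_pd hf j)]

lemma partialDeriv_sub {μ : Fin d → ℕ} {f g : (Fin d → ℝ) → ℂ} (hf : ContDiff ℝ (order μ) f)
    (hg : ContDiff ℝ (order μ) g) :
    partialDeriv μ (f - g) = partialDeriv μ f - partialDeriv μ g := by
  rw [sub_eq_add_neg, ← neg_one_smul ℂ g, partialDeriv_add (g := (-1 : ℂ) • g) hf (hg.const_smul (-1 : ℂ)),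
    partialDeriv_smul hg, neg_one_smul, sub_eq_add_neg]

lemma partialDeriv_zero_fun (μ : Fin d → ℕ) :
    partialDeriv μ (0 : (Fin d → ℝ) → ℂ) = 0 := by
  have := partialDeriv_smul (μ := μ) (f := (0 : (Fin d → ℝ) → ℂ)) contDiff_const 0
  simpa using this

lemma partialDeriv_sum {ι : Type*} {μ : Fin d → ℕ} (S : Finset ι) {f : ι → (Fin d → ℝ) → ℂ}
    (hf : ∀ i ∈ S, ContDiff ℝ (order μ) (f i)) :
    partialDeriv μ (∑ i ∈ S, f i) = ∑ i ∈ S, partialDeriv μ (f i) := by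
  classical
  induction S using Finset.induction_on with
  | empty => simp [partialDeriv_zero_fun]
  | insert i S hi ih =>
    have h2 : ∀ k ∈ S, ContDiff ℝ (order μ) (f k) := fun k hk => hf k (Finset.mem_insert_of_mem hk)
    rw [Finset.sum_insert hi, Finset.sum_insert hi, partialDeriv_add (hf i (Finset.mem_insert_self _ _))
      (by
        have : (∑ i ∈ S, f i) = fun x => ∑ i ∈ S, f i x := by ext x; simp
        rw [this]; exact ContDiff.sum h2), ih h2]

lemma partialDeriv_affine {μ : Fin d → ℕ} {f : (Fin d → ℝ) → ℂ} (hf : ContDiff ℝ (order μ) f)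
    (c : ℝ) (b : Fin d → ℝ) : partialDeriv μ (fun x => f (c • x + b))
      = (c : ℂ) ^ order μ • fun x => partialDeriv μ f (c • x + b) := by
  induction μ using multiIndex_induction generalizing f with
  | zero => simp [order]
  | succ μ j ih =>
    rw [order_add_single] at hf ⊢
    have hA : ∀ {n : ℕ} {g : (Fin d → ℝ) → ℂ}, ContDiff ℝ n g →
        ContDiff ℝ n (fun x => g (c • x + b)) := fun hg =>
      hg.comp ((contDiff_const_smul c).add contDiff_const)
    rw [partialDeriv_add_single (hA hf), partialDeriv_add_single hf,
      pd_affine (differentiable_of_contDiff_succ hf),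
      partialDeriv_smul (hA (contDiff_pd hf j)), ih (contDiff_pd hf j), smul_smul, pow_succ']

lemma partialDeriv_translate {μ : Fin d → ℕ} {f : (Fin d → ℝ) → ℂ} (hf : ContDiff ℝ (order μ) f)
    (b : Fin d → ℝ) : partialDeriv μ (fun x => f (x + b)) = fun x => partialDeriv μ f (x + b) := by
  simpa using partialDeriv_affine hf 1 b

lemma partialDeriv_partialDeriv {μ ν : Fin d → ℕ} {f : (Fin d → ℝ) → ℂ}
    (hf : ContDiff ℝ (order μ + order ν : ℕ) f) :
    partialDeriv μ (partialDeriv ν f) = partialDeriv (μ + ν) f := by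
  induction ν using multiIndex_induction generalizing f with
  | zero => simp
  | succ ν j ih =>
    rw [order_add_single] at hf
    rw [partialDeriv_add_single (contDiff_nat_of_le hf (by omega)), ih (contDiff_pd hf j),
      ← partialDeriv_add_single, ← add_assoc]
    rw [order_add]; exact hf

/-! Partial derivatives of monomials -/

lemma differentiable_mono (μ : Fin d → ℕ) : Differentiable ℝ (mono μ) :=
  (contDiff_mono μ).differentiable (by simp)

lemma pd_coord (i j : Fin d) :
    pd j (fun x : Fin d → ℝ => (x i : ℂ)) = fun _ => if i = j then 1 else 0 := by
  ext x
  have h : HasFDerivAt (fun x : Fin d → ℝ => (x i : ℂ))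
      (Complex.ofRealCLM.comp (ContinuousLinearMap.proj i : (Fin d → ℝ) →L[ℝ] ℝ)) x :=
    (Complex.ofRealCLM.comp (ContinuousLinearMap.proj i : (Fin d → ℝ) →L[ℝ] ℝ)).hasFDerivAt
  rw [pd, h.fderiv]
  by_cases hij : i = j <;> simp [hij]

/-- Truncated subtraction of exponents does no harm: it truncates only when ν_j = 0, and then the
coefficient vanishes. -/
lemma pd_mono (j : Fin d) (ν : Fin d → ℕ) :
    pd j (mono ν) = (ν j : ℂ) • mono (ν - Pi.single j 1) := by
  induction ν using multiIndex_induction with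
  | zero =>
    rw [mono_zero]
    ext x
    simp [pd, show (1 : (Fin d → ℝ) → ℂ) = fun _ => 1 from rfl]
  | succ ν i ih =>
    have hmul : pd j (mono (ν + Pi.single i 1))
        = pd j (mono ν) * (fun x => (x i : ℂ)) + mono ν * fun _ => if i = j then 1 else 0 := by
      rw [mono_add, mono_single_one, ← pd_coord i j]
      ext x
      have h2 : DifferentiableAt ℝ (fun x : Fin d → ℝ => (x i : ℂ)) x := by
        rw [← mono_single_one]; exact differentiable_mono _ x
      have h3 := ((differentiable_mono ν x).hasFDerivAt.mul h2.hasFDerivAt).fderiv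
      simp only [pd, Pi.add_apply, Pi.mul_apply]
      have h4 : fderiv ℝ (mono ν * fun x : Fin d → ℝ => (x i : ℂ)) x = _ := h3
      rw [h4]
      simp only [add_apply, smul_apply, smul_eq_mul]
      ring
    rw [hmul, ih]
    by_cases hij : i = j
    · subst hij
      have h1 : ν + Pi.single i 1 - Pi.single i 1 = ν := by ext k; simp
      rw [h1]
      ext x
      by_cases h0 : ν i = 0
      · simp [h0]
      · have h2 : ν = (ν - Pi.single i 1) + Pi.single i 1 := by
          ext k
          by_cases hk : k = i
          · subst hk; simp; omega
          · simp [hk]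
        have h3 : mono ν x = mono (ν - Pi.single i 1) x * (x i : ℂ) := by
          nth_rewrite 1 [h2]
          rw [mono_add, mono_single_one]; rfl
        simp [h3]; ring
    · by_cases h0 : ν j = 0
      · ext x
        simp [h0, hij, Ne.symm hij]
      · have h2 : ν + Pi.single i 1 - Pi.single j 1 = (ν - Pi.single j 1) + Pi.single i 1 := by
          ext k
          by_cases hk : k = j
          · subst hk; simp [Ne.symm hij]
          · simp [hk]
        rw [h2, mono_add, mono_single_one]
        ext x
        simp [hij, Ne.symm hij]

lemma pd_mem_Pl {n : ℕ} {f : (Fin d → ℝ) → ℂ} (hf : f ∈ Pl d (n + 1)) (j : Fin d) :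
    pd j f ∈ Pl d n := by
  have key : f ∈ Pl d (n + 1) ∧ pd j f ∈ Pl d n := by
    have hd : ∀ {g : (Fin d → ℝ) → ℂ}, g ∈ Pl d (n + 1) → Differentiable ℝ g := fun hg =>
      (contDiff_of_mem_Pl hg).differentiable (by simp)
    refine Pl_induction (P := fun f => f ∈ Pl d (n + 1) ∧ pd j f ∈ Pl d n) ?_ ?_ ?_ ?_ hf
    · intro μ hμ
      refine ⟨mono_mem_Pl hμ, ?_⟩
      rw [pd_mono]
      by_cases h0 : μ j = 0
      · simp [h0]
      · refine Submodule.smul_mem _ _ (mono_mem_Pl ?_)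
        have h2 : μ = (μ - Pi.single j 1) + Pi.single j 1 := by
          ext k
          by_cases hk : k = j
          · subst hk; simp; omega
          · simp [hk]
        rw [h2, order_add_single] at hμ
        omega
    · refine ⟨zero_mem _, ?_⟩
      have : pd j (0 : (Fin d → ℝ) → ℂ) = 0 := by
        ext x; simp [pd, show (0 : (Fin d → ℝ) → ℂ) = fun _ => 0 from rfl]
      rw [this]; exact zero_mem _
    · rintro f g ⟨hf, hf'⟩ ⟨hg, hg'⟩
      exact ⟨add_mem hf hg, by rw [pd_add (hd hf) (hd hg)]; exact add_mem hf' hg'⟩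
    · rintro c f ⟨hf, hf'⟩
      exact ⟨Submodule.smul_mem _ _ hf, by rw [pd_smul (hd hf)]; exact Submodule.smul_mem _ _ hf'⟩
  exact key.2

lemma partialDeriv_mem_Pl {n : ℕ} {μ : Fin d → ℕ} {f : (Fin d → ℝ) → ℂ}
    (hf : f ∈ Pl d (n + order μ)) : partialDeriv μ f ∈ Pl d n := by
  induction μ using multiIndex_induction generalizing f with
  | zero => simpa [order] using hf
  | succ μ j ih =>
    rw [order_add_single, ← add_assoc] at hf
    rw [partialDeriv_add_single (contDiff_infty.1 (contDiff_of_mem_Pl hf) _)]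
    exact ih (pd_mem_Pl hf j)

/-- The factorial `μ! = μ₁! ⋯ μ_d!`. -/
def mfact (μ : Fin d → ℕ) : ℂ := ∏ j, ((μ j).factorial : ℂ)

lemma mfact_ne_zero (μ : Fin d → ℕ) : mfact μ ≠ 0 :=
  Finset.prod_ne_zero_iff.2 fun _ _ => by exact_mod_cast Nat.factorial_ne_zero _

lemma mfact_add_single (μ : Fin d → ℕ) (j : Fin d) :
    mfact (μ + Pi.single j 1) = (μ j + 1) * mfact μ := by
  rw [mfact, mfact, ← Finset.mul_prod_erase _ _ (Finset.mem_univ j),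
    ← Finset.mul_prod_erase _ (fun i => ((μ i).factorial : ℂ)) (Finset.mem_univ j), ← mul_assoc]
  congr 1
  · simp [Nat.factorial_succ]
  · refine Finset.prod_congr rfl fun i hi => ?_
    simp [Finset.ne_of_mem_erase hi]

lemma partialDeriv_mono_zero (μ ν : Fin d → ℕ) :
    partialDeriv μ (mono ν) 0 = if μ = ν then mfact μ else 0 := by
  induction μ using multiIndex_induction generalizing ν with
  | zero =>
    rw [partialDeriv_zero_index]
    split_ifs with h
    · subst h; simp [mono_zero, mfact]
    · obtain ⟨j, hj⟩ := Function.ne_iff.1 (Ne.symm h)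
      exact Finset.prod_eq_zero (Finset.mem_univ j) (by simpa using hj)
  | succ μ j ih =>
    rw [partialDeriv_add_single (contDiff_infty.1 (contDiff_mono ν) _), pd_mono,
      partialDeriv_smul (contDiff_infty.1 (contDiff_mono _) _), Pi.smul_apply, ih]
    by_cases h0 : ν j = 0
    · rw [if_neg (c := μ + Pi.single j 1 = ν)]
      · simp [h0]
      · rintro rfl; simp at h0
    · have h2 : ν = (ν - Pi.single j 1) + Pi.single j 1 := by
        ext k
        by_cases hk : k = j
        · subst hk; simp; omega
        · simp [hk]
      have h3 : μ = ν - Pi.single j 1 ↔ μ + Pi.single j 1 = ν := by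
        constructor
        · intro h; rw [h, ← h2]
        · rintro rfl; ext k; simp
      simp_rw [h3]
      split_ifs with h
      · subst h
        rw [mfact_add_single]; simp
      · simp

lemma partialDeriv_mono_of_order_eq {μ ν : Fin d → ℕ} (h : order μ = order ν) (x : Fin d → ℝ) :
    partialDeriv μ (mono ν) x = if μ = ν then mfact μ else 0 := by
  have : partialDeriv μ (mono ν) ∈ Pl d 1 :=
    partialDeriv_mem_Pl (mono_mem_Pl (by omega))
  rw [Pl_one_apply this, ← partialDeriv_mono_zero]
  simp

/-! ### Taylor polynomials -/

/-- The multi-indices of order less than `n`. -/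
def orderLT (d n : ℕ) : Finset (Fin d → ℕ) := (finite_order_lt (d := d) n).toFinset

lemma mem_orderLT {n : ℕ} {μ : Fin d → ℕ} : μ ∈ orderLT d n ↔ order μ < n := by
  simp [orderLT]

/-- The Taylor polynomial of `f` at `x`, of degree less than `n`. -/
def taylorPoly (n : ℕ) (f : (Fin d → ℝ) → ℂ) (x : Fin d → ℝ) : (Fin d → ℝ) → ℂ :=
  ∑ μ ∈ orderLT d n, (partialDeriv μ f x / mfact μ) • mono μ

lemma taylorPoly_mem_Pl (n : ℕ) (f : (Fin d → ℝ) → ℂ) (x : Fin d → ℝ) :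
    taylorPoly n f x ∈ Pl d n :=
  Submodule.sum_mem _ fun _ hμ => Submodule.smul_mem _ _ (mono_mem_Pl (mem_orderLT.1 hμ))

lemma partialDeriv_taylorPoly_zero {n : ℕ} (f : (Fin d → ℝ) → ℂ) (x : Fin d → ℝ)
    {μ : Fin d → ℕ} (hμ : order μ < n) :
    partialDeriv μ (taylorPoly n f x) 0 = partialDeriv μ f x := by
  rw [taylorPoly, partialDeriv_sum (f := fun ν => (partialDeriv ν f x / mfact ν) • mono ν) _
    fun ν _ => (contDiff_infty.1 (contDiff_mono ν) _).const_smul (partialDeriv ν f x / mfact ν),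
    Finset.sum_apply,
    Finset.sum_eq_single_of_mem μ (mem_orderLT.2 hμ)]
  · rw [partialDeriv_smul (contDiff_infty.1 (contDiff_mono μ) _), Pi.smul_apply,
      partialDeriv_mono_zero, if_pos rfl, smul_eq_mul, div_mul_cancel₀ _ (mfact_ne_zero μ)]
  · intro ν _ hν
    rw [partialDeriv_smul (contDiff_infty.1 (contDiff_mono ν) _), Pi.smul_apply,
      partialDeriv_mono_zero, if_neg (Ne.symm hν), smul_zero]

lemma partialDeriv_eq_zero_of_mem_Pl {n : ℕ} {f : (Fin d → ℝ) → ℂ} (hf : f ∈ Pl d n)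
    {μ : Fin d → ℕ} (hμ : n ≤ order μ) : partialDeriv μ f = 0 := by
  have : partialDeriv μ f ∈ Pl d 0 := partialDeriv_mem_Pl (Pl_le (by omega) hf)
  rwa [Pl_zero, Submodule.mem_bot] at this

end Calculus

/-! ### Taylor estimates -/

section Taylor
variable {d : ℕ}

lemma eq_sum_single (v : Fin d → ℝ) : v = ∑ j, v j • (Pi.single j 1 : Fin d → ℝ) := by
  ext i
  simp [Finset.sum_apply, Pi.single_apply]

lemma norm_clm_le_sum (L : (Fin d → ℝ) →L[ℝ] ℂ) : ‖L‖ ≤ ∑ j, ‖L (Pi.single j 1)‖ := by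
  refine L.opNorm_le_bound (Finset.sum_nonneg fun _ _ => norm_nonneg _) fun v => ?_
  conv_lhs => rw [eq_sum_single v]
  rw [map_sum, Finset.sum_mul]
  refine (norm_sum_le _ _).trans (Finset.sum_le_sum fun j _ => ?_)
  rw [map_smul, norm_smul, mul_comm]
  exact mul_le_mul_of_nonneg_left (norm_le_pi_norm v j) (norm_nonneg _)

/-- Induction on n: the bound holds for each ∂_j g, and the mean value inequality on the ball gains
a factor R. The factor d comes from bounding the operator norm of the derivative, for the sup norm,
by the sum of the partial derivatives. -/
lemma norm_le_of_jet_eq_zero {n : ℕ} {g : (Fin d → ℝ) → ℂ} {R M : ℝ} (hg : ContDiff ℝ n g)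
    (hM : 0 ≤ M) (h0 : ∀ μ, order μ < n → partialDeriv μ g 0 = 0)
    (h1 : ∀ μ, order μ = n → ∀ x, ‖x‖ ≤ R → ‖partialDeriv μ g x‖ ≤ M) :
    ∀ x, ‖x‖ ≤ R → ‖g x‖ ≤ (d * R) ^ n * M := by
  induction n generalizing g with
  | zero =>
    intro x hx
    simpa using h1 0 (by simp [order]) x hx
  | succ n ih =>
    intro x hx
    have hR : 0 ≤ R := (norm_nonneg _).trans hx
    have hpd : ∀ j, ∀ y, ‖y‖ ≤ R → ‖pd j g y‖ ≤ (d * R) ^ n * M := by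
      intro j
      refine ih (contDiff_pd hg j) ?_ ?_
      · intro μ hμ
        rw [← partialDeriv_add_single (contDiff_nat_of_le hg (by omega))]
        exact h0 _ (by rw [order_add_single]; omega)
      · intro μ hμ y hy
        rw [← partialDeriv_add_single (contDiff_nat_of_le hg (by omega))]
        exact h1 _ (by rw [order_add_single]; omega) y hy
    have hfd : ∀ y ∈ Metric.closedBall (0 : Fin d → ℝ) R, ‖fderiv ℝ g y‖ ≤ d * ((d * R) ^ n * M) := by
      intro y hy
      refine (norm_clm_le_sum _).trans ?_
      refine (Finset.sum_le_sum fun j _ => hpd j y (by simpa using hy)).trans ?_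
      simp
    have := Convex.norm_image_sub_le_of_norm_fderiv_le (𝕜 := ℝ) (f := g) (x := 0) (y := x)
      (fun y _ => differentiable_of_contDiff_succ hg y) hfd (convex_closedBall _ _)
      (by simpa using hR) (by simpa using hx)
    have hg0 : g 0 = 0 := by simpa using h0 0 (by simp [order])
    rw [hg0, sub_zero, sub_zero] at this
    refine this.trans ?_
    calc d * ((d * R) ^ n * M) * ‖x‖ ≤ d * ((d * R) ^ n * M) * R :=
          mul_le_mul_of_nonneg_left hx (by positivity)
      _ = (d * R) ^ (n + 1) * M := by ring

/-- The Taylor polynomial includes the terms of order n, so the order n derivatives of the remainder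
are the oscillations ∂^μ f(x + y) - ∂^μ f(x). Only C^n regularity is needed. -/
lemma norm_sub_taylorPoly_le {n : ℕ} {f : (Fin d → ℝ) → ℂ} (hf : ContDiff ℝ n f)
    {x h : Fin d → ℝ} {ε : ℝ} (hε : 0 ≤ ε)
    (h1 : ∀ μ, order μ = n → ∀ y, ‖y‖ ≤ ‖h‖ →
      ‖partialDeriv μ f (x + y) - partialDeriv μ f x‖ ≤ ε) :
    ‖f (x + h) - taylorPoly (n + 1) f x h‖ ≤ (d * ‖h‖) ^ n * ε := by
  set q := taylorPoly (n + 1) f x with hq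
  have hqP : q ∈ Pl d (n + 1) := taylorPoly_mem_Pl _ _ _
  have hqs : ∀ k : ℕ, ContDiff ℝ k q := fun k => contDiff_infty.1 (contDiff_of_mem_Pl hqP) k
  have hfx : ContDiff ℝ n (fun y => f (y + x)) := hf.comp (contDiff_id.add contDiff_const)
  have hder : ∀ μ, order μ ≤ n → ∀ y, partialDeriv μ ((fun y => f (y + x)) - q) y
      = partialDeriv μ f (y + x) - partialDeriv μ q y := by
    intro μ hμ y
    rw [partialDeriv_sub (contDiff_nat_of_le hfx hμ) (hqs _),
      partialDeriv_translate (contDiff_nat_of_le hf hμ)]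
    rfl
  have := norm_le_of_jet_eq_zero (g := (fun y => f (y + x)) - q) (R := ‖h‖) (M := ε) (n := n)
    (hfx.sub (hqs n)) hε ?_ ?_ h le_rfl
  · simpa [add_comm] using this
  · intro μ hμ
    rw [hder μ hμ.le, zero_add, hq, partialDeriv_taylorPoly_zero _ _ (by omega), sub_self]
  · intro μ hμ y hy
    have h2 : partialDeriv μ q ∈ Pl d 1 :=
      partialDeriv_mem_Pl (by rw [hμ, add_comm]; exact hqP)
    have h3 : partialDeriv μ q y = partialDeriv μ f x := by
      rw [Pl_one_apply h2, ← partialDeriv_taylorPoly_zero (n := n + 1) f x (by omega)]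
      simp [hq]
    rw [hder μ hμ.le, h3, add_comm y x]
    exact h1 μ hμ y hy

/-- Derivative bounds on the remainder of the Taylor expansion at the origin. -/
lemma norm_partialDeriv_remainder_le {n : ℕ} {f : (Fin d → ℝ) → ℂ} (hf : ContDiff ℝ ∞ f)
    {R M : ℝ} (hM : 0 ≤ M)
    (h1 : ∀ μ, order μ = n → ∀ x, ‖x‖ ≤ R → ‖partialDeriv μ f x‖ ≤ M)
    {μ : Fin d → ℕ} (hμ : order μ ≤ n) {x : Fin d → ℝ} (hx : ‖x‖ ≤ R) :
    ‖partialDeriv μ (f - taylorPoly n f 0) x‖ ≤ (d * R) ^ (n - order μ) * M := by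
  have hfn := contDiff_infty.1 hf
  have hqP := taylorPoly_mem_Pl n f 0
  have hqs : ∀ k : ℕ, ContDiff ℝ k (taylorPoly n f 0) :=
    fun k => contDiff_infty.1 (contDiff_of_mem_Pl hqP) k
  have hgs : ∀ k : ℕ, ContDiff ℝ k (f - taylorPoly n f 0) := fun k => (hfn k).sub (hqs k)
  refine norm_le_of_jet_eq_zero (contDiff_partialDeriv (hgs _)) hM ?_ ?_ x hx
  · intro ν hν
    rw [partialDeriv_partialDeriv (hgs _), partialDeriv_sub (hfn _) (hqs _), Pi.sub_apply,
      partialDeriv_taylorPoly_zero _ _ (by rw [order_add]; omega), sub_self]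
  · intro ν hν y hy
    have ho : order (ν + μ) = n := by rw [order_add]; omega
    rw [partialDeriv_partialDeriv (hgs _), partialDeriv_sub (hfn _) (hqs _),
      partialDeriv_eq_zero_of_mem_Pl hqP ho.ge, sub_zero]
    exact h1 _ ho y hy

lemma norm_iteratedFDeriv_pd_le {n : ℕ} {f : (Fin d → ℝ) → ℂ} (hf : ContDiff ℝ (n + 1 : ℕ) f)
    (j : Fin d) (x : Fin d → ℝ) :
    ‖iteratedFDeriv ℝ n (pd j f) x‖ ≤ ‖iteratedFDeriv ℝ (n + 1) f x‖ := by
  have h1 : ContDiff ℝ n (fderiv ℝ f) := hf.fderiv_right (by push_cast; exact le_rfl)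
  have h2 := (ContinuousLinearMap.apply ℝ ℂ (Pi.single j 1 : Fin d → ℝ)).norm_iteratedFDeriv_comp_left
    (f := fderiv ℝ f) (x := x) (n := n) h1.contDiffAt le_rfl
  rw [norm_iteratedFDeriv_fderiv] at h2
  refine h2.trans ?_
  have h3 : ‖ContinuousLinearMap.apply ℝ ℂ (Pi.single j 1 : Fin d → ℝ)‖ ≤ 1 := by
    refine ContinuousLinearMap.opNorm_le_bound _ zero_le_one fun L => ?_
    have : ‖(Pi.single j 1 : Fin d → ℝ)‖ ≤ 1 := by
      rw [pi_norm_le_iff_of_nonneg zero_le_one]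
      intro i
      by_cases hij : i = j
      · subst hij; simp
      · simp [hij]
    rw [one_mul, ContinuousLinearMap.apply_apply]
    calc ‖L (Pi.single j 1)‖ ≤ ‖L‖ * ‖(Pi.single j 1 : Fin d → ℝ)‖ := L.le_opNorm _
      _ ≤ ‖L‖ * 1 := mul_le_mul_of_nonneg_left this (norm_nonneg _)
      _ = ‖L‖ := mul_one _
  calc _ ≤ 1 * ‖iteratedFDeriv ℝ (n + 1) f x‖ := mul_le_mul_of_nonneg_right h3 (norm_nonneg _)
    _ = _ := one_mul _

lemma norm_partialDeriv_le_iteratedFDeriv {μ : Fin d → ℕ} {f : (Fin d → ℝ) → ℂ}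
    (hf : ContDiff ℝ (order μ) f) (x : Fin d → ℝ) :
    ‖partialDeriv μ f x‖ ≤ ‖iteratedFDeriv ℝ (order μ) f x‖ := by
  induction μ using multiIndex_induction generalizing f with
  | zero =>
    have h0 : order (0 : Fin d → ℕ) = 0 := by simp [order]
    rw [h0]; simp
  | succ μ j ih =>
    rw [order_add_single] at hf ⊢
    rw [partialDeriv_add_single hf]
    exact (ih (contDiff_pd hf j)).trans (norm_iteratedFDeriv_pd_le hf j x)

/-- The derivative is the sum of the ∂_j f tensored with coordinate functionals of norm at most one.
The lemma allows seminorms of distributions to be expressed by partial derivatives. -/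
lemma norm_iteratedFDeriv_le_of_partialDeriv {n : ℕ} {f : (Fin d → ℝ) → ℂ}
    (hf : ContDiff ℝ n f) {x : Fin d → ℝ} {M : ℝ}
    (h : ∀ μ, order μ = n → ‖partialDeriv μ f x‖ ≤ M) :
    ‖iteratedFDeriv ℝ n f x‖ ≤ d ^ n * M := by
  induction n generalizing f with
  | zero => simpa using h 0 (by simp [order])
  | succ n ih =>
    rw [← norm_iteratedFDeriv_fderiv]
    let L : Fin d → ℂ →L[ℝ] ((Fin d → ℝ) →L[ℝ] ℂ) := fun j =>
      ContinuousLinearMap.smulRightL ℝ (Fin d → ℝ) ℂ (ContinuousLinearMap.proj j)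
    have hL : ∀ j, ‖L j‖ ≤ 1 := by
      intro j
      refine ContinuousLinearMap.opNorm_le_bound _ zero_le_one fun c => ?_
      have h1 : L j c = ContinuousLinearMap.smulRight (ContinuousLinearMap.proj j) c := rfl
      rw [h1, ContinuousLinearMap.norm_smulRight_apply]
      refine mul_le_mul_of_nonneg_right ?_ (norm_nonneg _)
      refine ContinuousLinearMap.opNorm_le_bound _ zero_le_one fun v => ?_
      rw [one_mul]; exact norm_le_pi_norm v j
    have hfd : fderiv ℝ f = fun x => ∑ j, (L j ∘ pd j f) x := by
      ext x v
      conv_lhs => rw [eq_sum_single v, map_sum]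
      rw [sum_apply]
      refine Finset.sum_congr rfl fun j _ => ?_
      rw [map_smul]; rfl
    rw [hfd, iteratedFDeriv_sum fun j _ => (L j).contDiff.comp (contDiff_pd hf j), Finset.sum_apply]
    refine (norm_sum_le _ _).trans ?_
    have hj : ∀ j ∈ (Finset.univ : Finset (Fin d)),
        ‖iteratedFDeriv ℝ n (L j ∘ pd j f) x‖ ≤ d ^ n * M := by
      intro j _
      refine ((L j).norm_iteratedFDeriv_comp_left (contDiff_pd hf j).contDiffAt le_rfl).trans ?_
      refine (mul_le_mul_of_nonneg_right (hL j) (norm_nonneg _)).trans ?_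
      rw [one_mul]
      refine ih (contDiff_pd hf j) fun μ hμ => ?_
      rw [← partialDeriv_add_single (by rw [hμ]; exact hf)]
      exact h _ (by rw [order_add_single, hμ])
    refine (Finset.sum_le_sum hj).trans ?_
    simp only [Finset.sum_const, Finset.card_univ, Fintype.card_fin, nsmul_eq_mul]
    rw [pow_succ]; exact le_of_eq (by ring)

end Taylor

/-! ### Compact support and integration by parts -/

section Parts
variable {d : ℕ}

lemma hasCompactSupport_pd {f : (Fin d → ℝ) → ℂ} (hf : HasCompactSupport f) (j : Fin d) :
    HasCompactSupport (pd j f) :=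
  hf.fderiv_apply ℝ _

lemma hasCompactSupport_partialDeriv {μ : Fin d → ℕ} {f : (Fin d → ℝ) → ℂ}
    (hf : HasCompactSupport f) (hf' : ContDiff ℝ (order μ) f) :
    HasCompactSupport (partialDeriv μ f) := by
  induction μ using multiIndex_induction generalizing f with
  | zero => simpa using hf
  | succ μ j ih =>
    rw [order_add_single] at hf'
    rw [partialDeriv_add_single hf']
    exact ih (hasCompactSupport_pd hf j) (contDiff_pd hf' j)

lemma integral_pd_mul {f g : (Fin d → ℝ) → ℂ} (hf : ContDiff ℝ (1 : ℕ) f)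
    (hc : HasCompactSupport f) (hg : ContDiff ℝ (1 : ℕ) g) (j : Fin d) :
    ∫ x, pd j f x * g x = -∫ x, f x * pd j g x := by
  have h := integral_mul_fderiv_eq_neg_fderiv_mul_of_integrable (μ := volume) (f := f) (g := g)
    (v := (Pi.single j 1 : Fin d → ℝ)) ?_ ?_ ?_
    (fun x _ => hf.differentiable (by simp) x) (fun x _ => hg.differentiable (by simp) x)
  · unfold pd
    rw [h, neg_neg]
  · exact ((contDiff_pd (n := 0) hf j).continuous.mul hg.continuous).integrable_of_hasCompactSupport
      (hasCompactSupport_pd hc j).mul_right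
  · exact (hf.continuous.mul (contDiff_pd (n := 0) hg j).continuous).integrable_of_hasCompactSupport
      hc.mul_right
  · exact (hf.continuous.mul hg.continuous).integrable_of_hasCompactSupport hc.mul_right

lemma integral_partialDeriv_mul {μ : Fin d → ℕ} {f g : (Fin d → ℝ) → ℂ}
    (hf : ContDiff ℝ (order μ) f) (hc : HasCompactSupport f) (hg : ContDiff ℝ (order μ) g) :
    ∫ x, partialDeriv μ f x * g x = (-1) ^ order μ * ∫ x, f x * partialDeriv μ g x := by
  induction μ using multiIndex_induction generalizing f g with
  | zero => simp [order]
  | succ μ j ih =>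
    rw [order_add_single] at hf hg ⊢
    rw [partialDeriv_add_single hf, ih (contDiff_pd hf j) (hasCompactSupport_pd hc j)
      (contDiff_nat_of_le hg (by omega)), integral_pd_mul (contDiff_nat_of_le hf (by omega)) hc
      (contDiff_partialDeriv (by rwa [add_comm])), partialDeriv_add_single hg,
      partialDeriv_pd_comm hg]
    ring

end Parts

/-! ### Compactly supported distributions: injectivity of the Fourier transform -/

section Distributions
variable {d : ℕ}

lemma contDiff_coe (f : smoothFns d) (n : ℕ) : ContDiff ℝ n (f : (Fin d → ℝ) → ℂ) :=
  contDiff_infty.1 f.2 n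

/-- A compactly supported distribution is controlled by finitely many partial derivatives. -/
lemma CSDist.exists_bound (T : CSDist d) : ∃ (C R : ℝ) (N : ℕ), 0 ≤ C ∧ 0 ≤ R ∧
    ∀ (f : smoothFns d) (M : ℝ), 0 ≤ M →
      (∀ μ, order μ ≤ N → ∀ x, ‖x‖ ≤ R → ‖partialDeriv μ (f : (Fin d → ℝ) → ℂ) x‖ ≤ M) →
        ‖T.toLin f‖ ≤ C * M := by
  obtain ⟨C, R, N, h⟩ := T.bounded
  refine ⟨|C| * (d + 1) ^ N, |R|, N, by positivity, abs_nonneg R, fun f M hM hf => ?_⟩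
  refine (h f ((d + 1) ^ N * M) fun j hj x hx => ?_).trans ?_
  · refine (norm_iteratedFDeriv_le_of_partialDeriv (contDiff_coe f j) (M := M) fun μ hμ =>
      hf μ (by omega) x (hx.trans (le_abs_self R))).trans ?_
    refine mul_le_mul_of_nonneg_right ?_ hM
    calc (d : ℝ) ^ j ≤ (d + 1) ^ j := pow_le_pow_left₀ (Nat.cast_nonneg _) (by linarith) _
      _ ≤ (d + 1) ^ N := pow_le_pow_right₀ (by linarith [Nat.cast_nonneg (α := ℝ) d]) hj
  · rw [mul_assoc]
    exact mul_le_mul_of_nonneg_right (le_abs_self C) (by positivity)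

/-- Construct a compactly supported distribution from bounds on partial derivatives. -/
def CSDist.ofBound (L : smoothFns d →ₗ[ℂ] ℂ) (h : ∃ (C R : ℝ) (N : ℕ), 0 ≤ R ∧
    ∀ (f : smoothFns d) (M : ℝ), 0 ≤ M →
      (∀ μ, order μ ≤ N → ∀ x, ‖x‖ ≤ R → ‖partialDeriv μ (f : (Fin d → ℝ) → ℂ) x‖ ≤ M) →
        ‖L f‖ ≤ C * M) : CSDist d where
  toLin := L
  bounded := by
    obtain ⟨C, R, N, hR, h⟩ := h
    refine ⟨C, R, N, fun f M hf => h f M ?_ fun μ hμ x hx => ?_⟩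
    · exact (norm_nonneg _).trans (hf 0 (Nat.zero_le _) 0 (by simpa using hR))
    · exact (norm_partialDeriv_le_iteratedFDeriv (contDiff_coe f _) x).trans (hf _ hμ x hx)

lemma partialDeriv_congr_nhds {μ : Fin d → ℕ} {f g : (Fin d → ℝ) → ℂ}
    (hf : ContDiff ℝ (order μ) f) (hg : ContDiff ℝ (order μ) g) {x : Fin d → ℝ}
    (h : f =ᶠ[𝓝 x] g) : partialDeriv μ f x = partialDeriv μ g x := by
  induction μ using multiIndex_induction generalizing f g with
  | zero => simpa using h.eq_of_nhds
  | succ μ j ih =>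
    rw [order_add_single] at hf hg
    rw [partialDeriv_add_single hf, partialDeriv_add_single hg]
    refine ih (contDiff_pd hf j) (contDiff_pd hg j) ?_
    filter_upwards [h.fderiv (𝕜 := ℝ)] with y hy
    simp only [pd, hy]

lemma partialDeriv_eq_zero_of_eventuallyEq {μ : Fin d → ℕ} {f : (Fin d → ℝ) → ℂ}
    (hf : ContDiff ℝ (order μ) f) {x : Fin d → ℝ} (h : f =ᶠ[𝓝 x] 0) : partialDeriv μ f x = 0 := by
  rw [partialDeriv_congr_nhds (g := 0) hf contDiff_const h, partialDeriv_zero_fun]; rfl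

lemma expFn_apply (ξ x : Fin d → ℝ) : (expFn ξ : (Fin d → ℝ) → ℂ) x
    = Complex.exp (-Complex.I * ((∑ j, x j * ξ j : ℝ) : ℂ)) := rfl

/-! ### Approximation by trigonometric polynomials -/

/-- Trigonometric polynomials with arbitrary frequencies. -/
def trigSpan (d : ℕ) : Submodule ℂ ((Fin d → ℝ) → ℂ) :=
  Submodule.span ℂ (Set.range fun ξ : Fin d → ℝ => (expFn ξ : (Fin d → ℝ) → ℂ))

lemma expFn_mem_trigSpan (ξ : Fin d → ℝ) : (expFn ξ : (Fin d → ℝ) → ℂ) ∈ trigSpan d :=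
  Submodule.subset_span ⟨ξ, rfl⟩

lemma trigSpan_induction {P : ((Fin d → ℝ) → ℂ) → Prop}
    (mem : ∀ ξ : Fin d → ℝ, P (expFn ξ)) (zero : P 0)
    (add : ∀ f g, f ∈ trigSpan d → g ∈ trigSpan d → P f → P g → P (f + g))
    (smul : ∀ (c : ℂ) f, f ∈ trigSpan d → P f → P (c • f))
    {p : (Fin d → ℝ) → ℂ} (hp : p ∈ trigSpan d) : P p := by
  induction hp using Submodule.span_induction with
  | mem x h => obtain ⟨μ, rfl⟩ := h; exact mem μ
  | zero => exact zero
  | add f g hf' hg' hf hg => exact add f g hf' hg' hf hg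
  | smul c f hf' hf => exact smul c f hf' hf

lemma expFn_mul (ξ η : Fin d → ℝ) : (expFn ξ : (Fin d → ℝ) → ℂ) * (expFn η : (Fin d → ℝ) → ℂ)
    = (expFn (ξ + η) : (Fin d → ℝ) → ℂ) := by
  ext x
  rw [Pi.mul_apply, expFn_apply, expFn_apply, expFn_apply, ← Complex.exp_add]
  congr 1
  rw [← mul_add, ← Complex.ofReal_add, ← Finset.sum_add_distrib]
  simp only [Pi.add_apply, mul_add]

lemma mul_mem_trigSpan {f g : (Fin d → ℝ) → ℂ} (hf : f ∈ trigSpan d) (hg : g ∈ trigSpan d) :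
    f * g ∈ trigSpan d := by
  refine trigSpan_induction (P := fun f => f * g ∈ trigSpan d) ?_ ?_ ?_ ?_ hf
  · intro ξ
    refine trigSpan_induction (P := fun g => (expFn ξ : (Fin d → ℝ) → ℂ) * g ∈ trigSpan d)
      ?_ ?_ ?_ ?_ hg
    · intro η; rw [expFn_mul]; exact expFn_mem_trigSpan _
    · simp
    · intro f g _ _ hf hg; rw [mul_add]; exact add_mem hf hg
    · intro c f _ hf; rw [mul_smul_comm]; exact Submodule.smul_mem _ _ hf
  · simp
  · intro f g _ _ hf hg; rw [add_mul]; exact add_mem hf hg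
  · intro c f _ hf; rw [smul_mul_assoc]; exact Submodule.smul_mem _ _ hf

lemma one_mem_trigSpan : (1 : (Fin d → ℝ) → ℂ) ∈ trigSpan d := by
  convert expFn_mem_trigSpan (d := d) 0 using 1
  ext x; simp [expFn_apply]

lemma continuous_of_mem_trigSpan {f : (Fin d → ℝ) → ℂ} (hf : f ∈ trigSpan d) : Continuous f :=
  trigSpan_induction (P := Continuous) (fun ξ => (contDiff_coe (expFn ξ) 0).continuous)
    continuous_const (fun _ _ _ _ hf hg => hf.add hg) (fun c _ _ hf => hf.const_smul c) hf

lemma CSDist.eq_zero_of_mem_trigSpan {T : CSDist d} (hT : ∀ ξ, T.toLin (expFn ξ) = 0)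
    {f : smoothFns d} (hf : (f : (Fin d → ℝ) → ℂ) ∈ trigSpan d) : T.toLin f = 0 := by
  have : ∀ F ∈ trigSpan d, ∃ f : smoothFns d, (f : (Fin d → ℝ) → ℂ) = F ∧ T.toLin f = 0 := by
    intro F hF
    refine trigSpan_induction
      (P := fun F => ∃ f : smoothFns d, (f : (Fin d → ℝ) → ℂ) = F ∧ T.toLin f = 0) ?_ ?_ ?_ ?_ hF
    · exact fun ξ => ⟨expFn ξ, rfl, hT ξ⟩
    · exact ⟨0, rfl, map_zero _⟩
    · rintro _ _ _ _ ⟨f, rfl, hf⟩ ⟨g, rfl, hg⟩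
      exact ⟨f + g, rfl, by rw [map_add, hf, hg, add_zero]⟩
    · rintro c _ _ ⟨f, rfl, hf⟩
      exact ⟨c • f, rfl, by rw [map_smul, hf, smul_zero]⟩
  obtain ⟨g, hg, hg0⟩ := this f hf
  rw [← Subtype.ext hg, hg0]

/-- Exponentials are multiplicative in x - y, so the variable x factors out of the integral. -/
lemma integral_trig_mem_trigSpan {K g : (Fin d → ℝ) → ℂ} (hK : K ∈ trigSpan d)
    (hg : Continuous g) (hc : HasCompactSupport g) :
    (fun x => ∫ y, K (x - y) * g y) ∈ trigSpan d := by
  have hint : ∀ {K : (Fin d → ℝ) → ℂ}, K ∈ trigSpan d → ∀ x,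
      Integrable (fun y => K (x - y) * g y) := fun hK x =>
    (((continuous_of_mem_trigSpan hK).comp (continuous_const.sub continuous_id)).mul
      hg).integrable_of_hasCompactSupport hc.mul_left
  refine trigSpan_induction (P := fun K => (fun x => ∫ y, K (x - y) * g y) ∈ trigSpan d)
    ?_ ?_ ?_ ?_ hK
  · intro ξ
    have : (fun x => ∫ y, (expFn ξ : (Fin d → ℝ) → ℂ) (x - y) * g y)
        = (∫ y, (expFn ξ : (Fin d → ℝ) → ℂ) (-y) * g y) • (expFn ξ : (Fin d → ℝ) → ℂ) := by
      ext x
      rw [Pi.smul_apply, smul_eq_mul, ← integral_mul_const]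
      congr 1
      ext y
      have : (expFn ξ : (Fin d → ℝ) → ℂ) (x - y)
          = (expFn ξ : (Fin d → ℝ) → ℂ) (-y) * (expFn ξ : (Fin d → ℝ) → ℂ) x := by
        rw [expFn_apply, expFn_apply, expFn_apply, ← Complex.exp_add]
        congr 1
        rw [← mul_add, ← Complex.ofReal_add, ← Finset.sum_add_distrib]
        congr 2
        refine Finset.sum_congr rfl fun j _ => ?_
        simp only [Pi.sub_apply, Pi.neg_apply]; ring
      rw [this]; ring
    rw [this]
    exact Submodule.smul_mem _ _ (expFn_mem_trigSpan ξ)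
  · convert zero_mem (trigSpan d) using 1
    ext x; simp
  · intro K L hK hL hK' hL'
    convert add_mem hK' hL' using 1
    ext x
    rw [Pi.add_apply, ← integral_add (hint hK x) (hint hL x)]
    simp only [Pi.add_apply, add_mul]
  · intro c K hK hK'
    convert Submodule.smul_mem _ c hK' using 1
    ext x
    rw [Pi.smul_apply, smul_eq_mul, ← integral_const_mul]
    simp only [Pi.smul_apply, smul_eq_mul, mul_assoc]

/-- A nonnegative trigonometric polynomial peaking at the origin. -/
def peak (κ : ℝ) (x : Fin d → ℝ) : ℝ := ∏ j, (1 + Real.cos (κ * x j)) / 2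

lemma continuous_peak (κ : ℝ) : Continuous (peak κ : (Fin d → ℝ) → ℝ) := by
  unfold peak; fun_prop

lemma peak_factor_mem (κ x : ℝ) : 0 ≤ (1 + Real.cos (κ * x)) / 2 ∧ (1 + Real.cos (κ * x)) / 2 ≤ 1 :=
  ⟨by linarith [Real.neg_one_le_cos (κ * x)], by linarith [Real.cos_le_one (κ * x)]⟩

lemma peak_nonneg (κ : ℝ) (x : Fin d → ℝ) : 0 ≤ peak κ x :=
  Finset.prod_nonneg fun j _ => (peak_factor_mem κ (x j)).1

lemma peak_zero (κ : ℝ) : peak κ (0 : Fin d → ℝ) = 1 := by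
  simp [peak]

/-- The condition κ‖x‖ ≤ 1 keeps every κ x_j within one period of the cosine, which excludes the
other maxima. -/
lemma peak_lt_one {κ : ℝ} (hκ : 0 < κ) {x : Fin d → ℝ} (hx : x ≠ 0) (h : κ * ‖x‖ ≤ 1) :
    peak κ x < 1 := by
  obtain ⟨j, hj⟩ := Function.ne_iff.1 hx
  rw [Pi.zero_apply] at hj
  rw [peak, ← Finset.mul_prod_erase _ _ (Finset.mem_univ j)]
  have h1 : ∏ i ∈ Finset.univ.erase j, (1 + Real.cos (κ * x i)) / 2 ≤ 1 :=
    Finset.prod_le_one (fun i _ => (peak_factor_mem κ (x i)).1)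
      (fun i _ => (peak_factor_mem κ (x i)).2)
  have h2 : Real.cos (κ * x j) < 1 := by
    have h3 : |κ * x j| ≤ 1 := by
      rw [abs_mul, abs_of_pos hκ]
      exact (mul_le_mul_of_nonneg_left (norm_le_pi_norm x j) hκ.le).trans h
    refine lt_of_le_of_ne (Real.cos_le_one _) fun h4 => ?_
    have h5 := Real.pi_gt_three
    rw [abs_le] at h3
    have h6 := (Real.cos_eq_one_iff_of_lt_of_lt (by linarith) (by linarith)).1 h4
    rcases mul_eq_zero.1 h6 with h7 | h7
    · exact hκ.ne' h7
    · exact hj h7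
  have h0 : 0 ≤ ∏ i ∈ Finset.univ.erase j, (1 + Real.cos (κ * x i)) / 2 :=
    Finset.prod_nonneg fun i _ => (peak_factor_mem κ (x i)).1
  have h8 := (peak_factor_mem κ (x j)).1
  nlinarith

lemma peak_pow_mem_trigSpan (κ : ℝ) (n : ℕ) :
    (fun x : Fin d → ℝ => ((peak κ x ^ n : ℝ) : ℂ)) ∈ trigSpan d := by
  have hone : ∀ j : Fin d, (fun x : Fin d → ℝ => (((1 + Real.cos (κ * x j)) / 2 : ℝ) : ℂ))
      ∈ trigSpan d := by
    intro j
    have : (fun x : Fin d → ℝ => (((1 + Real.cos (κ * x j)) / 2 : ℝ) : ℂ))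
        = (1 / 2 : ℂ) • (1 : (Fin d → ℝ) → ℂ)
          + ((1 / 4 : ℂ) • (expFn (Pi.single j κ) : (Fin d → ℝ) → ℂ)
          + (1 / 4 : ℂ) • (expFn (Pi.single j (-κ)) : (Fin d → ℝ) → ℂ)) := by
      ext x
      simp only [Pi.add_apply, Pi.smul_apply, smul_eq_mul, Pi.one_apply, expFn_apply]
      have h1 : ∀ t : ℝ, ∑ i, x i * (Pi.single j t : Fin d → ℝ) i = x j * t := by
        intro t; simp [Pi.single_apply]
      rw [h1, h1]
      push_cast
      rw [Complex.cos]
      have e1 : (κ : ℂ) * (x j : ℂ) * Complex.I = -Complex.I * ((x j : ℂ) * -(κ : ℂ)) := by ring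
      have e2 : -((κ : ℂ) * (x j : ℂ)) * Complex.I = -Complex.I * ((x j : ℂ) * (κ : ℂ)) := by ring
      rw [e1, e2]; ring
    rw [this]
    exact add_mem (Submodule.smul_mem _ _ one_mem_trigSpan)
      (add_mem (Submodule.smul_mem _ _ (expFn_mem_trigSpan _))
        (Submodule.smul_mem _ _ (expFn_mem_trigSpan _)))
  have hprod : ∀ s : Finset (Fin d),
      (fun x : Fin d → ℝ => ∏ j ∈ s, (((1 + Real.cos (κ * x j)) / 2 : ℝ) : ℂ)) ∈ trigSpan d := by
    intro s
    induction s using Finset.induction_on with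
    | empty => simp only [Finset.prod_empty]; exact one_mem_trigSpan
    | insert j s hj ih =>
      simp only [Finset.prod_insert hj]
      exact mul_mem_trigSpan (hone j) ih
  have hp : (fun x : Fin d → ℝ => ((peak κ x : ℝ) : ℂ)) ∈ trigSpan d := by
    have := hprod Finset.univ
    simpa only [peak, Complex.ofReal_prod] using this
  induction n with
  | zero => simp only [pow_zero, Complex.ofReal_one]; exact one_mem_trigSpan
  | succ n ih =>
    simp only [pow_succ, Complex.ofReal_mul] at ih ⊢
    exact mul_mem_trigSpan ih hp

/-- The convolution `∫ K(y) g(x - y) dy`. -/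
def convolve (K g : (Fin d → ℝ) → ℂ) : (Fin d → ℝ) → ℂ :=
  convolution K g (ContinuousLinearMap.mul ℝ ℂ) volume

lemma convolve_apply (K g : (Fin d → ℝ) → ℂ) (x : Fin d → ℝ) :
    convolve K g x = ∫ y, K y * g (x - y) := rfl

lemma contDiff_convolve {K g : (Fin d → ℝ) → ℂ} (hK : Continuous K) {n : ℕ}
    (hg : ContDiff ℝ n g) (hc : HasCompactSupport g) : ContDiff ℝ n (convolve K g) :=
  hc.contDiff_convolution_right (n := (n : ℕ∞)) _ hK.locallyIntegrable hg

lemma pd_convolve {K g : (Fin d → ℝ) → ℂ} (hK : Continuous K) (hg : ContDiff ℝ (1 : ℕ) g)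
    (hc : HasCompactSupport g) (j : Fin d) : pd j (convolve K g) = convolve K (pd j g) := by
  ext x
  have h := hc.hasFDerivAt_convolution_right (μ := volume) (ContinuousLinearMap.mul ℝ ℂ)
    hK.locallyIntegrable (by exact_mod_cast hg) x
  rw [pd, convolve, h.fderiv, convolution_precompR_apply _ hK.locallyIntegrable (hc.fderiv ℝ)
    (hg.continuous_fderiv (by simp))]
  rfl

lemma partialDeriv_convolve {μ : Fin d → ℕ} {K g : (Fin d → ℝ) → ℂ} (hK : Continuous K)
    (hg : ContDiff ℝ (order μ) g) (hc : HasCompactSupport g) :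
    partialDeriv μ (convolve K g) = convolve K (partialDeriv μ g) := by
  induction μ using multiIndex_induction generalizing g with
  | zero => simp
  | succ μ j ih =>
    rw [order_add_single] at hg
    rw [partialDeriv_add_single (contDiff_convolve hK hg hc), partialDeriv_add_single hg,
      pd_convolve hK (contDiff_nat_of_le hg (by omega)) hc,
      ih (contDiff_pd hg j) (hasCompactSupport_pd hc j)]

/-- Normalized powers of a function with a unique maximum concentrate at that maximum. Uniformity in
x comes from viewing y ↦ h(· - y) as a map into the Banach space C(B, ℂ) of functions on the ball of
radius R; `hsupp` makes the integral over the truncated domain equal to the full convolution. -/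
lemma tendsto_peak_convolve {R R' κ : ℝ} (hR' : 0 < R') (hκ : 0 < κ) (hκR : κ * R' ≤ 1)
    {h : (Fin d → ℝ) → ℂ} (hh : Continuous h)
    (hsupp : ∀ x y : Fin d → ℝ, ‖x‖ ≤ R → h (x - y) ≠ 0 → ‖y‖ ≤ R') {ε : ℝ} (hε : 0 < ε) :
    ∀ᶠ n : ℕ in atTop, ∀ x : Fin d → ℝ, ‖x‖ ≤ R →
      ‖convolve (fun y => (((∫ y in Metric.closedBall (0 : Fin d → ℝ) R', peak κ y ^ n)⁻¹
        * peak κ y ^ n : ℝ) : ℂ)) h x - h x‖ ≤ ε := by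
  set S := Metric.closedBall (0 : Fin d → ℝ) R' with hS
  set B := Metric.closedBall (0 : Fin d → ℝ) R with hB
  have : CompactSpace B := isCompact_iff_compactSpace.1 (isCompact_closedBall _ _)
  let F : C((Fin d → ℝ) × B, ℂ) := ⟨fun q => h (q.2.1 - q.1), by fun_prop⟩
  let G : (Fin d → ℝ) → C(B, ℂ) := fun y => F.curry y
  have hG : Continuous G := F.curry.continuous
  have hlim := tendsto_setIntegral_pow_smul_of_unique_maximum_of_isCompact_of_continuousOn
    (μ := volume) (g := G) (x₀ := 0) (s := S) (isCompact_closedBall _ _) (c := peak κ)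
    (continuous_peak κ).continuousOn
    (fun y hy hy0 => by
      rw [peak_zero]
      refine peak_lt_one hκ hy0 (le_trans ?_ hκR)
      exact mul_le_mul_of_nonneg_left (by simpa [hS] using hy) hκ.le)
    (fun y _ => peak_nonneg κ y) (by rw [peak_zero]; exact one_pos)
    (subset_closure (by
      rw [hS, interior_closedBall _ hR'.ne']; simpa using hR')) hG.continuousOn
  rw [Metric.tendsto_nhds] at hlim
  filter_upwards [hlim ε hε] with n hn x hx
  rw [dist_eq_norm] at hn
  have hxB : x ∈ B := by simpa [hB] using hx
  have hpt := (ContinuousMap.norm_coe_le_norm _ (⟨x, hxB⟩ : B)).trans hn.le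
  refine le_of_eq_of_le (congrArg norm ?_) hpt
  rw [ContinuousMap.sub_apply]
  congr 1
  · rw [convolve_apply, ContinuousMap.smul_apply]
    have hint : Integrable (fun y => peak κ y ^ n • G y) (volume.restrict S) := by
      refine ContinuousOn.integrableOn_compact (isCompact_closedBall _ _) ?_
      exact (((continuous_peak κ).pow n).smul hG).continuousOn
    have e1 : (∫ y in S, peak κ y ^ n • G y) (⟨x, hxB⟩ : B)
        = ∫ y in S, ((peak κ y ^ n : ℝ) : ℂ) * h (x - y) := by
      have := (ContinuousMap.evalCLM ℝ (M := ℂ) (⟨x, hxB⟩ : B)).integral_comp_comm hint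
      rw [ContinuousMap.evalCLM_apply] at this
      rw [← this]
      congr 1
    have e2 : ∫ y in S, ((peak κ y ^ n : ℝ) : ℂ) * h (x - y)
        = ∫ y, ((peak κ y ^ n : ℝ) : ℂ) * h (x - y) := by
      refine setIntegral_eq_integral_of_forall_compl_eq_zero fun y hy => ?_
      have : h (x - y) = 0 := by
        by_contra h0
        exact hy (by simpa [hS] using hsupp x y hx h0)
      rw [this, mul_zero]
    rw [e1, Complex.real_smul, e2]
    simp_rw [Complex.ofReal_mul, mul_assoc]
    exact integral_const_mul _ _
  · simp [G, F]

/-- The convolution of g with a peaked trigonometric polynomial is again a trigonometric polynomial,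
hence killed by T. With the right peak, it is close to g together with all derivatives that control
T, on the ball that matters for T. -/
lemma CSDist.eq_zero_of_compactSupport {T : CSDist d} (hT : ∀ ξ, T.toLin (expFn ξ) = 0)
    (g : smoothFns d) (hc : HasCompactSupport (g : (Fin d → ℝ) → ℂ)) : T.toLin g = 0 := by
  obtain ⟨C, R, N, hC, hR, hb⟩ := T.exists_bound
  obtain ⟨R₁, hR₁⟩ := hc.isCompact.isBounded.subset_closedBall (0 : Fin d → ℝ)
  set R' : ℝ := R + |R₁| + 1 with hR'
  have hR'pos : 0 < R' := by positivity
  have hsupp : ∀ μ : Fin d → ℕ, ∀ x y : Fin d → ℝ, ‖x‖ ≤ R →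
      partialDeriv μ (g : (Fin d → ℝ) → ℂ) (x - y) ≠ 0 → ‖y‖ ≤ R' := by
    intro μ x y hx hy
    have h1 : x - y ∈ tsupport (g : (Fin d → ℝ) → ℂ) := by
      by_contra hn
      apply hy
      have h0 : (g : (Fin d → ℝ) → ℂ) =ᶠ[𝓝 (x - y)] (0 : (Fin d → ℝ) → ℂ) :=
        notMem_tsupport_iff_eventuallyEq.1 hn
      exact partialDeriv_eq_zero_of_eventuallyEq (contDiff_coe g _) h0
    have h2 : ‖x - y‖ ≤ R₁ := by simpa using hR₁ h1
    have h3 : ‖y‖ ≤ ‖x‖ + ‖x - y‖ := by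
      have := norm_sub_le x (x - y); simpa using this
    linarith [le_abs_self R₁]
  have hall : ∀ ε > 0, ‖T.toLin g‖ ≤ C * ε := by
    intro ε hε
    have hev : ∀ᶠ n : ℕ in atTop, ∀ μ ∈ orderLT d (N + 1), ∀ x : Fin d → ℝ, ‖x‖ ≤ R →
        ‖convolve (fun y => (((∫ y in Metric.closedBall (0 : Fin d → ℝ) R', peak R'⁻¹ y ^ n)⁻¹
          * peak R'⁻¹ y ^ n : ℝ) : ℂ)) (partialDeriv μ (g : (Fin d → ℝ) → ℂ)) x
          - partialDeriv μ (g : (Fin d → ℝ) → ℂ) x‖ ≤ ε := by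
      rw [Filter.eventually_all_finset]
      intro μ _
      exact tendsto_peak_convolve hR'pos (inv_pos.2 hR'pos) (inv_mul_cancel₀ hR'pos.ne').le
        (continuous_partialDeriv (contDiff_coe g _)) (hsupp μ) hε
    obtain ⟨n, hn⟩ := hev.exists
    set c : ℝ := (∫ y in Metric.closedBall (0 : Fin d → ℝ) R', peak R'⁻¹ y ^ n)⁻¹
    set K : (Fin d → ℝ) → ℂ := fun y => ((c * peak R'⁻¹ y ^ n : ℝ) : ℂ) with hK
    have hKt : K ∈ trigSpan d := by
      have := Submodule.smul_mem _ (c : ℂ) (peak_pow_mem_trigSpan (d := d) R'⁻¹ n)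
      convert this using 1
      ext y; simp [hK]
    have hKc := continuous_of_mem_trigSpan hKt
    have hFs : ContDiff ℝ ∞ (convolve K g) :=
      contDiff_infty.2 fun k => contDiff_convolve hKc (contDiff_coe g k) hc
    let F : smoothFns d := ⟨convolve K g, hFs⟩
    have hFt : (F : (Fin d → ℝ) → ℂ) ∈ trigSpan d := by
      have := integral_trig_mem_trigSpan hKt (contDiff_coe g 0).continuous hc
      convert this using 1
      ext x
      exact convolution_eq_swap _
    have hF0 := CSDist.eq_zero_of_mem_trigSpan hT hFt
    have : T.toLin g = -T.toLin (F - g) := by rw [map_sub, hF0]; ring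
    rw [this, norm_neg]
    refine hb _ ε hε.le fun μ hμ x hx => ?_
    have h1 : ((F - g : smoothFns d) : (Fin d → ℝ) → ℂ) = convolve K g - g := rfl
    rw [h1, partialDeriv_sub (contDiff_infty.1 hFs _) (contDiff_coe g _),
      partialDeriv_convolve hKc (contDiff_coe g _) hc]
    exact hn μ (mem_orderLT.2 (by omega)) x hx
  rw [← norm_le_zero_iff]
  refine le_of_forall_pos_le_add fun δ hδ => ?_
  refine (hall (δ / (C + 1)) (by positivity)).trans ?_
  rw [zero_add, mul_div_assoc', div_le_iff₀ (by positivity)]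
  nlinarith

/-- A compactly supported distribution with vanishing Fourier transform is zero. -/
theorem CSDist.eq_zero_of_fourier {T : CSDist d} (hT : ∀ ξ, T.toLin (expFn ξ) = 0)
    (f : smoothFns d) : T.toLin f = 0 := by
  obtain ⟨C, R, N, hC, hR, hb⟩ := T.exists_bound
  -- The cutoff equals 1 on a neighbourhood of the ball of radius R that controls T, so all
  -- derivatives of f - χf vanish on that ball.
  let χ : ContDiffBump (0 : Fin d → ℝ) := ⟨R + 1, R + 2, by linarith, by linarith⟩
  have hχ : ContDiff ℝ ∞ (fun x : Fin d → ℝ => ((χ x : ℝ) : ℂ)) :=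
    Complex.ofRealCLM.contDiff.comp χ.contDiff
  let g : smoothFns d := ⟨fun x => ((χ x : ℝ) : ℂ) * (f : (Fin d → ℝ) → ℂ) x, hχ.mul f.2⟩
  have hgc : HasCompactSupport (g : (Fin d → ℝ) → ℂ) := by
    refine HasCompactSupport.mul_right ?_
    exact χ.hasCompactSupport.comp_left (g := fun t : ℝ => (t : ℂ)) Complex.ofReal_zero
  have h0 : T.toLin (f - g) = 0 := by
    rw [← norm_le_zero_iff]
    have := hb (f - g) 0 le_rfl fun μ _ x hx => ?_
    · simpa using this
    · have h1 : ((f - g : smoothFns d) : (Fin d → ℝ) → ℂ) =ᶠ[𝓝 x] (0 : (Fin d → ℝ) → ℂ) := by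
        have : Metric.ball (0 : Fin d → ℝ) (R + 1) ∈ 𝓝 x :=
          Metric.isOpen_ball.mem_nhds (by simp; linarith)
        filter_upwards [this] with y hy
        have h2 : χ y = 1 := χ.one_of_mem_closedBall (Metric.ball_subset_closedBall hy)
        change (f : (Fin d → ℝ) → ℂ) y - ((χ y : ℝ) : ℂ) * (f : (Fin d → ℝ) → ℂ) y = 0
        rw [h2]; simp
      rw [partialDeriv_eq_zero_of_eventuallyEq (contDiff_coe _ _) h1, norm_zero]
  rw [map_sub, CSDist.eq_zero_of_compactSupport hT g hgc, sub_zero] at h0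
  exact h0

end Distributions

/-! ### Simple eigenvalues -/

section SimpleEigenvalue
variable {r : ℕ} {A : Matrix (Fin r) (Fin r) ℂ} {y : Fin r → ℂ}

/-- Left and right eigenvectors of a simple eigenvalue are not orthogonal. -/
lemma eq_zero_of_simple_eigenvalue (hA : A.charpoly.rootMultiplicity 1 = 1) (hy : y ≠ 0)
    (hyA : y ᵥ* A = y) {x : Fin r → ℂ} (hx : A *ᵥ x = x) (hyx : y ⬝ᵥ x = 0) : x = 0 := by
  by_contra hx0
  set B : Module.End ℂ (Fin r → ℂ) := Matrix.toLin' A - algebraMap ℂ _ 1 with hB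
  have hBa : ∀ z, B z = A *ᵥ z - z := fun z => by simp [hB]
  -- Algebraic multiplicity one makes the whole generalized eigenspace a line, so no Jordan chain of
  -- length two exists.
  set G := Module.End.maxGenEigenspace (Matrix.toLin' A) 1 with hG
  have hGr : Module.finrank ℂ G = 1 := by
    rw [hG, LinearMap.finrank_maxGenEigenspace_eq, Matrix.charpoly_toLin', hA]
  have hmem : ∀ z, B (B z) = 0 → z ∈ G := fun z hz => by
    rw [hG, Module.End.mem_maxGenEigenspace]
    refine ⟨2, ?_⟩
    simpa [pow_two, hB] using hz
  have hBx : B x = 0 := by rw [hBa, hx, sub_self]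
  have hxG : x ∈ G := hmem x (by rw [hBx, map_zero])
  have hspan : ∀ z ∈ G, ∃ c : ℂ, z = c • x := by
    intro z hz
    obtain ⟨c, hc⟩ := (finrank_eq_one_iff_of_nonzero' (⟨x, hxG⟩ : G)
      (fun h => hx0 (congrArg Subtype.val h))).1 hGr ⟨z, hz⟩
    exact ⟨c, (congrArg Subtype.val hc).symm⟩
  have hker : LinearMap.ker B = ℂ ∙ x := by
    ext z
    rw [LinearMap.mem_ker, Submodule.mem_span_singleton]
    constructor
    · intro hz
      obtain ⟨c, hc⟩ := hspan z (hmem z (by rw [hz, map_zero]))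
      exact ⟨c, hc.symm⟩
    · rintro ⟨c, rfl⟩; rw [map_smul, hBx, smul_zero]
  let Y : (Fin r → ℂ) →ₗ[ℂ] ℂ := dotProductBilin ℂ ℂ y
  have hYa : ∀ z, Y z = y ⬝ᵥ z := fun z => rfl
  have hle : LinearMap.range B ≤ LinearMap.ker Y := by
    rintro _ ⟨z, rfl⟩
    rw [LinearMap.mem_ker, hYa, hBa, dotProduct_sub, Matrix.dotProduct_mulVec, hyA, sub_self]
  have hr1 := LinearMap.finrank_range_add_finrank_ker B
  rw [hker, finrank_span_singleton hx0] at hr1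
  have hr2 := LinearMap.finrank_range_add_finrank_ker Y
  have hr3 : Module.finrank ℂ (LinearMap.range Y) = 1 := by
    have : LinearMap.range Y = ⊤ := by
      refine LinearMap.range_eq_top.2 (LinearMap.surjective fun h => hy ?_)
      ext i
      have := LinearMap.congr_fun h (Pi.single i 1)
      simpa [hYa] using this
    rw [this, finrank_top, Module.finrank_self]
  -- Both spaces have dimension r - 1. Orthogonality to y therefore places x in the range of A - 1,
  -- and a preimage of x would extend it to a Jordan chain.
  have heq := Submodule.eq_of_le_of_finrank_eq hle (by omega)
  have hxY : x ∈ LinearMap.range B := by rw [heq]; exact hyx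
  obtain ⟨z, hz⟩ := hxY
  obtain ⟨c, rfl⟩ := hspan z (hmem z (by rw [hz, hBx]))
  rw [map_smul, hBx, smul_zero] at hz
  exact hx0 hz.symm

lemma exists_normalized_eigenvector (hA : A.charpoly.rootMultiplicity 1 = 1) (hy : y ≠ 0)
    (hyA : y ᵥ* A = y) : ∃ x : Fin r → ℂ, A *ᵥ x = x ∧ y ⬝ᵥ x = 1 := by
  have h1 : Module.End.HasEigenvalue (Matrix.toLin' A) 1 := by
    rw [Module.End.hasEigenvalue_iff_isRoot_charpoly, Matrix.charpoly_toLin']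
    exact (Polynomial.rootMultiplicity_pos (Matrix.charpoly_monic A).ne_zero).1 (by omega)
  obtain ⟨x, hx⟩ := h1.exists_hasEigenvector
  have hx1 : A *ᵥ x = x := by simpa using hx.apply_eq_smul
  have h0 : y ⬝ᵥ x ≠ 0 := fun h => hx.2 (eq_zero_of_simple_eigenvalue hA hy hyA hx1 h)
  refine ⟨(y ⬝ᵥ x)⁻¹ • x, by rw [Matrix.mulVec_smul, hx1], ?_⟩
  rw [dotProduct_smul, smul_eq_mul, inv_mul_cancel₀ h0]

lemma eq_zero_of_not_eigenvalue {c : ℂ} (h : ¬ Module.End.HasEigenvalue (Matrix.toLin' A) c)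
    {x : Fin r → ℂ} (hx : A *ᵥ x = c • x) : x = 0 := by
  by_contra h0
  exact h (Module.End.hasEigenvalue_of_hasEigenvector
    (x := x) ⟨Module.End.mem_eigenspace_iff.2 (by simpa using hx), h0⟩)

end SimpleEigenvalue

/-! ### Vectors of distributions and the refinement operator -/

section Refinement
variable {d r : ℕ}

/-- The sum of the norms of all entries of all coefficients of a filter. -/
def coefNorm {s t : ℕ} (a : MFilter d s t) : ℝ := ∑ k ∈ a.support, ∑ i, ∑ j, ‖a k i j‖

lemma norm_mulVec_le {s t : ℕ} (A : Matrix (Fin s) (Fin t) ℂ) (x : Fin t → ℂ) :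
    ‖A *ᵥ x‖ ≤ (∑ i, ∑ j, ‖A i j‖) * ‖x‖ := by
  have h0 : ∀ i, 0 ≤ ∑ j, ‖A i j‖ := fun i => Finset.sum_nonneg fun j _ => norm_nonneg _
  refine (pi_norm_le_iff_of_nonneg
    (mul_nonneg (Finset.sum_nonneg fun i _ => h0 i) (norm_nonneg _))).2 fun i => ?_
  calc ‖(A *ᵥ x) i‖ = ‖∑ j, A i j * x j‖ := rfl
    _ ≤ ∑ j, ‖A i j * x j‖ := norm_sum_le _ _
    _ ≤ ∑ j, ‖A i j‖ * ‖x‖ := Finset.sum_le_sum fun j _ => by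
        rw [norm_mul]; exact mul_le_mul_of_nonneg_left (norm_le_pi_norm x j) (norm_nonneg _)
    _ = (∑ j, ‖A i j‖) * ‖x‖ := by rw [Finset.sum_mul]
    _ ≤ _ := mul_le_mul_of_nonneg_right
        (Finset.single_le_sum (f := fun i => ∑ j, ‖A i j‖) (fun i _ => h0 i) (Finset.mem_univ i))
        (norm_nonneg _)

/-- The dilation `f ↦ f((x + k)/2)` on smooth functions. -/
def dil (k : Fin d → ℤ) : smoothFns d →ₗ[ℂ] smoothFns d where
  toFun f := ⟨fun x => (f : (Fin d → ℝ) → ℂ) ((1 / 2 : ℝ) • x + (1 / 2 : ℝ) • castVec k),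
    (show ContDiff ℝ ∞ _ from f.2).comp ((contDiff_id.const_smul (1 / 2 : ℝ)).add contDiff_const)⟩
  map_add' _ _ := rfl
  map_smul' _ _ := rfl

lemma dil_coe (k : Fin d → ℤ) (f : smoothFns d) : (dil k f : (Fin d → ℝ) → ℂ)
    = fun x => (f : (Fin d → ℝ) → ℂ) ((1 / 2 : ℝ) • x + (1 / 2 : ℝ) • castVec k) := rfl

lemma partialDeriv_dil (k : Fin d → ℤ) (f : smoothFns d) (μ : Fin d → ℕ) (x : Fin d → ℝ) :
    partialDeriv μ (dil k f : (Fin d → ℝ) → ℂ) x = (1 / 2 : ℂ) ^ order μ *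
      partialDeriv μ (f : (Fin d → ℝ) → ℂ) ((1 / 2 : ℝ) • x + (1 / 2 : ℝ) • castVec k) := by
  rw [dil_coe, partialDeriv_affine (contDiff_coe f _)]
  simp

/-- The refinement operator on vector-valued functionals. -/
def refineOp (a : MFilter d r r) :
    (smoothFns d →ₗ[ℂ] (Fin r → ℂ)) →ₗ[ℂ] (smoothFns d →ₗ[ℂ] (Fin r → ℂ)) where
  toFun L := ∑ k ∈ a.support, (a k).mulVecLin ∘ₗ L ∘ₗ dil k
  map_add' L L' := by
    rw [← Finset.sum_add_distrib]
    refine Finset.sum_congr rfl fun k _ => ?_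
    rw [LinearMap.add_comp, LinearMap.comp_add]
  map_smul' c L := by
    rw [RingHom.id_apply, Finset.smul_sum]
    refine Finset.sum_congr rfl fun k _ => ?_
    rw [LinearMap.smul_comp, LinearMap.comp_smul]

lemma refineOp_apply (a : MFilter d r r) (L : smoothFns d →ₗ[ℂ] (Fin r → ℂ)) (f : smoothFns d) :
    refineOp a L f = ∑ k ∈ a.support, a k *ᵥ L (dil k f) := by
  simp [refineOp]

/-- Functionals bounded by the derivatives of order at most `N` on a ball. -/
def IsCSOrder (N : ℕ) (L : smoothFns d →ₗ[ℂ] (Fin r → ℂ)) : Prop :=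
  ∃ C R : ℝ, 0 ≤ C ∧ 0 ≤ R ∧ ∀ (f : smoothFns d) (M : ℝ), 0 ≤ M →
    (∀ μ, order μ ≤ N → ∀ x, ‖x‖ ≤ R → ‖partialDeriv μ (f : (Fin d → ℝ) → ℂ) x‖ ≤ M) →
      ‖L f‖ ≤ C * M

/-- Functionals bounded by finitely many derivatives on a ball. -/
def IsCS (L : smoothFns d →ₗ[ℂ] (Fin r → ℂ)) : Prop := ∃ N, IsCSOrder N L

/-- Functionals bounded by the derivatives of order exactly `n` on a ball. -/
def TopBound (C R : ℝ) (n : ℕ) (L : smoothFns d →ₗ[ℂ] (Fin r → ℂ)) : Prop :=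
  ∀ (f : smoothFns d) (M : ℝ), 0 ≤ M →
    (∀ μ, order μ = n → ∀ x, ‖x‖ ≤ R → ‖partialDeriv μ (f : (Fin d → ℝ) → ℂ) x‖ ≤ M) →
      ‖L f‖ ≤ C * M

lemma Pl_le_smoothFns (n : ℕ) : Pl d n ≤ smoothFns d := fun _ hf => contDiff_of_mem_Pl hf

/-- A polynomial as a smooth function. -/
def polyIncl (d n : ℕ) : Pl d n →ₗ[ℂ] smoothFns d := Submodule.inclusion (Pl_le_smoothFns n)

lemma coe_sub_polyIncl {n : ℕ} (f : smoothFns d) (p : Pl d n) :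
    ((f - polyIncl d n p : smoothFns d) : (Fin d → ℝ) → ℂ) = f - p := rfl

/-- Subtracting the Taylor polynomial at 0 does not change L f, and all derivatives of the remainder
up to order n are controlled by those of order exactly n. The parameter ρ only enlarges the ball, so
that the refinement operator can be made to preserve it. -/
lemma IsCSOrder.topBound {N : ℕ} {L : smoothFns d →ₗ[ℂ] (Fin r → ℂ)} (hL : IsCSOrder N L)
    (ρ : ℝ) {n : ℕ} (hn : N ≤ n) (hk : L ∘ₗ polyIncl d n = 0) :
    ∃ C R, 0 ≤ C ∧ ρ ≤ R ∧ TopBound C R n L := by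
  obtain ⟨C, R, hC, hR, h⟩ := hL
  set R' := max R ρ with hR'
  have hR'0 : 0 ≤ R' := hR.trans (le_max_left _ _)
  have hd : 0 ≤ (d : ℝ) * R' := mul_nonneg (Nat.cast_nonneg d) hR'0
  have hd1 : 0 ≤ (1 + d * R') ^ n := pow_nonneg (by linarith) _
  refine ⟨C * (1 + d * R') ^ n, R', mul_nonneg hC hd1, le_max_right _ _, fun f M hM hf => ?_⟩
  obtain ⟨p, hp⟩ : ∃ p : Pl d n, (p : (Fin d → ℝ) → ℂ) = taylorPoly n f 0 :=
    ⟨⟨_, taylorPoly_mem_Pl n (f : (Fin d → ℝ) → ℂ) 0⟩, rfl⟩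
  have h1 : L f = L (f - polyIncl d n p) := by
    have := LinearMap.congr_fun hk p
    rw [LinearMap.comp_apply, LinearMap.zero_apply] at this
    rw [map_sub, this, sub_zero]
  rw [h1, mul_assoc]
  refine h _ _ (mul_nonneg hd1 hM) fun μ hμ x hx => ?_
  rw [coe_sub_polyIncl, hp]
  have h2 := norm_partialDeriv_remainder_le (contDiff_infty.2 (contDiff_coe f)) hM hf
    (hμ.trans hn) (hx.trans (le_max_left R ρ))
  refine h2.trans (mul_le_mul_of_nonneg_right ?_ hM)
  exact (pow_le_pow_left₀ hd (by linarith) _).trans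
    (pow_le_pow_right₀ (by linarith) (Nat.sub_le _ _))

lemma coefNorm_nonneg {s t : ℕ} (a : MFilter d s t) : 0 ≤ coefNorm a :=
  Finset.sum_nonneg fun _ _ => Finset.sum_nonneg fun _ _ => Finset.sum_nonneg fun _ _ =>
    norm_nonneg _

/-- Each derivative of a dilated function gains a factor 1/2, giving 2^{-n}, and x ↦ (x + k)/2 maps
the ball of radius R ≥ `radius a` into itself. Hence the operator contracts for large n. -/
lemma TopBound.refineOp {a : MFilter d r r} {L : smoothFns d →ₗ[ℂ] (Fin r → ℂ)} {C R : ℝ} {n : ℕ}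
    (hR : (radius a : ℝ) ≤ R) (hL : TopBound C R n L) :
    TopBound (C * (coefNorm a / 2 ^ n)) R n (refineOp a L) := by
  intro f M hM hf
  rw [refineOp_apply]
  refine (norm_sum_le _ _).trans ?_
  have h1 : ∀ k ∈ a.support, ‖a k *ᵥ L (dil k f)‖ ≤ (∑ i, ∑ j, ‖a k i j‖) * (C * (M / 2 ^ n)) := by
    intro k hk
    refine (norm_mulVec_le _ _).trans (mul_le_mul_of_nonneg_left ?_
      (Finset.sum_nonneg fun _ _ => Finset.sum_nonneg fun _ _ => norm_nonneg _))
    refine hL _ _ (by positivity) fun μ hμ x hx => ?_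
    have hk' : ‖castVec k‖ ≤ R := by
      rw [norm_castVec]; exact (norm_le_radius (Finsupp.mem_support_iff.1 hk)).trans hR
    have h3 : ‖(1 / 2 : ℂ) ^ n‖ = (2 ^ n)⁻¹ := by simp
    rw [partialDeriv_dil, norm_mul, hμ, h3, div_eq_inv_mul M]
    refine mul_le_mul_of_nonneg_left (hf μ hμ _ ?_) (by positivity)
    refine (norm_add_le _ _).trans ?_
    rw [norm_smul, norm_smul]
    norm_num
    linarith
  refine (Finset.sum_le_sum h1).trans (le_of_eq ?_)
  rw [← Finset.sum_mul, ← coefNorm]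
  ring

lemma TopBound.iterate_refineOp {a : MFilter d r r} {L : smoothFns d →ₗ[ℂ] (Fin r → ℂ)}
    {C R : ℝ} {n : ℕ} (hR : (radius a : ℝ) ≤ R) (hL : TopBound C R n L) (N : ℕ) :
    TopBound (C * (coefNorm a / 2 ^ n) ^ N) R n ((GHSD.refineOp a)^[N] L) := by
  induction N with
  | zero => simpa using hL
  | succ N ih =>
    rw [Function.iterate_succ_apply', pow_succ, ← mul_assoc]
    exact ih.refineOp hR

/-! ### The refinement operator on polynomials -/

/-- The dilation on polynomials. -/
def dilPoly (n : ℕ) (k : Fin d → ℤ) : Pl d n →ₗ[ℂ] Pl d n where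
  toFun p := ⟨fun x => (p : (Fin d → ℝ) → ℂ) ((1 / 2 : ℝ) • x + (1 / 2 : ℝ) • castVec k),
    affine_mem_Pl p.2 _ _⟩
  map_add' _ _ := rfl
  map_smul' _ _ := rfl

/-- The refinement operator on functionals on polynomials. -/
def refinePoly (a : MFilter d r r) (n : ℕ) :
    (Pl d n →ₗ[ℂ] (Fin r → ℂ)) →ₗ[ℂ] (Pl d n →ₗ[ℂ] (Fin r → ℂ)) where
  toFun L := ∑ k ∈ a.support, (a k).mulVecLin ∘ₗ L ∘ₗ dilPoly n k
  map_add' L L' := by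
    rw [← Finset.sum_add_distrib]
    refine Finset.sum_congr rfl fun k _ => ?_
    rw [LinearMap.add_comp, LinearMap.comp_add]
  map_smul' c L := by
    rw [RingHom.id_apply, Finset.smul_sum]
    refine Finset.sum_congr rfl fun k _ => ?_
    rw [LinearMap.smul_comp, LinearMap.comp_smul]

lemma refinePoly_apply (a : MFilter d r r) {n : ℕ} (L : Pl d n →ₗ[ℂ] (Fin r → ℂ)) (p : Pl d n) :
    refinePoly a n L p = ∑ k ∈ a.support, a k *ᵥ L (dilPoly n k p) := by
  simp [refinePoly]

lemma refineOp_comp_polyIncl (a : MFilter d r r) (n : ℕ) (L : smoothFns d →ₗ[ℂ] (Fin r → ℂ)) :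
    refineOp a L ∘ₗ polyIncl d n = refinePoly a n (L ∘ₗ polyIncl d n) := by
  ext1 p
  rw [LinearMap.comp_apply, refineOp_apply, refinePoly_apply]
  rfl

/-- The constant polynomial `1`. -/
def polyOne {n : ℕ} (hn : 0 < n) : Pl d n := ⟨1, one_mem_Pl hn⟩

lemma refinePoly_one (a : MFilter d r r) {n : ℕ} (hn : 0 < n) (L : Pl d n →ₗ[ℂ] (Fin r → ℂ)) :
    refinePoly a n L (polyOne hn) = symbol a 0 *ᵥ L (polyOne hn) := by
  rw [refinePoly_apply, symbol_zero, Matrix.sum_mulVec]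
  rfl

/-- By induction on the degree, L takes the dilate of a polynomial p of degree D to 2^{-D} L p, so
the fixed point equation reads â(0) L p = 2^D L p. The eigenvalue hypothesis excludes D ≥ 1, and the
value at 1 settles D = 0. -/
lemma refinePoly_fixed_eq_zero {a : MFilter d r r}
    (ha2 : ∀ n : ℕ, 1 ≤ n →
      ¬ Module.End.HasEigenvalue (Matrix.toLin' (symbol a 0)) ((2 : ℂ) ^ n))
    {n : ℕ} (hn : 0 < n) {L : Pl d n →ₗ[ℂ] (Fin r → ℂ)} (hL : refinePoly a n L = L)
    (h1 : L (polyOne hn) = 0) : L = 0 := by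
  have key : ∀ D, D ≤ n → ∀ p : Pl d n, (p : (Fin d → ℝ) → ℂ) ∈ Pl d D → L p = 0 := by
    intro D
    induction D with
    | zero =>
      intro _ p hp
      rw [Pl_zero, Submodule.mem_bot] at hp
      have : p = 0 := Subtype.ext hp
      rw [this, map_zero]
    | succ D ih =>
      intro hD p hp
      rcases Nat.eq_zero_or_pos D with rfl | hD0
      · have : p = (p : (Fin d → ℝ) → ℂ) 0 • polyOne hn := Subtype.ext (Pl_one_apply hp)
        rw [this, map_smul, h1, smul_zero]
      · have h2 : ∀ k, L (dilPoly n k p) = (1 / 2 : ℂ) ^ D • L p := by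
          intro k
          have := ih (by omega) (dilPoly n k p - (1 / 2 : ℂ) ^ D • p) (by
            convert lead_mem_Pl hp (1 / 2 : ℝ) ((1 / 2 : ℝ) • castVec k) using 1
            simp [dilPoly])
          rw [map_sub, map_smul, sub_eq_zero] at this
          exact this
        have h3 : L p = (1 / 2 : ℂ) ^ D • (symbol a 0 *ᵥ L p) := by
          conv_lhs => rw [← hL]
          rw [refinePoly_apply, symbol_zero, Matrix.sum_mulVec, Finset.smul_sum]
          refine Finset.sum_congr rfl fun k _ => ?_
          rw [h2, Matrix.mulVec_smul]
        refine eq_zero_of_not_eigenvalue (ha2 D hD0) ?_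
        conv_rhs => rw [h3]
        rw [smul_smul, ← mul_pow]
        norm_num
  ext1 p
  exact key n le_rfl p p.2

/-- An injective endomorphism of a finite-dimensional space is onto. It is used with e the
evaluation at the polynomial 1 and Q the refinement operator minus the identity. -/
lemma exists_preimage_in_ker {V W : Type*} [AddCommGroup V] [Module ℂ V] [FiniteDimensional ℂ V]
    [AddCommGroup W] [Module ℂ W] (e : V →ₗ[ℂ] W) (Q : Module.End ℂ V)
    (hinv : ∀ v, e v = 0 → e (Q v) = 0) (hinj : ∀ v, e v = 0 → Q v = 0 → v = 0) {u : V}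
    (hu : e u = 0) : ∃ v, e v = 0 ∧ Q v = u := by
  let T : LinearMap.ker e →ₗ[ℂ] LinearMap.ker e := Q.restrict hinv
  have hT : Function.Injective T := (injective_iff_map_eq_zero T).2 fun v hv =>
    Subtype.ext (hinj v v.2 (congrArg Subtype.val hv))
  obtain ⟨v, hv⟩ := LinearMap.surjective_of_injective hT ⟨u, hu⟩
  exact ⟨v, v.2, congrArg Subtype.val hv⟩

/-- The functional p ↦ p(0) c has the right value at 1 but is not fixed. Its defect vanishes at 1,
and uniqueness makes the operator minus the identity invertible on such functionals, which supplies
the correction. -/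
lemma exists_refinePoly_fixed {a : MFilter d r r}
    (ha2 : ∀ n : ℕ, 1 ≤ n →
      ¬ Module.End.HasEigenvalue (Matrix.toLin' (symbol a 0)) ((2 : ℂ) ^ n))
    {c : Fin r → ℂ} (hc : symbol a 0 *ᵥ c = c) {n : ℕ} (hn : 0 < n) :
    ∃ L : Pl d n →ₗ[ℂ] (Fin r → ℂ), refinePoly a n L = L ∧ L (polyOne hn) = c := by
  let ev1 : (Pl d n →ₗ[ℂ] (Fin r → ℂ)) →ₗ[ℂ] (Fin r → ℂ) := LinearMap.applyₗ (polyOne hn)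
  have hX : ∀ L, ev1 L = 0 → ev1 ((refinePoly a n - 1 : Module.End ℂ _) L) = 0 := by
    intro L hL
    have hL' : L (polyOne hn) = 0 := hL
    change (refinePoly a n L - L) (polyOne hn) = 0
    rw [LinearMap.sub_apply, refinePoly_one, hL', Matrix.mulVec_zero, sub_zero]
  let L0 : Pl d n →ₗ[ℂ] (Fin r → ℂ) :=
    { toFun := fun p => (p : (Fin d → ℝ) → ℂ) 0 • c
      map_add' := fun p q => by simp [add_smul]
      map_smul' := fun t p => by simp [mul_smul] }
  have hL0 : L0 (polyOne hn) = c := by simp [L0, polyOne]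
  have hmem : ev1 (-(refinePoly a n L0 - L0)) = 0 := by
    change (-(refinePoly a n L0 - L0)) (polyOne hn) = 0
    rw [LinearMap.neg_apply, LinearMap.sub_apply, refinePoly_one, hL0, hc, sub_self, neg_zero]
  obtain ⟨L1, hL1, h⟩ := exists_preimage_in_ker ev1 (refinePoly a n - 1) hX
    (fun L hL h => refinePoly_fixed_eq_zero ha2 hn (sub_eq_zero.1 h) hL) hmem
  have h' : refinePoly a n L1 - L1 = -(refinePoly a n L0 - L0) := h
  refine ⟨L0 + L1, ?_, ?_⟩
  · rw [map_add]
    have : refinePoly a n L1 = L1 - (refinePoly a n L0 - L0) := by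
      rw [sub_eq_iff_eq_add] at h'; rw [h']; abel
    rw [this]; abel
  · rw [LinearMap.add_apply, hL0, show L1 (polyOne hn) = 0 from hL1, add_zero]

end Refinement

/-! ### Existence and uniqueness of the standard refinable distribution -/

section Existence
variable {d r : ℕ}

lemma IsMatchingFilter.symbol_mul {a : MFilter d r r} {n : ℕ} {y : MFilter d 1 r}
    (h : IsMatchingFilter a n y) (hn : 0 < n) : symbol y 0 * symbol a 0 = symbol y 0 := by
  ext i j
  have := h.2 0 (fun _ => Or.inl rfl) i j 0 (by simpa [order] using hn)
  simpa using this

lemma IsMatchingFilter.row_ne_zero {a : MFilter d r r} {n : ℕ} {y : MFilter d 1 r}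
    (h : IsMatchingFilter a n y) : symbol y 0 0 ≠ 0 := fun h0 => h.1 <| by
  ext i j
  rw [Subsingleton.elim i 0, h0]; rfl

lemma IsMatchingFilter.row_vecMul {a : MFilter d r r} {n : ℕ} {y : MFilter d 1 r}
    (h : IsMatchingFilter a n y) (hn : 0 < n) : symbol y 0 0 ᵥ* symbol a 0 = symbol y 0 0 :=
  congrFun (h.symbol_mul hn) 0

lemma IsCSOrder.sub {N N' : ℕ} {L L' : smoothFns d →ₗ[ℂ] (Fin r → ℂ)} (h : IsCSOrder N L)
    (h' : IsCSOrder N' L') : IsCSOrder (max N N') (L - L') := by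
  obtain ⟨C, R, hC, hR, hb⟩ := h
  obtain ⟨C', R', hC', hR', hb'⟩ := h'
  refine ⟨C + C', max R R', add_nonneg hC hC', hR.trans (le_max_left _ _),
    fun f M hM hf => ?_⟩
  rw [LinearMap.sub_apply, add_mul]
  exact (norm_sub_le _ _).trans (add_le_add
    (hb f M hM fun μ hμ x hx => hf μ (hμ.trans (le_max_left _ _)) x (hx.trans (le_max_left _ _)))
    (hb' f M hM fun μ hμ x hx => hf μ (hμ.trans (le_max_right _ _)) x
      (hx.trans (le_max_right _ _))))

lemma IsCSOrder.refineOp {N : ℕ} {L : smoothFns d →ₗ[ℂ] (Fin r → ℂ)} (h : IsCSOrder N L)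
    (a : MFilter d r r) : IsCSOrder N (refineOp a L) := by
  obtain ⟨C, R, hC, hR, hb⟩ := h
  refine ⟨coefNorm a * C, R + radius a, mul_nonneg (coefNorm_nonneg a) hC,
    add_nonneg hR (Nat.cast_nonneg _), fun f M hM hf => ?_⟩
  rw [refineOp_apply]
  refine (norm_sum_le _ _).trans ?_
  rw [coefNorm, Finset.sum_mul, Finset.sum_mul]
  refine Finset.sum_le_sum fun k hk => (norm_mulVec_le _ _).trans ?_
  rw [mul_assoc]
  refine mul_le_mul_of_nonneg_left (hb _ _ hM fun μ hμ x hx => ?_)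
    (Finset.sum_nonneg fun _ _ => Finset.sum_nonneg fun _ _ => norm_nonneg _)
  have hk' : ‖castVec k‖ ≤ radius a := by
    rw [norm_castVec]; exact norm_le_radius (Finsupp.mem_support_iff.1 hk)
  rw [partialDeriv_dil, norm_mul]
  have h1 : ‖(1 / 2 : ℂ) ^ order μ‖ ≤ 1 := by
    rw [norm_pow]; exact pow_le_one₀ (norm_nonneg _) (by norm_num)
  refine (mul_le_of_le_one_left (norm_nonneg _) h1).trans (hf μ hμ _ ?_)
  refine (norm_add_le _ _).trans ?_
  rw [norm_smul, norm_smul]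
  norm_num
  linarith [(Nat.cast_nonneg (radius a) : (0 : ℝ) ≤ _)]

lemma IsCS.sub {L L' : smoothFns d →ₗ[ℂ] (Fin r → ℂ)} (h : IsCS L) (h' : IsCS L') :
    IsCS (L - L') := by
  obtain ⟨N, h⟩ := h
  obtain ⟨N', h'⟩ := h'
  exact ⟨_, h.sub h'⟩

lemma IsCS.refineOp {L : smoothFns d →ₗ[ℂ] (Fin r → ℂ)} (h : IsCS L) (a : MFilter d r r) :
    IsCS (refineOp a L) :=
  h.imp fun _ h => h.refineOp a

/-- A vector of distributions as one vector-valued functional. -/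
def vecOf (φ : Fin r → CSDist d) : smoothFns d →ₗ[ℂ] (Fin r → ℂ) :=
  LinearMap.pi fun i => (φ i).toLin

lemma isCS_vecOf (φ : Fin r → CSDist d) : IsCS (vecOf φ) := by
  choose C R N hC hR hb using fun i => (φ i).exists_bound
  refine ⟨∑ i, N i, ∑ i, C i, ∑ i, R i, Finset.sum_nonneg fun i _ => hC i,
    Finset.sum_nonneg fun i _ => hR i, fun f M hM hf => ?_⟩
  refine (pi_norm_le_iff_of_nonneg
    (mul_nonneg (Finset.sum_nonneg fun i _ => hC i) hM)).2 fun i => ?_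
  refine (hb i f M hM fun μ hμ x hx => hf μ (hμ.trans ?_) x (hx.trans ?_)).trans ?_
  · exact Finset.single_le_sum (fun i _ => Nat.zero_le _) (Finset.mem_univ i)
  · exact Finset.single_le_sum (fun i _ => hR i) (Finset.mem_univ i)
  · exact mul_le_mul_of_nonneg_right
      (Finset.single_le_sum (fun i _ => hC i) (Finset.mem_univ i)) hM

/-- The components of a vector-valued functional. -/
def IsCS.dist {L : smoothFns d →ₗ[ℂ] (Fin r → ℂ)} (h : IsCS L) (i : Fin r) : CSDist d :=
  CSDist.ofBound (LinearMap.proj i ∘ₗ L) <| by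
    obtain ⟨N, C, R, hC, hR, hb⟩ := h
    exact ⟨C, R, N, hR, fun f M hM hf => (norm_le_pi_norm (L f) i).trans (hb f M hM hf)⟩

lemma IsCS.vecOf_dist {L : smoothFns d →ₗ[ℂ] (Fin r → ℂ)} (h : IsCS L) : vecOf h.dist = L := rfl

lemma IsCS.eq_zero {L : smoothFns d →ₗ[ℂ] (Fin r → ℂ)} (h : IsCS L)
    (h0 : ∀ ξ, L (expFn ξ) = 0) : L = 0 := by
  ext1 f
  ext i
  exact CSDist.eq_zero_of_fourier (T := h.dist i) (fun ξ => congrFun (h0 ξ) i) f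

lemma dil_expFn (k : Fin d → ℤ) (ξ : Fin d → ℝ) : dil k (expFn ((2 : ℝ) • ξ))
    = Complex.exp (-Complex.I * ((∑ j, (k j : ℝ) * ξ j : ℝ) : ℂ)) • expFn ξ := by
  apply Subtype.ext
  ext x
  change (expFn ((2 : ℝ) • ξ) : (Fin d → ℝ) → ℂ) ((1 / 2 : ℝ) • x + (1 / 2 : ℝ) • castVec k)
    = Complex.exp _ * (expFn ξ : (Fin d → ℝ) → ℂ) x
  rw [expFn_apply, expFn_apply, ← Complex.exp_add, ← mul_add, ← Complex.ofReal_add,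
    ← Finset.sum_add_distrib]
  congr 3
  refine Finset.sum_congr rfl fun j _ => ?_
  simp only [Pi.add_apply, Pi.smul_apply, smul_eq_mul, castVec_apply]
  ring

lemma refineOp_expFn (a : MFilter d r r) (L : smoothFns d →ₗ[ℂ] (Fin r → ℂ)) (ξ : Fin d → ℝ) :
    refineOp a L (expFn ((2 : ℝ) • ξ)) = symbol a ξ *ᵥ L (expFn ξ) := by
  rw [refineOp_apply, symbol, Finsupp.sum, Matrix.sum_mulVec]
  refine Finset.sum_congr rfl fun k _ => ?_
  rw [dil_expFn, map_smul, Matrix.mulVec_smul, Matrix.smul_mulVec]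

/-- The smooth function `1`. -/
def oneFn (d : ℕ) : smoothFns d := ⟨fun _ => 1, (contDiff_const : ContDiff ℝ ∞ fun _ : Fin d → ℝ => (1 : ℂ))⟩

lemma expFn_zero : expFn (0 : Fin d → ℝ) = oneFn d := by
  apply Subtype.ext
  ext x
  rw [expFn_apply]
  simp [oneFn]

lemma isStdRefinable_iff {a : MFilter d r r} {υ : MFilter d 1 r} {φ : Fin r → CSDist d} :
    IsStdRefinable a υ φ ↔
      refineOp a (vecOf φ) = vecOf φ ∧ symbol υ 0 0 ⬝ᵥ vecOf φ (oneFn d) = 1 := by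
  refine and_congr ⟨fun h => ?_, fun h ξ => ?_⟩ ⟨fun h => ?_, fun h => ?_⟩
  · refine sub_eq_zero.1 (IsCS.eq_zero (((isCS_vecOf φ).refineOp a).sub (isCS_vecOf φ)) fun ξ => ?_)
    have h1 := h ((1 / 2 : ℝ) • ξ)
    have h2 := refineOp_expFn a (vecOf φ) ((1 / 2 : ℝ) • ξ)
    rw [smul_smul] at h1 h2
    norm_num at h1 h2
    rw [LinearMap.sub_apply, h2, sub_eq_zero]
    exact h1.symm
  · have := refineOp_expFn a (vecOf φ) ξ
    rw [h] at this
    exact this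
  · have := congrFun h 0
    rw [← expFn_zero]
    exact this
  · ext i
    rw [Subsingleton.elim i 0]
    rw [← expFn_zero] at h
    exact h

lemma exists_partialDeriv_bound (f : smoothFns d) (R : ℝ) (n : ℕ) : ∃ M, 0 ≤ M ∧
    ∀ μ, order μ ≤ n → ∀ x, ‖x‖ ≤ R → ‖partialDeriv μ (f : (Fin d → ℝ) → ℂ) x‖ ≤ M := by
  have h : ∀ μ : Fin d → ℕ, ∃ M, 0 ≤ M ∧ ∀ x, ‖x‖ ≤ R →
      ‖partialDeriv μ (f : (Fin d → ℝ) → ℂ) x‖ ≤ M := by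
    intro μ
    obtain ⟨M, hM⟩ := (isCompact_closedBall (0 : Fin d → ℝ) R).exists_bound_of_continuousOn
      (continuous_partialDeriv (μ := μ) (contDiff_coe f _)).continuousOn
    exact ⟨|M|, abs_nonneg _, fun x hx => (hM x (by simpa using hx)).trans (le_abs_self M)⟩
  choose M hM0 hM using h
  refine ⟨∑ μ ∈ orderLT d (n + 1), M μ, Finset.sum_nonneg fun μ _ => hM0 μ, fun μ hμ x hx => ?_⟩
  exact (hM μ x hx).trans (Finset.single_le_sum (f := M) (fun μ _ => hM0 μ)
    (mem_orderLT.2 (by omega)))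

lemma exists_contraction_order (a : MFilter d r r) :
    ∃ n₀, ∀ n, n₀ ≤ n → coefNorm a / 2 ^ n < 1 := by
  obtain ⟨n₀, h⟩ := pow_unbounded_of_one_lt (coefNorm a) (one_lt_two (α := ℝ))
  refine ⟨n₀, fun n hn => (div_lt_one (by positivity)).2 (h.trans_le ?_)⟩
  exact pow_le_pow_right₀ one_le_two hn

/-- The restriction to polynomials vanishes, so L is bounded by derivatives of a single high order.
Iterating the contraction bounds the fixed L by quantities tending to 0. -/
lemma refineOp_fixed_eq_zero {a : MFilter d r r}
    (ha2 : ∀ n : ℕ, 1 ≤ n →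
      ¬ Module.End.HasEigenvalue (Matrix.toLin' (symbol a 0)) ((2 : ℂ) ^ n))
    {L : smoothFns d →ₗ[ℂ] (Fin r → ℂ)} (hL : IsCS L) (hQ : refineOp a L = L)
    (h1 : L (oneFn d) = 0) : L = 0 := by
  obtain ⟨N, hL⟩ := hL
  obtain ⟨n₀, hn₀⟩ := exists_contraction_order a
  set n := N + n₀ + 1
  have hk : L ∘ₗ polyIncl d n = 0 :=
    refinePoly_fixed_eq_zero ha2 (Nat.succ_pos _) (by rw [← refineOp_comp_polyIncl, hQ]) h1
  obtain ⟨C, R, hC, hR, hb⟩ := hL.topBound (radius a) (n := n) (by omega) hk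
  ext1 f
  obtain ⟨M, hM, hf⟩ := exists_partialDeriv_bound f R n
  have hit : ∀ j, (refineOp a)^[j] L = L := fun j => Function.iterate_fixed hQ j
  have hj : ∀ j, ‖L f‖ ≤ C * (coefNorm a / 2 ^ n) ^ j * M := fun j => by
    have := hb.iterate_refineOp hR j f M hM fun μ hμ => hf μ hμ.le
    rwa [hit] at this
  have hlim : Tendsto (fun j : ℕ => C * (coefNorm a / 2 ^ n) ^ j * M) atTop (𝓝 (C * 0 * M)) :=
    ((tendsto_pow_atTop_nhds_zero_of_lt_one
      (div_nonneg (coefNorm_nonneg a) (by positivity)) (hn₀ n (by omega))).const_mul C).mul_const M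
  rw [mul_zero, zero_mul] at hlim
  exact norm_le_zero_iff.1 (ge_of_tendsto' hlim hj)

lemma refineOp_one (a : MFilter d r r) (L : smoothFns d →ₗ[ℂ] (Fin r → ℂ)) :
    refineOp a L (oneFn d) = symbol a 0 *ᵥ L (oneFn d) := by
  have := refineOp_expFn a L 0
  rwa [smul_zero, expFn_zero] at this

/-- Uniqueness of the standard refinable distribution. -/
lemma IsStdRefinable.unique {a : MFilter d r r} {υ : MFilter d 1 r}
    (ha1 : (symbol a 0).charpoly.rootMultiplicity 1 = 1)
    (ha2 : ∀ n : ℕ, 1 ≤ n →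
      ¬ Module.End.HasEigenvalue (Matrix.toLin' (symbol a 0)) ((2 : ℂ) ^ n))
    {n : ℕ} (hn : 0 < n) (hυ : IsMatchingFilter a n υ) {φ ψ : Fin r → CSDist d}
    (hφ : IsStdRefinable a υ φ) (hψ : IsStdRefinable a υ ψ) : φ = ψ := by
  rw [isStdRefinable_iff] at hφ hψ
  have hQ : refineOp a (vecOf φ - vecOf ψ) = vecOf φ - vecOf ψ := by
    rw [map_sub, hφ.1, hψ.1]
  have h1 : (vecOf φ - vecOf ψ) (oneFn d) = 0 := by
    refine eq_zero_of_simple_eigenvalue ha1 hυ.row_ne_zero (hυ.row_vecMul hn) ?_ ?_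
    · rw [← refineOp_one, hQ]
    · rw [LinearMap.sub_apply, dotProduct_sub, hφ.2, hψ.2, sub_self]
  have h := refineOp_fixed_eq_zero ha2 ((isCS_vecOf φ).sub (isCS_vecOf ψ)) hQ h1
  rw [sub_eq_zero] at h
  ext i f
  exact congrFun (LinearMap.congr_fun h f) i

/-- Existence of a fixed point of the refinement operator. -/
lemma exists_refineOp_fixed {a : MFilter d r r}
    (ha2 : ∀ n : ℕ, 1 ≤ n →
      ¬ Module.End.HasEigenvalue (Matrix.toLin' (symbol a 0)) ((2 : ℂ) ^ n))
    {c : Fin r → ℂ} (hc : symbol a 0 *ᵥ c = c) :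
    ∃ L : smoothFns d →ₗ[ℂ] (Fin r → ℂ), IsCS L ∧ refineOp a L = L ∧ L (oneFn d) = c := by
  obtain ⟨n₀, hn₀⟩ := exists_contraction_order a
  -- a finite combination of point evaluations which is fixed on polynomials
  have hstart : ∀ n, 0 < n → ∃ L : smoothFns d →ₗ[ℂ] (Fin r → ℂ),
      (∃ C R, 0 ≤ C ∧ 0 ≤ R ∧ ∀ (f : smoothFns d) (M : ℝ), 0 ≤ M →
        (∀ x, ‖x‖ ≤ R → ‖(f : (Fin d → ℝ) → ℂ) x‖ ≤ M) → ‖L f‖ ≤ C * M) ∧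
      (refineOp a L - L) ∘ₗ polyIncl d n = 0 ∧ L (oneFn d) = c := by
    intro n hn
    -- A functional on polynomials has no canonical extension to smooth functions; writing it
    -- through evaluations at lattice points provides one of order 0.
    obtain ⟨l, hl, hl1⟩ := exists_refinePoly_fixed ha2 hc hn (d := d)
    choose u hu using fun i : Fin r => exists_lattice_functional (LinearMap.proj i ∘ₗ l)
    let L : smoothFns d →ₗ[ℂ] (Fin r → ℂ) := LinearMap.pi fun i =>
      { toFun := fun f => (u i).sum fun k t => t * (f : (Fin d → ℝ) → ℂ) (castVec k)
        map_add' := fun f g => by simp [Finsupp.sum, mul_add, Finset.sum_add_distrib]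
        map_smul' := fun s f => by
          simp only [Finsupp.sum, RingHom.id_apply, smul_eq_mul, Finset.mul_sum]
          exact Finset.sum_congr rfl fun k _ => mul_left_comm _ _ _ }
    have hLl : L ∘ₗ polyIncl d n = l := by
      ext1 p
      ext i
      exact (hu i p).symm
    refine ⟨L, ⟨∑ i, ∑ k ∈ (u i).support, ‖u i k‖, ∑ i, ∑ k ∈ (u i).support, ‖castVec k‖,
      Finset.sum_nonneg fun _ _ => Finset.sum_nonneg fun _ _ => norm_nonneg _,
      Finset.sum_nonneg fun _ _ => Finset.sum_nonneg fun _ _ => norm_nonneg _,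
      fun f M hM hf => ?_⟩, ?_, ?_⟩
    · refine (pi_norm_le_iff_of_nonneg (mul_nonneg (Finset.sum_nonneg fun _ _ =>
        Finset.sum_nonneg fun _ _ => norm_nonneg _) hM)).2 fun i => ?_
      have h1 : ‖L f i‖ ≤ ∑ k ∈ (u i).support, ‖u i k‖ * M := by
        refine (norm_sum_le _ _).trans (Finset.sum_le_sum fun k hk => ?_)
        rw [norm_mul]
        refine mul_le_mul_of_nonneg_left (hf _ ?_) (norm_nonneg _)
        exact (Finset.single_le_sum (f := fun k => ‖castVec k‖) (fun k _ => norm_nonneg _) hk).trans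
          (Finset.single_le_sum (f := fun i => ∑ k ∈ (u i).support, ‖castVec k‖)
            (fun _ _ => Finset.sum_nonneg fun _ _ => norm_nonneg _) (Finset.mem_univ i))
      refine h1.trans ?_
      rw [← Finset.sum_mul]
      exact mul_le_mul_of_nonneg_right (Finset.single_le_sum
        (f := fun i => ∑ k ∈ (u i).support, ‖u i k‖)
        (fun _ _ => Finset.sum_nonneg fun _ _ => norm_nonneg _) (Finset.mem_univ i)) hM
    · rw [LinearMap.sub_comp, refineOp_comp_polyIncl, hLl, hl, sub_self]
    · rw [← hl1, ← hLl]; rfl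
  set n := n₀ + 1
  obtain ⟨L₀, ⟨C₀, R₀, hC₀, hR₀, hb₀⟩, hD0, hL1⟩ := hstart n (Nat.succ_pos _)
  have hcs₀ : IsCSOrder 0 L₀ := ⟨C₀, R₀, hC₀, hR₀, fun f M hM hf => hb₀ f M hM fun x hx => by
    simpa using hf 0 (by simp [order]) x hx⟩
  obtain ⟨C, R, hC, hR, hb⟩ := ((hcs₀.refineOp a).sub hcs₀).topBound (radius a) (n := n)
    (by simp) hD0
  set q := coefNorm a / 2 ^ n with hq
  have hq0 : 0 ≤ q := div_nonneg (coefNorm_nonneg a) (by positivity)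
  have hq1 : q < 1 := hn₀ n (by omega)
  let T : ℕ → smoothFns d →ₗ[ℂ] (Fin r → ℂ) := fun N => (refineOp a)^[N] L₀
  have hTs : ∀ N, T (N + 1) = refineOp a (T N) := fun N => Function.iterate_succ_apply' _ _ _
  -- The increments are iterates of one functional that kills polynomials of degree below n, so they
  -- shrink geometrically.
  have hTd : ∀ N, T (N + 1) - T N = (refineOp a)^[N] (refineOp a L₀ - L₀) := by
    intro N
    induction N with
    | zero => rfl
    | succ N ih => rw [hTs, hTs, ← map_sub, ← hTs, ih, Function.iterate_succ_apply']
  have hdist : ∀ (f : smoothFns d) (M : ℝ), 0 ≤ M →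
      (∀ μ, order μ = n → ∀ x, ‖x‖ ≤ R → ‖partialDeriv μ (f : (Fin d → ℝ) → ℂ) x‖ ≤ M) →
      ∀ N, dist (T N f) (T (N + 1) f) ≤ C * M * q ^ N := by
    intro f M hM hf N
    rw [dist_comm, dist_eq_norm, ← LinearMap.sub_apply, hTd]
    refine (hb.iterate_refineOp hR N f M hM hf).trans (le_of_eq (by ring))
  have hlim : ∀ f, ∃ l, Tendsto (fun N => T N f) atTop (𝓝 l) := by
    intro f
    obtain ⟨M, hM, hf⟩ := exists_partialDeriv_bound f R n
    exact cauchySeq_tendsto_of_complete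
      (cauchySeq_of_le_geometric q (C * M) hq1 (hdist f M hM fun μ hμ => hf μ hμ.le))
  choose l hl using hlim
  let L : smoothFns d →ₗ[ℂ] (Fin r → ℂ) :=
    { toFun := l
      map_add' := fun f g => tendsto_nhds_unique (hl (f + g))
        (by simpa only [map_add] using (hl f).add (hl g))
      map_smul' := fun c f => tendsto_nhds_unique (hl (c • f))
        (by simpa only [map_smul, RingHom.id_apply] using (hl f).const_smul c) }
  have hL0 : ∀ (f : smoothFns d) (M : ℝ), 0 ≤ M →
      (∀ μ, order μ = n → ∀ x, ‖x‖ ≤ R → ‖partialDeriv μ (f : (Fin d → ℝ) → ℂ) x‖ ≤ M) →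
      ‖L₀ f - L f‖ ≤ C * M / (1 - q) := fun f M hM hf => by
    rw [← dist_eq_norm]
    exact dist_le_of_le_geometric_of_tendsto₀ q (C * M) hq1 (hdist f M hM hf) (hl f)
  refine ⟨L, ⟨n, C₀ + C / (1 - q), max R₀ R, ?_, hR₀.trans (le_max_left _ _), ?_⟩, ?_, ?_⟩
  · exact add_nonneg hC₀ (div_nonneg hC (by linarith))
  · intro f M hM hf
    have h1 := hL0 f M hM fun μ hμ x hx => hf μ hμ.le x (hx.trans (le_max_right _ _))
    have h2 := hb₀ f M hM fun x hx => by
      simpa using hf 0 (by simp [order]) x (hx.trans (le_max_left _ _))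
    have h3 : L f = L₀ f - (L₀ f - L f) := by abel
    rw [h3, add_mul]
    refine (norm_sub_le _ _).trans (add_le_add h2 (h1.trans (le_of_eq (by ring))))
  · ext1 f
    rw [refineOp_apply]
    refine tendsto_nhds_unique ?_ ((hl f).comp (tendsto_add_atTop_nat 1))
    have : ∀ N, T (N + 1) f = ∑ k ∈ a.support, (a k).mulVecLin (T N (dil k f)) := fun N => by
      rw [hTs, refineOp_apply]; rfl
    simp only [Function.comp_def, this]
    refine tendsto_finsetSum _ fun k _ => ?_
    exact ((a k).mulVecLin.continuous_of_finiteDimensional.tendsto _).comp (hl (dil k f))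
  -- All derivatives of the constant 1 of order n ≥ 1 vanish, so the distance estimate with M = 0
  -- keeps the normalization through the limit.
  · have h1 := hL0 (oneFn d) 0 le_rfl fun μ hμ x _ => by
      rw [show (oneFn d : (Fin d → ℝ) → ℂ) = 1 from rfl,
        partialDeriv_eq_zero_of_mem_Pl (one_mem_Pl one_pos) (by omega)]
      simp
    rw [mul_zero, zero_div, norm_le_zero_iff, sub_eq_zero] at h1
    rw [← h1, hL1]

/-- Existence and uniqueness of the standard refinable distribution. -/
theorem existsUnique_isStdRefinable {a : MFilter d r r} {υ : MFilter d 1 r}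
    (ha1 : (symbol a 0).charpoly.rootMultiplicity 1 = 1)
    (ha2 : ∀ n : ℕ, 1 ≤ n →
      ¬ Module.End.HasEigenvalue (Matrix.toLin' (symbol a 0)) ((2 : ℂ) ^ n))
    {n : ℕ} (hn : 0 < n) (hυ : IsMatchingFilter a n υ) :
    ∃! φ : Fin r → CSDist d, IsStdRefinable a υ φ := by
  obtain ⟨c, hc, hc1⟩ := exists_normalized_eigenvector ha1 hυ.row_ne_zero (hυ.row_vecMul hn)
  obtain ⟨L, hL, hQ, hL1⟩ := exists_refineOp_fixed (d := d) ha2 hc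
  refine ⟨hL.dist, isStdRefinable_iff.2 ?_, fun ψ hψ => ?_⟩
  · rw [hL.vecOf_dist, hL1]
    exact ⟨hQ, hc1⟩
  · exact hψ.unique ha1 ha2 hn hυ (isStdRefinable_iff.2 (by
      rw [hL.vecOf_dist, hL1]
      exact ⟨hQ, hc1⟩))

end Existence

/-! ### Series of integer translates of compactly supported functions -/

section Synth
variable {d r : ℕ}

/-- The series `∑ₖ v(k) G(x - k)`. -/
def synth (v : (Fin d → ℤ) → Matrix (Fin 1) (Fin r) ℂ) (G : Fin r → (Fin d → ℝ) → ℂ)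
    (x : Fin d → ℝ) : ℂ := ∑ᶠ k : Fin d → ℤ, ∑ j, v k 0 j * G j (x - castVec k)

/-- The functions `G j` vanish outside of the ball of radius `R`. -/
def SuppIn (R : ℕ) (G : Fin r → (Fin d → ℝ) → ℂ) : Prop := ∀ j x, G j x ≠ 0 → ‖x‖ ≤ R

/-- The refinement equation `G(x) = 2^d ∑ₖ a(k) G(2x - k)`. -/
def Refines (a : MFilter d r r) (G : Fin r → (Fin d → ℝ) → ℂ) : Prop :=
  ∀ i x, G i x = 2 ^ d * ∑ k ∈ a.support, ∑ j, a k i j * G j ((2 : ℝ) • x - castVec k)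

lemma synth_eq_sum (v : (Fin d → ℤ) → Matrix (Fin 1) (Fin r) ℂ) {G : Fin r → (Fin d → ℝ) → ℂ}
    {x : Fin d → ℝ} {B : Finset (Fin d → ℤ)} (hB : ∀ j k, G j (x - castVec k) ≠ 0 → k ∈ B) :
    synth v G x = ∑ k ∈ B, ∑ j, v k 0 j * G j (x - castVec k) := by
  refine finsum_eq_sum_of_support_subset _ fun k hk => ?_
  obtain ⟨j, _, hj⟩ := Finset.exists_ne_zero_of_sum_ne_zero hk
  exact hB j k (right_ne_zero_of_mul hj)

lemma SuppIn.mem_box {R n : ℕ} {G : Fin r → (Fin d → ℝ) → ℂ} (hG : SuppIn R G) {x : Fin d → ℝ}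
    (hx : ‖x‖ ≤ n) (j : Fin r) (k : Fin d → ℤ) (h : G j (x - castVec k) ≠ 0) :
    k ∈ box d (n + R) := by
  rw [GHSD.mem_box, ← norm_castVec]
  have h1 := hG _ _ h
  have h2 := norm_sub_le x (x - castVec k)
  rw [sub_sub_cancel] at h2
  push_cast
  linarith

lemma SuppIn.exists_box {R : ℕ} {G : Fin r → (Fin d → ℝ) → ℂ} (hG : SuppIn R G)
    (x : Fin d → ℝ) : ∃ B : Finset (Fin d → ℤ), ∀ j k, G j (x - castVec k) ≠ 0 → k ∈ B := by
  obtain ⟨n, hn⟩ := exists_nat_ge ‖x‖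
  exact ⟨_, hG.mem_box hn⟩

lemma sum_eq_sum_of_support {ι M : Type*} [AddCommMonoid M] {f : ι → M} {S T : Finset ι}
    (hS : ∀ k, f k ≠ 0 → k ∈ S) (hT : ∀ k, f k ≠ 0 → k ∈ T) : ∑ k ∈ S, f k = ∑ k ∈ T, f k := by
  rw [← finsum_eq_sum_of_support_subset f hS, ← finsum_eq_sum_of_support_subset f hT]

lemma synth_smul_left (c : ℂ) (v : (Fin d → ℤ) → Matrix (Fin 1) (Fin r) ℂ)
    {G : Fin r → (Fin d → ℝ) → ℂ} {R : ℕ} (hG : SuppIn R G) (x : Fin d → ℝ) :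
    synth (c • v) G x = c * synth v G x := by
  obtain ⟨B, hB⟩ := hG.exists_box x
  simp only [synth_eq_sum _ hB, Finset.mul_sum, Pi.smul_apply, Matrix.smul_apply, smul_eq_mul,
    mul_assoc]

lemma synth_sub_left (v v' : (Fin d → ℤ) → Matrix (Fin 1) (Fin r) ℂ)
    {G : Fin r → (Fin d → ℝ) → ℂ} {R : ℕ} (hG : SuppIn R G) (x : Fin d → ℝ) :
    synth (v - v') G x = synth v G x - synth v' G x := by
  obtain ⟨B, hB⟩ := hG.exists_box x
  simp only [synth_eq_sum _ hB, ← Finset.sum_sub_distrib, Pi.sub_apply, Matrix.sub_apply, sub_mul]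

lemma synth_translate (v : (Fin d → ℤ) → Matrix (Fin 1) (Fin r) ℂ)
    (G : Fin r → (Fin d → ℝ) → ℂ) (x : Fin d → ℝ) (l : Fin d → ℤ) :
    synth v G (x + castVec l) = synth (fun k => v (k + l)) G x := by
  rw [synth, synth, ← finsum_comp_equiv (Equiv.addRight l)]
  refine finsum_congr fun k => Finset.sum_congr rfl fun j _ => ?_
  rw [Equiv.coe_addRight, castVec_add, add_sub_add_right_eq_sub]

lemma sum_reorder {α β γ δ : Type*} (A : Finset α) (B : Finset β) (C : Finset γ) (D : Finset δ)
    (F : α → β → γ → δ → ℂ) : ∑ k ∈ A, ∑ j ∈ B, ∑ z ∈ C, ∑ i ∈ D, F k j z i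
      = ∑ z ∈ C, ∑ i ∈ D, ∑ j ∈ B, ∑ k ∈ A, F k j z i := by
  calc _ = ∑ k ∈ A, ∑ z ∈ C, ∑ j ∈ B, ∑ i ∈ D, F k j z i :=
        Finset.sum_congr rfl fun k _ => Finset.sum_comm
    _ = ∑ z ∈ C, ∑ k ∈ A, ∑ j ∈ B, ∑ i ∈ D, F k j z i := Finset.sum_comm
    _ = ∑ z ∈ C, ∑ k ∈ A, ∑ i ∈ D, ∑ j ∈ B, F k j z i :=
        Finset.sum_congr rfl fun z _ => Finset.sum_congr rfl fun k _ => Finset.sum_comm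
    _ = ∑ z ∈ C, ∑ i ∈ D, ∑ k ∈ A, ∑ j ∈ B, F k j z i :=
        Finset.sum_congr rfl fun z _ => Finset.sum_comm
    _ = _ := Finset.sum_congr rfl fun z _ => Finset.sum_congr rfl fun i _ => Finset.sum_comm

/-- Inserting the refinement equation into ∑ v(z) G(x - z) and collecting the translates G(2x - k)
gives exactly the subdivided coefficients. -/
lemma Refines.synth_subdiv {a : MFilter d r r} {G : Fin r → (Fin d → ℝ) → ℂ} {R : ℕ}
    (hG : SuppIn R G) (ha : Refines a G) (v : (Fin d → ℤ) → Matrix (Fin 1) (Fin r) ℂ)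
    (x : Fin d → ℝ) : synth (subdiv a v) G ((2 : ℝ) • x) = synth v G x := by
  obtain ⟨n, hn⟩ := exists_nat_ge ‖(2 : ℝ) • x‖
  have hxn : ‖x‖ ≤ n := by
    rw [norm_smul] at hn; norm_num at hn; linarith [norm_nonneg x]
  have hB := hG.mem_box hn
  have hZ : ∀ j k, G j (x - castVec k) ≠ 0 → k ∈ box d (n + R + radius a) := fun j k h => by
    have := hG.mem_box hxn j k h
    rw [GHSD.mem_box] at this ⊢
    push_cast at this ⊢
    linarith [(Nat.cast_nonneg (radius a) : (0 : ℝ) ≤ _)]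
  rw [synth_eq_sum _ hB, synth_eq_sum _ hZ]
  have h1 : ∀ k ∈ box d (n + R), subdiv a v k
      = (2 : ℂ) ^ d • ∑ z ∈ box d (n + R + radius a), v z * a (k - 2 • z) := fun k hk =>
    subdiv_eq_sum a v fun z hz => mem_box_of_mask_one (GHSD.mem_box.1 hk) hz
  have h2 : ∀ (z : Fin d → ℤ) (i j : Fin r),
      ∑ k ∈ box d (n + R), a (k - 2 • z) i j * G j ((2 : ℝ) • x - castVec k)
        = ∑ k ∈ a.support, a k i j * G j ((2 : ℝ) • (x - castVec z) - castVec k) := by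
    intro z i j
    rw [← finsum_eq_sum_of_support_subset _ (fun k hk => hB j k (right_ne_zero_of_mul hk)),
      ← finsum_eq_sum_of_support_subset _ (fun k hk => by
        have : a k i j ≠ 0 := left_ne_zero_of_mul hk
        rw [Finset.mem_coe, Finsupp.mem_support_iff]
        intro h0; rw [h0] at this; exact this rfl),
      ← finsum_comp_equiv (Equiv.addRight (2 • z))]
    refine finsum_congr fun k => ?_
    rw [Equiv.coe_addRight, add_sub_cancel_right, castVec_add, castVec_two_smul, smul_sub,
      sub_sub, add_comm (castVec k)]
  calc ∑ k ∈ box d (n + R), ∑ j, subdiv a v k 0 j * G j ((2 : ℝ) • x - castVec k)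
      = ∑ k ∈ box d (n + R), ∑ j, ∑ z ∈ box d (n + R + radius a), ∑ i,
          v z 0 i * (2 ^ d * (a (k - 2 • z) i j * G j ((2 : ℝ) • x - castVec k))) := by
        refine Finset.sum_congr rfl fun k hk => Finset.sum_congr rfl fun j _ => ?_
        rw [h1 k hk, Matrix.smul_apply, Matrix.sum_apply, smul_eq_mul, Finset.mul_sum,
          Finset.sum_mul]
        refine Finset.sum_congr rfl fun z _ => ?_
        rw [Matrix.mul_apply, Finset.mul_sum, Finset.sum_mul]
        exact Finset.sum_congr rfl fun i _ => by ring
    _ = ∑ z ∈ box d (n + R + radius a), ∑ i, v z 0 i * (2 ^ d * ∑ j,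
          ∑ k ∈ box d (n + R), a (k - 2 • z) i j * G j ((2 : ℝ) • x - castVec k)) := by
        simp only [Finset.mul_sum]
        exact sum_reorder _ _ _ _ _
    _ = ∑ z ∈ box d (n + R + radius a), ∑ i, v z 0 i * G i (x - castVec z) := by
        refine Finset.sum_congr rfl fun z _ => Finset.sum_congr rfl fun i _ => ?_
        rw [ha i (x - castVec z), Finset.sum_comm (s := a.support)]
        simp only [h2]

lemma Refines.synth_iterate_subdiv {a : MFilter d r r} {G : Fin r → (Fin d → ℝ) → ℂ} {R : ℕ}
    (hG : SuppIn R G) (ha : Refines a G) (v : (Fin d → ℤ) → Matrix (Fin 1) (Fin r) ℂ) (N : ℕ)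
    (x : Fin d → ℝ) : synth ((subdiv a)^[N] v) G ((2 : ℝ) ^ N • x) = synth v G x := by
  induction N with
  | zero => simp
  | succ N ih => rw [Function.iterate_succ_apply', pow_succ', mul_smul, ha.synth_subdiv hG, ih]

/-- The filter of the values of `G` at the lattice points. -/
def sampleFilter {R : ℕ} {G : Fin r → (Fin d → ℝ) → ℂ} (hG : SuppIn R G) : MFilter d r 1 :=
  Finsupp.onFinset (box d R) (fun k => Matrix.of fun i _ => G i (castVec k)) fun k hk => by
    rw [mem_box, ← norm_castVec]
    by_contra h
    apply hk
    ext i j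
    by_contra h0
    exact h (hG i _ h0)

lemma conv_sampleFilter {R : ℕ} {G : Fin r → (Fin d → ℝ) → ℂ} (hG : SuppIn R G)
    (v : (Fin d → ℤ) → Matrix (Fin 1) (Fin r) ℂ) (k : Fin d → ℤ) :
    conv v (sampleFilter hG) k 0 0 = synth v G (castVec k) := by
  obtain ⟨B, hB⟩ := hG.exists_box (castVec k)
  rw [synth_eq_sum v hB, conv_eq_sum' v (sampleFilter hG) k (B := B), Matrix.sum_apply]
  · refine Finset.sum_congr rfl fun q _ => ?_
    rw [Matrix.mul_apply]
    refine Finset.sum_congr rfl fun j _ => ?_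
    rw [← castVec_sub]; rfl
  · intro q hq
    by_contra h
    apply hq
    ext i j
    change G i (castVec (k - q)) = 0
    by_contra h0
    rw [castVec_sub] at h0
    exact h (hB i q h0)

lemma SuppIn.partialDeriv {R m : ℕ} {G : Fin r → (Fin d → ℝ) → ℂ} (hG : SuppIn R G)
    (hm : ∀ j, ContDiff ℝ m (G j)) {μ : Fin d → ℕ} (hμ : order μ ≤ m) :
    SuppIn R fun j => partialDeriv μ (G j) := by
  intro j x hx
  by_contra h
  rw [not_le] at h
  apply hx
  refine partialDeriv_eq_zero_of_eventuallyEq (contDiff_nat_of_le (hm j) hμ) ?_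
  filter_upwards [(isOpen_lt continuous_const continuous_norm).mem_nhds h] with y hy
  by_contra h0
  exact absurd (hG j y h0) (not_le.2 hy)

lemma synth_eventuallyEq {R n : ℕ} {G : Fin r → (Fin d → ℝ) → ℂ} (hG : SuppIn R G)
    (v : (Fin d → ℤ) → Matrix (Fin 1) (Fin r) ℂ) {x : Fin d → ℝ} (hx : ‖x‖ < n) :
    synth v G =ᶠ[𝓝 x] ∑ k ∈ box d (n + R), ∑ j, v k 0 j • fun y => G j (y + (-castVec k)) := by
  filter_upwards [(isOpen_lt continuous_norm continuous_const).mem_nhds hx] with y hy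
  rw [synth_eq_sum v (hG.mem_box (le_of_lt hy))]
  simp [Finset.sum_apply, sub_eq_add_neg]

lemma contDiff_translate {m : ℕ} {f : (Fin d → ℝ) → ℂ} (hf : ContDiff ℝ m f) (b : Fin d → ℝ) :
    ContDiff ℝ m fun y => f (y + b) := hf.comp (contDiff_id.add contDiff_const)

lemma contDiff_synth {R m : ℕ} {G : Fin r → (Fin d → ℝ) → ℂ} (hG : SuppIn R G)
    (hm : ∀ j, ContDiff ℝ m (G j)) (v : (Fin d → ℤ) → Matrix (Fin 1) (Fin r) ℂ) :
    ContDiff ℝ m (synth v G) := by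
  refine contDiff_iff_contDiffAt.2 fun x => ?_
  obtain ⟨n, hn⟩ := exists_nat_gt ‖x‖
  refine ContDiffAt.congr_of_eventuallyEq ?_ (synth_eventuallyEq hG v hn)
  refine ContDiff.contDiffAt ?_
  have : ContDiff ℝ m fun y => ∑ k ∈ box d (n + R), ∑ j, v k 0 j • G j (y + (-castVec k)) :=
    ContDiff.sum fun k _ => ContDiff.sum fun j _ => (contDiff_translate (hm j) _).const_smul _
  convert this using 1
  ext y; simp [Finset.sum_apply]

lemma partialDeriv_synth {R m : ℕ} {G : Fin r → (Fin d → ℝ) → ℂ} (hG : SuppIn R G)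
    (hm : ∀ j, ContDiff ℝ m (G j)) (v : (Fin d → ℤ) → Matrix (Fin 1) (Fin r) ℂ)
    {μ : Fin d → ℕ} (hμ : order μ ≤ m) :
    partialDeriv μ (synth v G) = synth v fun j => partialDeriv μ (G j) := by
  ext x
  obtain ⟨n, hn⟩ := exists_nat_gt ‖x‖
  have hm' : ∀ j, ContDiff ℝ (order μ) (G j) := fun j => contDiff_nat_of_le (hm j) hμ
  have hc : ∀ k j, ContDiff ℝ (order μ) (v k 0 j • fun y => G j (y + (-castVec k))) :=
    fun k j => ContDiff.const_smul (v k 0 j) (contDiff_translate (hm' j) (-castVec k))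
  have hs : ∀ k, ContDiff ℝ (order μ)
      (∑ j, v k 0 j • fun y => G j (y + (-castVec k)) : (Fin d → ℝ) → ℂ) := by
    intro k
    have := ContDiff.sum (s := (Finset.univ : Finset (Fin r))) fun j _ => hc k j
    convert this using 1
    ext y; simp [Finset.sum_apply]
  have hss : ContDiff ℝ (order μ)
      (∑ k ∈ box d (n + R), ∑ j, v k 0 j • fun y => G j (y + (-castVec k)) :
        (Fin d → ℝ) → ℂ) := by
    have := ContDiff.sum (s := box d (n + R)) fun k _ => hs k
    convert this using 1
    ext y; simp only [Finset.sum_apply]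
  rw [partialDeriv_congr_nhds (contDiff_nat_of_le (contDiff_synth hG hm v) hμ) hss
    (synth_eventuallyEq hG v hn), (synth_eventuallyEq (hG.partialDeriv hm hμ) v hn).eq_of_nhds,
    partialDeriv_sum _ fun k _ => hs k]
  refine congrFun (Finset.sum_congr rfl fun k _ => ?_) x
  rw [partialDeriv_sum _ fun j _ => hc k j]
  refine Finset.sum_congr rfl fun j _ => ?_
  rw [partialDeriv_smul (contDiff_translate (hm' j) _), partialDeriv_translate (hm' j)]

lemma continuous_synth {R : ℕ} {G : Fin r → (Fin d → ℝ) → ℂ} (hG : SuppIn R G)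
    (hc : ∀ j, Continuous (G j)) (v : (Fin d → ℤ) → Matrix (Fin 1) (Fin r) ℂ) :
    Continuous (synth v G) :=
  (contDiff_synth (m := 0) hG (fun j => contDiff_zero.2 (hc j)) v).continuous

end Synth

/-! ### Refinable functions and refinable distributions -/

section RefinableFunctions
variable {d r : ℕ}

lemma SuppIn.hasCompactSupport {R : ℕ} {G : Fin r → (Fin d → ℝ) → ℂ} (hG : SuppIn R G)
    (j : Fin r) : HasCompactSupport (G j) :=
  HasCompactSupport.intro (isCompact_closedBall (0 : Fin d → ℝ) R) fun x hx => by
    by_contra h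
    exact hx (by simpa using hG j x h)

lemma exists_suppIn {G : Fin r → (Fin d → ℝ) → ℂ} (h : ∀ j, HasCompactSupport (G j)) :
    ∃ R, SuppIn R G := by
  have h1 : ∀ j, ∃ R : ℕ, ∀ x, G j x ≠ 0 → ‖x‖ ≤ R := fun j => by
    obtain ⟨R, hR⟩ := (h j).isCompact.isBounded.subset_closedBall (0 : Fin d → ℝ)
    obtain ⟨n, hn⟩ := exists_nat_ge R
    refine ⟨n, fun x hx => ?_⟩
    have := hR (subset_tsupport _ hx)
    rw [mem_closedBall_zero_iff] at this
    exact this.trans hn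
  choose R hR using h1
  refine ⟨∑ j, R j, fun j x hx => (hR j x hx).trans ?_⟩
  exact_mod_cast Finset.single_le_sum (fun j _ => Nat.zero_le (R j)) (Finset.mem_univ j)

lemma integrable_mul_of_suppIn {R : ℕ} {G : Fin r → (Fin d → ℝ) → ℂ} (hG : SuppIn R G)
    (hc : ∀ j, Continuous (G j)) {f : (Fin d → ℝ) → ℂ} (hf : Continuous f) (j : Fin r) :
    Integrable fun x => f x * G j x :=
  (hf.mul (hc j)).integrable_of_hasCompactSupport (hG.hasCompactSupport j).mul_left

/-- Integration against a vector of compactly supported continuous functions. -/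
def intFun {R : ℕ} {G : Fin r → (Fin d → ℝ) → ℂ} (hG : SuppIn R G)
    (hc : ∀ j, Continuous (G j)) : smoothFns d →ₗ[ℂ] (Fin r → ℂ) :=
  LinearMap.pi fun j =>
    { toFun := fun f => ∫ x, (f : (Fin d → ℝ) → ℂ) x * G j x
      map_add' := fun f g => by
        rw [← integral_add (integrable_mul_of_suppIn hG hc (contDiff_coe f 0).continuous j)
          (integrable_mul_of_suppIn hG hc (contDiff_coe g 0).continuous j)]
        congr 1
        ext x
        exact add_mul _ _ _
      map_smul' := fun c f => by
        rw [RingHom.id_apply, smul_eq_mul, ← integral_const_mul]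
        congr 1
        ext x
        exact mul_assoc _ _ _ }

lemma intFun_apply {R : ℕ} {G : Fin r → (Fin d → ℝ) → ℂ} (hG : SuppIn R G)
    (hc : ∀ j, Continuous (G j)) (f : smoothFns d) (j : Fin r) :
    intFun hG hc f j = ∫ x, (f : (Fin d → ℝ) → ℂ) x * G j x := rfl

lemma isCS_intFun {R : ℕ} {G : Fin r → (Fin d → ℝ) → ℂ} (hG : SuppIn R G)
    (hc : ∀ j, Continuous (G j)) : IsCS (intFun hG hc) := by
  refine ⟨0, ∑ j, ∫ x, ‖G j x‖, R,
    Finset.sum_nonneg fun j _ => integral_nonneg fun x => norm_nonneg _, Nat.cast_nonneg R,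
    fun f M hM hf => ?_⟩
  refine (pi_norm_le_iff_of_nonneg (mul_nonneg (Finset.sum_nonneg fun j _ =>
    integral_nonneg fun x => norm_nonneg _) hM)).2 fun j => ?_
  have hint : Integrable (G j) := (hc j).integrable_of_hasCompactSupport (hG.hasCompactSupport j)
  rw [intFun_apply]
  calc ‖∫ x, (f : (Fin d → ℝ) → ℂ) x * G j x‖ ≤ ∫ x, ‖G j x‖ * M := by
        refine norm_integral_le_of_norm_le (hint.norm.mul_const M) (Eventually.of_forall fun x => ?_)
        rw [norm_mul, mul_comm]
        by_cases h0 : G j x = 0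
        · simp [h0]
        · refine mul_le_mul_of_nonneg_left ?_ (norm_nonneg _)
          simpa using hf 0 (by simp [order]) x (hG j x h0)
    _ = (∫ x, ‖G j x‖) * M := integral_mul_const _ _
    _ ≤ _ := mul_le_mul_of_nonneg_right (Finset.single_le_sum (f := fun j => ∫ x, ‖G j x‖)
        (fun j _ => integral_nonneg fun x => norm_nonneg _) (Finset.mem_univ j)) hM

lemma integral_comp_two_smul_sub (F : (Fin d → ℝ) → ℂ) (b : Fin d → ℝ) :
    ∫ x, F x = 2 ^ d * ∫ x, F ((2 : ℝ) • x - b) := by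
  have h1 := Measure.integral_comp_smul volume (fun x => F (x - b)) (2 : ℝ)
  rw [h1, integral_sub_right_eq_self (μ := volume) F b, Module.finrank_fintype_fun_eq_card,
    Fintype.card_fin, abs_of_pos (by positivity), Complex.real_smul]
  push_cast
  rw [← mul_assoc, mul_inv_cancel₀ (pow_ne_zero _ two_ne_zero), one_mul]

lemma continuous_refine {G : Fin r → (Fin d → ℝ) → ℂ} (hc : ∀ j, Continuous (G j))
    (a : MFilter d r r) (i : Fin r) : Continuous fun x =>
      (2 : ℂ) ^ d * ∑ k ∈ a.support, ∑ j, a k i j * G j ((2 : ℝ) • x - castVec k) := by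
  refine continuous_const.mul (continuous_finsetSum _ fun k _ => continuous_finsetSum _
    fun j _ => continuous_const.mul ((hc j).comp ?_))
  fun_prop

lemma refineOp_intFun {R : ℕ} {G : Fin r → (Fin d → ℝ) → ℂ} (hG : SuppIn R G)
    (hc : ∀ j, Continuous (G j)) (a : MFilter d r r) (f : smoothFns d) (i : Fin r) :
    refineOp a (intFun hG hc) f i = ∫ x, (f : (Fin d → ℝ) → ℂ) x *
      (2 ^ d * ∑ k ∈ a.support, ∑ j, a k i j * G j ((2 : ℝ) • x - castVec k)) := by
  have hint : ∀ k j, Integrable fun x : Fin d → ℝ =>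
      2 ^ d * a k i j * ((f : (Fin d → ℝ) → ℂ) x * G j ((2 : ℝ) • x - castVec k)) := by
    intro k j
    refine Integrable.const_mul ?_ _
    refine Continuous.integrable_of_hasCompactSupport ?_ ?_
    · refine (contDiff_coe f 0).continuous.mul ((hc j).comp ?_)
      fun_prop
    · refine HasCompactSupport.intro (isCompact_closedBall (0 : Fin d → ℝ) (R + ‖castVec k‖))
        fun x hx => ?_
      by_contra h
      have h1 := hG j _ (right_ne_zero_of_mul h)
      apply hx
      have h2 := norm_sub_norm_le ((2 : ℝ) • x) (castVec k)
      rw [norm_smul, Real.norm_ofNat] at h2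
      rw [mem_closedBall_zero_iff]
      linarith [norm_nonneg x]
  have h1 : ∀ k j, a k i j * intFun hG hc (dil k f) j
      = ∫ x, 2 ^ d * a k i j * ((f : (Fin d → ℝ) → ℂ) x * G j ((2 : ℝ) • x - castVec k)) := by
    intro k j
    rw [integral_const_mul, intFun_apply, integral_comp_two_smul_sub _ (castVec k), ← mul_assoc,
      mul_comm (a k i j)]
    refine congrArg (_ * ·) (integral_congr_ae (Eventually.of_forall fun x => ?_))
    rw [dil_coe]
    refine congrArg (· * _) (congrArg _ (funext fun l => ?_))
    simp only [Pi.add_apply, Pi.smul_apply, Pi.sub_apply, smul_eq_mul]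
    ring
  rw [refineOp_apply, Finset.sum_apply]
  calc ∑ k ∈ a.support, (a k *ᵥ intFun hG hc (dil k f)) i
      = ∑ k ∈ a.support, ∑ j, ∫ x,
          2 ^ d * a k i j * ((f : (Fin d → ℝ) → ℂ) x * G j ((2 : ℝ) • x - castVec k)) := by
        refine Finset.sum_congr rfl fun k _ => ?_
        rw [Matrix.mulVec, dotProduct]
        exact Finset.sum_congr rfl fun j _ => h1 k j
    _ = ∫ x, ∑ k ∈ a.support, ∑ j,
          2 ^ d * a k i j * ((f : (Fin d → ℝ) → ℂ) x * G j ((2 : ℝ) • x - castVec k)) := by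
        rw [integral_finsetSum _ fun k _ => integrable_finsetSum _ fun j _ => hint k j]
        refine Finset.sum_congr rfl fun k _ => ?_
        rw [integral_finsetSum _ fun j _ => hint k j]
    _ = _ := by
        congr 1
        ext x
        simp only [Finset.mul_sum]
        refine Finset.sum_congr rfl fun k _ => Finset.sum_congr rfl fun j _ => by ring

lemma eq_of_integral_smooth_mul_eq {g h : (Fin d → ℝ) → ℂ} (hg : Continuous g)
    (hh : Continuous h) (hgi : ∀ f : smoothFns d, HasCompactSupport (f : (Fin d → ℝ) → ℂ) →
      ∫ x, (f : (Fin d → ℝ) → ℂ) x * g x = ∫ x, (f : (Fin d → ℝ) → ℂ) x * h x) : g = h := by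
  have hae : ∀ᵐ x, (g - h) x = 0 := by
    refine ae_eq_zero_of_integral_contDiff_smul_eq_zero (hg.sub hh).locallyIntegrable
      fun f hf hfc => ?_
    let F : smoothFns d := ⟨fun x => (f x : ℂ), Complex.ofRealCLM.contDiff.comp hf⟩
    have hFc : HasCompactSupport (F : (Fin d → ℝ) → ℂ) :=
      hfc.comp_left (g := fun t : ℝ => (t : ℂ)) Complex.ofReal_zero
    have hF := hgi F hFc
    have hFcont : Continuous (F : (Fin d → ℝ) → ℂ) := (contDiff_coe F 0).continuous
    have hi1 : Integrable fun x => (F : (Fin d → ℝ) → ℂ) x * g x :=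
      (hFcont.mul hg).integrable_of_hasCompactSupport hFc.mul_right
    have hi2 : Integrable fun x => (F : (Fin d → ℝ) → ℂ) x * h x :=
      (hFcont.mul hh).integrable_of_hasCompactSupport hFc.mul_right
    rw [← sub_eq_zero, ← integral_sub hi1 hi2] at hF
    rw [← hF]
    congr 1
    ext x
    simp only [Pi.sub_apply, Complex.real_smul, mul_sub]
    rfl
  have h1 : g =ᵐ[volume] h := hae.mono fun x hx => sub_eq_zero.1 hx
  exact (hg.ae_eq_iff_eq volume hh).1 h1

/-- A change of variables in each term shows that refining the functional is integration against the
refined function; continuous functions with equal integrals against all test functions coincide. -/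
lemma refines_iff {R : ℕ} {G : Fin r → (Fin d → ℝ) → ℂ} (hG : SuppIn R G)
    (hc : ∀ j, Continuous (G j)) (a : MFilter d r r) :
    refineOp a (intFun hG hc) = intFun hG hc ↔ Refines a G := by
  constructor
  · intro h i x
    refine congrFun (eq_of_integral_smooth_mul_eq (hc i) (continuous_refine hc a i)
      fun f _ => ?_) x
    rw [← refineOp_intFun hG hc, h, intFun_apply]
  · intro h
    ext1 f
    ext i
    rw [refineOp_intFun, intFun_apply]
    simp only [← h i]

/-- A standard refinable vector of `C^m` distributions comes from refinable functions. -/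
lemma IsStdRefinable.exists_functions {a : MFilter d r r} {υ : MFilter d 1 r}
    {φ : Fin r → CSDist d} (hφ : IsStdRefinable a υ φ) {m : ℕ} (hm : ∀ i, (φ i).IsCm m) :
    ∃ (R : ℕ) (G : Fin r → (Fin d → ℝ) → ℂ), SuppIn R G ∧ (∀ j, ContDiff ℝ m (G j)) ∧
      Refines a G ∧ symbol υ 0 0 ⬝ᵥ (fun j => ∫ x, G j x) = 1 ∧
      ∀ i (f : smoothFns d), (φ i).toLin f = ∫ x, (f : (Fin d → ℝ) → ℂ) x * G i x := by
  choose G hGm hGc hGi using hm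
  obtain ⟨R, hR⟩ := exists_suppIn hGc
  have hc : ∀ j, Continuous (G j) := fun j => (hGm j).continuous
  have hv : vecOf φ = intFun hR hc := by
    ext1 f
    ext i
    exact hGi i f
  rw [isStdRefinable_iff, hv] at hφ
  refine ⟨R, G, hR, hGm, (refines_iff hR hc a).1 hφ.1, ?_, hGi⟩
  rw [← hφ.2]
  congr 1
  ext j
  rw [intFun_apply]
  simp [oneFn]

/-- A normalized refinable vector of functions is the standard refinable vector. -/
lemma IsStdRefinable.toLin_eq_integral {a : MFilter d r r} {υ : MFilter d 1 r}
    (ha1 : (symbol a 0).charpoly.rootMultiplicity 1 = 1)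
    (ha2 : ∀ n : ℕ, 1 ≤ n →
      ¬ Module.End.HasEigenvalue (Matrix.toLin' (symbol a 0)) ((2 : ℂ) ^ n))
    {n : ℕ} (hn : 0 < n) (hυ : IsMatchingFilter a n υ) {φ : Fin r → CSDist d}
    (hφ : IsStdRefinable a υ φ) {R : ℕ} {G : Fin r → (Fin d → ℝ) → ℂ} (hG : SuppIn R G)
    (hc : ∀ j, Continuous (G j)) (ha : Refines a G)
    (h1 : symbol υ 0 0 ⬝ᵥ (fun j => ∫ x, G j x) = 1) (i : Fin r) (f : smoothFns d) :
    (φ i).toLin f = ∫ x, (f : (Fin d → ℝ) → ℂ) x * G i x := by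
  have hψ : IsStdRefinable a υ (isCS_intFun hG hc).dist := by
    rw [isStdRefinable_iff, IsCS.vecOf_dist]
    refine ⟨(refines_iff hG hc a).2 ha, ?_⟩
    rw [← h1]
    congr 1
    ext j
    rw [intFun_apply]
    simp [oneFn]
  rw [hφ.unique ha1 ha2 hn hυ hψ]
  rfl

end RefinableFunctions

/-! ### Polynomial reproduction -/

section Reproduction
variable {d r : ℕ}

/-- A continuous function with integer periods is bounded. -/
lemma exists_bound_of_periodic {h : (Fin d → ℝ) → ℂ} (hc : Continuous h)
    (hp : ∀ (x : Fin d → ℝ) (l : Fin d → ℤ), h (x + castVec l) = h x) : ∃ C, ∀ x, ‖h x‖ ≤ C := by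
  obtain ⟨C, hC⟩ := (isCompact_Icc (a := (0 : Fin d → ℝ)) (b := 1)).exists_bound_of_continuousOn
    hc.continuousOn
  refine ⟨C, fun x => ?_⟩
  rw [← hp x fun j => -⌊x j⌋]
  refine hC _ ⟨fun j => ?_, fun j => ?_⟩
  · have := Int.floor_le (x j)
    simp only [Pi.zero_apply, Pi.add_apply, castVec_apply, Int.cast_neg]
    linarith
  · have := (Int.lt_floor_add_one (x j)).le
    simp only [Pi.one_apply, Pi.add_apply, castVec_apply, Int.cast_neg]
    linarith

lemma exists_castVec_near_of_unit (x : Fin d → ℝ) : ∃! k : Fin d → ℤ,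
    ∀ j, 0 ≤ x j + k j ∧ x j + k j < 1 := by
  refine ⟨fun j => -⌊x j⌋, fun j => ?_, fun k hk => ?_⟩
  · have h1 := Int.floor_le (x j)
    have h2 := Int.lt_floor_add_one (x j)
    simp only [Int.cast_neg]
    constructor <;> linarith
  · ext j
    have h := hk j
    have : ⌊x j⌋ = -k j := by
      rw [Int.floor_eq_iff]
      push_cast
      constructor <;> linarith [h.1, h.2]
    rw [this, neg_neg]

/-- The half-open unit cube. -/
def unitCube (d : ℕ) : Set (Fin d → ℝ) := Set.pi Set.univ fun _ => Set.Ico 0 1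

lemma measurableSet_unitCube : MeasurableSet (unitCube d) :=
  MeasurableSet.univ_pi fun _ => measurableSet_Ico

lemma volume_unitCube : (volume (unitCube d)).toReal = 1 := by
  rw [unitCube, Real.volume_pi_Ico_toReal (by intro j; simp)]
  simp

lemma norm_le_of_mem_unitCube {x : Fin d → ℝ} (hx : x ∈ unitCube d) : ‖x‖ ≤ ((1 : ℕ) : ℝ) := by
  refine (pi_norm_le_iff_of_nonneg (by norm_num)).2 fun j => ?_
  have := hx j (Set.mem_univ j)
  rw [Real.norm_eq_abs, abs_of_nonneg this.1]
  push_cast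
  exact this.2.le

/-- Integration over the space by periodization. -/
lemma integral_eq_setIntegral_sum {R : ℕ} {g : (Fin d → ℝ) → ℂ} (hgi : Integrable g)
    (hg : ∀ x, g x ≠ 0 → ‖x‖ ≤ R) :
    ∫ x, g x = ∫ x in unitCube d, ∑ k ∈ box d (1 + R), g (x - castVec k) := by
  set Q := unitCube d with hQ
  have hQm : MeasurableSet Q := measurableSet_unitCube
  have e2 : ∀ k : Fin d → ℤ, ∫ x in Q, g (x - castVec k)
      = ∫ x, Q.indicator 1 (x + castVec k) * g x := by
    intro k
    rw [← integral_indicator hQm, ← integral_add_right_eq_self _ (castVec k)]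
    congr 1
    ext x
    by_cases hx : x + castVec k ∈ Q
    · simp [Set.indicator_of_mem hx]
    · simp [Set.indicator_of_notMem hx]
  have e3 : ∀ k : Fin d → ℤ,
      Integrable fun x => Q.indicator (1 : (Fin d → ℝ) → ℂ) (x + castVec k) * g x := by
    intro k
    refine hgi.bdd_mul (c := 1) ?_ (Eventually.of_forall fun x => ?_)
    · exact ((measurable_one.indicator hQm).comp (measurable_id.add_const _)).aestronglyMeasurable
    · by_cases hx : x + castVec k ∈ Q
      · simp [Set.indicator_of_mem hx]
      · simp [Set.indicator_of_notMem hx]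
  rw [integral_finsetSum _ fun k _ => (hgi.comp_sub_right (castVec k)).integrableOn]
  simp only [e2]
  rw [← integral_finsetSum _ fun k _ => e3 k]
  congr 1
  ext x
  by_cases hg0 : g x = 0
  · simp [hg0]
  have hxR : ‖x‖ ≤ R := hg x hg0
  -- Exactly one lattice translate of x lies in the half-open cube, so the indicators add up to one.
  obtain ⟨k₀, hk₀, huniq⟩ := exists_castVec_near_of_unit x
  have hk₀Q : x + castVec k₀ ∈ Q := fun j _ => hk₀ j
  rw [Finset.sum_eq_single k₀]
  · simp [Set.indicator_of_mem hk₀Q]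
  · intro k _ hk
    have : x + castVec k ∉ Q := fun hx => hk (huniq k fun j => hx j (Set.mem_univ j))
    simp [Set.indicator_of_notMem this]
  · intro hk
    refine absurd ?_ hk
    rw [mem_box, ← norm_castVec]
    have := norm_sub_le (x + castVec k₀) x
    rw [add_sub_cancel_left] at this
    have h1 := norm_le_of_mem_unitCube hk₀Q
    push_cast at h1 ⊢
    linarith

/-- A constant series of integer translates is the integral. -/
lemma integral_eq_of_synth_const {R : ℕ} {G : Fin r → (Fin d → ℝ) → ℂ} (hG : SuppIn R G)
    (hc : ∀ j, Continuous (G j)) {y : Matrix (Fin 1) (Fin r) ℂ} {c : ℂ}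
    (h : ∀ x, synth (fun _ => y) G x = c) : y 0 ⬝ᵥ (fun j => ∫ x, G j x) = c := by
  have hgi : ∀ j, Integrable fun x => y 0 j * G j x := fun j =>
    ((hc j).integrable_of_hasCompactSupport (hG.hasCompactSupport j)).const_mul _
  have e1 := integral_eq_setIntegral_sum (R := R) (g := fun x => ∑ j, y 0 j * G j x)
    (integrable_finsetSum _ fun j _ => hgi j) fun x hx => by
      obtain ⟨j, _, hj⟩ := Finset.exists_ne_zero_of_sum_ne_zero hx
      exact hG j x (right_ne_zero_of_mul hj)
  have e2 : ∫ x in unitCube d, ∑ k ∈ box d (1 + R), ∑ j, y 0 j * G j (x - castVec k)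
      = ∫ x in unitCube d, c := by
    refine setIntegral_congr_fun measurableSet_unitCube fun x hx => ?_
    rw [← h x, synth_eq_sum _ (hG.mem_box (norm_le_of_mem_unitCube hx))]
  rw [e2, setIntegral_const, measureReal_def, volume_unitCube, one_smul,
    integral_finsetSum _ fun j _ => hgi j] at e1
  rw [← e1]
  exact Finset.sum_congr rfl fun j _ => (integral_const_mul _ _).symm

/-- Refinable functions reproduce polynomials. -/
theorem synth_polyConv {a : MFilter d r r} {n : ℕ} {y : MFilter d 1 r}
    (hy : IsMatchingFilter a n y) {R : ℕ} {G : Fin r → (Fin d → ℝ) → ℂ} (hG : SuppIn R G)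
    (hc : ∀ j, Continuous (G j)) (ha : Refines a G) {p : (Fin d → ℝ) → ℂ} (hp : p ∈ Pl d n)
    (x : Fin d → ℝ) :
    synth (polyConv y p) G x = (symbol y 0 0 ⬝ᵥ fun j => ∫ x, G j x) * p x := by
  obtain ⟨-, hy⟩ := (isMatchingFilter_iff a n y).1 hy
  set c := symbol y 0 0 ⬝ᵥ fun j => ∫ x, G j x with hcdef
  -- The defect of reproduction. It is linear in p, commutes with integer translations, and
  -- intertwines halving of p with doubling of x.
  let h : ((Fin d → ℝ) → ℂ) → (Fin d → ℝ) → ℂ := fun p x => synth (polyConv y p) G x - c * p x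
  have hsub : ∀ p q, h (p - q) = h p - h q := by
    intro p q
    ext x
    simp only [h, polyConv_sub, synth_sub_left _ _ hG, Pi.sub_apply]
    ring
  have hsmul : ∀ (t : ℂ) p, h (t • p) = t • h p := by
    intro t p
    ext x
    simp only [h, polyConv_smul, synth_smul_left _ _ hG, Pi.smul_apply, smul_eq_mul]
    ring
  have htrans : ∀ p (l : Fin d → ℤ) x, h (fun x => p (x + castVec l)) x = h p (x + castVec l) := by
    intro p l x
    simp only [h]
    rw [synth_translate]
    congr 2
    ext1 k
    exact polyConv_translate y p k l
  have hcont : ∀ p, Continuous p → Continuous (h p) := fun p hp =>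
    (continuous_synth hG hc _).sub (continuous_const.mul hp)
  have hdil : ∀ p ∈ Pl d n, ∀ x, h (fun x => p ((1 / 2 : ℝ) • x)) ((2 : ℝ) • x) = h p x := by
    intro p hp x
    simp only [h]
    rw [← hy p hp, ha.synth_subdiv hG, smul_smul]
    norm_num
  have key : ∀ D, D ≤ n → ∀ p ∈ Pl d D, h p = 0 := by
    intro D
    induction D with
    | zero =>
      intro _ p hp
      rw [Pl_zero, Submodule.mem_bot] at hp
      have := hsmul 0 0
      rw [hp]; simpa using this
    | succ D ih =>
      intro hD p hp
      -- The difference p(· + l) - p has lower degree, so its defect is already zero.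
      have hper : ∀ (x : Fin d → ℝ) (l : Fin d → ℤ), h p (x + castVec l) = h p x := by
        intro x l
        have h1 := ih (by omega) _ (lead_mem_Pl hp 1 (castVec l))
        simp only [one_smul, Complex.ofReal_one, one_pow] at h1
        rw [hsub, sub_eq_zero] at h1
        rw [← htrans, h1]
      have hscale : ∀ x, h p ((2 : ℝ) • x) = 2 ^ D * h p x := by
        intro x
        have h1 := ih (by omega) _ (lead_mem_Pl hp (1 / 2) 0)
        simp only [add_zero] at h1
        rw [hsub, hsmul, sub_eq_zero] at h1
        have h2 := hdil p (Pl_le hD hp) x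
        rw [h1, Pi.smul_apply, smul_eq_mul] at h2
        rw [← h2, ← mul_assoc, ← mul_pow]
        norm_num
      have hscaleN : ∀ (N : ℕ) x, h p ((2 : ℝ) ^ N • x) = (2 ^ D) ^ N * h p x := by
        intro N x
        induction N with
        | zero => simp
        | succ N ihN => rw [pow_succ', mul_smul, hscale, ihN, ← mul_assoc, ← pow_succ']
      have hpc : Continuous (h p) := hcont p (contDiff_of_mem_Pl hp).continuous
      -- In degree 0 the defect is invariant under doubling and continuous at 0, hence constant;
      -- integrating over the unit cube shows that the constant is zero.
      rcases Nat.eq_zero_or_pos D with rfl | hD0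
      · have hconst : ∀ x, h p x = h p 0 := by
          intro x
          have hlim : Tendsto (fun N : ℕ => h p ((1 / 2 : ℝ) ^ N • x)) atTop (𝓝 (h p 0)) := by
            refine (hpc.tendsto _).comp ?_
            have := (tendsto_pow_atTop_nhds_zero_of_lt_one (r := (1 / 2 : ℝ)) (by norm_num)
              (by norm_num)).smul_const x
            rwa [zero_smul] at this
          refine tendsto_nhds_unique ?_ hlim
          refine tendsto_const_nhds.congr fun N => ?_
          have := hscaleN N ((1 / 2 : ℝ) ^ N • x)
          rw [smul_smul, ← mul_pow] at this
          norm_num at this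
          simpa using this
        have hp1 := Pl_one_apply hp
        have hv : polyConv y p = fun _ => p 0 • symbol y 0 := by
          rw [hp1, polyConv_smul]
          ext1 k
          rw [Pi.smul_apply, polyConv_one, ← hp1]
        have h1 := integral_eq_of_synth_const hG hc (y := p 0 • symbol y 0)
          (c := h p 0 + c * p 0) fun x => by
            rw [← hconst x, ← hv]
            have : p x = p 0 := by rw [hp1]; simp
            simp only [h, this]
            ring
        change (p 0 • symbol y 0 0) ⬝ᵥ _ = _ at h1
        rw [smul_dotProduct, ← hcdef, smul_eq_mul, mul_comm c,
          right_eq_add] at h1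
        ext x
        rw [hconst, h1]; rfl
      -- In degree D ≥ 1 a periodic continuous defect is bounded, whereas doubling multiplies it by
      -- 2^D.
      · obtain ⟨C, hC⟩ := exists_bound_of_periodic hpc hper
        ext x
        by_contra hx
        rw [Pi.zero_apply] at hx
        have hpos : 0 < ‖h p x‖ := norm_pos_iff.2 hx
        obtain ⟨N, hN⟩ := pow_unbounded_of_one_lt (C / ‖h p x‖) (one_lt_two (α := ℝ))
        have h1 := hC ((2 : ℝ) ^ N • x)
        rw [hscaleN, norm_mul, norm_pow, norm_pow, Complex.norm_ofNat] at h1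
        rw [div_lt_iff₀ hpos] at hN
        have h2 : (2 : ℝ) ^ N ≤ (2 ^ D) ^ N :=
          pow_le_pow_left₀ (by norm_num) (by
            calc (2 : ℝ) = 2 ^ 1 := (pow_one _).symm
              _ ≤ 2 ^ D := pow_le_pow_right₀ (by norm_num) hD0) _
        nlinarith
  have := congrFun (key n le_rfl p hp) x
  simp only [h, Pi.zero_apply, sub_eq_zero] at this
  exact this

end Reproduction

/-! ### Decay of the subdivision scheme and the spectral quantity `ρ` -/

section Decay
variable {d r : ℕ}

/-- `2^{sN} ‖[S^N(δI)] * w‖_∞ → 0`. -/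
def Decays (a : MFilter d r r) (s : ℕ) (w : MFilter d r 1) : Prop :=
  ∀ ε > 0, ∀ᶠ N : ℕ in atTop, ∀ k i, 2 ^ (s * N) * ‖conv (mask a N) w k i 0‖ ≤ ε

/-- `‖[S^N(δI)] * w‖_∞ ≤ K θ^N`. -/
def DecaysAt (a : MFilter d r r) (θ : ℝ) (w : MFilter d r 1) : Prop :=
  ∃ K, 0 ≤ K ∧ ∀ N k i, ‖conv (mask a N) w k i 0‖ ≤ K * θ ^ N

lemma exists_bound_conv_mask (a : MFilter d r r) (N : ℕ) (w : MFilter d r 1) :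
    ∃ K, 0 ≤ K ∧ ∀ k i, ‖conv (mask a N) w k i 0‖ ≤ K := by
  obtain ⟨n, hn⟩ := exists_nat_ge ((2 : ℝ) ^ N * radius a + radius w)
  have h0 : ∀ k, 0 ≤ ∑ i, ‖conv (mask a N) w k i 0‖ := fun k =>
    Finset.sum_nonneg fun i _ => norm_nonneg _
  refine ⟨∑ k ∈ box d n, ∑ i, ‖conv (mask a N) w k i 0‖,
    Finset.sum_nonneg fun k _ => h0 k, fun k i => ?_⟩
  by_cases hk : conv (mask a N) w k = 0
  · rw [hk, Matrix.zero_apply, norm_zero]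
    exact Finset.sum_nonneg fun k _ => h0 k
  · have : k ∈ box d n := mem_box.2 ((norm_le_of_conv_mask_ne_zero hk).trans hn)
    exact (Finset.single_le_sum (f := fun i => ‖conv (mask a N) w k i 0‖)
      (fun i _ => norm_nonneg _) (Finset.mem_univ i)).trans
      (Finset.single_le_sum (f := fun k => ∑ i, ‖conv (mask a N) w k i 0‖)
        (fun k _ => h0 k) this)

lemma zero_mem_vanishSet (n : ℕ) (y : MFilter d 1 r) : 0 ∈ vanishSet n y :=
  mem_vanishSet_iff.2 fun p _ => by rw [conv_zero]; rfl

/-- `vanishSet` as a linear subspace. -/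
def vanishSub (n : ℕ) (y : MFilter d 1 r) : Submodule ℂ (MFilter d r 1) where
  carrier := vanishSet n y
  zero_mem' := zero_mem_vanishSet n y
  add_mem' hw hw' := by
    rw [mem_vanishSet_iff] at *
    intro p hp
    rw [conv_add, Pi.add_apply, Matrix.add_apply, hw p hp, hw' p hp, add_zero]
  smul_mem' c w hw := by
    rw [mem_vanishSet_iff] at *
    intro p hp
    rw [conv_smul, Pi.smul_apply, Matrix.smul_apply, hw p hp, smul_zero]

lemma mem_vanishSub {n : ℕ} {y : MFilter d 1 r} {w : MFilter d r 1} :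
    w ∈ vanishSub n y ↔ ∀ p ∈ Pl d n, conv (polyConv y p) w 0 0 0 = 0 := mem_vanishSet_iff

lemma conv_translate {s t : ℕ} (v : (Fin d → ℤ) → Matrix (Fin s) (Fin r) ℂ) (w : MFilter d r t)
    (k l : Fin d → ℤ) : conv (fun z => v (z + l)) w k = conv v w (k + l) := by
  rw [conv, conv]
  refine Finsupp.sum_congr fun z _ => ?_
  rw [sub_add_eq_add_sub]

lemma conv_polyConv_apply (y : MFilter d 1 r) (p : (Fin d → ℝ) → ℂ) (w : MFilter d r 1)
    (l : Fin d → ℤ) :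
    conv (polyConv y p) w l = conv (polyConv y fun x => p (x + castVec l)) w 0 := by
  have : polyConv y (fun x => p (x + castVec l)) = fun z => polyConv y p (z + l) := by
    ext1 z; exact polyConv_translate y p z l
  rw [this, conv_translate, zero_add]

lemma IsMatchingFilter.iterate_polyConv {a : MFilter d r r} {n : ℕ} {y : MFilter d 1 r}
    (hy : IsMatchingFilter a n y) {p : (Fin d → ℝ) → ℂ} (hp : p ∈ Pl d n) (N : ℕ) :
    (subdiv a)^[N] (polyConv y p) = polyConv y fun x => p ((1 / 2 : ℝ) ^ N • x) := by
  obtain ⟨-, hy⟩ := (isMatchingFilter_iff a n y).1 hy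
  induction N with
  | zero => simp
  | succ N ih =>
    rw [Function.iterate_succ_apply', ih, hy _ (scale_mem_Pl hp _)]
    simp only [smul_smul, pow_succ]

/-- Dual form of the sum rules: subdivision preserves the sequences p * y with deg p < n, so the
transition operator preserves their annihilator. -/
lemma IsMatchingFilter.trans_mem {a : MFilter d r r} {n : ℕ} {y : MFilter d 1 r}
    (hy : IsMatchingFilter a n y) {w : MFilter d r 1} (hw : w ∈ vanishSub n y) (N : ℕ)
    (ε : Fin d → ℤ) : trans a N ε w ∈ vanishSub n y := by
  rw [mem_vanishSub] at *
  intro p hp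
  rw [← conv_iterate_subdiv, hy.iterate_polyConv hp, conv_polyConv_apply]
  exact hw _ (translate_mem_Pl (scale_mem_Pl hp _) _)

lemma exists_leftInverse_of_ker_eq_bot {V W : Type*} [AddCommGroup V] [Module ℂ V]
    [AddCommGroup W] [Module ℂ W] (e : V →ₗ[ℂ] W) (h : LinearMap.ker e = ⊥) :
    ∃ g : W →ₗ[ℂ] V, g ∘ₗ e = LinearMap.id :=
  LinearMap.exists_leftInverse_of_injective e h

/-- A finite spanning family of the filters with small support in a subspace, with coefficients
given by the entries. -/
lemma exists_spanning_family (V : Submodule ℂ (MFilter d r 1)) (n : ℕ) :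
    ∃ e : box d n × Fin r → MFilter d r 1, (∀ q, e q ∈ V) ∧
      ∀ u ∈ V, (∀ k, u k ≠ 0 → k ∈ box d n) → u = ∑ q, u q.1 q.2 0 • e q := by
  let U : Submodule ℂ (MFilter d r 1) := V ⊓ Finsupp.supported _ ℂ (box d n : Set (Fin d → ℤ))
  let ev : U →ₗ[ℂ] (box d n × Fin r → ℂ) :=
    { toFun := fun u q => (u : MFilter d r 1) q.1 q.2 0
      map_add' := fun _ _ => rfl
      map_smul' := fun _ _ => rfl }
  have hev : LinearMap.ker ev = ⊥ := by
    refine LinearMap.ker_eq_bot'.2 fun u hu => Subtype.ext ?_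
    ext k i j
    rw [Subsingleton.elim j 0]
    by_cases hk : k ∈ box d n
    · exact congrFun hu (⟨k, hk⟩, i)
    · have h1 := (Finsupp.mem_supported' ℂ (u : MFilter d r 1)).1 u.2.2 k hk
      rw [h1]; rfl
  obtain ⟨g, hg⟩ := @exists_leftInverse_of_ker_eq_bot U (box d n × Fin r → ℂ) _ _ _ _ ev hev
  refine ⟨fun q => g fun j => if q = j then 1 else 0, fun q => (g _).2.1, fun u hu hs => ?_⟩
  have hsU : u ∈ U := ⟨hu, (Finsupp.mem_supported' ℂ u).2 fun k hk => by
    by_contra h; exact hk (hs k h)⟩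
  have h1 : g (ev ⟨u, hsU⟩) = ⟨u, hsU⟩ := LinearMap.congr_fun hg _
  rw [LinearMap.pi_apply_eq_sum_univ g] at h1
  have h2 := congrArg Subtype.val h1
  rw [AddSubmonoidClass.coe_finsetSum] at h2
  exact h2.symm

/-- The contraction principle: decay of every filter in `V_{n,y}` at rate `2^{-s}` is uniformly
strictly faster than `2^{-s}`. -/
theorem exists_uniform_decay {a : MFilter d r r} {n : ℕ} {y : MFilter d 1 r}
    (hy : IsMatchingFilter a n y) {s : ℕ} (h : ∀ w ∈ vanishSub n y, Decays a s w) :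
    ∃ θ : ℝ, 0 < θ ∧ 2 ^ s * θ < 1 ∧ ∀ w ∈ vanishSub n y, DecaysAt a θ w := by
  -- The radius in which every sufficiently iterated transition image is supported: one unit absorbs
  -- the support of w, the other the residue ε.
  set ρ := radius a + 2 with hρ
  obtain ⟨e, he, hspan⟩ := exists_spanning_family (vanishSub n y) ρ
  set c := Fintype.card (box d ρ × Fin r) with hc
  -- The constant 1/(2(c + 1)) makes the sum over the c spanning filters at most half of 2^{-sA};
  -- this half yields the strict improvement of the rate.
  obtain ⟨A, hA, hA1⟩ : ∃ A : ℕ, (∀ q k i,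
      2 ^ (s * A) * ‖conv (mask a A) (e q) k i 0‖ ≤ 1 / (2 * (c + 1))) ∧ 1 ≤ A :=
    ((eventually_all.2 fun q => h (e q) (he q) _ (by positivity)).and
      (eventually_ge_atTop 1)).exists
  set κ : ℝ := (2 ^ (s * A))⁻¹ / 2 with hκ
  have hκ0 : 0 < κ := by positivity
  -- one block of `A` steps contracts by `κ`
  have hsmall : ∀ u ∈ vanishSub n y, (∀ k, u k ≠ 0 → k ∈ box d ρ) → ∀ b, 0 ≤ b →
      (∀ k i, ‖u k i 0‖ ≤ b) → ∀ k i, ‖conv (mask a A) u k i 0‖ ≤ κ * b := by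
    intro u hu hs b hb hub k i
    have h1 : conv (mask a A) u k = ∑ q : box d ρ × Fin r, u q.1 q.2 0 • conv (mask a A) (e q) k := by
      conv_lhs => rw [hspan u hu hs]
      have : ∀ w : MFilter d r 1, conv (mask a A) w k = convLin (mask a A) k w := fun _ => rfl
      simp only [this, map_sum, map_smul]
    rw [h1, Matrix.sum_apply]
    refine (norm_sum_le _ _).trans ?_
    calc ∑ q : box d ρ × Fin r, ‖(u q.1 q.2 0 • conv (mask a A) (e q) k) i 0‖
        ≤ ∑ _q : box d ρ × Fin r, b * ((2 ^ (s * A))⁻¹ * (1 / (2 * (c + 1)))) := by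
          refine Finset.sum_le_sum fun q _ => ?_
          rw [Matrix.smul_apply, smul_eq_mul, norm_mul]
          refine mul_le_mul (hub _ _) ?_ (norm_nonneg _) hb
          rw [← div_eq_inv_mul, le_div_iff₀ (by positivity), mul_comm]
          exact hA q k i
      _ = κ * b * (c / (c + 1)) := by
          rw [Finset.sum_const, Finset.card_univ, ← hc, nsmul_eq_mul, hκ]
          field_simp
      _ ≤ κ * b * 1 := by
          refine mul_le_mul_of_nonneg_left ?_ (by positivity)
          rw [div_le_one (by positivity)]; linarith
      _ = κ * b := mul_one _
  have hstep : ∀ w ∈ vanishSub n y, ∀ B, (radius w : ℝ) ≤ 2 ^ B → ∀ b, 0 ≤ b →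
      (∀ k i, ‖conv (mask a B) w k i 0‖ ≤ b) →
      ∀ k i, ‖conv (mask a (A + B)) w k i 0‖ ≤ κ * b := by
    intro w hw B hB b hb hwb k i
    obtain ⟨q, ε, rfl, hε⟩ := exists_eq_two_pow_smul_add B k
    rw [conv_mask_add]
    refine hsmall _ (hy.trans_mem hw B ε) (fun z hz => ?_) b hb (fun z i => ?_) q i
    · have h1 := trans_support_bound hz
      have h2 := norm_le_of_lt_two_pow hε
      rw [mem_box, hρ]
      have h3 : (2 : ℝ) ^ B * ‖z‖ ≤ 2 ^ B * (radius a + 2) := by linarith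
      push_cast
      exact le_of_mul_le_mul_left h3 (by positivity)
    · rw [trans_apply]; exact hwb _ i
  -- the rate
  set θ : ℝ := κ ^ ((A : ℝ)⁻¹) with hθ
  have hθ0 : 0 < θ := Real.rpow_pos_of_pos hκ0 _
  have hθA : θ ^ A = κ := Real.rpow_inv_natCast_pow hκ0.le (by omega)
  -- Taking A-th powers, (2^s θ)^A = 2^{sA} κ = 1/2.
  have hθs : 2 ^ s * θ < 1 := by
    refine lt_of_pow_lt_pow_left₀ A zero_le_one ?_
    rw [mul_pow, hθA, ← pow_mul, one_pow, hκ, mul_div_assoc', mul_inv_cancel₀ (by positivity)]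
    norm_num
  have hθ1 : θ ≤ 1 := by
    have : (1 : ℝ) ≤ 2 ^ s := one_le_pow₀ one_le_two
    nlinarith
  refine ⟨θ, hθ0, hθs, fun w hw => ?_⟩
  choose K hK0 hK using fun N => exists_bound_conv_mask a N w
  -- A block of A steps contracts only after the support of w has been absorbed, that is, once
  -- radius w ≤ 2^B; the finitely many earlier levels are put into the constant.
  obtain ⟨B₀, hB₀⟩ := pow_unbounded_of_one_lt (radius w : ℝ) one_lt_two
  set L := ∑ N ∈ Finset.range (B₀ + A), K N with hL
  have hL0 : 0 ≤ L := Finset.sum_nonneg fun N _ => hK0 N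
  have hKL : ∀ N, N < B₀ + A → ∀ k i, ‖conv (mask a N) w k i 0‖ ≤ L := fun N hN k i =>
    (hK N k i).trans (Finset.single_le_sum (fun N _ => hK0 N) (Finset.mem_range.2 hN))
  have hind : ∀ N k i, ‖conv (mask a N) w k i 0‖ ≤ L / θ ^ (B₀ + A) * θ ^ N := by
    intro N
    induction N using Nat.strong_induction_on with
    | _ N ih =>
      intro k i
      rcases lt_or_ge N (B₀ + A) with hN | hN
      · refine (hKL N hN k i).trans ?_
        rw [div_mul_eq_mul_div, le_div_iff₀ (by positivity)]
        exact mul_le_mul_of_nonneg_left (pow_le_pow_of_le_one hθ0.le hθ1 hN.le) hL0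
      · obtain ⟨B, rfl⟩ := Nat.exists_eq_add_of_le (show A ≤ N by omega)
        have := hstep w hw B (hB₀.le.trans (pow_le_pow_right₀ one_le_two (by omega)))
          (L / θ ^ (B₀ + A) * θ ^ B) (by positivity) (ih B (by omega)) k i
        refine this.trans (le_of_eq ?_)
        rw [pow_add θ A B, hθA]; ring
  exact ⟨_, by positivity, hind⟩

/-! ### Decay and the smoothness exponent -/

lemma normInf_le {s t : ℕ} {v : (Fin d → ℤ) → Matrix (Fin s) (Fin t) ℂ} {b : ℝ}
    (h : ∀ k i j, ‖v k i j‖ ≤ b) : normInf v ≤ s * (t * ENNReal.ofReal b) := by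
  have h1 : ∀ i j, ⨆ k, ‖v k i j‖ₑ ≤ ENNReal.ofReal b := fun i j => iSup_le fun k => by
    rw [← ofReal_norm]; exact ENNReal.ofReal_le_ofReal (h k i j)
  calc normInf v ≤ ∑ _i : Fin s, ∑ _j : Fin t, ENNReal.ofReal b :=
        Finset.sum_le_sum fun i _ => Finset.sum_le_sum fun j _ => h1 i j
    _ = _ := by simp

lemma enorm_le_normInf {s t : ℕ} (v : (Fin d → ℤ) → Matrix (Fin s) (Fin t) ℂ) (k : Fin d → ℤ)
    (i : Fin s) (j : Fin t) : ‖v k i j‖ₑ ≤ normInf v :=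
  (le_iSup (fun k => ‖v k i j‖ₑ) k).trans <|
    (Finset.single_le_sum (f := fun j => ⨆ k, ‖v k i j‖ₑ) (fun _ _ => zero_le)
      (Finset.mem_univ j)).trans
    (Finset.single_le_sum (f := fun i => ∑ j, ⨆ k, ‖v k i j‖ₑ) (fun _ _ => zero_le)
      (Finset.mem_univ i))

/-- The constant disappears because L^{1/N} → 1; adding 1 to it keeps the base positive. -/
lemma DecaysAt.limsup_le {a : MFilter d r r} {θ : ℝ} {w : MFilter d r 1} (h : DecaysAt a θ w)
    (h0 : 0 < θ) : limsup (fun N : ℕ => normInf (conv ((subdiv a)^[N] (deltaI d r)) w)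
      ^ (1 / (N : ℝ))) atTop ≤ ENNReal.ofReal θ := by
  obtain ⟨K, hK, h⟩ := h
  set L : ℝ := r * K + 1 with hL
  have hL0 : 0 < L := by positivity
  have h1 : ∀ᶠ N : ℕ in atTop, normInf (conv ((subdiv a)^[N] (deltaI d r)) w) ^ (1 / (N : ℝ))
      ≤ ENNReal.ofReal (L ^ (1 / (N : ℝ)) * θ) := by
    filter_upwards [eventually_ge_atTop 1] with N hN
    have h2 : normInf (conv (mask a N) w) ≤ ENNReal.ofReal (L * θ ^ N) := by
      refine (normInf_le fun k i j => by rw [Subsingleton.elim j 0]; exact h N k i).trans ?_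
      rw [← ENNReal.ofReal_natCast, ← ENNReal.ofReal_natCast, ← ENNReal.ofReal_mul (by positivity),
        ← ENNReal.ofReal_mul (by positivity)]
      refine ENNReal.ofReal_le_ofReal ?_
      have : 0 ≤ θ ^ N := by positivity
      rw [hL]; push_cast; nlinarith
    refine (ENNReal.rpow_le_rpow h2 (by positivity)).trans (le_of_eq ?_)
    rw [ENNReal.ofReal_rpow_of_nonneg (by positivity) (by positivity),
      Real.mul_rpow hL0.le (by positivity)]
    congr 2
    rw [one_div, Real.pow_rpow_inv_natCast h0.le (by omega)]
  have h3 : Tendsto (fun N : ℕ => ENNReal.ofReal (L ^ (1 / (N : ℝ)) * θ)) atTop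
      (𝓝 (ENNReal.ofReal θ)) := by
    refine ENNReal.tendsto_ofReal ?_
    have : Tendsto (fun N : ℕ => L ^ (1 / (N : ℝ)) * θ) atTop (𝓝 (L ^ (0 : ℝ) * θ)) := by
      refine Tendsto.mul_const θ ?_
      exact (Real.continuousAt_const_rpow hL0.ne').tendsto.comp tendsto_one_div_atTop_nhds_zero_nat
    simpa using this
  calc _ ≤ limsup (fun N : ℕ => ENNReal.ofReal (L ^ (1 / (N : ℝ)) * θ)) atTop :=
        limsup_le_limsup h1
    _ = _ := h3.limsup_eq

lemma lt_smInf_iff (a : MFilter d r r) (s : ℕ) :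
    (s : EReal) < smInf a ↔ rho a < ENNReal.ofReal ((2 ^ s)⁻¹) := by
  have h2 : (0 : EReal) < (Real.log 2 : ℝ) := by exact_mod_cast Real.log_pos one_lt_two
  rw [smInf, EReal.lt_neg_comm, EReal.div_lt_iff h2 (EReal.coe_ne_top _), ← ENNReal.log_lt_log_iff,
    ENNReal.log_ofReal_of_pos (by positivity), Real.log_inv, Real.log_pow, EReal.coe_neg,
    EReal.coe_mul, EReal.neg_mul]
  rfl

/-- Decay on `V_{n,y}` bounds the smoothness exponent. -/
lemma lt_smInf_of_decays {a : MFilter d r r} {n : ℕ} {y : MFilter d 1 r}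
    (hy : IsMatchingFilter a n y) {s : ℕ} (h : ∀ w ∈ vanishSub n y, Decays a s w) :
    (s : EReal) < smInf a := by
  obtain ⟨θ, hθ0, hθs, hθ⟩ := exists_uniform_decay hy h
  rw [lt_smInf_iff]
  have h1 : rho a ≤ ENNReal.ofReal θ :=
    (iInf_le_of_le n <| iInf_le_of_le y <| iInf_le _ hy).trans
      (iSup₂_le fun w hw => (hθ w hw).limsup_le hθ0)
  refine h1.trans_lt ((ENNReal.ofReal_lt_ofReal_iff (by positivity)).2 ?_)
  rw [← one_div, lt_div_iff₀ (by positivity), mul_comm]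
  exact hθs

/-- A θ strictly between the limsup and 2^{-s} gives decay like (2^s θ)^N → 0 after rescaling. The
order n and the filter y come from an infimum and need not be related to a prescribed matching
filter. -/
lemma exists_decays_of_lt_smInf {a : MFilter d r r} {s : ℕ} (h : (s : EReal) < smInf a) :
    ∃ (n : ℕ) (y : MFilter d 1 r), IsMatchingFilter a n y ∧
      ∀ w ∈ vanishSub n y, Decays a s w := by
  rw [lt_smInf_iff, rho] at h
  simp only [iInf_lt_iff] at h
  obtain ⟨n, y, hy, h⟩ := h
  refine ⟨n, y, hy, fun w hw => ?_⟩
  obtain ⟨θ, hθ1, hθ2⟩ := exists_between h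
  have hθt : θ ≠ ⊤ := ne_top_of_lt hθ2
  set t := θ.toReal with ht
  have hts : 2 ^ s * t < 1 := by
    have := (ENNReal.lt_ofReal_iff_toReal_lt hθt).1 hθ2
    rw [← one_div, lt_div_iff₀ (by positivity)] at this
    rw [mul_comm]; exact this
  have hlim := (le_iSup₂ (f := fun w (_ : w ∈ vanishSet n y) =>
    limsup (fun N : ℕ => normInf (conv ((subdiv a)^[N] (deltaI d r)) w) ^ (1 / (N : ℝ))) atTop)
    w hw).trans_lt hθ1
  have hev := eventually_lt_of_limsup_lt hlim
  intro ε hε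
  have hpow : Tendsto (fun N : ℕ => (2 ^ s * t) ^ N) atTop (𝓝 0) :=
    tendsto_pow_atTop_nhds_zero_of_lt_one (by positivity) hts
  filter_upwards [hev, hpow.eventually_le_const hε, eventually_ge_atTop 1] with N h1 h2 hN k i
  refine le_trans ?_ h2
  have h3 : normInf (conv (mask a N) w) ≤ θ ^ N := by
    have := ENNReal.rpow_le_rpow h1.le (show (0 : ℝ) ≤ N by positivity)
    rw [← ENNReal.rpow_mul, one_div, inv_mul_cancel₀ (by positivity), ENNReal.rpow_one,
      ENNReal.rpow_natCast] at this
    exact this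
  have h4 := (enorm_le_normInf (conv (mask a N) w) k i 0).trans h3
  have h5 : ‖conv (mask a N) w k i 0‖ ≤ t ^ N := by
    rw [ht, ← ENNReal.toReal_pow, ← toReal_enorm]
    exact ENNReal.toReal_mono (ENNReal.pow_ne_top hθt) h4
  rw [mul_pow, ← pow_mul]
  exact mul_le_mul_of_nonneg_left h5 (by positivity)

end Decay

/-! ### The Hermite form of a matching filter -/

section HermiteForm
variable {d r : ℕ}

/-- Both sides of (H) are differentiated at 0: the symbol gives i^{|μ|} times (x^μ * υ)(0), and
(iξ)^ν gives i^{|ν|} ν! if μ = ν and 0 otherwise. Thus (H) says that convolution with υ acts at 0 as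
∂^{ν_l} on polynomials of degree at most |ν_l|. -/
lemma hasHermiteForm_iff_mono (ν : Fin r → Fin d → ℕ) (υ : MFilter d 1 r) :
    HasHermiteForm ν υ ↔ ∀ l (μ : Fin d → ℕ), order μ < order (ν l) + 1 →
      polyConv υ (mono μ) 0 0 l = partialDeriv (ν l) (mono μ) 0 := by
  refine forall_congr' fun l => ?_
  have hform : (fun ξ : Fin d → ℝ => ∏ j, (Complex.I * (ξ j : ℂ)) ^ ν l j)
      = Complex.I ^ order (ν l) • mono (ν l) := by
    ext ξ
    simp only [mul_pow, Finset.prod_mul_distrib, Finset.prod_pow_eq_pow_sum, Pi.smul_apply,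
      smul_eq_mul, mono, order]
  have hsym : (fun ξ => symbol υ ξ 0 l) = expSum υ.support (fun k => υ k 0 l) castVec :=
    funext fun ξ => symbol_apply υ ξ 0 l
  have hmono : ∀ μ : Fin d → ℕ, polyConv υ (mono μ) 0 0 l
      = (-1) ^ order μ * ∑ k ∈ υ.support, υ k 0 l * mono μ (castVec k) := by
    intro μ
    rw [polyConv_apply, Finset.mul_sum]
    refine Finset.sum_congr rfl fun k _ => ?_
    rw [zero_sub, castVec_neg]
    have : mono μ (-castVec k) = (-1) ^ order μ * mono μ (castVec k) := by
      simp only [mono, order, ← Finset.prod_pow_eq_pow_sum, ← Finset.prod_mul_distrib, ← mul_pow]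
      simp
    rw [this]; ring
  have hone : ∀ μ : Fin d → ℕ, order μ < order (ν l) + 1 →
      (partialDeriv μ (fun ξ => symbol υ ξ 0 l) 0
        = partialDeriv μ (fun ξ => ∏ j, (Complex.I * (ξ j : ℂ)) ^ ν l j) 0 ↔
      polyConv υ (mono μ) 0 0 l = partialDeriv (ν l) (mono μ) 0) := by
    intro μ hμ
    rw [hform, hsym, partialDeriv_expSum_zero, partialDeriv_smul
      (contDiff_infty.1 (contDiff_mono _) _), Pi.smul_apply, partialDeriv_mono_zero,
      partialDeriv_mono_zero, hmono, smul_eq_mul]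
    set X := ∑ k ∈ υ.support, υ k 0 l * mono μ (castVec k)
    have hI : ∀ n : ℕ, Complex.I ^ n ≠ 0 := fun n => pow_ne_zero _ Complex.I_ne_zero
    have h1 : (-Complex.I) ^ order μ * X = Complex.I ^ order μ * ((-1) ^ order μ * X) := by
      rw [neg_pow]; ring
    rw [h1]
    by_cases h : μ = ν l
    · subst h
      simp [hI]
    · rw [if_neg h, if_neg (Ne.symm h), mul_zero, mul_eq_zero, or_iff_right (hI _)]
  exact forall_congr' fun μ => forall_congr' fun hμ => hone μ hμ

lemma hasHermiteForm_iff (ν : Fin r → Fin d → ℕ) (υ : MFilter d 1 r) :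
    HasHermiteForm ν υ ↔ ∀ l, ∀ p ∈ Pl d (order (ν l) + 1),
      polyConv υ p 0 0 l = partialDeriv (ν l) p 0 := by
  rw [hasHermiteForm_iff_mono]
  refine forall_congr' fun l => ⟨fun h p hp => ?_, fun h μ hμ => h _ (mono_mem_Pl hμ)⟩
  have hp' : p ∈ Pl d (order (ν l) + 1) ∧ polyConv υ p 0 0 l = partialDeriv (ν l) p 0 := by
    refine Pl_induction (P := fun p => p ∈ Pl d (order (ν l) + 1) ∧
      polyConv υ p 0 0 l = partialDeriv (ν l) p 0) ?_ ?_ ?_ ?_ hp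
    · exact fun μ hμ => ⟨mono_mem_Pl hμ, h μ hμ⟩
    · refine ⟨zero_mem _, ?_⟩
      rw [partialDeriv_zero_fun, polyConv_apply]; simp
    · rintro f g ⟨hf, hf'⟩ ⟨hg, hg'⟩
      refine ⟨add_mem hf hg, ?_⟩
      rw [polyConv_add, partialDeriv_add (contDiff_infty.1 (contDiff_of_mem_Pl hf) _)
        (contDiff_infty.1 (contDiff_of_mem_Pl hg) _), Pi.add_apply, Pi.add_apply,
        Matrix.add_apply, hf', hg']
    · rintro c f ⟨hf, hf'⟩
      refine ⟨Submodule.smul_mem _ _ hf, ?_⟩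
      rw [polyConv_smul, partialDeriv_smul (contDiff_infty.1 (contDiff_of_mem_Pl hf) _),
        Pi.smul_apply, Pi.smul_apply, Matrix.smul_apply, hf']
  exact hp'.2

end HermiteForm

/-! ### Discrete convolution on polynomials -/

section ConvPoly
variable {d r : ℕ}

/-- The operator `p ↦ ∑_z c(z) p(· - z)` on polynomials. -/
def convPoly (n : ℕ) (c : (Fin d → ℤ) →₀ ℂ) : Pl d n →ₗ[ℂ] Pl d n :=
  ∑ z ∈ c.support, c z •
    { toFun := fun p => ⟨fun x => (p : (Fin d → ℝ) → ℂ) (x + (-castVec z)), translate_mem_Pl p.2 _⟩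
      map_add' := fun _ _ => rfl
      map_smul' := fun _ _ => rfl }

lemma convPoly_apply (n : ℕ) (c : (Fin d → ℤ) →₀ ℂ) (p : Pl d n) (x : Fin d → ℝ) :
    (convPoly n c p : (Fin d → ℝ) → ℂ) x
      = ∑ z ∈ c.support, c z * (p : (Fin d → ℝ) → ℂ) (x - castVec z) := by
  rw [convPoly, LinearMap.sum_apply, AddSubmonoidClass.coe_finsetSum, Finset.sum_apply]
  refine Finset.sum_congr rfl fun z _ => ?_
  rw [sub_eq_add_neg]; rfl

/-- On the leading part the operator is multiplication by the nonzero mean ∑ c(z), so an element of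
the kernel loses one degree after another. -/
lemma convPoly_injective (n : ℕ) {c : (Fin d → ℤ) →₀ ℂ} (hc : ∑ z ∈ c.support, c z ≠ 0) :
    Function.Injective (convPoly n c) := by
  refine (injective_iff_map_eq_zero _).2 fun p hp => ?_
  have key : ∀ D, D ≤ n → (p : (Fin d → ℝ) → ℂ) ∈ Pl d (n - D) := by
    intro D
    induction D with
    | zero => exact fun _ => p.2
    | succ D ih =>
      intro hD
      have h1 := ih (by omega)
      have h2 : n - D = (n - (D + 1)) + 1 := by omega
      rw [h2] at h1
      have h3 : (∑ z ∈ c.support, c z) • (p : (Fin d → ℝ) → ℂ)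
          = -∑ z ∈ c.support, c z • ((fun x => (p : (Fin d → ℝ) → ℂ) ((1 : ℝ) • x + (-castVec z)))
            - ((1 : ℝ) : ℂ) ^ (n - (D + 1)) • (p : (Fin d → ℝ) → ℂ)) := by
        ext x
        have h4 := congrFun (congrArg Subtype.val hp) x
        rw [convPoly_apply] at h4
        simp only [Pi.smul_apply, Pi.neg_apply, Finset.sum_apply, Pi.sub_apply, one_smul,
          Complex.ofReal_one, one_pow, smul_eq_mul, mul_sub, Finset.sum_sub_distrib,
          ← sub_eq_add_neg, h4, ← Finset.sum_mul]
        change _ = -((0 : ℂ) - _)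
        ring
      have h5 : (∑ z ∈ c.support, c z) • (p : (Fin d → ℝ) → ℂ) ∈ Pl d (n - (D + 1)) := by
        rw [h3]
        exact neg_mem (sum_mem fun z _ => Submodule.smul_mem _ _ (lead_mem_Pl h1 1 _))
      rwa [Submodule.smul_mem_iff _ hc] at h5
  have := key n le_rfl
  rw [Nat.sub_self, Pl_zero, Submodule.mem_bot] at this
  exact Subtype.ext this

lemma convPoly_bijective (n : ℕ) {c : (Fin d → ℤ) →₀ ℂ} (hc : ∑ z ∈ c.support, c z ≠ 0) :
    Function.Bijective (convPoly n c) :=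
  ⟨convPoly_injective n hc, LinearMap.surjective_of_injective (convPoly_injective n hc)⟩

lemma conv_apply_support {s t : ℕ} (v : (Fin d → ℤ) → Matrix (Fin s) (Fin r) ℂ)
    (w : MFilter d r t) (k : Fin d → ℤ) : conv v w k = ∑ z ∈ w.support, v (k - z) * w z := rfl

/-- The scalar filter `z ↦ y(z) b`. -/
def dotFilter (y : MFilter d 1 r) (b : Matrix (Fin r) (Fin 1) ℂ) : (Fin d → ℤ) →₀ ℂ :=
  Finsupp.onFinset y.support (fun z => (y z * b) 0 0) fun z hz => by
    rw [Finsupp.mem_support_iff]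
    intro h0
    rw [h0, Matrix.zero_mul] at hz
    exact hz rfl

lemma convPoly_dotFilter (n : ℕ) (y : MFilter d 1 r) (b : Matrix (Fin r) (Fin 1) ℂ) (p : Pl d n)
    (k : Fin d → ℤ) : (convPoly n (dotFilter y b) p : (Fin d → ℝ) → ℂ) (castVec k)
      = (polyConv y p k * b) 0 0 := by
  rw [convPoly_apply, polyConv, Matrix.sum_mul, Matrix.sum_apply]
  have hsub : (dotFilter y b).support ⊆ y.support := Finsupp.support_onFinset_subset
  refine (Finset.sum_subset hsub fun z _ hz => ?_).trans (Finset.sum_congr rfl fun z _ => ?_)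
  · rw [Finsupp.notMem_support_iff.1 hz, zero_mul]
  · rw [Matrix.smul_mul, Matrix.smul_apply, castVec_sub, smul_eq_mul, mul_comm]
    rfl

lemma sum_dotFilter (y : MFilter d 1 r) (b : Matrix (Fin r) (Fin 1) ℂ) :
    ∑ z ∈ (dotFilter y b).support, dotFilter y b z = (symbol y 0 * b) 0 0 := by
  have := convPoly_dotFilter 1 y b (polyOne one_pos) 0
  rw [convPoly_apply] at this
  simpa [polyOne, polyConv_one] using this

/-- Prescribing the mean of a filter in `V_{n,y}`. -/
lemma exists_mem_vanishSub {n : ℕ} (hn : 0 < n) {y : MFilter d 1 r} (hy : symbol y 0 0 ≠ 0)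
    {b : Matrix (Fin r) (Fin 1) ℂ} (hb : symbol y 0 * b = 0) :
    ∃ w ∈ vanishSub n y, symbol w 0 = b := by
  obtain ⟨i, hi⟩ := Function.ne_iff.1 hy
  -- A coordinate vector not orthogonal to ŷ(0), so that convolution with the scalar filter y e is
  -- invertible on polynomials.
  let e : Matrix (Fin r) (Fin 1) ℂ := fun j _ => if j = i then 1 else 0
  have he : (symbol y 0 * e) 0 0 ≠ 0 := by
    rw [Matrix.mul_apply]
    simpa [e] using hi
  have hbij := convPoly_bijective n (c := dotFilter y e) (by rw [sum_dotFilter]; exact he)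
  let E := LinearEquiv.ofBijective _ hbij
  let ev0 : Pl d n →ₗ[ℂ] ℂ :=
    { toFun := fun p => (p : (Fin d → ℝ) → ℂ) 0
      map_add' := fun _ _ => rfl
      map_smul' := fun _ _ => rfl }
  -- The functional solves for u in (y * b) = u * (y * e) at the level of polynomials; the filter δ
  -- b minus the corresponding shifts of e then lies in V_{n,y}.
  let l : Pl d n →ₗ[ℂ] ℂ := ev0 ∘ₗ convPoly n (dotFilter y b) ∘ₗ E.symm.toLinearMap
  obtain ⟨u, hu⟩ := exists_lattice_functional l
  have hl : ∀ p : Pl d n, (polyConv y p 0 * b) 0 0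
      = ∑ k ∈ u.support, u k * (polyConv y p k * e) 0 0 := by
    intro p
    have h1 := hu (convPoly n (dotFilter y e) p)
    have h2 : E.symm (convPoly n (dotFilter y e) p) = p := E.symm_apply_apply p
    have h3 : l (convPoly n (dotFilter y e) p) = (polyConv y p 0 * b) 0 0 := by
      change (convPoly n (dotFilter y b) (E.symm _) : (Fin d → ℝ) → ℂ) 0 = _
      rw [h2, ← castVec_zero, convPoly_dotFilter]
    rw [h3] at h1
    rw [h1, Finsupp.sum]
    refine Finset.sum_congr rfl fun k _ => ?_
    rw [convPoly_dotFilter]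
  let w : MFilter d r 1 := Finsupp.single 0 b - ∑ k ∈ u.support, u k • Finsupp.single (-k) e
  have hconv : ∀ v : (Fin d → ℤ) → Matrix (Fin 1) (Fin r) ℂ, conv v w 0
      = v 0 * b - ∑ k ∈ u.support, u k • (v k * e) := by
    intro v
    have h1 : ∀ w : MFilter d r 1, conv v w 0 = convLin v 0 w := fun _ => rfl
    rw [h1, map_sub, map_sum]
    simp only [map_smul]
    simp only [← h1, conv_single, sub_zero, zero_sub, neg_neg]
  have hw0 : ∀ w : MFilter d r 1, conv (fun _ => (1 : Matrix (Fin r) (Fin r) ℂ)) w 0 = symbol w 0 := by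
    intro w
    rw [conv_apply_support, symbol_zero]
    simp
  refine ⟨w, mem_vanishSub.2 fun p hp => ?_, ?_⟩
  · rw [hconv, Matrix.sub_apply, hl ⟨p, hp⟩, Matrix.sum_apply, sub_eq_zero]
    rfl
  -- Testing on p = 1 and using ŷ(0) b = 0 shows that the correction has mean zero, so the
  -- prescribed mean b is unchanged.
  · have hsum : ∑ k ∈ u.support, u k = 0 := by
      have h1 := hl (polyOne hn)
      have h2 : ∀ k, polyConv y (polyOne hn : Pl d n) k = symbol y 0 := polyConv_one y
      simp only [h2, hb, ← Finset.sum_mul, Matrix.zero_apply] at h1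
      exact (mul_eq_zero.1 h1.symm).resolve_right he
    have h1 : ∀ w : MFilter d r 1, symbol w 0
        = convLin (fun _ => (1 : Matrix (Fin r) (Fin r) ℂ)) 0 w := fun w => (hw0 w).symm
    rw [h1, map_sub, map_sum]
    simp only [map_smul]
    simp only [← h1]
    have h2 : ∀ (k : Fin d → ℤ) (B : Matrix (Fin r) (Fin 1) ℂ),
        symbol (Finsupp.single k B : MFilter d r 1) 0 = B := by
      intro k B
      rw [← hw0, conv_single, Matrix.one_mul]
    simp only [h2]
    rw [← Finset.sum_smul, hsum, zero_smul, sub_zero]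

end ConvPoly

/-! ### Uniqueness of matching filters in the presence of decay -/

section MatchingUnique
variable {d r : ℕ}

lemma eq_smul_of_mul_eq_zero {y z : Fin r → ℂ} (hy : y ≠ 0)
    (h : ∀ b : Fin r → ℂ, y ⬝ᵥ b = 0 → z ⬝ᵥ b = 0) : ∃ t : ℂ, z = t • y := by
  obtain ⟨i, hi⟩ := Function.ne_iff.1 hy
  rw [Pi.zero_apply] at hi
  refine ⟨z i / y i, ?_⟩
  ext j
  have h1 := h (Pi.single j (y i) - Pi.single i (y j)) (by
    rw [dotProduct_sub, dotProduct_single, dotProduct_single]; ring)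
  rw [dotProduct_sub, dotProduct_single, dotProduct_single, sub_eq_zero] at h1
  rw [Pi.smul_apply, smul_eq_mul]
  field_simp
  linear_combination h1

lemma conv_const {s : ℕ} (z : Matrix (Fin s) (Fin r) ℂ) (w : MFilter d r 1) (k : Fin d → ℤ) :
    conv (fun _ => z) w k = z * symbol w 0 := by
  rw [conv_apply_support, symbol_zero, Matrix.mul_sum]

lemma subdiv_smul {s : ℕ} (a : MFilter d r r) (c : ℂ)
    (v : (Fin d → ℤ) → Matrix (Fin s) (Fin r) ℂ) : subdiv a (c • v) = c • subdiv a v := by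
  ext1 k
  obtain ⟨n, hn⟩ := exists_nat_ge ‖k‖
  rw [Pi.smul_apply, subdiv_eq_sum a _ (fun z hz => mem_box_of_mask_one hn hz),
    subdiv_eq_sum a _ (fun z hz => mem_box_of_mask_one hn hz), smul_comm c]
  simp only [Pi.smul_apply, Matrix.smul_mul, Finset.smul_sum]

lemma subdiv_sub {s : ℕ} (a : MFilter d r r)
    (v v' : (Fin d → ℤ) → Matrix (Fin s) (Fin r) ℂ) :
    subdiv a (v - v') = subdiv a v - subdiv a v' := by
  ext1 k
  obtain ⟨n, hn⟩ := exists_nat_ge ‖k‖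
  rw [Pi.sub_apply, subdiv_eq_sum a _ (fun z hz => mem_box_of_mask_one hn hz),
    subdiv_eq_sum a _ (fun z hz => mem_box_of_mask_one hn hz),
    subdiv_eq_sum a _ (fun z hz => mem_box_of_mask_one hn hz), ← smul_sub,
    ← Finset.sum_sub_distrib]
  simp only [Pi.sub_apply, Matrix.sub_mul]

/-- Constant eigensequences of the subdivision operator annihilate decaying filters. -/
lemma mul_symbol_eq_zero_of_decays {a : MFilter d r r} {s j : ℕ} (hj : j ≤ s)
    {z : Matrix (Fin 1) (Fin r) ℂ}
    (hz : subdiv a (fun _ => z) = (1 / 2 : ℂ) ^ j • fun _ => z) {w : MFilter d r 1}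
    (hw : Decays a s w) : z * symbol w 0 = 0 := by
  have hit : ∀ N, (subdiv a)^[N] (fun _ => z) = ((1 / 2 : ℂ) ^ j) ^ N • fun _ => z := by
    intro N
    induction N with
    | zero => simp
    | succ N ih => rw [Function.iterate_succ_apply', ih, subdiv_smul, hz, smul_smul, ← pow_succ]
  -- By duality the eigensequence applied to w after N steps is a sum of mask values over a fixed
  -- number of lattice points, the box being independent of N.
  have h1 : ∀ N, ((1 / 2 : ℂ) ^ j) ^ N • (z * symbol w 0)
      = z * ∑ q ∈ box d (radius a + radius w), conv (mask a N) w (2 ^ N • q) := by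
    intro N
    have h2 := conv_iterate_subdiv a (fun _ => z) N 0 w 0
    rw [smul_zero, add_zero, hit] at h2
    have h3 : conv (((1 / 2 : ℂ) ^ j) ^ N • fun _ => z) w (0 : Fin d → ℤ)
        = ((1 / 2 : ℂ) ^ j) ^ N • (z * symbol w 0) := by
      rw [← Matrix.smul_mul, ← conv_const]; rfl
    rw [← h3, h2, conv_const, symbol_zero]
    congr 1
    have h7 : ∀ q, conv (mask a N) w (2 ^ N • q) = trans a N 0 w q := fun q => by
      rw [trans_apply, add_zero]
    simp only [h7]
    refine Finset.sum_subset (fun q hq => ?_) fun q _ hq => Finsupp.notMem_support_iff.1 hq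
    have h4 := trans_support_bound (Finsupp.mem_support_iff.1 hq)
    rw [norm_zero, add_zero] at h4
    rw [mem_box]
    push_cast
    have h5 : (1 : ℝ) ≤ 2 ^ N := one_le_pow₀ one_le_two
    refine le_of_mul_le_mul_left (a := (2 : ℝ) ^ N) ?_ (by positivity)
    have h6 : (radius w : ℝ) ≤ 2 ^ N * radius w := le_mul_of_one_le_left (Nat.cast_nonneg _) h5
    linarith
  ext i l
  rw [Subsingleton.elim i 0, Subsingleton.elim l 0, Matrix.zero_apply]
  set C : ℝ := (∑ i, ‖z 0 i‖) * (box d (radius a + radius w)).card with hC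
  have hC0 : 0 ≤ C := mul_nonneg (Finset.sum_nonneg fun i _ => norm_nonneg _) (Nat.cast_nonneg _)
  rw [← norm_le_zero_iff]
  refine le_of_forall_pos_le_add fun δ hδ => ?_
  obtain ⟨N, hN⟩ := (hw (δ / (C + 1)) (by positivity)).exists
  have h2 := congrArg (fun M : Matrix (Fin 1) (Fin 1) ℂ => ‖M 0 0‖) (h1 N)
  simp only [Matrix.smul_apply, smul_eq_mul, norm_mul] at h2
  have h3 : ‖((1 / 2 : ℂ) ^ j) ^ N‖ = (2 ^ (j * N))⁻¹ := by rw [← pow_mul]; simp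
  rw [h3] at h2
  have h4 : ‖(z * ∑ q ∈ box d (radius a + radius w), conv (mask a N) w (2 ^ N • q)) 0 0‖
      ≤ C * (δ / (C + 1) / 2 ^ (s * N)) := by
    obtain ⟨D, hD⟩ : ∃ D, D = δ / (C + 1) / 2 ^ (s * N) := ⟨_, rfl⟩
    rw [Matrix.mul_apply, ← hD, hC, Finset.sum_mul, Finset.sum_mul]
    refine (norm_sum_le _ _).trans (Finset.sum_le_sum fun i _ => ?_)
    rw [norm_mul, mul_assoc]
    refine mul_le_mul_of_nonneg_left ?_ (norm_nonneg _)
    rw [Matrix.sum_apply, ← nsmul_eq_mul]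
    refine (norm_sum_le _ _).trans (Finset.sum_le_card_nsmul _ _ _ fun q _ => ?_)
    rw [hD, le_div_iff₀ (by positivity), mul_comm]
    exact hN _ i
  rw [← h2] at h4
  have h5 : (2 : ℝ) ^ (j * N) ≤ 2 ^ (s * N) :=
    pow_le_pow_right₀ one_le_two (Nat.mul_le_mul_right N hj)
  rw [zero_add]
  calc ‖(z * symbol w 0) 0 0‖
      = 2 ^ (j * N) * ((2 ^ (j * N))⁻¹ * ‖(z * symbol w 0) 0 0‖) := by
        rw [← mul_assoc, mul_inv_cancel₀ (by positivity), one_mul]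
    _ ≤ 2 ^ (s * N) * (C * (δ / (C + 1) / 2 ^ (s * N))) := by
        refine mul_le_mul h5 h4 (by positivity) (by positivity)
    _ = δ * (C / (C + 1)) := by field_simp
    _ ≤ δ * 1 := by
        refine mul_le_mul_of_nonneg_left ?_ hδ.le
        rw [div_le_one (by positivity)]; linarith
    _ = δ := mul_one δ

/-- Both rows are left eigenvectors for the simple eigenvalue 1. After subtracting a multiple the
difference is orthogonal to the right eigenvector, and the orthogonality criterion for the transpose
makes it zero. -/
lemma exists_smul_eq_row {a : MFilter d r r}
    (ha1 : (symbol a 0).charpoly.rootMultiplicity 1 = 1) {n n' : ℕ} {y υ : MFilter d 1 r}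
    (hn : 0 < n) (hn' : 0 < n') (hy : IsMatchingFilter a n y) (hυ : IsMatchingFilter a n' υ) :
    ∃ c : ℂ, c ≠ 0 ∧ symbol y 0 = c • symbol υ 0 := by
  obtain ⟨x, hx, hx1⟩ := exists_normalized_eigenvector ha1 hυ.row_ne_zero (hυ.row_vecMul hn')
  have hx0 : x ≠ 0 := fun h => by rw [h, dotProduct_zero] at hx1; exact zero_ne_one hx1
  have h := eq_zero_of_simple_eigenvalue (A := (symbol a 0)ᵀ) (y := x)
    (by rw [Matrix.charpoly_transpose]; exact ha1) hx0 (by rw [Matrix.vecMul_transpose, hx])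
    (x := symbol y 0 0 - (symbol y 0 0 ⬝ᵥ x) • symbol υ 0 0)
    (by rw [Matrix.mulVec_transpose, Matrix.sub_vecMul, Matrix.smul_vecMul, hy.row_vecMul hn,
      hυ.row_vecMul hn'])
    (by rw [dotProduct_comm, sub_dotProduct, smul_dotProduct, hx1, smul_eq_mul, mul_one, sub_self])
  rw [sub_eq_zero] at h
  refine ⟨symbol y 0 0 ⬝ᵥ x, fun h0 => hy.row_ne_zero (by rw [h, h0, zero_smul]), ?_⟩
  ext i j
  rw [Subsingleton.elim i 0]
  exact congrFun h j

/-- Matching filters agree up to a constant, to the order controlled by decay. -/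
theorem exists_polyConv_eq_smul {a : MFilter d r r}
    (ha1 : (symbol a 0).charpoly.rootMultiplicity 1 = 1) {n n' s : ℕ} {y υ : MFilter d 1 r}
    (hn' : 0 < n') (hy : IsMatchingFilter a n y) (hυ : IsMatchingFilter a n' υ) (hs : n' ≤ s + 1)
    (hdec : ∀ w ∈ vanishSub n y, Decays a s w) :
    ∃ c : ℂ, c ≠ 0 ∧ ∀ p ∈ Pl d (min n n'), polyConv y p = c • polyConv υ p := by
  -- For n = 0 only p = 0 is tested, and any nonzero constant serves; comparing the rows at 0 needs
  -- both orders to be positive.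
  rcases Nat.eq_zero_or_pos n with rfl | hn
  · refine ⟨1, one_ne_zero, fun p hp => ?_⟩
    rw [Nat.zero_min, Pl_zero, Submodule.mem_bot] at hp
    rw [hp, ← zero_smul ℂ (0 : (Fin d → ℝ) → ℂ), polyConv_smul, polyConv_smul, zero_smul,
      zero_smul, smul_zero]
  obtain ⟨c, hc0, hc⟩ := exists_smul_eq_row ha1 hn hn' hy hυ
  have hyS := ((isMatchingFilter_iff a n y).1 hy).2
  have hυS := ((isMatchingFilter_iff a n' υ).1 hυ).2
  refine ⟨c, hc0, ?_⟩
  -- The constant c matches the values on p = 1; D measures the discrepancy on higher degrees, which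
  -- is then killed degree by degree.
  let D : ((Fin d → ℝ) → ℂ) → (Fin d → ℤ) → Matrix (Fin 1) (Fin r) ℂ :=
    fun p => polyConv y p - c • polyConv υ p
  have hDsub : ∀ p q, D (p - q) = D p - D q := by
    intro p q
    simp only [D, polyConv_sub, smul_sub]; abel
  have hDsmul : ∀ (t : ℂ) p, D (t • p) = t • D p := by
    intro t p
    simp only [D, polyConv_smul, smul_sub, smul_comm t c]
  suffices key : ∀ m, m ≤ min n n' → ∀ p ∈ Pl d m, D p = 0 by
    intro p hp
    exact sub_eq_zero.1 (key _ le_rfl p hp)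
  intro m
  induction m with
  | zero =>
    intro _ p hp
    rw [Pl_zero, Submodule.mem_bot] at hp
    have := hDsmul 0 0
    rw [zero_smul, zero_smul] at this
    rw [hp, this]
  | succ m ih =>
    intro hm p hp
    have hpn : p ∈ Pl d n := Pl_le (hm.trans (min_le_left _ _)) hp
    have hpn' : p ∈ Pl d n' := Pl_le (hm.trans (min_le_right _ _)) hp
    have hone : ∀ k, D 1 k = 0 := fun k => by
      simp only [D, Pi.sub_apply, Pi.smul_apply, polyConv_one, hc, sub_self]
    rcases Nat.eq_zero_or_pos m with rfl | hm0
    · rw [Pl_one_apply hp, hDsmul, show D 1 = 0 from funext hone, smul_zero]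
    have hconst : D p = fun _ => D p 0 := by
      ext1 k
      have h1 := ih (by omega) _ (lead_mem_Pl hp 1 (castVec k))
      simp only [one_smul, Complex.ofReal_one, one_pow] at h1
      rw [hDsub, sub_eq_zero] at h1
      have h2 := congrFun h1 0
      simp only [D, Pi.sub_apply, Pi.smul_apply, polyConv_translate, zero_add] at h2 ⊢
      exact h2
    -- Modulo lower degrees, where D vanishes, halving acts as 2^{-m}; so D p is a constant
    -- eigensequence of subdivision for 2^{-m}.
    have hS : subdiv a (D p) = (1 / 2 : ℂ) ^ m • D p := by
      have h1 := ih (by omega) _ (lead_mem_Pl hp (1 / 2) 0)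
      simp only [add_zero] at h1
      rw [hDsub, hDsmul, sub_eq_zero] at h1
      simp only [D] at h1 ⊢
      rw [subdiv_sub, subdiv_smul, hyS p hpn, hυS p hpn', h1]
      norm_num
    -- Decay at rate 2^{-s} with m ≤ s makes this eigensequence annihilate every vector orthogonal
    -- to ŷ(0), since each of them is the mean of some filter in V_{n,y}.
    obtain ⟨t, ht⟩ : ∃ t : ℂ, D p 0 0 = t • symbol y 0 0 := by
      refine eq_smul_of_mul_eq_zero hy.row_ne_zero fun b hb => ?_
      obtain ⟨w, hw, hwb⟩ := exists_mem_vanishSub hn hy.row_ne_zero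
        (b := Matrix.of fun i _ => b i) (by
          ext i j
          rw [Subsingleton.elim i 0]
          exact hb)
      have h1 := mul_symbol_eq_zero_of_decays (j := m) (z := D p 0) (s := s)
        (by have := min_le_right n n'; omega)
        (by rw [← hconst]; exact hS) (hdec w hw)
      rw [hwb] at h1
      exact congrFun (congrFun h1 0) 0
    have hDy : D p = t • polyConv y 1 := by
      rw [hconst]
      ext k i j
      rw [Subsingleton.elim i 0, Pi.smul_apply, polyConv_one]
      exact congrFun ht j
    -- A multiple of ŷ(0) is fixed by subdivision, in conflict with the factor 2^{-m} for m ≥ 1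
    -- unless D p = 0.
    have hfix : subdiv a (D p) = D p := by
      rw [hDy, subdiv_smul, hyS 1 (one_mem_Pl hn)]
      rfl
    rw [hS] at hfix
    have h2 : ((1 / 2 : ℂ) ^ m - 1) • D p = 0 := by rw [sub_smul, one_smul, hfix, sub_self]
    refine (smul_eq_zero.1 h2).resolve_left fun h3 => ?_
    have h4 : ‖(1 / 2 : ℂ) ^ m‖ = 1 := by rw [sub_eq_zero.1 h3, norm_one]
    rw [norm_pow] at h4
    have h5 : ‖(1 / 2 : ℂ)‖ ^ m < 1 := pow_lt_one₀ (norm_nonneg _) (by norm_num) (by omega)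
    linarith

end MatchingUnique

/-! ### Convergence of the Hermite scheme -/

section Convergence
variable {d r : ℕ}

lemma Decays.mono {a : MFilter d r r} {s t : ℕ} (hts : t ≤ s) {w : MFilter d r 1}
    (h : Decays a s w) : Decays a t w := by
  intro ε hε
  filter_upwards [h ε hε] with N hN k i
  refine le_trans (mul_le_mul_of_nonneg_right ?_ (norm_nonneg _)) (hN k i)
  exact pow_le_pow_right₀ one_le_two (Nat.mul_le_mul_right N hts)

/-- One subdivision step acts on `V_i / V_{i+1}` as the factor `2^{-i}`. -/
lemma trans_one_sub_mem {a : MFilter d r r} {n i : ℕ} {y : MFilter d 1 r}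
    (hy : IsMatchingFilter a n y) (hi : i < n) {w : MFilter d r 1} (hw : w ∈ vanishSub i y)
    (ε : Fin d → ℤ) : trans a 1 ε w - (1 / 2 : ℂ) ^ i • w ∈ vanishSub (i + 1) y := by
  rw [mem_vanishSub] at *
  intro p hp
  have h1 := hy.iterate_polyConv (Pl_le hi hp) 1
  have h2 := conv_iterate_subdiv a (polyConv y p) 1 ε w 0
  rw [smul_zero, zero_add, h1, conv_polyConv_apply] at h2
  have h3 := hw _ (lead_mem_Pl hp (1 / 2) ((1 / 2 : ℝ) • castVec ε))
  have hlin : ∀ p q, conv (polyConv y (p - q)) w 0 = conv (polyConv y p) w 0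
      - conv (polyConv y q) w 0 := by
    intro p q
    simp only [conv_apply_support, polyConv_sub, Pi.sub_apply, Matrix.sub_mul,
      Finset.sum_sub_distrib]
  have hsm : ∀ (c : ℂ) p, conv (polyConv y (c • p)) w 0 = c • conv (polyConv y p) w 0 := by
    intro c p
    simp only [conv_apply_support, polyConv_smul, Pi.smul_apply, Matrix.smul_mul,
      Finset.smul_sum]
  rw [hlin, hsm] at h3
  rw [conv_sub, conv_smul, Pi.sub_apply, Pi.smul_apply, ← h2]
  simp only [pow_one, smul_add]
  convert h3 using 6
  norm_num

/-- One transition step is 2^{-i} w plus a term with known decay. Since 2^t 2^{-i} ≤ 1/2, the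
rescaled norms satisfy X_{N+1} ≤ X_N / 2 + small, which forces them to become small. -/
lemma decays_of_trans {a : MFilter d r r} {t i : ℕ} (hi : t + 1 ≤ i) {w : MFilter d r 1}
    (h : ∀ ε, Decays a t (trans a 1 ε w - (1 / 2 : ℂ) ^ i • w)) : Decays a t w := by
  intro δ hδ
  -- The recursion settles at 2 · 2^t δ' = δ/2, leaving δ/2 for the geometric transient.
  set δ' : ℝ := δ / (4 * 2 ^ t) with hδ'
  have hδ'0 : 0 < δ' := by positivity
  have h1 : ∀ᶠ N : ℕ in atTop, ∀ ε ∈ box d 2, ∀ k i', 2 ^ (t * N) *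
      ‖conv (mask a N) (trans a 1 ε w - (1 / 2 : ℂ) ^ i • w) k i' 0‖ ≤ δ' := by
    rw [Filter.eventually_all_finset]
    exact fun ε _ => h ε δ' hδ'0
  obtain ⟨N₀, hN₀⟩ := eventually_atTop.1 h1
  obtain ⟨K, hK0, hK⟩ := exists_bound_conv_mask a N₀ w
  set L := 2 ^ (t * N₀) * K with hL
  have hL0 : 0 ≤ L := by positivity
  have hind : ∀ j k i', 2 ^ (t * (N₀ + j)) * ‖conv (mask a (N₀ + j)) w k i' 0‖
      ≤ L * (1 / 2) ^ j + 2 * (2 ^ t * δ') := by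
    intro j
    induction j with
    | zero =>
      intro k i'
      have := mul_le_mul_of_nonneg_left (hK k i') (show (0 : ℝ) ≤ 2 ^ (t * N₀) by positivity)
      simp only [add_zero, pow_zero, mul_one]
      have h0 : 0 ≤ 2 ^ t * δ' := by positivity
      linarith
    | succ j ih =>
      intro k i'
      obtain ⟨q, ε, rfl, hε⟩ := exists_eq_two_pow_smul_add 1 k
      have hεb : ε ∈ box d 2 := mem_box.2 (by simpa using norm_le_of_lt_two_pow hε)
      rw [← add_assoc, conv_mask_add]
      have h2 : conv (mask a (N₀ + j)) (trans a 1 ε w) q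
          = conv (mask a (N₀ + j)) (trans a 1 ε w - (1 / 2 : ℂ) ^ i • w) q
            + (1 / 2 : ℂ) ^ i • conv (mask a (N₀ + j)) w q := by
        rw [conv_sub, conv_smul, Pi.sub_apply, Pi.smul_apply, sub_add_cancel]
      have h3 := hN₀ (N₀ + j) (by omega) ε hεb q i'
      have h4 := ih q i'
      rw [h2, Matrix.add_apply, Matrix.smul_apply, smul_eq_mul]
      set X := ‖conv (mask a (N₀ + j)) w q i' 0‖
      set Y := ‖conv (mask a (N₀ + j)) (trans a 1 ε w - (1 / 2 : ℂ) ^ i • w) q i' 0‖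
      have h5 : ‖(1 / 2 : ℂ) ^ i‖ ≤ (1 / 2) ^ (t + 1) := by
        rw [norm_pow, show ‖(1 / 2 : ℂ)‖ = 1 / 2 by norm_num]
        exact pow_le_pow_of_le_one (by norm_num) (by norm_num) hi
      have hP : (2 : ℝ) ^ (t * (N₀ + j + 1)) = 2 ^ t * 2 ^ (t * (N₀ + j)) := by
        rw [← pow_add]; congr 1; ring
      have h6 : ‖conv (mask a (N₀ + j)) (trans a 1 ε w - (1 / 2 : ℂ) ^ i • w) q i' 0
          + (1 / 2 : ℂ) ^ i * conv (mask a (N₀ + j)) w q i' 0‖ ≤ Y + (1 / 2) ^ (t + 1) * X := by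
        refine (norm_add_le _ _).trans (add_le_add le_rfl ?_)
        rw [norm_mul]
        exact mul_le_mul_of_nonneg_right h5 (norm_nonneg _)
      have h7 : (2 : ℝ) ^ t * (1 / 2) ^ (t + 1) = 1 / 2 := by
        rw [pow_succ, ← mul_assoc, ← mul_pow]; norm_num
      rw [hP]
      calc 2 ^ t * 2 ^ (t * (N₀ + j)) * _ ≤ 2 ^ t * 2 ^ (t * (N₀ + j)) *
            (Y + (1 / 2) ^ (t + 1) * X) := mul_le_mul_of_nonneg_left h6 (by positivity)
        _ = 2 ^ t * (2 ^ (t * (N₀ + j)) * Y)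
            + (2 ^ t * (1 / 2) ^ (t + 1)) * (2 ^ (t * (N₀ + j)) * X) := by ring
        _ ≤ 2 ^ t * δ' + 1 / 2 * (L * (1 / 2) ^ j + 2 * (2 ^ t * δ')) := by
            rw [h7]
            exact add_le_add (mul_le_mul_of_nonneg_left h3 (by positivity))
              (mul_le_mul_of_nonneg_left h4 (by norm_num))
        _ = _ := by ring
  have hlim : Tendsto (fun j : ℕ => L * (1 / 2 : ℝ) ^ j) atTop (𝓝 (L * 0)) :=
    (tendsto_pow_atTop_nhds_zero_of_lt_one (by norm_num) (by norm_num)).const_mul L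
  rw [mul_zero] at hlim
  obtain ⟨J, hJ⟩ := eventually_atTop.1 (hlim.eventually_le_const (half_pos hδ))
  filter_upwards [eventually_ge_atTop (N₀ + J)] with N hN k i'
  obtain ⟨j, rfl⟩ := Nat.exists_eq_add_of_le (show N₀ ≤ N by omega)
  refine (hind j k i').trans ?_
  have h8 := hJ j (by omega)
  have h9 : 2 * (2 ^ t * δ') = δ / 2 := by rw [hδ']; field_simp; ring
  linarith

/-- Decay on `V_n` propagates to slower decay on the larger spaces `V_i`. -/
lemma decays_of_mem_vanishSub {a : MFilter d r r} {n s : ℕ} {y : MFilter d 1 r}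
    (hy : IsMatchingFilter a n y) (h : ∀ w ∈ vanishSub n y, Decays a s w) {i t : ℕ}
    (hts : t ≤ s) (hin : i ≤ n) (hti : t + 1 ≤ i ∨ i = n) {w : MFilter d r 1}
    (hw : w ∈ vanishSub i y) : Decays a t w := by
  induction hin using Nat.decreasingInduction generalizing w with
  | self => exact (h w hw).mono hts
  | of_succ i hi ih =>
    have hti' : t + 1 ≤ i := by omega
    exact decays_of_trans hti' fun ε => ih (Or.inl (by omega)) (trans_one_sub_mem hy hi hw ε)

lemma tendsto_iSup_enorm_iff {ι : Type*} {f : ℕ → ι → ℂ} :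
    Tendsto (fun n => ⨆ k, ‖f n k‖ₑ) atTop (𝓝 0) ↔ ∀ ε > 0, ∀ᶠ n in atTop, ∀ k, ‖f n k‖ ≤ ε := by
  rw [ENNReal.tendsto_nhds_zero]
  constructor
  · intro h ε hε
    filter_upwards [h (ENNReal.ofReal ε) (ENNReal.ofReal_pos.2 hε)] with n hn k
    have := (le_iSup (fun k => ‖f n k‖ₑ) k).trans hn
    rw [← ofReal_norm, ENNReal.ofReal_le_ofReal_iff hε.le] at this
    exact this
  · intro h ε hε
    obtain rfl | hε' := eq_or_ne ε ⊤
    · exact Eventually.of_forall fun n => le_top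
    · filter_upwards [h ε.toReal (ENNReal.toReal_pos hε.ne' hε')] with n hn
      refine iSup_le fun k => ?_
      rw [← ofReal_norm, ← ENNReal.ofReal_toReal hε']
      exact ENNReal.ofReal_le_ofReal (hn k)

lemma Decays.iterate_filter {a : MFilter d r r} {s : ℕ} {w : MFilter d r 1} (h : Decays a s w)
    (v : MFilter d 1 r) {ε : ℝ} (hε : 0 < ε) :
    ∀ᶠ N : ℕ in atTop, ∀ k, 2 ^ (s * N) * ‖conv ((subdiv a)^[N] v) w k 0 0‖ ≤ ε := by
  set C := coefNorm v with hC
  have hC0 : 0 ≤ C := coefNorm_nonneg v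
  filter_upwards [h (ε / (C + 1)) (by positivity)] with N hN k
  have hP : (0 : ℝ) < 2 ^ (s * N) := by positivity
  rw [conv_iterate_filter, Matrix.sum_apply]
  have h1 : ‖∑ z ∈ v.support, (v z * conv (mask a N) w (k - 2 ^ N • z)) 0 0‖
      ≤ C * (ε / (C + 1) / 2 ^ (s * N)) := by
    refine (norm_sum_le _ _).trans ?_
    obtain ⟨D, hD⟩ : ∃ D, D = ε / (C + 1) / 2 ^ (s * N) := ⟨_, rfl⟩
    rw [← hD, hC, coefNorm, Finset.sum_mul]
    refine Finset.sum_le_sum fun z _ => ?_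
    rw [Matrix.mul_apply, Fin.sum_univ_one, Finset.sum_mul]
    refine (norm_sum_le _ _).trans (Finset.sum_le_sum fun i _ => ?_)
    rw [norm_mul]
    refine mul_le_mul_of_nonneg_left ?_ (norm_nonneg _)
    rw [hD, le_div_iff₀ hP, mul_comm]
    exact hN _ i
  calc 2 ^ (s * N) * _ ≤ 2 ^ (s * N) * (C * (ε / (C + 1) / 2 ^ (s * N))) :=
        mul_le_mul_of_nonneg_left h1 hP.le
    _ = ε * (C / (C + 1)) := by field_simp
    _ ≤ ε * 1 := by
        refine mul_le_mul_of_nonneg_left ?_ hε.le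
        rw [div_le_one (by positivity)]; linarith
    _ = ε := mul_one ε

/-- The error filter of the `l`-th component of the Hermite scheme. -/
def errFilter {R m : ℕ} {G : Fin r → (Fin d → ℝ) → ℂ} (hG : SuppIn R G)
    (hm : ∀ j, ContDiff ℝ m (G j)) (ν : Fin r → Fin d → ℕ) (hν : ∀ l, order (ν l) ≤ m)
    (l : Fin r) : MFilter d r 1 :=
  Finsupp.single 0 (Matrix.of fun i _ => if i = l then 1 else 0)
    - sampleFilter (hG.partialDeriv hm (hν l))

lemma conv_errFilter {R m : ℕ} {G : Fin r → (Fin d → ℝ) → ℂ} (hG : SuppIn R G)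
    (hm : ∀ j, ContDiff ℝ m (G j)) {ν : Fin r → Fin d → ℕ} (hν : ∀ l, order (ν l) ≤ m)
    (l : Fin r) (v : (Fin d → ℤ) → Matrix (Fin 1) (Fin r) ℂ) (k : Fin d → ℤ) :
    conv v (errFilter hG hm ν hν l) k 0 0
      = v k 0 l - partialDeriv (ν l) (synth v G) (castVec k) := by
  rw [errFilter, conv_sub, Pi.sub_apply, Matrix.sub_apply, conv_sampleFilter, conv_single,
    sub_zero, partialDeriv_synth hG hm v (hν l), Matrix.mul_apply]
  simp

lemma partialDeriv_synth_dyadic {a : MFilter d r r} {R m : ℕ} {G : Fin r → (Fin d → ℝ) → ℂ}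
    (hG : SuppIn R G) (hm : ∀ j, ContDiff ℝ m (G j)) (ha : Refines a G) {μ : Fin d → ℕ}
    (hμ : order μ ≤ m) (v : (Fin d → ℤ) → Matrix (Fin 1) (Fin r) ℂ) (N : ℕ) (x : Fin d → ℝ) :
    partialDeriv μ (synth v G) x
      = 2 ^ (order μ * N) * partialDeriv μ (synth ((subdiv a)^[N] v) G) ((2 : ℝ) ^ N • x) := by
  have h1 : synth v G = fun x => synth ((subdiv a)^[N] v) G ((2 : ℝ) ^ N • x + 0) := by
    ext x; rw [add_zero, ha.synth_iterate_subdiv hG]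
  conv_lhs => rw [h1, partialDeriv_affine (contDiff_nat_of_le (contDiff_synth hG hm _) hμ)]
  rw [Pi.smul_apply, smul_eq_mul, add_zero]
  congr 1
  push_cast
  rw [← pow_mul, mul_comm]

/-- By refinability the l-th rescaled error at k/2^N is 2^{|ν_l| N} times the convolution of S_a^N v
with the error filter at k, so convergence is a statement about the decay of that one filter. -/
theorem hermiteConvergent_of_decays {a : MFilter d r r} {R m : ℕ}
    {G : Fin r → (Fin d → ℝ) → ℂ} (hG : SuppIn R G) (hm : ∀ j, ContDiff ℝ m (G j))
    (ha : Refines a G) {ν : Fin r → Fin d → ℕ} (hν : ∀ l, order (ν l) ≤ m)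
    (hdec : ∀ l, Decays a (order (ν l)) (errFilter hG hm ν hν l)) : HermiteConvergent m ν a := by
  intro v
  refine ⟨synth v G, contDiff_synth hG hm v, fun l => tendsto_iSup_enorm_iff.2 fun ε hε => ?_⟩
  filter_upwards [(hdec l).iterate_filter v hε] with N hN k
  refine le_trans (le_of_eq ?_) (hN k)
  have hpt : (2 : ℝ) ^ N • (fun j => (k j : ℝ) / 2 ^ N : Fin d → ℝ) = castVec k := by
    ext j
    simp only [Pi.smul_apply, smul_eq_mul, castVec_apply]
    field_simp
  rw [partialDeriv_synth_dyadic hG hm ha (hν l) _ N, hpt, ← mul_sub, ← conv_errFilter hG hm hν,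
    norm_mul, norm_pow, Complex.norm_ofNat]

/-- Smoothness of the filter and of the refinable functions implies convergence. -/
theorem hermiteConvergent_of_lt_smInf {a : MFilter d r r} {m : ℕ} {ν : Fin r → Fin d → ℕ}
    (hν : ∀ l, order (ν l) ≤ m) (ha1 : (symbol a 0).charpoly.rootMultiplicity 1 = 1)
    {υ : MFilter d 1 r} (hυ : IsMatchingFilter a (maxOrder ν + 1) υ) {φ : Fin r → CSDist d}
    (hφ : IsStdRefinable a υ φ) (hsm : (maxOrder ν : EReal) < smInf a)
    (hm : ∀ i, (φ i).IsCm m) (hH : HasHermiteForm ν υ) : HermiteConvergent m ν a := by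
  obtain ⟨R, G, hG, hGm, ha, hG1, -⟩ := hφ.exists_functions hm
  obtain ⟨n, y, hy, hdec⟩ := exists_decays_of_lt_smInf hsm
  obtain ⟨c, -, hc⟩ := exists_polyConv_eq_smul ha1 (Nat.succ_pos _) hy hυ le_rfl hdec
  rw [hasHermiteForm_iff] at hH
  have hmax : ∀ l, order (ν l) ≤ maxOrder ν := fun l =>
    Finset.le_sup (f := fun l => order (ν l)) (Finset.mem_univ l)
  refine hermiteConvergent_of_decays hG hGm ha hν fun l => ?_
  -- The order n of y may be smaller than |ν_l| + 1. Then i = n and the assumed decay applies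
  -- directly; otherwise i = |ν_l| + 1, which is just enough for decay at rate 2^{-|ν_l|}.
  refine decays_of_mem_vanishSub hy hdec (i := min n (order (ν l) + 1)) (hmax l)
    (min_le_left _ _) (by omega) (mem_vanishSub.2 fun p hp => ?_)
  have hp1 : p ∈ Pl d (order (ν l) + 1) := Pl_le (min_le_right _ _) hp
  have hp2 : p ∈ Pl d (maxOrder ν + 1) := Pl_le (Nat.succ_le_succ (hmax l)) hp1
  have hp3 : p ∈ Pl d (min n (maxOrder ν + 1)) :=
    Pl_le (min_le_min_left _ (Nat.succ_le_succ (hmax l))) hp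
  -- Reproduction turns the sampled derivative into ∂^{ν_l} p(0), and (H) says that this equals the
  -- l-th entry of p * υ at 0.
  have hrep : synth (polyConv υ p) G = p := by
    ext x
    rw [synth_polyConv hυ hG (fun j => (hGm j).continuous) ha hp2, hG1, one_mul]
  have h0 : conv (polyConv υ p) (errFilter hG hGm ν hν l) 0 0 0 = 0 := by
    rw [conv_errFilter, hrep, hH l p hp1, castVec_zero, sub_self]
  rw [hc p hp3]
  have : conv (c • polyConv υ p) (errFilter hG hGm ν hν l) 0
      = c • conv (polyConv υ p) (errFilter hG hGm ν hν l) 0 := by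
    simp only [conv_apply_support, Pi.smul_apply, Matrix.smul_mul, Finset.smul_sum]
  rw [this, Matrix.smul_apply, h0, smul_zero]

end Convergence

/-! ### Limit functions of a convergent Hermite scheme -/

section Limits
variable {d r : ℕ}

lemma tendsto_prod_top_iff {ι : Type*} {f : ℕ → ι → ℂ} :
    Tendsto (fun q : ℕ × ι => f q.1 q.2) (atTop ×ˢ ⊤) (𝓝 0) ↔
      ∀ ε > 0, ∀ᶠ n in atTop, ∀ k, ‖f n k‖ ≤ ε := by
  rw [Metric.nhds_basis_closedBall.tendsto_right_iff]
  refine forall_congr' fun ε => forall_congr' fun _ => ?_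
  rw [← Filter.principal_univ, Filter.eventually_prod_principal_iff]
  simp

/-- A continuous identity on an open set can be checked at dyadic points. -/
lemma eqOn_of_dyadic {f g : (Fin d → ℝ) → ℂ} (hf : Continuous f) (hg : Continuous g)
    {U : Set (Fin d → ℝ)} (hU : IsOpen U)
    (h : ∀ (n : ℕ) (k : Fin d → ℤ), (1 / 2 : ℝ) ^ n • castVec k ∈ U →
      f ((1 / 2 : ℝ) ^ n • castVec k) = g ((1 / 2 : ℝ) ^ n • castVec k)) :
    Set.EqOn f g U := by
  intro x hx
  set u : ℕ → Fin d → ℝ := fun n => (1 / 2 : ℝ) ^ n • castVec fun j => ⌊(2 : ℝ) ^ n * x j⌋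
  have hu : Tendsto u atTop (𝓝 x) := by
    rw [tendsto_pi_nhds]
    intro j
    have h2 : Tendsto (fun n : ℕ => (2 : ℝ) ^ n) atTop atTop :=
      tendsto_pow_atTop_atTop_of_one_lt one_lt_two
    have h3 : Tendsto (fun n : ℕ => (1 / 2 : ℝ) ^ n) atTop (𝓝 0) :=
      tendsto_pow_atTop_nhds_zero_of_lt_one (by norm_num) (by norm_num)
    have h4 : Tendsto (fun n : ℕ => x j - (1 / 2 : ℝ) ^ n) atTop (𝓝 (x j)) := by
      simpa using tendsto_const_nhds.sub h3
    have hpos : ∀ n : ℕ, (1 / 2 : ℝ) ^ n * 2 ^ n = 1 := fun n => by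
      rw [← mul_pow]; norm_num
    refine tendsto_of_tendsto_of_tendsto_of_le_of_le h4 tendsto_const_nhds (fun n => ?_)
      fun n => ?_
    · have := (Int.sub_one_lt_floor ((2 : ℝ) ^ n * x j)).le
      have h5 := mul_le_mul_of_nonneg_left this (by positivity : (0 : ℝ) ≤ (1 / 2) ^ n)
      simp only [u, Pi.smul_apply, smul_eq_mul, castVec_apply]
      rw [mul_sub, ← mul_assoc, hpos, one_mul, mul_one] at h5
      exact h5
    · have := Int.floor_le ((2 : ℝ) ^ n * x j)
      have h5 := mul_le_mul_of_nonneg_left this (by positivity : (0 : ℝ) ≤ (1 / 2) ^ n)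
      simp only [u, Pi.smul_apply, smul_eq_mul, castVec_apply]
      rw [← mul_assoc, hpos, one_mul] at h5
      exact h5
  refine tendsto_nhds_unique ((hf.tendsto x).comp hu)
    (Tendsto.congr' ?_ ((hg.tendsto x).comp hu))
  filter_upwards [hu.eventually (hU.mem_nhds hx)] with n hn
  exact (h n _ hn).symm

lemma eq_of_dyadic {f g : (Fin d → ℝ) → ℂ} (hf : Continuous f) (hg : Continuous g)
    (h : ∀ (n : ℕ) (k : Fin d → ℤ),
      f ((1 / 2 : ℝ) ^ n • castVec k) = g ((1 / 2 : ℝ) ^ n • castVec k)) : f = g :=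
  funext fun x => eqOn_of_dyadic hf hg isOpen_univ (fun n k _ => h n k) (Set.mem_univ x)

/-- The normalized masks converge uniformly to the derivatives of `G`. -/
def MaskLimit (ν : Fin r → Fin d → ℕ) (a : MFilter d r r) (G : Fin r → (Fin d → ℝ) → ℂ) : Prop :=
  ∀ i l, Tendsto (fun q : ℕ × (Fin d → ℤ) => (2 : ℂ) ^ (order (ν l) * q.1) * mask a q.1 q.2 i l
    - partialDeriv (ν l) (G i) ((1 / 2 : ℝ) ^ q.1 • castVec q.2)) (atTop ×ˢ ⊤) (𝓝 0)

lemma iterate_subdiv_single (a : MFilter d r r) (i : Fin r) (n : ℕ) (k : Fin d → ℤ) (l : Fin r) :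
    (subdiv a)^[n] (Finsupp.single 0 (Matrix.of fun _ j => if j = i then 1 else 0) :
      MFilter d 1 r) k 0 l = mask a n k i l := by
  classical
  rw [iterate_subdiv_filter, Finset.sum_subset (Finsupp.support_single_subset)]
  · simp [Matrix.mul_apply]
  · intro x _ hx
    rw [Finsupp.notMem_support_iff.1 hx, Matrix.zero_mul]

/-- The initial data δ e_i select the i-th row of the masks, so the G_i are their limit functions.
-/
lemma HermiteConvergent.exists_maskLimit {m : ℕ} {ν : Fin r → Fin d → ℕ} {a : MFilter d r r}
    (h : HermiteConvergent m ν a) :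
    ∃ G : Fin r → (Fin d → ℝ) → ℂ, (∀ i, ContDiff ℝ m (G i)) ∧ MaskLimit ν a G := by
  choose η hη hlim using h
  refine ⟨fun i => η (Finsupp.single 0 (Matrix.of fun _ j => if j = i then 1 else 0)),
    fun i => hη _, fun i l => ?_⟩
  have := tendsto_prod_top_iff.2 (tendsto_iSup_enorm_iff.1
    (hlim (Finsupp.single 0 (Matrix.of fun _ j => if j = i then 1 else 0)) l))
  refine this.congr fun q => ?_
  rw [iterate_subdiv_single]
  congr 2
  ext j
  simp only [Pi.smul_apply, smul_eq_mul, castVec_apply, one_div, inv_pow]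
  field_simp

variable {ν : Fin r → Fin d → ℕ} {a : MFilter d r r} {G : Fin r → (Fin d → ℝ) → ℂ}

/-- A dyadic point k/2^{n₀} is represented at every finer level n₀ + n by the lattice point 2^n k.
-/
lemma MaskLimit.tendsto_dyadic (h : MaskLimit ν a G) (i l : Fin r) (n₀ : ℕ) (k : Fin d → ℤ) :
    Tendsto (fun n : ℕ => (2 : ℂ) ^ (order (ν l) * (n₀ + n)) * mask a (n₀ + n) (2 ^ n • k) i l)
      atTop (𝓝 (partialDeriv (ν l) (G i) ((1 / 2 : ℝ) ^ n₀ • castVec k))) := by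
  have h1 : Tendsto (fun n : ℕ => ((n₀ + n, 2 ^ n • k) : ℕ × (Fin d → ℤ))) atTop
      (atTop ×ˢ ⊤) :=
    (tendsto_atTop_mono (fun n => Nat.le_add_left n n₀) tendsto_id).prodMk tendsto_top
  have h2 := ((h i l).comp h1).add_const
    (partialDeriv (ν l) (G i) ((1 / 2 : ℝ) ^ n₀ • castVec k))
  rw [zero_add] at h2
  refine h2.congr fun n => ?_
  have hpt : (1 / 2 : ℝ) ^ (n₀ + n) • castVec (2 ^ n • k) = (1 / 2 : ℝ) ^ n₀ • castVec k := by
    rw [castVec_two_pow_smul, smul_smul, pow_add, mul_assoc, ← mul_pow]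
    norm_num
  simp only [Function.comp, hpt]
  ring

variable [NeZero r]

lemma MaskLimit.tendsto_value (h : MaskLimit ν a G) (hν0 : ν 0 = 0) (i : Fin r) (n₀ : ℕ)
    (k : Fin d → ℤ) :
    Tendsto (fun n : ℕ => mask a (n₀ + n) (2 ^ n • k) i 0)
      atTop (𝓝 (G i ((1 / 2 : ℝ) ^ n₀ • castVec k))) := by
  have := h.tendsto_dyadic i 0 n₀ k
  simpa [hν0, order] using this

/-- The N-th mask is supported in the ball of radius 2^N `radius a`, so its limit vanishes at dyadic
points outside the unscaled ball, and by continuity everywhere outside. -/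
lemma MaskLimit.suppIn (h : MaskLimit ν a G) (hν0 : ν 0 = 0) (hc : ∀ i, Continuous (G i)) :
    SuppIn (radius a) G := by
  intro i x hx
  by_contra hlt
  refine hx (eqOn_of_dyadic (hc i) continuous_zero (U := {x | (radius a : ℝ) < ‖x‖})
    (isOpen_lt continuous_const continuous_norm) (fun n k hk => ?_) (not_le.1 hlt))
  refine tendsto_nhds_unique (h.tendsto_value hν0 i n k) ?_
  refine tendsto_const_nhds.congr fun N => ?_
  have hz : mask a (n + N) (2 ^ N • k) = 0 := by
    by_contra h0
    have h1 := norm_le_of_mask_ne_zero h0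
    rw [norm_two_pow_smul, pow_add] at h1
    change (radius a : ℝ) < _ at hk
    rw [norm_smul, norm_castVec, norm_pow, Real.norm_of_nonneg (by norm_num), one_div, inv_pow,
      inv_mul_eq_div, lt_div_iff₀ (by positivity)] at hk
    have : (2 : ℝ) ^ N * ‖k‖ ≤ 2 ^ N * (radius a * 2 ^ n) := by linarith
    exact absurd (le_of_mul_le_mul_left this (by positivity)) (not_le.2 hk)
  rw [hz]; rfl

omit [NeZero r] in
lemma mask_one (a : MFilter d r r) (z : Fin d → ℤ) : mask a 1 z = (2 : ℂ) ^ d • a z := by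
  have h := mask_succ a 0
  rw [zero_add] at h
  rw [h, subdiv_eq_sum a _ (B := {0} ∪ box d (⌈‖z‖⌉₊ + radius a))
    (fun y hy => Finset.mem_union_right _ (mem_box_of_mask_one (Nat.le_ceil _) hy))]
  rw [Finset.sum_eq_single 0]
  · simp [mask, deltaI]
  · intro b _ hb
    simp [mask, deltaI, hb]
  · intro h0; simp at h0

omit [NeZero r] in
lemma mask_one_add (a : MFilter d r r) (N : ℕ) (k : Fin d → ℤ) :
    mask a (1 + N) k = (2 : ℂ) ^ d • ∑ z ∈ a.support, a z * mask a N (k - 2 ^ N • z) := by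
  rw [mask_add, show mask a 1 = ((2 : ℂ) ^ d • a : MFilter d r r) from funext (mask_one a),
    iterate_subdiv_filter, Finsupp.support_smul_eq (pow_ne_zero _ two_ne_zero), Finset.smul_sum]
  simp

/-- Splitting off the first subdivision step instead of the last writes a mask as 2^d ∑ a(z)
mask_N(· - 2^N z), which becomes the refinement equation in the limit at dyadic points. -/
lemma MaskLimit.refines (h : MaskLimit ν a G) (hν0 : ν 0 = 0) (hc : ∀ i, Continuous (G i)) :
    Refines a G := by
  intro i
  refine congrFun (eq_of_dyadic (hc i) (continuous_refine hc a i) fun n k => ?_)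
  have hshift : Tendsto (fun N : ℕ => mask a (1 + (n + N)) (2 ^ (N + 1) • k) i 0) atTop
      (𝓝 (G i ((1 / 2 : ℝ) ^ n • castVec k))) := by
    refine ((h.tendsto_value hν0 i n k).comp (tendsto_add_atTop_nat 1)).congr fun N => ?_
    simp only [Function.comp]
    rw [show n + (N + 1) = 1 + (n + N) by ring]
  refine tendsto_nhds_unique hshift ?_
  have hlim : Tendsto (fun N : ℕ => (2 : ℂ) ^ d * ∑ z ∈ a.support, ∑ j, a z i j *
      mask a (n + N) (2 ^ N • (2 • k - 2 ^ n • z)) j 0) atTop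
      (𝓝 (2 ^ d * ∑ z ∈ a.support, ∑ j, a z i j *
        G j ((2 : ℝ) • ((1 / 2 : ℝ) ^ n • castVec k) - castVec z))) := by
    refine Tendsto.const_mul _ (tendsto_finsetSum _ fun z _ => tendsto_finsetSum _ fun j _ =>
      Tendsto.const_mul _ ?_)
    convert h.tendsto_value hν0 j n (2 • k - 2 ^ n • z) using 3
    rw [castVec_sub, castVec_two_pow_smul, castVec_two_smul, smul_sub, smul_smul ((1 / 2 : ℝ) ^ n) (2 ^ n),
      ← mul_pow, smul_comm]
    norm_num
  refine hlim.congr fun N => ?_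
  rw [mask_one_add, Matrix.smul_apply, Matrix.sum_apply, smul_eq_mul]
  congr 1
  refine Finset.sum_congr rfl fun z _ => ?_
  rw [Matrix.mul_apply]
  refine Finset.sum_congr rfl fun j _ => ?_
  congr 3
  rw [smul_sub, smul_smul, smul_smul, ← pow_add, pow_succ, add_comm N n]

/-- The scheme is run on x^μ * υ and observed at 0. The sum rules give exactly 2^{-|μ| n} times the
initial value, while the mask limit and polynomial reproduction identify the rescaled limit as C
∂^{ν_l} x^μ at 0. No finite support is needed, since only finitely many coefficients influence the
value at 0. -/
lemma MaskLimit.polyConv_apply (h : MaskLimit ν a G) (hν0 : ν 0 = 0) {m : ℕ}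
    (hν : ∀ l, order (ν l) ≤ m) (hm : ∀ i, ContDiff ℝ m (G i)) {υ : MFilter d 1 r}
    (hυ : IsMatchingFilter a (maxOrder ν + 1) υ) (l : Fin r) {μ : Fin d → ℕ}
    (hμ : order μ < order (ν l) + 1) :
    polyConv υ (mono μ) 0 0 l =
      (symbol υ 0 0 ⬝ᵥ fun j => ∫ x, G j x) * partialDeriv (ν l) (mono μ) 0 := by
  have hc : ∀ i, Continuous (G i) := fun i => (hm i).continuous
  have hG := h.suppIn hν0 hc
  have hmax : order (ν l) ≤ maxOrder ν :=
    Finset.le_sup (f := fun l => order (ν l)) (Finset.mem_univ l)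
  have hp : mono μ ∈ Pl d (maxOrder ν + 1) := mono_mem_Pl (by omega)
  set C := symbol υ 0 0 ⬝ᵥ fun j => ∫ x, G j x with hC
  have hsyn : synth (polyConv υ (mono μ)) G = C • mono μ := by
    ext x
    rw [synth_polyConv hυ hG hc (h.refines hν0 hc) hp, Pi.smul_apply, smul_eq_mul]
  have hlim : Tendsto (fun n : ℕ => (2 : ℂ) ^ (order (ν l) * n) *
      (subdiv a)^[n] (polyConv υ (mono μ)) 0 0 l) atTop
      (𝓝 (C * partialDeriv (ν l) (mono μ) 0)) := by
    have h1 : C * partialDeriv (ν l) (mono μ) 0 = ∑ z ∈ box d (0 + radius a), ∑ j,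
        polyConv υ (mono μ) z 0 j * partialDeriv (ν l) (G j) ((1 / 2 : ℝ) ^ 0 • castVec (-z)) := by
      have h2 : partialDeriv (ν l) (synth (polyConv υ (mono μ)) G) 0
          = C * partialDeriv (ν l) (mono μ) 0 := by
        rw [hsyn, partialDeriv_smul (contDiff_infty.1 (contDiff_mono μ) _)]
        rfl
      rw [← h2, partialDeriv_synth hG hm _ (hν l),
        synth_eq_sum _ ((hG.partialDeriv hm (hν l)).mem_box (n := 0) (by simp))]
      simp [castVec_neg]
    rw [h1]
    have h3 : Tendsto (fun n : ℕ => ∑ z ∈ box d (0 + radius a), ∑ j,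
        polyConv υ (mono μ) z 0 j * ((2 : ℂ) ^ (order (ν l) * (0 + n)) *
          mask a (0 + n) (2 ^ n • (-z)) j l)) atTop (𝓝 (∑ z ∈ box d (0 + radius a), ∑ j,
        polyConv υ (mono μ) z 0 j *
          partialDeriv (ν l) (G j) ((1 / 2 : ℝ) ^ 0 • castVec (-z)))) :=
      tendsto_finsetSum _ fun z _ => tendsto_finsetSum _ fun j _ =>
        (h.tendsto_dyadic j l 0 (-z)).const_mul _
    refine h3.congr fun n => ?_
    rw [iterate_subdiv_eq_sum a _ n (B := box d (0 + radius a))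
      (fun z hz => mem_box_of_mask (by simp) hz), Matrix.sum_apply, Finset.mul_sum]
    refine Finset.sum_congr rfl fun z _ => ?_
    rw [Matrix.mul_apply, Finset.mul_sum]
    refine Finset.sum_congr rfl fun j _ => ?_
    rw [zero_add, smul_neg, zero_sub]
    ring
  set v := polyConv υ (mono μ) 0 0 l with hv
  have hval : ∀ n : ℕ, (subdiv a)^[n] (polyConv υ (mono μ)) 0 0 l
      = ((1 / 2 : ℂ) ^ n) ^ order μ * v := by
    intro n
    have hs : (fun x : Fin d → ℝ => mono μ ((1 / 2 : ℝ) ^ n • x))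
        = (((1 / 2 : ℂ) ^ n) ^ order μ) • mono μ := by
      ext x
      simp only [mono, Pi.smul_apply, smul_eq_mul, Complex.ofReal_mul, mul_pow,
        Finset.prod_mul_distrib, Finset.prod_pow_eq_pow_sum, order]
      push_cast
      rfl
    rw [hυ.iterate_polyConv hp, hs, polyConv_smul]
    rfl
  simp only [hval] at hlim
  -- If |μ| < |ν_l|, the limit is 0 while the prefactor is at least 1, so the entry is 0. If the
  -- orders agree, the sequence is constant and equals its limit.
  rcases Nat.lt_succ_iff_lt_or_eq.1 hμ with hlt | heq
  · have hne : ν l ≠ μ := by rintro rfl; exact lt_irrefl _ hlt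
    rw [partialDeriv_mono_zero, if_neg hne, mul_zero] at hlim ⊢
    have hle : ∀ n : ℕ, ‖v‖ ≤ ‖(2 : ℂ) ^ (order (ν l) * n) *
        (((1 / 2 : ℂ) ^ n) ^ order μ * v)‖ := by
      intro n
      rw [norm_mul, norm_mul, norm_pow, norm_pow, norm_pow, ← mul_assoc]
      refine le_mul_of_one_le_left (norm_nonneg _) ?_
      rw [norm_div, norm_one, Complex.norm_ofNat, ← pow_mul, one_div, inv_pow,
        ← div_eq_mul_inv, one_le_div (by positivity), mul_comm (order (ν l))]
      exact pow_le_pow_right₀ one_le_two (Nat.mul_le_mul_left n hlt.le)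
    have h0 : ‖v‖ ≤ 0 := by
      have h5 := hlim.norm
      rw [norm_zero] at h5
      exact ge_of_tendsto' h5 hle
    exact norm_le_zero_iff.1 h0
  · refine tendsto_nhds_unique (Tendsto.congr (fun n => ?_) tendsto_const_nhds) hlim
    rw [heq, ← mul_assoc, ← pow_mul, mul_comm n, ← mul_pow]
    norm_num


lemma polyConv_smul_left (y : MFilter d 1 r) {c : ℂ} (hc : c ≠ 0) (p : (Fin d → ℝ) → ℂ) :
    polyConv (c • y) p = c • polyConv y p := by
  ext k i j
  rw [Pi.smul_apply, Matrix.smul_apply, polyConv_apply, polyConv_apply,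
    Finsupp.support_smul_eq hc, smul_eq_mul, Finset.mul_sum]
  refine Finset.sum_congr rfl fun z _ => ?_
  simp only [Finsupp.smul_apply, Matrix.smul_apply, smul_eq_mul]
  ring

/-- With normalization zero, the case μ = 0 of the preceding identity would make every entry of
υ̂(0) vanish. -/
lemma MaskLimit.normalization_ne_zero (h : MaskLimit ν a G) (hν0 : ν 0 = 0) {m : ℕ}
    (hν : ∀ l, order (ν l) ≤ m) (hm : ∀ i, ContDiff ℝ m (G i)) {υ : MFilter d 1 r}
    (hυ : IsMatchingFilter a (maxOrder ν + 1) υ) :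
    (symbol υ 0 0 ⬝ᵥ fun j => ∫ x, G j x) ≠ 0 := by
  intro h0
  refine hυ.row_ne_zero (funext fun l => ?_)
  have := h.polyConv_apply hν0 hν hm hυ l (μ := 0) (by simp [order])
  rwa [h0, zero_mul, mono_zero, polyConv_one] at this

lemma MaskLimit.hasHermiteForm (h : MaskLimit ν a G) (hν0 : ν 0 = 0) {m : ℕ}
    (hν : ∀ l, order (ν l) ≤ m) (hm : ∀ i, ContDiff ℝ m (G i)) {υ : MFilter d 1 r}
    (hυ : IsMatchingFilter a (maxOrder ν + 1) υ) :
    HasHermiteForm ν ((symbol υ 0 0 ⬝ᵥ fun j => ∫ x, G j x)⁻¹ • υ) := by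
  have hC := h.normalization_ne_zero hν0 hν hm hυ
  rw [hasHermiteForm_iff_mono]
  intro l μ hμ
  rw [polyConv_smul_left _ (inv_ne_zero hC), Pi.smul_apply, Matrix.smul_apply, smul_eq_mul,
    h.polyConv_apply hν0 hν hm hυ l hμ, inv_mul_cancel_left₀ hC]

omit [NeZero r] in
lemma SuppIn.smul {R : ℕ} {F : Fin r → (Fin d → ℝ) → ℂ} (hF : SuppIn R F) (c : ℂ) :
    SuppIn R fun j => c • F j := fun j x hx => hF j x fun h0 => hx (by simp [h0])

omit [NeZero r] in
lemma Refines.smul {F : Fin r → (Fin d → ℝ) → ℂ} (hF : Refines a F) (c : ℂ) :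
    Refines a fun j => c • F j := by
  intro i x
  simp only [Pi.smul_apply, smul_eq_mul]
  rw [hF i x, mul_left_comm]
  congr 1
  rw [Finset.mul_sum]
  refine Finset.sum_congr rfl fun k _ => ?_
  rw [Finset.mul_sum]
  exact Finset.sum_congr rfl fun j _ => by ring

lemma MaskLimit.toLin_eq_integral (h : MaskLimit ν a G) (hν0 : ν 0 = 0)
    (ha1 : (symbol a 0).charpoly.rootMultiplicity 1 = 1)
    (ha2 : ∀ n : ℕ, 1 ≤ n →
      ¬ Module.End.HasEigenvalue (Matrix.toLin' (symbol a 0)) ((2 : ℂ) ^ n)) {m : ℕ}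
    (hν : ∀ l, order (ν l) ≤ m) (hm : ∀ i, ContDiff ℝ m (G i)) {υ : MFilter d 1 r}
    (hυ : IsMatchingFilter a (maxOrder ν + 1) υ) {φ : Fin r → CSDist d}
    (hφ : IsStdRefinable a υ φ) (i : Fin r) (f : smoothFns d) :
    (φ i).toLin f = ∫ x, (f : (Fin d → ℝ) → ℂ) x *
      ((symbol υ 0 0 ⬝ᵥ fun j => ∫ x, G j x)⁻¹ • G i) x := by
  have hc : ∀ i, Continuous (G i) := fun i => (hm i).continuous
  have hC := h.normalization_ne_zero hν0 hν hm hυ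
  refine hφ.toLin_eq_integral ha1 ha2 (Nat.succ_pos _) hυ
    (G := fun i => (symbol υ 0 0 ⬝ᵥ fun j => ∫ x, G j x)⁻¹ • G i) ((h.suppIn hν0 hc).smul _)
    (fun j => (hc j).const_smul _) ((h.refines hν0 hc).smul _) ?_ i f
  simp only [Pi.smul_apply, smul_eq_mul, integral_const_mul]
  rw [← inv_mul_cancel₀ hC]
  simp only [dotProduct, Finset.mul_sum]
  exact Finset.sum_congr rfl fun j _ => by ring

lemma MaskLimit.isCm (h : MaskLimit ν a G) (hν0 : ν 0 = 0)
    (ha1 : (symbol a 0).charpoly.rootMultiplicity 1 = 1)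
    (ha2 : ∀ n : ℕ, 1 ≤ n →
      ¬ Module.End.HasEigenvalue (Matrix.toLin' (symbol a 0)) ((2 : ℂ) ^ n)) {m : ℕ}
    (hν : ∀ l, order (ν l) ≤ m) (hm : ∀ i, ContDiff ℝ m (G i)) {υ : MFilter d 1 r}
    (hυ : IsMatchingFilter a (maxOrder ν + 1) υ) {φ : Fin r → CSDist d}
    (hφ : IsStdRefinable a υ φ) (i : Fin r) : (φ i).IsCm m := by
  have hG := (h.suppIn hν0 fun i => (hm i).continuous).smul
    (symbol υ 0 0 ⬝ᵥ fun j => ∫ x, G j x)⁻¹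
  exact ⟨(symbol υ 0 0 ⬝ᵥ fun j => ∫ x, G j x)⁻¹ • G i, contDiff_const.smul (hm i),
    hG.hasCompactSupport i, fun f => h.toLin_eq_integral hν0 ha1 ha2 hν hm hυ hφ i f⟩

omit [NeZero r] in
lemma IsMatchingFilter.mono {n n' : ℕ} (hn : n' ≤ n) {y : MFilter d 1 r}
    (hy : IsMatchingFilter a n y) : IsMatchingFilter a n' y :=
  ⟨hy.1, fun w hw i j μ hμ => hy.2 w hw i j μ (hμ.trans_le hn)⟩

/-- The masks converge to the integer-shift invariant limit, up to the components carrying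
derivatives, which vanish in the limit. -/
lemma MaskLimit.tendsto_shift (h : MaskLimit ν a G) (hν0 : ν 0 = 0) {m : ℕ}
    (hν : ∀ l, order (ν l) ≤ m) (hm : ∀ i, ContDiff ℝ m (G i)) (z : Fin d → ℤ) (i l : Fin r) :
    Tendsto (fun q : ℕ × (Fin d → ℤ) => mask a q.1 (q.2 - z) i l
      - (if order (ν l) = 0 then 1 else 0) * G i ((1 / 2 : ℝ) ^ q.1 • castVec q.2))
      (atTop ×ˢ ⊤) (𝓝 0) := by
  have hc : ∀ i, Continuous (G i) := fun i => (hm i).continuous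
  have hG := h.suppIn hν0 hc
  have hsh : Tendsto (fun q : ℕ × (Fin d → ℤ) => ((q.1, q.2 - z) : ℕ × (Fin d → ℤ)))
      (atTop ×ˢ ⊤) (atTop ×ˢ ⊤) := tendsto_fst.prodMk tendsto_top
  have h1 := (h i l).comp hsh
  simp only [Function.comp_def] at h1
  have hfst : Tendsto (fun q : ℕ × (Fin d → ℤ) => q.1) (atTop ×ˢ ⊤) atTop := tendsto_fst
  have hpow : Tendsto (fun q : ℕ × (Fin d → ℤ) => (1 / 2 : ℝ) ^ q.1) (atTop ×ˢ ⊤) (𝓝 0) :=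
    (tendsto_pow_atTop_nhds_zero_of_lt_one (by norm_num) (by norm_num)).comp hfst
  by_cases h0 : order (ν l) = 0
  · have hνl : ν l = 0 := by
      funext j
      have := Finset.sum_eq_zero_iff.1 h0 j (Finset.mem_univ j)
      simpa using this
    rw [hνl] at h1
    simp only [hνl, order, Pi.zero_apply, Finset.sum_const_zero, zero_mul, pow_zero, one_mul,
      partialDeriv_zero_index, if_true] at h1 ⊢
    have huc := ((hG.hasCompactSupport i).uniformContinuous_of_continuous (hc i))
    rw [Metric.uniformContinuous_iff] at huc
    have h2 : Tendsto (fun q : ℕ × (Fin d → ℤ) => G i ((1 / 2 : ℝ) ^ q.1 • castVec (q.2 - z))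
        - G i ((1 / 2 : ℝ) ^ q.1 • castVec q.2)) (atTop ×ˢ ⊤) (𝓝 0) := by
      rw [Metric.tendsto_nhds]
      intro ε hε
      obtain ⟨δ, hδ, hδ'⟩ := huc ε hε
      have h3 := hpow.mul_const ‖castVec z‖
      rw [zero_mul] at h3
      filter_upwards [h3.eventually_lt_const hδ] with q hq
      rw [dist_zero_right, ← dist_eq_norm]
      apply hδ'
      rw [castVec_sub, smul_sub, dist_eq_norm, sub_sub_cancel_left, norm_neg, norm_smul,
        norm_pow, Real.norm_of_nonneg (by norm_num)]
      exact hq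
    simpa using h1.add h2
  · rw [if_neg h0]
    simp only [zero_mul, sub_zero]
    have hcont : Continuous (partialDeriv (ν l) (G i)) :=
      continuous_partialDeriv (contDiff_nat_of_le (hm i) (hν l))
    obtain ⟨K, hK⟩ := hcont.bounded_above_of_compact_support
      ((hG.partialDeriv hm (hν l)).hasCompactSupport i)
    have h2 := h1.norm.add (hpow.mul_const K)
    rw [norm_zero, zero_mul, add_zero] at h2
    refine squeeze_zero_norm (fun q => ?_) h2
    set x := partialDeriv (ν l) (G i) ((1 / 2 : ℝ) ^ q.1 • castVec (q.2 - z)) with hx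
    set u := mask a q.1 (q.2 - z) i l
    have h4 : (2 : ℝ) ^ q.1 ≤ 2 ^ (order (ν l) * q.1) :=
      pow_le_pow_right₀ one_le_two (Nat.le_mul_of_pos_left _ (Nat.pos_of_ne_zero h0))
    have h5 : (2 : ℝ) ^ (order (ν l) * q.1) * ‖u‖ ≤ ‖(2 : ℂ) ^ (order (ν l) * q.1) * u - x‖ + K := by
      have := norm_le_norm_sub_add ((2 : ℂ) ^ (order (ν l) * q.1) * u) x
      rw [norm_mul, norm_pow, Complex.norm_ofNat] at this
      exact this.trans (add_le_add_right (hK _) _)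
    have h6 : (2 : ℝ) ^ q.1 * ‖u‖ ≤ ‖(2 : ℂ) ^ (order (ν l) * q.1) * u - x‖ + K :=
      (mul_le_mul_of_nonneg_right h4 (norm_nonneg _)).trans h5
    have h7 : (1 / 2 : ℝ) ^ q.1 * 2 ^ q.1 = 1 := by rw [← mul_pow]; norm_num
    have h8 := mul_le_mul_of_nonneg_left h6 (by positivity : (0 : ℝ) ≤ (1 / 2) ^ q.1)
    rw [← mul_assoc, h7, one_mul, mul_add] at h8
    refine h8.trans (add_le_add_left ?_ _)
    exact mul_le_of_le_one_left (norm_nonneg _) (pow_le_one₀ (by norm_num) (by norm_num))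

/-- Sum rules of order one and s = 0 suffice. For w in V_{1,υ} the columns with ν_l = 0 of the mask
are nearly G_i, uniformly under bounded shifts, and the other columns tend to 0; the limit of the
convolution is then a multiple of υ̂(0)ŵ(0) = 0. -/
lemma MaskLimit.smInf_pos (h : MaskLimit ν a G) (hν0 : ν 0 = 0) {m : ℕ}
    (hν : ∀ l, order (ν l) ≤ m) (hm : ∀ i, ContDiff ℝ m (G i)) {υ : MFilter d 1 r}
    (hυ : IsMatchingFilter a (maxOrder ν + 1) υ) : 0 < smInf a := by
  have hυ1 : IsMatchingFilter a 1 υ := hυ.mono (by omega)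
  have hC := h.normalization_ne_zero hν0 hν hm hυ
  refine lt_of_eq_of_lt (by simp) (lt_smInf_of_decays (s := 0) hυ1 fun w hw => ?_)
  -- By the moment identity for μ = 0, υ̂(0) is C times the indicator of the indices with ν_l = 0,
  -- and C ≠ 0 can be cancelled.
  have hw0 : (∑ z ∈ w.support, ∑ l, (if order (ν l) = 0 then 1 else 0) * w z l 0 : ℂ) = 0 := by
    have h1 := mem_vanishSub.1 hw 1 (one_mem_Pl one_pos)
    rw [conv_apply_support, Matrix.sum_apply] at h1
    refine (mul_eq_zero.1 ?_).resolve_left hC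
    refine Eq.trans ?_ h1
    rw [Finset.mul_sum]
    refine Finset.sum_congr rfl fun z _ => ?_
    rw [Matrix.mul_apply, Finset.mul_sum]
    refine Finset.sum_congr rfl fun l _ => ?_
    have h2 := h.polyConv_apply hν0 hν hm hυ l (μ := 0) (by simp [order])
    rw [partialDeriv_mono_zero, mono_zero, polyConv_one] at h2
    rw [polyConv_one, h2, mul_assoc]
    congr 2
    by_cases h0 : ν l = 0
    · simp [h0, order, mfact]
    · rw [if_neg h0, if_neg]
      intro h3
      refine h0 (funext fun j => ?_)
      simpa using Finset.sum_eq_zero_iff.1 h3 j (Finset.mem_univ j)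
  intro ε hε
  have hlim : ∀ i, Tendsto (fun q : ℕ × (Fin d → ℤ) => conv (mask a q.1) w q.2 i 0)
      (atTop ×ˢ ⊤) (𝓝 0) := by
    intro i
    have h1 : Tendsto (fun q : ℕ × (Fin d → ℤ) => ∑ z ∈ w.support, ∑ l,
        (mask a q.1 (q.2 - z) i l - (if order (ν l) = 0 then 1 else 0) *
          G i ((1 / 2 : ℝ) ^ q.1 • castVec q.2)) * w z l 0) (atTop ×ˢ ⊤)
        (𝓝 (∑ z ∈ w.support, ∑ l, 0 * w z l 0)) :=
      tendsto_finsetSum _ fun z _ => tendsto_finsetSum _ fun l _ =>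
        (h.tendsto_shift hν0 hν hm z i l).mul_const _
    simp only [zero_mul, Finset.sum_const_zero] at h1
    refine h1.congr fun q => ?_
    have h2 : (∑ z ∈ w.support, ∑ l, (if order (ν l) = 0 then 1 else 0) *
        G i ((1 / 2 : ℝ) ^ q.1 • castVec q.2) * w z l 0 : ℂ) = 0 := by
      refine Eq.trans ?_ (congrArg (G i ((1 / 2 : ℝ) ^ q.1 • castVec q.2) * ·) hw0 |>.trans
        (mul_zero _))
      simp only [Finset.mul_sum]
      exact Finset.sum_congr rfl fun z _ => Finset.sum_congr rfl fun l _ => by ring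
    simp only [sub_mul, Finset.sum_sub_distrib]
    rw [h2, sub_zero, conv_apply_support, Matrix.sum_apply]
    exact Finset.sum_congr rfl fun z _ => (Matrix.mul_apply).symm
  have hev : ∀ᶠ N : ℕ in atTop, ∀ i ∈ (Finset.univ : Finset (Fin r)), ∀ k,
      ‖conv (mask a N) w k i 0‖ ≤ ε := by
    rw [Filter.eventually_all_finset]
    exact fun i _ => tendsto_prod_top_iff.1 (hlim i) ε hε
  filter_upwards [hev] with N hN k i
  simpa using hN i (Finset.mem_univ i) k

end Limits

/-! ### The group algebra of the lattice -/

section LatticeAlgebra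
variable {d : ℕ}

/-- Finitely supported scalar filters with the convolution product. -/
abbrev LatAlg (d : ℕ) : Type := AddMonoidAlgebra ℂ (Fin d → ℤ)

/-- Translation of sequences. -/
def shiftHom (d : ℕ) : Multiplicative (Fin d → ℤ) →* Module.End ℂ ((Fin d → ℤ) → ℂ) where
  toFun z :=
    { toFun := fun v k => v (k - z.toAdd)
      map_add' := fun _ _ => rfl
      map_smul' := fun _ _ => rfl }
  map_one' := by ext v k; simp
  map_mul' z w := by
    ext v k
    simp only [toAdd_mul, LinearMap.coe_mk, AddHom.coe_mk, Module.End.mul_apply]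
    congr 1
    abel

/-- Convolution of sequences with finitely supported scalar filters. -/
def act (d : ℕ) : LatAlg d →ₐ[ℂ] Module.End ℂ ((Fin d → ℤ) → ℂ) :=
  AddMonoidAlgebra.lift ℂ _ _ (shiftHom d)

lemma act_apply (f : LatAlg d) (v : (Fin d → ℤ) → ℂ) (k : Fin d → ℤ) :
    act d f v k = ∑ z ∈ f.coeff.support, f.coeff z * v (k - z) := by
  rw [act, AddMonoidAlgebra.lift_apply, Finsupp.sum, LinearMap.sum_apply, Finset.sum_apply]
  rfl

/-- Characters of the torus as a homomorphism. -/
def charHom (d : ℕ) : Multiplicative (Fin d → ℤ) →* C(UnitAddTorus (Fin d), ℂ) where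
  toFun z := UnitAddTorus.mFourier z.toAdd
  map_one' := by rw [toAdd_one, UnitAddTorus.mFourier_zero]
  map_mul' z w := by ext x; rw [toAdd_mul, UnitAddTorus.mFourier_add]; rfl

/-- The trigonometric polynomial of a finitely supported scalar filter. -/
def torusEval (d : ℕ) : LatAlg d →ₐ[ℂ] C(UnitAddTorus (Fin d), ℂ) :=
  AddMonoidAlgebra.lift ℂ _ _ (charHom d)

lemma torusEval_eq (f : LatAlg d) :
    torusEval d f = ∑ z ∈ f.coeff.support, f.coeff z • UnitAddTorus.mFourier z := by
  rw [torusEval, AddMonoidAlgebra.lift_apply, Finsupp.sum]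
  rfl

lemma torusEval_apply (f : LatAlg d) (x : UnitAddTorus (Fin d)) :
    torusEval d f x = ∑ z ∈ f.coeff.support, f.coeff z * UnitAddTorus.mFourier z x := by
  rw [torusEval_eq, ContinuousMap.sum_apply]
  rfl

/-- Fourier coefficients are bounded by the sup norm. -/
lemma norm_coeff_le (f : LatAlg d) {C : ℝ} (h : ∀ x, ‖torusEval d f x‖ ≤ C)
    (k : Fin d → ℤ) : ‖f.coeff k‖ ≤ C := by
  have h1 : UnitAddTorus.mFourierCoeff (torusEval d f) k = f.coeff k := by
    rw [← UnitAddTorus.mFourierCoeff_toLp, torusEval_eq, map_sum,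
      ← UnitAddTorus.mFourierBasis_repr, HilbertBasis.repr_apply_apply,
      UnitAddTorus.coe_mFourierBasis]
    simp only [map_smul]
    have h2 := (UnitAddTorus.orthonormal_mFourier (d := Fin d)).inner_right_finsupp f.coeff k
    rw [Finsupp.linearCombination_apply, Finsupp.sum] at h2
    exact h2
  rw [← h1, UnitAddTorus.mFourierCoeff]
  let _ : MeasureSpace UnitAddCircle := ⟨AddCircle.haarAddCircle⟩
  have : IsProbabilityMeasure (volume : Measure UnitAddCircle) :=
    inferInstanceAs (IsProbabilityMeasure AddCircle.haarAddCircle)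
  have : IsProbabilityMeasure (volume : Measure (UnitAddTorus (Fin d))) :=
    inferInstanceAs (IsProbabilityMeasure (Measure.pi fun _ => volume))
  refine (norm_integral_le_of_norm_le_const (C := C) (Eventually.of_forall fun x => ?_)).trans ?_
  · rw [norm_smul]
    refine (mul_le_of_le_one_left (norm_nonneg _) ?_).trans (h x)
    exact ((UnitAddTorus.mFourier (-k)).norm_coe_le_norm x).trans UnitAddTorus.mFourier_norm.le
  · simp

lemma exists_conj (g : LatAlg d) :
    ∃ f : LatAlg d, ∀ x, torusEval d f x = (starRingEnd ℂ) (torusEval d g x) := by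
  refine ⟨∑ z ∈ g.coeff.support, AddMonoidAlgebra.single (-z) ((starRingEnd ℂ) (g.coeff z)),
    fun x => ?_⟩
  rw [map_sum, torusEval_apply, map_sum, ContinuousMap.sum_apply]
  refine Finset.sum_congr rfl fun z _ => ?_
  rw [torusEval, AddMonoidAlgebra.lift_single, map_mul, ← UnitAddTorus.mFourier_neg]
  rfl

lemma mem_box_pow {h : LatAlg d} {ρ : ℕ} (hs : ∀ z, h.coeff z ≠ 0 → z ∈ box d ρ) (n : ℕ) :
    ∀ z, (h ^ n).coeff z ≠ 0 → z ∈ box d (n * ρ) := by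
  classical
  induction n with
  | zero =>
    intro z hz
    rw [pow_zero, AddMonoidAlgebra.one_def] at hz
    have : z = 0 := by
      by_contra h0
      exact hz (by simp [Ne.symm h0])
    rw [this, mem_box]
    simp
  | succ n ih =>
    intro z hz
    rw [pow_succ] at hz
    have h1 := AddMonoidAlgebra.support_coeff_mul_subset (h ^ n) h (Finsupp.mem_support_iff.2 hz)
    obtain ⟨b, hb, c, hc, rfl⟩ := Finset.mem_add.1 h1
    have hb' := ih b (Finsupp.mem_support_iff.1 hb)
    have hc' := hs c (Finsupp.mem_support_iff.1 hc)
    rw [mem_box] at *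
    refine (norm_add_le _ _).trans ?_
    push_cast at hb' ⊢
    linarith

lemma norm_act_le {f : LatAlg d} {ρ D : ℕ} {q B : ℝ} (hs : ∀ z, f.coeff z ≠ 0 → z ∈ box d ρ)
    (hq : ∀ z, ‖f.coeff z‖ ≤ q) {v : (Fin d → ℤ) → ℂ} (hv : ∀ k, ‖v k‖ ≤ B * (1 + ‖k‖) ^ D)
    (k : Fin d → ℤ) :
    ‖act d f v k‖ ≤ (2 * ρ + 1) ^ d * q * (1 + ρ) ^ D * B * (1 + ‖k‖) ^ D := by
  have hq0 : 0 ≤ q := (norm_nonneg _).trans (hq 0)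
  have hB : 0 ≤ B := by simpa using (norm_nonneg _).trans (hv 0)
  have hsub : f.coeff.support ⊆ box d ρ := fun z hz => hs z (Finsupp.mem_support_iff.1 hz)
  rw [act_apply, Finset.sum_subset hsub fun z _ hz => by
    rw [Finsupp.notMem_support_iff.1 hz, zero_mul]]
  refine (norm_sum_le_of_le (f := fun z => f.coeff z * v (k - z)) _
    (n := fun _ => q * ((1 + ρ) ^ D * (B * (1 + ‖k‖) ^ D))) fun z hz => ?_).trans (le_of_eq ?_)
  · rw [norm_mul]
    refine mul_le_mul (hq z) ((hv _).trans ?_) (norm_nonneg _) hq0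
    rw [mul_left_comm]
    refine mul_le_mul_of_nonneg_left ?_ hB
    rw [← mul_pow]
    refine pow_le_pow_left₀ (by positivity) ?_ D
    have h1 := mem_box.1 hz
    have h2 := norm_sub_le k z
    nlinarith [norm_nonneg k, norm_nonneg z]
  · rw [Finset.sum_const, card_box, nsmul_eq_mul]
    push_cast
    ring

lemma exists_norm_act_le (f : LatAlg d) (D : ℕ) : ∃ C : ℝ, 0 ≤ C ∧ ∀ (v : (Fin d → ℤ) → ℂ) (B : ℝ),
    (∀ k, ‖v k‖ ≤ B * (1 + ‖k‖) ^ D) → ∀ k, ‖act d f v k‖ ≤ C * B * (1 + ‖k‖) ^ D := by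
  obtain ⟨q, hq⟩ : ∃ q : ℝ, ∀ z, ‖f.coeff z‖ ≤ q := by
    refine ⟨∑ z ∈ f.coeff.support, ‖f.coeff z‖, fun z => ?_⟩
    by_cases hz : f.coeff z = 0
    · rw [hz, norm_zero]; exact Finset.sum_nonneg fun _ _ => norm_nonneg _
    · exact Finset.single_le_sum (f := fun z => ‖f.coeff z‖) (fun _ _ => norm_nonneg _)
        (Finsupp.mem_support_iff.2 hz)
  obtain ⟨ρ, hρ⟩ : ∃ ρ : ℕ, ∀ z, f.coeff z ≠ 0 → z ∈ box d ρ := by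
    refine ⟨f.coeff.support.sup fun k => ⌈‖k‖⌉₊, fun z hz => mem_box.2 ?_⟩
    refine (Nat.le_ceil _).trans (Nat.cast_le.2 ?_)
    exact Finset.le_sup (f := fun k : Fin d → ℤ => ⌈‖k‖⌉₊) (Finsupp.mem_support_iff.2 hz)
  have hq0 : 0 ≤ q := (norm_nonneg _).trans (hq 0)
  exact ⟨_, by positivity, fun v B hv k => norm_act_le hρ hq hv k⟩

/-- A filter without zeros on the torus is invertible on sequences of polynomial growth. -/
theorem exists_growth_bound_of_act {g : LatAlg d} (hg : ∀ x, torusEval d g x ≠ 0) (D : ℕ) :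
    ∃ C : ℝ, 0 ≤ C ∧ ∀ (v : (Fin d → ℤ) → ℂ) (K B : ℝ), (∀ k, ‖v k‖ ≤ K * (1 + ‖k‖) ^ D) →
      (∀ k, ‖act d g v k‖ ≤ B * (1 + ‖k‖) ^ D) → ∀ k, ‖v k‖ ≤ C * B * (1 + ‖k‖) ^ D := by
  obtain ⟨f, hf⟩ := exists_conj g
  have hcont : Continuous fun x => ‖torusEval d g x‖ ^ 2 :=
    ((torusEval d g).continuous.norm).pow 2
  obtain ⟨x₀, -, hx₀⟩ := isCompact_univ.exists_isMinOn Set.univ_nonempty hcont.continuousOn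
  obtain ⟨x₁, -, hx₁⟩ := isCompact_univ.exists_isMaxOn Set.univ_nonempty hcont.continuousOn
  set δ := ‖torusEval d g x₀‖ ^ 2 with hδ
  set M := ‖torusEval d g x₁‖ ^ 2 with hM
  have hδ0 : 0 < δ := by have := norm_pos_iff.2 (hg x₀); positivity
  have hM0 : 0 < M := by have := norm_pos_iff.2 (hg x₁); positivity
  have hlo : ∀ x, δ ≤ ‖torusEval d g x‖ ^ 2 := fun x => hx₀ (Set.mem_univ x)
  have hhi : ∀ x, ‖torusEval d g x‖ ^ 2 ≤ M := fun x => hx₁ (Set.mem_univ x)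
  -- The symbol of h is 1 - |ĝ|²/M, with values in [0, q] and q < 1, since f has the conjugate
  -- symbol of g and |ĝ|² lies between δ > 0 and M.
  set h : LatAlg d := 1 - ((M : ℂ)⁻¹ • f) * g with hh
  set q := 1 - δ / M with hq
  have hq0 : 0 ≤ q := by
    rw [hq, sub_nonneg, div_le_one hM0]; exact (hlo x₁)
  have hq1 : q < 1 := by rw [hq]; have := div_pos hδ0 hM0; linarith
  have hqn : ∀ x, ‖torusEval d h x‖ ≤ q := by
    intro x
    have : torusEval d h x = ((1 - ‖torusEval d g x‖ ^ 2 / M : ℝ) : ℂ) := by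
      rw [hh, map_sub, map_one, map_mul, map_smul]
      simp only [ContinuousMap.sub_apply, ContinuousMap.one_apply, ContinuousMap.mul_apply,
        ContinuousMap.smul_apply, hf, smul_eq_mul]
      rw [mul_assoc, ← Complex.normSq_eq_conj_mul_self, Complex.normSq_eq_norm_sq]
      push_cast
      ring
    rw [this, Complex.norm_real, Real.norm_of_nonneg]
    · rw [hq]
      have := div_le_div_of_nonneg_right (hlo x) hM0.le
      linarith
    · rw [sub_nonneg, div_le_one hM0]; exact hhi x
  obtain ⟨ρ, hρ⟩ : ∃ ρ : ℕ, ∀ z, h.coeff z ≠ 0 → z ∈ box d ρ := by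
    refine ⟨h.coeff.support.sup fun k => ⌈‖k‖⌉₊, fun z hz => mem_box.2 ?_⟩
    refine (Nat.le_ceil _).trans (Nat.cast_le.2 ?_)
    exact Finset.le_sup (f := fun k : Fin d → ℤ => ⌈‖k‖⌉₊) (Finsupp.mem_support_iff.2 hz)
  -- The coefficients of h^n are at most q^n, while its support and growth factors are polynomial in
  -- n, so some power acts with norm at most 1/2 on sequences of growth D.
  obtain ⟨n, hn⟩ : ∃ n : ℕ, (2 * (n * ρ : ℕ) + 1 : ℝ) ^ d * q ^ n * (1 + (n * ρ : ℕ)) ^ D ≤ 1 / 2 := by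
    have h1 := (tendsto_pow_const_mul_const_pow_of_abs_lt_one (d + D) (r := q)
      (by rwa [abs_of_nonneg hq0])).const_mul ((2 * ρ + 1 : ℝ) ^ d * (1 + ρ) ^ D)
    rw [mul_zero] at h1
    obtain ⟨n, hn1, hn2⟩ := ((h1.eventually_le_const (by norm_num : (0 : ℝ) < 1 / 2)).and
      (eventually_ge_atTop 1)).exists
    refine ⟨n, le_trans ?_ hn1⟩
    have hn1' : (1 : ℝ) ≤ n := by exact_mod_cast hn2
    have e1 : (2 * (n * ρ : ℕ) + 1 : ℝ) ^ d ≤ ((2 * ρ + 1) * n) ^ d := by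
      refine pow_le_pow_left₀ (by positivity) ?_ _
      push_cast; nlinarith [Nat.cast_nonneg (α := ℝ) ρ]
    have e2 : (1 + (n * ρ : ℕ) : ℝ) ^ D ≤ ((1 + ρ) * n) ^ D := by
      refine pow_le_pow_left₀ (by positivity) ?_ _
      push_cast; nlinarith [Nat.cast_nonneg (α := ℝ) ρ]
    calc (2 * (n * ρ : ℕ) + 1 : ℝ) ^ d * q ^ n * (1 + (n * ρ : ℕ)) ^ D
        ≤ ((2 * ρ + 1) * n) ^ d * q ^ n * ((1 + ρ) * n) ^ D := by gcongr
      _ = _ := by rw [mul_pow, mul_pow, pow_add]; ring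
  set F : LatAlg d := (∑ i ∈ Finset.range n, h ^ i) * ((M : ℂ)⁻¹ • f) with hF
  have hFg : h ^ n + F * g = 1 := by
    have h1 := geom_sum_mul_neg h n
    rw [hF, mul_assoc, show ((M : ℂ)⁻¹ • f) * g = 1 - h by rw [hh]; ring, h1]
    ring
  obtain ⟨CF, hCF0, hCF⟩ := exists_norm_act_le F D
  refine ⟨2 * CF, by positivity, fun v K B hK hB => ?_⟩
  have hdec : ∀ k, v k = act d (h ^ n) v k + act d F (act d g v) k := by
    intro k
    rw [← Pi.add_apply, ← Module.End.mul_apply, ← map_mul, ← LinearMap.add_apply, ← map_add,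
      hFg, map_one]
    rfl
  -- A self-improving bound: v = h^n v + F(g v) replaces any growth constant K' by K'/2 + C_F B. The
  -- initial K is needed to start but disappears in the limit.
  have hstep : ∀ K', (∀ k, ‖v k‖ ≤ K' * (1 + ‖k‖) ^ D) →
      ∀ k, ‖v k‖ ≤ (1 / 2 * K' + CF * B) * (1 + ‖k‖) ^ D := by
    intro K' hK' k
    have hK0 : 0 ≤ K' := by simpa using (norm_nonneg _).trans (hK' 0)
    rw [hdec k, add_mul]
    refine (norm_add_le _ _).trans (add_le_add ?_ (hCF _ B hB k))
    refine (norm_act_le (mem_box_pow hρ n) (q := q ^ n) (norm_coeff_le _ fun x => ?_) hK' k).trans ?_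
    · rw [map_pow, ContinuousMap.pow_apply, norm_pow]
      exact pow_le_pow_left₀ (norm_nonneg _) (hqn x) n
    · exact mul_le_mul_of_nonneg_right (mul_le_mul_of_nonneg_right hn hK0) (by positivity)
  have hiter : ∀ j : ℕ, ∀ k, ‖v k‖ ≤ ((1 / 2) ^ j * K + 2 * CF * B * (1 - (1 / 2) ^ j))
      * (1 + ‖k‖) ^ D := by
    intro j
    induction j with
    | zero => simpa using hK
    | succ j ih =>
      intro k
      refine (hstep _ ih k).trans (le_of_eq ?_)
      rw [pow_succ]; ring
  intro k
  have h3 : Tendsto (fun n : ℕ => (1 / 2 : ℝ) ^ n) atTop (𝓝 0) :=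
    tendsto_pow_atTop_nhds_zero_of_lt_one (by norm_num) (by norm_num)
  have h4 := ((h3.mul_const K).add ((h3.const_sub 1).const_mul (2 * CF * B))).mul_const
    ((1 + ‖k‖) ^ D)
  rw [zero_mul, zero_add, sub_zero, mul_one] at h4
  exact ge_of_tendsto' h4 fun j => hiter j k

end LatticeAlgebra

/-! ### The Gram matrix of the integer shifts -/

section Gram
variable {d r R : ℕ} {G : Fin r → (Fin d → ℝ) → ℂ}

lemma mem_box_of_integral_ne_zero (hG : SuppIn R G) (i j : Fin r) (n : Fin d → ℤ)
    (hn : ∫ x, G i (x + castVec n) * (starRingEnd ℂ) (G j x) ≠ 0) : n ∈ box d (R + R) := by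
  obtain ⟨x, hx⟩ : ∃ x, G i (x + castVec n) * (starRingEnd ℂ) (G j x) ≠ 0 := by
    by_contra h
    push Not at h
    simp only [h, integral_zero, ne_eq, not_true_eq_false] at hn
  have h1 := hG i _ (left_ne_zero_of_mul hx)
  have h2 := hG j x fun h0 => right_ne_zero_of_mul hx (by rw [h0, map_zero])
  have h3 := norm_sub_le (x + castVec n) x
  rw [add_sub_cancel_left] at h3
  rw [mem_box, ← norm_castVec]
  push_cast
  linarith

/-- The correlation sequences `n ↦ ⟨G_i(· + n), G_j⟩`. -/
def gram (hG : SuppIn R G) : Matrix (Fin r) (Fin r) (LatAlg d) :=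
  Matrix.of fun i j => AddMonoidAlgebra.ofCoeff <| Finsupp.onFinset (box d (R + R))
    (fun n => ∫ x, G i (x + castVec n) * (starRingEnd ℂ) (G j x))
    (mem_box_of_integral_ne_zero hG i j)

lemma gram_coeff (hG : SuppIn R G) (i j : Fin r) (n : Fin d → ℤ) :
    (gram hG i j).coeff n = ∫ x, G i (x + castVec n) * (starRingEnd ℂ) (G j x) := rfl

lemma support_gram_subset (hG : SuppIn R G) (i j : Fin r) :
    (gram hG i j).coeff.support ⊆ box d (R + R) :=
  Finsupp.support_onFinset_subset (hf := mem_box_of_integral_ne_zero hG i j)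

lemma act_gram_apply (hG : SuppIn R G) (i j : Fin r) (v : (Fin d → ℤ) → ℂ) (k : Fin d → ℤ) :
    act d (gram hG i j) v k = ∑ n ∈ box d (R + R), (gram hG i j).coeff n * v (k - n) := by
  rw [act_apply, Finset.sum_subset (support_gram_subset hG i j) fun z _ hz => by
    rw [Finsupp.notMem_support_iff.1 hz, zero_mul]]

/-- The inner products of `f` with the integer shifts of `G_j`. -/
def analysis (G : Fin r → (Fin d → ℝ) → ℂ) (f : (Fin d → ℝ) → ℂ) (j : Fin r) (k : Fin d → ℤ) : ℂ :=
  ∫ x, f (x + castVec k) * (starRingEnd ℂ) (G j x)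

lemma integrable_mul_conj (hG : SuppIn R G) (hc : ∀ j, Continuous (G j)) {f : (Fin d → ℝ) → ℂ}
    (hf : Continuous f) (j : Fin r) : Integrable fun x => f x * (starRingEnd ℂ) (G j x) := by
  refine (hf.mul (Complex.continuous_conj.comp (hc j))).integrable_of_hasCompactSupport ?_
  refine HasCompactSupport.mul_left ?_
  exact (hG.hasCompactSupport j).comp_left (map_zero _)

lemma sum_box_neg {n : ℕ} (F : (Fin d → ℤ) → ℂ) : ∑ k ∈ box d n, F (-k) = ∑ k ∈ box d n, F k :=
  Finset.sum_equiv (Equiv.neg _) (fun k => by simp [mem_box]) fun k _ => by simp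

/-- Synthesis followed by analysis is matrix convolution with the Gram sequences; its inversion
recovers coefficients from functions. -/
lemma analysis_synth (hG : SuppIn R G) (hc : ∀ j, Continuous (G j))
    (v : (Fin d → ℤ) → Matrix (Fin 1) (Fin r) ℂ) (j : Fin r) :
    analysis G (synth v G) j = ∑ i, act d (gram hG i j) fun z => v z 0 i := by
  ext k
  rw [Finset.sum_apply]
  simp only [act_gram_apply]
  have h1 : ∀ x, synth v G (x + castVec k) * (starRingEnd ℂ) (G j x)
      = ∑ z ∈ box d (R + R), ∑ i, v (z + k) 0 i *
          (G i (x - castVec z) * (starRingEnd ℂ) (G j x)) := by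
    intro x
    by_cases hx : G j x = 0
    · simp [hx]
    · rw [synth_translate, synth_eq_sum _ (hG.mem_box (hG j x hx)), Finset.sum_mul]
      refine Finset.sum_congr rfl fun z _ => ?_
      rw [Finset.sum_mul]
      exact Finset.sum_congr rfl fun i _ => mul_assoc _ _ _
  have hint : ∀ (z : Fin d → ℤ) i, Integrable fun x => v (z + k) 0 i *
      (G i (x - castVec z) * (starRingEnd ℂ) (G j x)) := fun z i =>
    (integrable_mul_conj hG hc ((hc i).comp (continuous_id.sub continuous_const)) j).const_mul _
  simp only [analysis, h1]
  rw [integral_finsetSum _ fun z _ => integrable_finsetSum _ fun i _ => hint z i,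
    Finset.sum_comm, ← sum_box_neg]
  refine Finset.sum_congr rfl fun z _ => ?_
  rw [integral_finsetSum _ fun i _ => hint _ i]
  refine Finset.sum_congr rfl fun i _ => ?_
  rw [integral_const_mul, gram_coeff, mul_comm]
  congr 1
  · simp only [castVec_neg, sub_neg_eq_add]
  · rw [neg_add_eq_sub]

lemma subset_closure_interior_unitCube : unitCube d ⊆ closure (interior (unitCube d)) := by
  rw [unitCube, interior_pi_set Set.finite_univ, closure_pi_set]
  simp only [interior_Ico, closure_Ioo (zero_ne_one (α := ℝ))]
  exact Set.pi_mono fun _ _ => Set.Ico_subset_Icc_self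

/-- A vanishing square integral forces H = 0 on the cube by continuity, and quasiperiodicity carries
this to every translate. -/
lemma eq_zero_of_quasiperiodic {H : (Fin d → ℝ) → ℂ} (hH : Continuous H)
    {χ : (Fin d → ℤ) → ℂ} (hq : ∀ x l, H (x + castVec l) = χ l * H x)
    (h0 : ∫ x in unitCube d, ‖H x‖ ^ 2 = 0) : H = 0 := by
  have hint : IntegrableOn (fun x => ‖H x‖ ^ 2) (unitCube d) := by
    refine ((hH.norm.pow 2).locallyIntegrable.integrableOn_isCompact
      (isCompact_closedBall (0 : Fin d → ℝ) ((1 : ℕ) : ℝ))).mono_set fun x hx => ?_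
    rw [mem_closedBall_zero_iff]
    exact norm_le_of_mem_unitCube hx
  have h1 := (setIntegral_eq_zero_iff_of_nonneg_ae (Eventually.of_forall fun x => by positivity)
    hint).1 h0
  have h2 : Set.EqOn (fun x => ‖H x‖ ^ 2) 0 (unitCube d) :=
    Measure.eqOn_of_ae_eq h1 (hH.norm.pow 2).continuousOn continuousOn_const
      subset_closure_interior_unitCube
  ext x
  obtain ⟨k, hk, -⟩ := exists_castVec_near_of_unit x
  have hx : H (x + castVec k) = 0 := by
    have := h2 (x := x + castVec k) (fun j _ => hk j)
    simpa using this
  have h3 := hq (x + castVec k) (-k)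
  rw [castVec_neg, add_neg_cancel_right, hx, mul_zero] at h3
  exact h3

lemma mFourier_coe (n : Fin d → ℤ) (t : Fin d → ℝ) :
    UnitAddTorus.mFourier n (fun j => (t j : UnitAddCircle))
      = Complex.exp (2 * Real.pi * Complex.I * ((∑ j, (n j : ℝ) * t j : ℝ) : ℂ)) := by
  simp only [UnitAddTorus.mFourier, ContinuousMap.coe_mk, fourier_coe_apply]
  rw [← Complex.exp_sum]
  congr 1
  push_cast
  rw [Finset.mul_sum]
  exact Finset.sum_congr rfl fun j _ => by ring

lemma conj_mFourier (n : Fin d → ℤ) (τ : UnitAddTorus (Fin d)) :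
    (starRingEnd ℂ) (UnitAddTorus.mFourier n τ) = UnitAddTorus.mFourier (-n) τ :=
  UnitAddTorus.mFourier_neg.symm

/-- A vector in the left kernel of the Gram matrix gives a vanishing combination of shifts. -/
lemma synth_eq_zero_of_gram (hG : SuppIn R G) (hc : ∀ j, Continuous (G j))
    (τ : UnitAddTorus (Fin d)) {c : Fin r → ℂ}
    (h : ∀ j, ∑ i, c i * torusEval d (gram hG i j) τ = 0) :
    synth (fun z => Matrix.of fun _ i => c i * UnitAddTorus.mFourier (-z) τ) G = 0 := by
  set v : (Fin d → ℤ) → Matrix (Fin 1) (Fin r) ℂ :=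
    fun z => Matrix.of fun _ i => c i * UnitAddTorus.mFourier (-z) τ with hv
  set H := synth v G with hH
  have hHc : Continuous H := continuous_synth hG hc v
  have hq : ∀ x l, H (x + castVec l) = UnitAddTorus.mFourier (-l) τ * H x := by
    intro x l
    rw [hH, synth_translate, ← synth_smul_left _ _ hG]
    congr 1
    ext z i j
    simp only [hv, Pi.smul_apply, Matrix.smul_apply, Matrix.of_apply, smul_eq_mul, neg_add,
      UnitAddTorus.mFourier_add]
    ring
  -- The kernel condition says precisely that H is orthogonal to every G_j.
  have hA : ∀ j, ∫ x, H x * (starRingEnd ℂ) (G j x) = 0 := by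
    intro j
    have h1 := congrFun (analysis_synth hG hc v j) 0
    simp only [analysis, castVec_zero, add_zero] at h1
    rw [h1, Finset.sum_apply, ← h j]
    refine Finset.sum_congr rfl fun i _ => ?_
    rw [act_apply, torusEval_apply, Finset.mul_sum]
    refine Finset.sum_congr rfl fun z _ => ?_
    simp only [hv, Matrix.of_apply, zero_sub, neg_neg]
    ring
  have hint : ∀ j, Integrable fun x => (starRingEnd ℂ) (c j) * (H x * (starRingEnd ℂ) (G j x)) :=
    fun j => (integrable_mul_conj hG hc hHc j).const_mul _
  have h0 := integral_eq_setIntegral_sum (R := R)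
    (g := fun x => ∑ j, (starRingEnd ℂ) (c j) * (H x * (starRingEnd ℂ) (G j x)))
    (integrable_finsetSum _ fun j _ => hint j) fun x hx => by
      obtain ⟨j, _, hj⟩ := Finset.exists_ne_zero_of_sum_ne_zero hx
      refine hG j x fun h0 => hj ?_
      rw [h0, map_zero, mul_zero, mul_zero]
  rw [integral_finsetSum _ fun j _ => hint j] at h0
  simp only [integral_const_mul, hA, mul_zero, Finset.sum_const_zero] at h0
  refine eq_zero_of_quasiperiodic hHc hq ?_
  -- Expanding the conjugate of H and absorbing the characters into translates of H unfolds the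
  -- integral of |H|² over the cube into the inner products ⟨H, G_j⟩ over the whole space.
  have h3 : ∫ x in unitCube d, ((‖H x‖ ^ 2 : ℝ) : ℂ) = 0 := by
    rw [h0]
    refine setIntegral_congr_fun measurableSet_unitCube fun x hx => ?_
    have h4 : H x = ∑ k ∈ box d (1 + R), ∑ j, v k 0 j * G j (x - castVec k) :=
      synth_eq_sum _ (hG.mem_box (norm_le_of_mem_unitCube hx))
    rw [← Complex.normSq_eq_norm_sq, ← Complex.mul_conj,
      show (starRingEnd ℂ) (H x) = _ from congrArg _ h4, map_sum, Finset.mul_sum]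
    refine Finset.sum_congr rfl fun k _ => ?_
    rw [map_sum, Finset.mul_sum]
    refine Finset.sum_congr rfl fun j _ => ?_
    have h5 := hq x (-k)
    rw [castVec_neg, neg_neg, ← sub_eq_add_neg] at h5
    rw [h5, map_mul]
    simp only [hv, Matrix.of_apply, map_mul, conj_mFourier, neg_neg]
    ring
  rw [integral_complex_ofReal] at h3
  exact_mod_cast h3

/-- For η = -2πt + 2πk, multiplying the vanishing series by e^{-ix·η} makes its coefficients
constant. The integral of the synthesized function then gives c · φ̂(η) = 0 for all k, and stability
at -2πt forces c = 0. -/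
lemma eq_zero_of_stable (hG : SuppIn R G) (hc : ∀ j, Continuous (G j)) {φ : Fin r → CSDist d}
    (hφ : ∀ i (f : smoothFns d), (φ i).toLin f = ∫ x, (f : (Fin d → ℝ) → ℂ) x * G i x)
    (hst : HasStableShifts φ) (τ : UnitAddTorus (Fin d)) {c : Fin r → ℂ}
    (h : ∀ j, ∑ i, c i * torusEval d (gram hG i j) τ = 0) : c = 0 := by
  have hH := synth_eq_zero_of_gram hG hc τ h
  obtain ⟨t, rfl⟩ : ∃ t : Fin d → ℝ, τ = fun j => (t j : UnitAddCircle) := by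
    choose t ht using fun j => QuotientAddGroup.mk_surjective (τ j)
    exact ⟨t, funext fun j => (ht j).symm⟩
  have hk : ∀ k : Fin d → ℤ,
      c ⬝ᵥ fourierVec φ ((-2 * Real.pi) • t + fun j => 2 * Real.pi * (k j : ℝ)) = 0 := by
    intro k
    set η : Fin d → ℝ := (-2 * Real.pi) • t + fun j => 2 * Real.pi * (k j : ℝ) with hη
    have hS : SuppIn R fun j x => (expFn η : (Fin d → ℝ) → ℂ) x * G j x := fun j x hx =>
      hG j x (right_ne_zero_of_mul hx)
    have hSc : ∀ j, Continuous fun x => (expFn η : (Fin d → ℝ) → ℂ) x * G j x := fun j =>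
      (contDiff_coe (expFn η) 0).continuous.mul (hc j)
    have h1 := integral_eq_of_synth_const hS hSc (y := Matrix.of fun _ i => c i) (c := 0)
      fun x => by
        obtain ⟨B, hB⟩ := hG.exists_box x
        have hB' : ∀ j z, (expFn η : (Fin d → ℝ) → ℂ) (x - castVec z) * G j (x - castVec z) ≠ 0 →
            z ∈ B := fun j z hz => hB j z (right_ne_zero_of_mul hz)
        rw [synth_eq_sum _ hB']
        have h2 := congrFun hH x
        rw [synth_eq_sum _ hB, Pi.zero_apply] at h2
        have h3 := congrArg ((expFn η : (Fin d → ℝ) → ℂ) x * ·) h2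
        simp only [mul_zero] at h3
        rw [← h3, Finset.mul_sum]
        refine Finset.sum_congr rfl fun z _ => ?_
        rw [Finset.mul_sum]
        refine Finset.sum_congr rfl fun j _ => ?_
        have h4 : (expFn η : (Fin d → ℝ) → ℂ) (x - castVec z) = (expFn η : (Fin d → ℝ) → ℂ) x *
            UnitAddTorus.mFourier (-z) (fun j => (t j : UnitAddCircle)) := by
          rw [mFourier_coe, expFn_apply, expFn_apply, ← Complex.exp_add,
            Complex.exp_eq_exp_iff_exists_int]
          refine ⟨∑ j, z j * k j, ?_⟩
          simp only [hη, Pi.sub_apply, Pi.add_apply, Pi.smul_apply, castVec_apply, smul_eq_mul,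
            Pi.neg_apply]
          push_cast
          simp only [Finset.mul_sum, Finset.sum_mul, ← Finset.sum_add_distrib]
          refine Finset.sum_congr rfl fun j _ => ?_
          ring
        simp only [Matrix.of_apply]
        rw [h4]
        ring
    rw [← h1]
    simp only [dotProduct, fourierVec, hφ, Matrix.of_apply]
  have hspan := hst ((-2 * Real.pi) • t)
  have hle : Submodule.span ℂ (Set.range fun k : Fin d → ℤ =>
      fourierVec φ ((-2 * Real.pi) • t + fun j => 2 * Real.pi * (k j : ℝ)))
      ≤ LinearMap.ker (Matrix.toLin' (Matrix.of fun (_ : Fin 1) i => c i)) := by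
    rw [Submodule.span_le]
    rintro _ ⟨k, rfl⟩
    rw [SetLike.mem_coe, LinearMap.mem_ker, Matrix.toLin'_apply]
    ext i
    exact hk k
  rw [hspan] at hle
  ext i
  have h5 := congrFun (LinearMap.mem_ker.1 (hle (Submodule.mem_top (x := Pi.single i 1)))) 0
  rw [Matrix.toLin'_apply] at h5
  simpa using h5

lemma torusEval_det_gram_ne_zero (hG : SuppIn R G) (hc : ∀ j, Continuous (G j))
    {φ : Fin r → CSDist d}
    (hφ : ∀ i (f : smoothFns d), (φ i).toLin f = ∫ x, (f : (Fin d → ℝ) → ℂ) x * G i x)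
    (hst : HasStableShifts φ) (τ : UnitAddTorus (Fin d)) : torusEval d (gram hG).det τ ≠ 0 := by
  set e : LatAlg d →+* ℂ :=
    (ContinuousMap.evalAlgHom ℂ ℂ τ : C(UnitAddTorus (Fin d), ℂ) →ₐ[ℂ] ℂ).toRingHom.comp
      (torusEval d).toRingHom with he
  change e (gram hG).det ≠ 0
  rw [RingHom.map_det]
  intro h0
  obtain ⟨c, hc0, hcv⟩ := Matrix.exists_vecMul_eq_zero_iff.2 h0
  exact hc0 (eq_zero_of_stable hG hc hφ hst τ fun j => congrFun hcv j)

end Gram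

/-! ### The dual filter of stable shifts -/

section Dual
variable {d r R : ℕ} {G : Fin r → (Fin d → ℝ) → ℂ}

/-- Analysis followed by multiplication with the adjugate of the Gram matrix. -/
def dualAnalysis (hG : SuppIn R G) (f : (Fin d → ℝ) → ℂ) (l : Fin r) : (Fin d → ℤ) → ℂ :=
  ∑ j, act d ((gram hG).adjugate j l) (analysis G f j)

/-- The adjugate inverts the Gram matrix up to its determinant while staying inside finitely
supported filters; the remaining scalar convolution is undone by `exists_growth_bound_of_act`. -/
lemma dualAnalysis_synth (hG : SuppIn R G) (hc : ∀ j, Continuous (G j))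
    (v : (Fin d → ℤ) → Matrix (Fin 1) (Fin r) ℂ) (l : Fin r) :
    dualAnalysis hG (synth v G) l = act d (gram hG).det fun z => v z 0 l := by
  have h1 : ∀ i, ∑ j, act d ((gram hG).adjugate j l) (act d (gram hG i j) fun z => v z 0 i)
      = if i = l then act d (gram hG).det fun z => v z 0 l else 0 := by
    intro i
    have h2 := congrFun (congrFun (gram hG).mul_adjugate i) l
    rw [Matrix.mul_apply, Matrix.smul_apply, Matrix.one_apply] at h2
    simp only [← Module.End.mul_apply, ← map_mul]
    rw [← LinearMap.sum_apply, ← map_sum]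
    simp only [mul_comm ((gram hG).adjugate _ _)]
    rw [h2]
    split_ifs with h
    · rw [h, smul_eq_mul, mul_one]
    · rw [smul_zero, map_zero, LinearMap.zero_apply]
  simp only [dualAnalysis, analysis_synth hG hc, map_sum]
  rw [Finset.sum_comm]
  simp only [h1, Finset.sum_ite_eq', Finset.mem_univ, if_true]

lemma sum_act_dualAnalysis (hG : SuppIn R G) (f : (Fin d → ℝ) → ℂ) (j : Fin r) :
    ∑ l, act d (gram hG l j) (dualAnalysis hG f l) = act d (gram hG).det (analysis G f j) := by
  have h1 : ∀ i, ∑ l, act d (gram hG l j) (act d ((gram hG).adjugate i l) (analysis G f i))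
      = if i = j then act d (gram hG).det (analysis G f j) else 0 := by
    intro i
    have h2 := congrFun (congrFun (gram hG).adjugate_mul i) j
    rw [Matrix.mul_apply, Matrix.smul_apply, Matrix.one_apply] at h2
    simp only [← Module.End.mul_apply, ← map_mul]
    rw [← LinearMap.sum_apply, ← map_sum]
    simp only [mul_comm (gram hG _ _)]
    rw [h2]
    split_ifs with h
    · rw [h, smul_eq_mul, mul_one]
    · rw [smul_zero, map_zero, LinearMap.zero_apply]
  simp only [dualAnalysis, map_sum]
  rw [Finset.sum_comm]
  simp only [h1, Finset.sum_ite_eq', Finset.mem_univ, if_true]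

lemma analysis_translate (f : (Fin d → ℝ) → ℂ) (j : Fin r) (k l : Fin d → ℤ) :
    analysis G (fun x => f (x + castVec l)) j k = analysis G f j (k + l) := by
  simp only [analysis, castVec_add, add_assoc]

lemma act_translate (f : LatAlg d) (v : (Fin d → ℤ) → ℂ) (k l : Fin d → ℤ) :
    act d f (fun z => v (z + l)) k = act d f v (k + l) := by
  rw [act_apply, act_apply]
  refine Finset.sum_congr rfl fun z _ => ?_
  rw [sub_add_eq_add_sub]

lemma dualAnalysis_translate (hG : SuppIn R G) (f : (Fin d → ℝ) → ℂ) (i : Fin r)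
    (k l : Fin d → ℤ) :
    dualAnalysis hG (fun x => f (x + castVec l)) i k = dualAnalysis hG f i (k + l) := by
  simp only [dualAnalysis, Finset.sum_apply, ← act_translate]
  refine Finset.sum_congr rfl fun j _ => ?_
  rw [show analysis G (fun x => f (x + castVec l)) j = fun z => analysis G f j (z + l) from
    funext fun z => analysis_translate f j z l]

/-- Taylor's formula is exact for polynomials. -/
lemma taylorPoly_eq {m : ℕ} {p : (Fin d → ℝ) → ℂ} (hp : p ∈ Pl d (m + 1)) (x h : Fin d → ℝ) :
    p (x + h) = taylorPoly (m + 1) p x h := by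
  have h1 := norm_sub_taylorPoly_le (contDiff_infty.1 (contDiff_of_mem_Pl hp) m) (x := x) (h := h)
    le_rfl fun μ hμ y _ => by
      have h2 : partialDeriv μ p ∈ Pl d 1 := partialDeriv_mem_Pl (by rwa [hμ, add_comm])
      rw [Pl_one_apply h2]
      simp
  rw [mul_zero, norm_le_zero_iff, sub_eq_zero] at h1
  exact h1

/-- The Taylor expansion of p(x + y) in y is exact, so integrating in x only changes the
coefficients. -/
lemma integral_translate_mem_Pl (hG : SuppIn R G) (hc : ∀ j, Continuous (G j)) {m : ℕ}
    {p : (Fin d → ℝ) → ℂ} (hp : p ∈ Pl d (m + 1)) (j : Fin r) :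
    (fun y => ∫ x, p (x + y) * (starRingEnd ℂ) (G j x)) ∈ Pl d (m + 1) := by
  have h1 : (fun y => ∫ x, p (x + y) * (starRingEnd ℂ) (G j x))
      = ∑ μ ∈ orderLT d (m + 1),
        (∫ x, (partialDeriv μ p x / mfact μ) * (starRingEnd ℂ) (G j x)) • mono μ := by
    ext y
    rw [Finset.sum_apply]
    have h2 : ∀ x, p (x + y) * (starRingEnd ℂ) (G j x) = ∑ μ ∈ orderLT d (m + 1),
        (partialDeriv μ p x / mfact μ) * (starRingEnd ℂ) (G j x) * mono μ y := by
      intro x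
      rw [taylorPoly_eq hp, taylorPoly, Finset.sum_apply, Finset.sum_mul]
      refine Finset.sum_congr rfl fun μ _ => ?_
      rw [Pi.smul_apply, smul_eq_mul]
      ring
    simp only [h2]
    rw [integral_finsetSum _ fun μ _ => (integrable_mul_conj hG hc
      ((continuous_partialDeriv (contDiff_infty.1 (contDiff_of_mem_Pl hp) _)).div_const _)
      j).mul_const _]
    refine Finset.sum_congr rfl fun μ _ => ?_
    rw [integral_mul_const]
    rfl
  rw [h1]
  exact Submodule.sum_mem _ fun μ hμ =>
    Submodule.smul_mem _ _ (mono_mem_Pl (mem_orderLT.1 hμ))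

/-- Analysis of polynomials. -/
def corrPoly (hG : SuppIn R G) (hc : ∀ j, Continuous (G j)) (m : ℕ) (j : Fin r) :
    Pl d (m + 1) →ₗ[ℂ] Pl d (m + 1) where
  toFun p := ⟨_, integral_translate_mem_Pl hG hc p.2 j⟩
  map_add' p q := by
    ext y
    have hcont : ∀ p : Pl d (m + 1), Continuous fun x => (p : (Fin d → ℝ) → ℂ) (x + y) :=
      fun p => (contDiff_of_mem_Pl p.2).continuous.comp (continuous_id.add continuous_const)
    change ∫ x, ((p : (Fin d → ℝ) → ℂ) (x + y) + (q : (Fin d → ℝ) → ℂ) (x + y)) * _ = _ + _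
    rw [← integral_add (integrable_mul_conj hG hc (hcont p) j)
      (integrable_mul_conj hG hc (hcont q) j)]
    simp only [add_mul]
  map_smul' c p := by
    ext y
    change ∫ x, (c * (p : (Fin d → ℝ) → ℂ) (x + y)) * _ = c * _
    rw [← integral_const_mul]
    simp only [mul_assoc]

lemma corrPoly_castVec (hG : SuppIn R G) (hc : ∀ j, Continuous (G j)) (m : ℕ) (j : Fin r)
    (p : Pl d (m + 1)) (k : Fin d → ℤ) :
    (corrPoly hG hc m j p : (Fin d → ℝ) → ℂ) (castVec k) = analysis G p j k := rfl

lemma act_eq_convPoly {n : ℕ} (f : LatAlg d) (p : Pl d n) (k : Fin d → ℤ) :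
    act d f (fun z => (p : (Fin d → ℝ) → ℂ) (castVec z)) k
      = (convPoly n f.coeff p : (Fin d → ℝ) → ℂ) (castVec k) := by
  rw [act_apply, convPoly_apply]
  simp only [castVec_sub]

lemma sum_coeff_ne_zero {g : LatAlg d} (hg : ∀ τ, torusEval d g τ ≠ 0) :
    ∑ z ∈ g.coeff.support, g.coeff z ≠ 0 := by
  have := hg fun j => ((0 : ℝ) : UnitAddCircle)
  rw [torusEval_apply] at this
  simpa only [mFourier_coe, mul_zero, Finset.sum_const_zero, Complex.ofReal_zero, Complex.exp_zero,
    mul_one] using this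

/-- The polynomial sequences representing polynomials. -/
lemma exists_polynomial_solution (hG : SuppIn R G) (hc : ∀ j, Continuous (G j))
    (hg : ∀ τ, torusEval d (gram hG).det τ ≠ 0) (m : ℕ) (l : Fin r) :
    ∃ V : Pl d (m + 1) →ₗ[ℂ] Pl d (m + 1), ∀ p : Pl d (m + 1),
      act d (gram hG).det (fun z => (V p : (Fin d → ℝ) → ℂ) (castVec z))
        = dualAnalysis hG p l := by
  set E := LinearEquiv.ofBijective _ (convPoly_bijective (m + 1) (sum_coeff_ne_zero hg)) with hE
  refine ⟨E.symm.toLinearMap ∘ₗ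
    ∑ j, convPoly (m + 1) ((gram hG).adjugate j l).coeff ∘ₗ corrPoly hG hc m j, fun p => ?_⟩
  ext k
  rw [act_eq_convPoly]
  have h1 := LinearEquiv.apply_symm_apply E
    ((∑ j, convPoly (m + 1) ((gram hG).adjugate j l).coeff ∘ₗ corrPoly hG hc m j) p)
  rw [hE, LinearEquiv.ofBijective_apply] at h1
  rw [LinearMap.comp_apply, LinearEquiv.coe_coe, h1, LinearMap.sum_apply,
    AddSubmonoidClass.coe_finsetSum, Finset.sum_apply, dualAnalysis, Finset.sum_apply]
  refine Finset.sum_congr rfl fun j _ => ?_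
  rw [LinearMap.comp_apply, ← act_eq_convPoly]
  simp only [corrPoly_castVec]

/-- The polynomial sequence representing p depends linearly on p and commutes with translations. Its
value at 0 is a finite combination of lattice values of p, and these coefficients, reflected, define
y. -/
theorem exists_dual_filter (hG : SuppIn R G) (hc : ∀ j, Continuous (G j))
    (hg : ∀ τ, torusEval d (gram hG).det τ ≠ 0) (m : ℕ) :
    ∃ y : MFilter d 1 r, ∀ p ∈ Pl d (m + 1), ∀ l,
      act d (gram hG).det (fun z => polyConv y p z 0 l) = dualAnalysis hG p l := by
  choose V hV using exists_polynomial_solution hG hc hg m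
  have hinj := convPoly_injective (d := d) (m + 1) (sum_coeff_ne_zero hg)
  choose u hu using fun l => exists_lattice_functional
    ({ toFun := fun p => (V l p : (Fin d → ℝ) → ℂ) 0
       map_add' := fun p q => by rw [map_add]; rfl
       map_smul' := fun c p => by rw [map_smul]; rfl } : Pl d (m + 1) →ₗ[ℂ] ℂ)
  have hfin : (Function.support fun z : Fin d → ℤ =>
      (Matrix.of fun _ l => u l (-z) : Matrix (Fin 1) (Fin r) ℂ)).Finite := by
    refine Set.Finite.subset (Finset.finite_toSet (Finset.univ.biUnion fun l =>
      (u l).support.image Neg.neg)) fun z hz => ?_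
    rw [Function.mem_support] at hz
    obtain ⟨l, hl⟩ : ∃ l, u l (-z) ≠ 0 := by
      by_contra h
      push Not at h
      exact hz (by ext i l; exact h l)
    simp only [Finset.coe_biUnion, Set.mem_iUnion, Finset.mem_coe, Finset.mem_image,
      Finset.mem_univ, Finsupp.mem_support_iff]
    exact ⟨l, trivial, -z, hl, neg_neg z⟩
  set y : MFilter d 1 r := Finsupp.ofSupportFinite _ hfin with hy
  have hyz : ∀ z l, y z 0 l = u l (-z) := fun z l => rfl
  have h0 : ∀ (p : Pl d (m + 1)) l, polyConv y p 0 0 l = (V l p : (Fin d → ℝ) → ℂ) 0 := by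
    intro p l
    have h1 := hu l p
    simp only [LinearMap.coe_mk, AddHom.coe_mk] at h1
    rw [h1, polyConv_apply, Finsupp.sum]
    classical
    have h2 : ∑ k ∈ (u l).support, u l k * (p : (Fin d → ℝ) → ℂ) (castVec k)
        = ∑ k ∈ y.support.image Neg.neg, u l k * (p : (Fin d → ℝ) → ℂ) (castVec k) := by
      refine sum_eq_sum_of_support (fun k hk => Finsupp.mem_support_iff.2 (left_ne_zero_of_mul hk))
        fun k hk => Finset.mem_image.2 ⟨-k, Finsupp.mem_support_iff.2 fun hk0 => ?_, neg_neg k⟩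
      have := hyz (-k) l
      rw [hk0, neg_neg] at this
      exact left_ne_zero_of_mul hk this.symm
    rw [h2, Finset.sum_image fun a _ b _ hab => neg_injective hab]
    refine Finset.sum_congr rfl fun z _ => ?_
    rw [hyz, zero_sub, mul_comm]
  refine ⟨y, fun p hp l => ?_⟩
  -- Passing from 0 to k uses translation equivariance, which holds because convolution with the
  -- determinant is injective on polynomials.
  have hval : ∀ k, polyConv y p k 0 l = (V l ⟨p, hp⟩ : (Fin d → ℝ) → ℂ) (castVec k) := by
    intro k
    have h1 := h0 ⟨_, translate_mem_Pl hp (castVec k)⟩ l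
    simp only [] at h1
    rw [polyConv_translate, zero_add] at h1
    rw [h1]
    set q : Pl d (m + 1) := ⟨_, translate_mem_Pl (V l ⟨p, hp⟩).2 (castVec k)⟩ with hq
    have h2 : V l ⟨_, translate_mem_Pl hp (castVec k)⟩ = q := by
      refine hinj (Subtype.ext (sub_eq_zero.1 (Pl_eq_zero_of_lattice (n := m + 1)
        (Submodule.sub_mem _ (Subtype.mem _) (Subtype.mem _)) fun z => ?_)))
      rw [Pi.sub_apply, ← act_eq_convPoly, ← act_eq_convPoly, hV, sub_eq_zero,
        dualAnalysis_translate, ← hV l ⟨p, hp⟩, ← act_translate]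
      simp only [hq, castVec_add]
    rw [h2]
    simp only [hq, zero_add]
  simp only [hval]
  exact hV l ⟨p, hp⟩

/-- The row of the dual filter at the origin does not vanish. -/
lemma dual_filter_symbol_ne_zero (hG : SuppIn R G)
    (hg : ∀ τ, torusEval d (gram hG).det τ ≠ 0) {y : MFilter d 1 r}
    (hy : ∀ l, act d (gram hG).det (fun z => polyConv y 1 z 0 l) = dualAnalysis hG 1 l)
    {j : Fin r} (hj : ∫ x, G j x ≠ 0) : symbol y 0 ≠ 0 := by
  intro h0
  have h1 : ∀ l, dualAnalysis hG 1 l = 0 := by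
    intro l
    rw [← hy l]
    simp only [polyConv_one, h0]
    exact map_zero _
  have h2 := congrFun (sum_act_dualAnalysis hG 1 j) 0
  simp only [h1, map_zero, Finset.sum_const_zero] at h2
  have h3 : analysis G 1 j = fun _ => (starRingEnd ℂ) (∫ x, G j x) := by
    ext k
    simp only [analysis, Pi.one_apply, one_mul]
    exact integral_conj
  rw [h3, act_apply, ← Finset.sum_mul, Pi.zero_apply, eq_comm, mul_eq_zero,
    or_iff_right (sum_coeff_ne_zero hg), map_eq_zero] at h2
  exact hj h2

end Dual

/-! ### Polynomial approximation of the masks -/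

section Approximation
variable {d r R : ℕ} {G : Fin r → (Fin d → ℝ) → ℂ}

lemma one_add_norm_add_le {x y : Fin d → ℝ} {b : ℝ} (hx : ‖x‖ ≤ b) :
    1 + ‖x + y‖ ≤ (1 + b) * (1 + ‖y‖) := by
  have h1 := norm_add_le x y
  nlinarith [norm_nonneg x, norm_nonneg y]

lemma exists_norm_dualAnalysis_le (hG : SuppIn R G) (hc : ∀ j, Continuous (G j)) (D : ℕ) :
    ∃ C : ℝ, 0 ≤ C ∧ ∀ (f : (Fin d → ℝ) → ℂ) (B : ℝ), (∀ t, ‖f t‖ ≤ B * (1 + ‖t‖) ^ D) →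
      ∀ l k, ‖dualAnalysis hG f l k‖ ≤ C * B * (1 + ‖k‖) ^ D := by
  choose C hC0 hC using fun (q : Fin r × Fin r) =>
    exists_norm_act_le ((gram hG).adjugate q.1 q.2) D
  have hI : ∀ j, 0 ≤ ∫ x, ‖G j x‖ := fun j => integral_nonneg fun x => norm_nonneg _
  have hana : ∀ (f : (Fin d → ℝ) → ℂ) (B : ℝ), (∀ t, ‖f t‖ ≤ B * (1 + ‖t‖) ^ D) →
      ∀ j k, ‖analysis G f j k‖ ≤ ((1 + R) ^ D * (∫ x, ‖G j x‖) * B) * (1 + ‖k‖) ^ D := by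
    intro f B hf j k
    have hB : 0 ≤ B := by simpa using (norm_nonneg _).trans (hf 0)
    have hint : Integrable fun x => ((1 + R : ℝ) ^ D * B * (1 + ‖k‖) ^ D) * ‖G j x‖ :=
      ((hc j).integrable_of_hasCompactSupport (hG.hasCompactSupport j)).norm.const_mul _
    refine (norm_integral_le_of_norm_le hint (Eventually.of_forall fun x => ?_)).trans
      (le_of_eq ?_)
    · rw [norm_mul, RCLike.norm_conj]
      by_cases hx : G j x = 0
      · simp [hx]
      refine mul_le_mul_of_nonneg_right ((hf _).trans ?_) (norm_nonneg _)
      have h1 := one_add_norm_add_le (y := castVec k) (hG j x hx)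
      rw [norm_castVec] at h1
      calc B * (1 + ‖x + castVec k‖) ^ D ≤ B * ((1 + R) * (1 + ‖k‖)) ^ D := by gcongr
        _ = _ := by rw [mul_pow]; ring
    · rw [integral_const_mul]; ring
  refine ⟨∑ q : Fin r × Fin r, C q * ((1 + R) ^ D * ∫ x, ‖G q.1 x‖),
    Finset.sum_nonneg fun q _ => mul_nonneg (hC0 q) (mul_nonneg (by positivity) (hI _)),
    fun f B hf l k => ?_⟩
  have hB : 0 ≤ B := by simpa using (norm_nonneg _).trans (hf 0)
  rw [dualAnalysis, Finset.sum_apply]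
  refine (norm_sum_le_of_le _ fun j _ => hC (j, l) _ _ (hana f B hf j) k).trans ?_
  rw [← Finset.sum_mul]
  refine mul_le_mul_of_nonneg_right ?_ (by positivity)
  rw [Fintype.sum_prod_type, Finset.sum_mul]
  refine Finset.sum_le_sum fun j _ => ?_
  rw [Finset.sum_mul]
  refine le_trans (le_of_eq ?_) (Finset.single_le_sum
    (f := fun l => C (j, l) * ((1 + R) ^ D * ∫ x, ‖G j x‖) * B)
    (fun l _ => mul_nonneg (mul_nonneg (hC0 _) (mul_nonneg (by positivity) (hI _))) hB)
    (Finset.mem_univ l))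
  ring

/-- The Taylor remainder of a compactly supported function at scale `2^{-N}`. -/
lemma eventually_taylor_le {m : ℕ} {f : (Fin d → ℝ) → ℂ} (hf : ContDiff ℝ m f)
    (hs : HasCompactSupport f) {ε : ℝ} (hε : 0 < ε) :
    ∀ᶠ N : ℕ in atTop, ∀ x t : Fin d → ℝ,
      ‖f (x + (1 / 2 : ℝ) ^ N • t) - taylorPoly (m + 1) f x ((1 / 2 : ℝ) ^ N • t)‖
        ≤ ε * ((1 / 2) ^ N) ^ m * (1 + ‖t‖) ^ (m + 1) := by
  set ε₁ := ε / (d ^ m + 1) with hε₁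
  have hε₁0 : 0 < ε₁ := by positivity
  -- For small y this is uniform continuity. Otherwise ‖t‖ is at least δ 2^N, so the trivial bound
  -- 2K is below ε₁‖t‖ for large N; the additional factor 1 + ‖t‖ pays for this case.
  have key : ∀ᶠ N : ℕ in atTop, ∀ μ ∈ orderLT d (m + 1), order μ = m →
      ∀ x t y : Fin d → ℝ, ‖y‖ ≤ ‖(1 / 2 : ℝ) ^ N • t‖ →
        ‖partialDeriv μ f (x + y) - partialDeriv μ f x‖ ≤ ε₁ * (1 + ‖t‖) := by
    rw [Filter.eventually_all_finset]
    intro μ hμ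
    by_cases hμm : order μ = m
    swap
    · exact Eventually.of_forall fun N h => absurd h hμm
    have hfμ : ContDiff ℝ (order μ) f := by rwa [hμm]
    have hcont : Continuous (partialDeriv μ f) := continuous_partialDeriv hfμ
    have hsupp := hasCompactSupport_partialDeriv hs hfμ
    obtain ⟨K, hK⟩ := hcont.bounded_above_of_compact_support hsupp
    have hK0 : 0 ≤ K := (norm_nonneg _).trans (hK 0)
    have huc := hsupp.uniformContinuous_of_continuous hcont
    rw [Metric.uniformContinuous_iff] at huc
    obtain ⟨δ, hδ, hδ'⟩ := huc ε₁ hε₁0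
    have hpow : Tendsto (fun N : ℕ => (1 / 2 : ℝ) ^ N * (2 * K)) atTop (𝓝 0) := by
      simpa using (tendsto_pow_atTop_nhds_zero_of_lt_one (r := (1 / 2 : ℝ)) (by norm_num)
        (by norm_num)).mul_const (2 * K)
    filter_upwards [hpow.eventually_lt_const (mul_pos hε₁0 hδ)] with N hN _ x t y hy
    rw [norm_smul, norm_pow, Real.norm_of_nonneg (by norm_num : (0 : ℝ) ≤ 1 / 2)] at hy
    by_cases hlt : ‖y‖ < δ
    · rw [← dist_eq_norm]
      refine (hδ' (by rw [dist_eq_norm, add_sub_cancel_left]; exact hlt)).le.trans ?_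
      nlinarith [norm_nonneg t]
    · have h1 : δ ≤ (1 / 2 : ℝ) ^ N * ‖t‖ := (not_lt.1 hlt).trans hy
      have h2 : (1 / 2 : ℝ) ^ N * (2 * K) ≤ (1 / 2 : ℝ) ^ N * (ε₁ * ‖t‖) := by
        nlinarith
      have h3 := le_of_mul_le_mul_left h2 (by positivity)
      refine (norm_sub_le _ _).trans ?_
      have := hK (x + y)
      have := hK x
      nlinarith
  filter_upwards [key] with N hN x t
  have h1 := norm_sub_taylorPoly_le hf (x := x) (h := (1 / 2 : ℝ) ^ N • t)
    (ε := ε₁ * (1 + ‖t‖)) (by positivity)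
    fun μ hμ y hy => hN μ (mem_orderLT.2 (by omega)) hμ x t y hy
  refine h1.trans ?_
  rw [norm_smul, norm_pow, Real.norm_of_nonneg (by norm_num : (0 : ℝ) ≤ 1 / 2)]
  have h2 : (d : ℝ) ^ m * ε₁ ≤ ε := by
    rw [hε₁, ← mul_div_assoc, div_le_iff₀ (by positivity)]
    nlinarith
  have h3 : ‖t‖ ^ m ≤ (1 + ‖t‖) ^ m := pow_le_pow_left₀ (norm_nonneg _) (by linarith) _
  calc (d * ((1 / 2 : ℝ) ^ N * ‖t‖)) ^ m * (ε₁ * (1 + ‖t‖))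
      = (d ^ m * ε₁) * ((1 / 2) ^ N) ^ m * (‖t‖ ^ m * (1 + ‖t‖)) := by
        rw [mul_pow, mul_pow]; ring
    _ ≤ ε * ((1 / 2) ^ N) ^ m * ((1 + ‖t‖) ^ m * (1 + ‖t‖)) := by gcongr
    _ = _ := by rw [pow_succ]

/-- Rows of the masks as sequences. -/
def rowSeq (a : MFilter d r r) (i : Fin r) (N : ℕ) : (Fin d → ℤ) → Matrix (Fin 1) (Fin r) ℂ :=
  (subdiv a)^[N] (Finsupp.single 0 (Matrix.of fun _ j => if j = i then 1 else 0) : MFilter d 1 r)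

lemma rowSeq_apply (a : MFilter d r r) (i : Fin r) (N : ℕ) (k : Fin d → ℤ) (l : Fin r) :
    rowSeq a i N k 0 l = mask a N k i l := iterate_subdiv_single a i N k l

lemma rowSeq_succ (a : MFilter d r r) (i : Fin r) (N : ℕ) :
    rowSeq a i (N + 1) = subdiv a (rowSeq a i N) := Function.iterate_succ_apply' _ _ _

/-- The rows of the N-th mask are the coefficients of G_i in the shifts of G at scale 2^{-N}, here
recentred at 2^{-N}K. -/
lemma synth_rowSeq {a : MFilter d r r} (hG : SuppIn R G) (ha : Refines a G) (i : Fin r) (N : ℕ)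
    (K : Fin d → ℤ) (t : Fin d → ℝ) :
    synth (fun k => rowSeq a i N (k + K)) G t
      = G i ((1 / 2 : ℝ) ^ N • castVec K + (1 / 2 : ℝ) ^ N • t) := by
  have h1 := ha.synth_iterate_subdiv hG (Finsupp.single 0 (Matrix.of fun _ j =>
    if j = i then 1 else 0) : MFilter d 1 r) N ((1 / 2 : ℝ) ^ N • (t + castVec K))
  rw [smul_smul, ← mul_pow, show (2 * (1 / 2) : ℝ) = 1 by norm_num, one_pow, one_smul,
    synth_translate, synth_eq_sum _ (B := insert 0 (hG.exists_box
      ((1 / 2 : ℝ) ^ N • (t + castVec K))).choose) fun j k hk =>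
      Finset.mem_insert_of_mem ((hG.exists_box _).choose_spec j k hk),
    Finset.sum_eq_single 0 (fun k _ hk => by simp [Ne.symm hk])
      (fun h => absurd (Finset.mem_insert_self _ _) h)] at h1
  rw [← smul_add, add_comm (castVec K)]
  refine h1.trans ?_
  simp

lemma exists_growth_bound_polyConv {n : ℕ} {p : (Fin d → ℝ) → ℂ} (hp : p ∈ Pl d n)
    (y : MFilter d 1 r) (l : Fin r) :
    ∃ K : ℝ, ∀ k, ‖polyConv y p k 0 l‖ ≤ K * (1 + ‖k‖) ^ n := by
  obtain ⟨C, hC0, hC⟩ := exists_growth_bound hp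
  refine ⟨∑ z ∈ y.support, C * (1 + ‖z‖) ^ n * ‖y z 0 l‖, fun k => ?_⟩
  rw [polyConv_apply, Finset.sum_mul]
  refine norm_sum_le_of_le _ fun z _ => ?_
  rw [norm_mul]
  have h1 : ‖p (castVec (k - z))‖ ≤ C * (1 + ‖z‖) ^ n * (1 + ‖k‖) ^ n := by
    refine (hC _).trans ?_
    rw [norm_castVec, mul_assoc, ← mul_pow]
    have := norm_sub_le k z
    gcongr
    nlinarith [norm_nonneg k, norm_nonneg z]
  calc _ ≤ C * (1 + ‖z‖) ^ n * (1 + ‖k‖) ^ n * ‖y z 0 l‖ :=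
        mul_le_mul_of_nonneg_right h1 (norm_nonneg _)
    _ = _ := by ring

lemma exists_bound_mask (a : MFilter d r r) (N : ℕ) (i l : Fin r) :
    ∃ K : ℝ, 0 ≤ K ∧ ∀ k, ‖mask a N k i l‖ ≤ K := by
  obtain ⟨K, hK0, hK⟩ := exists_bound_conv_mask a N
    (Finsupp.single 0 (Matrix.of fun j _ => if j = l then 1 else 0) : MFilter d r 1)
  refine ⟨K, hK0, fun k => ?_⟩
  have := hK k i
  rw [conv_single, sub_zero, Matrix.mul_apply] at this
  simpa using this

/-- The masks of a stable refinable vector are locally polynomial up to `o(2^{-mN})`. -/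
theorem eventually_mask_approx {a : MFilter d r r} {m : ℕ} (hG : SuppIn R G)
    (hm : ∀ j, ContDiff ℝ m (G j)) (ha : Refines a G)
    (hg : ∀ τ, torusEval d (gram hG).det τ ≠ 0) {y : MFilter d 1 r}
    (hy : ∀ p ∈ Pl d (m + 1), ∀ l,
      act d (gram hG).det (fun z => polyConv y p z 0 l) = dualAnalysis hG p l)
    {ε : ℝ} (hε : 0 < ε) :
    ∀ᶠ N : ℕ in atTop, ∀ i l (K k : Fin d → ℤ),
      ‖mask a N (k + K) i l - polyConv y (fun t => taylorPoly (m + 1) (G i)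
          ((1 / 2 : ℝ) ^ N • castVec K) ((1 / 2 : ℝ) ^ N • t)) k 0 l‖
        ≤ ε * ((1 / 2) ^ N) ^ m * (1 + ‖k‖) ^ (m + 1) := by
  have hc : ∀ j, Continuous (G j) := fun j => (hm j).continuous
  obtain ⟨C, hC0, hC⟩ := exists_growth_bound_of_act hg (m + 1)
  obtain ⟨C', hC'0, hC'⟩ := exists_norm_dualAnalysis_le hG hc (m + 1)
  set ε₁ := ε / (C * C' + 1) with hε₁
  have hε₁0 : 0 < ε₁ := by positivity
  have key : ∀ᶠ N : ℕ in atTop, ∀ i ∈ (Finset.univ : Finset (Fin r)), ∀ x t : Fin d → ℝ,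
      ‖G i (x + (1 / 2 : ℝ) ^ N • t) - taylorPoly (m + 1) (G i) x ((1 / 2 : ℝ) ^ N • t)‖
        ≤ ε₁ * ((1 / 2) ^ N) ^ m * (1 + ‖t‖) ^ (m + 1) := by
    rw [Filter.eventually_all_finset]
    exact fun i _ => eventually_taylor_le (hm i) (hG.hasCompactSupport i) hε₁0
  filter_upwards [key] with N hN i l K k
  set x := (1 / 2 : ℝ) ^ N • castVec K with hx
  set q : (Fin d → ℝ) → ℂ := fun t => taylorPoly (m + 1) (G i) x ((1 / 2 : ℝ) ^ N • t) with hq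
  have hqP : q ∈ Pl d (m + 1) := scale_mem_Pl (taylorPoly_mem_Pl _ _ _) _
  obtain ⟨K₁, hK₁⟩ := exists_growth_bound_polyConv hqP y l
  obtain ⟨K₂, hK₂0, hK₂⟩ := exists_bound_mask a N i l
  -- After convolution with the determinant, the mask becomes the dual analysis of G_i and the
  -- polynomial sequence that of its Taylor polynomial; the difference sees only the Taylor
  -- remainder.
  have hact : act d (gram hG).det (fun z => mask a N (z + K) i l - polyConv y q z 0 l)
      = dualAnalysis hG (fun t => G i (x + (1 / 2 : ℝ) ^ N • t) - q t) l := by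
    have h1 := dualAnalysis_synth hG hc (fun k => rowSeq a i N (k + K)) l
    have h2 := hy q hqP l
    have h3 : synth (fun k => rowSeq a i N (k + K)) G
        = fun t => G i (x + (1 / 2 : ℝ) ^ N • t) := funext fun t => synth_rowSeq hG ha i N K t
    rw [h3] at h1
    simp only [rowSeq_apply] at h1
    have h4 : (fun z => mask a N (z + K) i l - polyConv y q z 0 l)
        = (fun z => mask a N (z + K) i l) - fun z => polyConv y q z 0 l := rfl
    rw [h4, map_sub, ← h1, h2]
    simp only [dualAnalysis]
    rw [← Finset.sum_sub_distrib]
    refine Finset.sum_congr rfl fun j _ => ?_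
    rw [← map_sub]
    congr 1
    ext z
    simp only [Pi.sub_apply, analysis, sub_mul]
    refine (integral_sub ?_ ?_).symm
    · exact integrable_mul_conj hG hc ((hc i).comp (by fun_prop)) j
    · exact integrable_mul_conj hG hc ((contDiff_of_mem_Pl hqP).continuous.comp (by fun_prop)) j
  -- The crude growth constant K₂ + K₁ may depend on N and K, because it does not enter the
  -- resulting bound.
  refine (hC (fun z => mask a N (z + K) i l - polyConv y q z 0 l) (K₂ + K₁)
    (C' * (ε₁ * ((1 / 2) ^ N) ^ m)) (fun z => ?_) (fun z => ?_) k).trans ?_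
  · refine (norm_sub_le _ _).trans ?_
    rw [add_mul]
    refine add_le_add ((hK₂ _).trans ?_) (hK₁ z)
    exact le_mul_of_one_le_right hK₂0 (one_le_pow₀ (by linarith [norm_nonneg z]))
  · rw [hact]
    exact hC' _ _ (hN i (Finset.mem_univ i) x) l z
  · refine mul_le_mul_of_nonneg_right ?_ (by positivity)
    have h5 : C * C' * ε₁ ≤ ε := by
      rw [hε₁, ← mul_div_assoc, div_le_iff₀ (by positivity)]
      nlinarith
    calc C * (C' * (ε₁ * ((1 / 2 : ℝ) ^ N) ^ m)) = C * C' * ε₁ * ((1 / 2) ^ N) ^ m := by ring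
      _ ≤ _ := by gcongr

end Approximation

/-! ### Smoothness of masks with stable refinable functions -/

section Stable
variable {d r R : ℕ} {G : Fin r → (Fin d → ℝ) → ℂ}

lemma subdiv_add {s : ℕ} (a : MFilter d r r) (v v' : (Fin d → ℤ) → Matrix (Fin s) (Fin r) ℂ) :
    subdiv a (v + v') = subdiv a v + subdiv a v' := by
  have h := subdiv_sub a (v + v') v'
  rw [add_sub_cancel_right] at h
  rw [h, sub_add_cancel]

/-- The defect of a polynomial sequence under subdivision, as a linear map of the polynomial. -/
def subdivDefect (a : MFilter d r r) (y : MFilter d 1 r) (k : Fin d → ℤ) (l : Fin r) :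
    ((Fin d → ℝ) → ℂ) →ₗ[ℂ] ℂ where
  toFun p := subdiv a (polyConv y p) k 0 l - polyConv y (fun x => p ((1 / 2 : ℝ) • x)) k 0 l
  map_add' p q := by
    rw [polyConv_add, subdiv_add, show (fun x => (p + q) ((1 / 2 : ℝ) • x))
      = (fun x => p ((1 / 2 : ℝ) • x)) + fun x => q ((1 / 2 : ℝ) • x) from rfl, polyConv_add]
    simp only [Pi.add_apply, Matrix.add_apply]
    ring
  map_smul' c p := by
    rw [polyConv_smul, subdiv_smul, show (fun x => (c • p) ((1 / 2 : ℝ) • x))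
      = c • (fun x => p ((1 / 2 : ℝ) • x)) from rfl, polyConv_smul]
    simp only [Pi.smul_apply, Matrix.smul_apply, smul_eq_mul, RingHom.id_apply]
    ring

lemma subdivDefect_apply (a : MFilter d r r) (y : MFilter d 1 r) (k : Fin d → ℤ) (l : Fin r)
    (p : (Fin d → ℝ) → ℂ) : subdivDefect a y k l p =
      subdiv a (polyConv y p) k 0 l - polyConv y (fun x => p ((1 / 2 : ℝ) • x)) k 0 l := rfl

lemma mono_smul (μ : Fin d → ℕ) (c : ℝ) :
    (fun t : Fin d → ℝ => mono μ (c • t)) = ((c : ℂ) ^ order μ) • mono μ := by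
  ext x
  simp only [mono, Pi.smul_apply, smul_eq_mul, Complex.ofReal_mul, mul_pow,
    Finset.prod_mul_distrib, Finset.prod_pow_eq_pow_sum, order]

/-- A polynomial in `2^{-N}` of degree `m` that is `o(2^{-mN})` vanishes. -/
lemma eq_zero_of_tendsto_two_pow (m : ℕ) : ∀ D : ℕ → ℂ,
    Tendsto (fun N : ℕ => ((2 : ℂ) ^ N) ^ m * ∑ j ∈ Finset.range (m + 1), ((1 / 2 : ℂ) ^ N) ^ j * D j)
      atTop (𝓝 0) → ∀ j ≤ m, D j = 0 := by
  have hx : Tendsto (fun N : ℕ => (1 / 2 : ℂ) ^ N) atTop (𝓝 0) :=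
    tendsto_pow_atTop_nhds_zero_of_norm_lt_one (by norm_num)
  have h21 : ∀ N : ℕ, (1 / 2 : ℂ) ^ N * 2 ^ N = 1 := fun N => by rw [← mul_pow]; norm_num
  induction m with
  | zero =>
    intro D h j hj
    obtain rfl : j = 0 := by omega
    simpa using h
  | succ m ih =>
    intro D h
    have h1 : Tendsto (fun N : ℕ => ∑ j ∈ Finset.range (m + 1 + 1), ((1 / 2 : ℂ) ^ N) ^ j * D j)
        atTop (𝓝 0) := by
      have := (hx.pow (m + 1)).mul h
      rw [mul_zero] at this
      refine this.congr fun N => ?_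
      rw [← mul_assoc, ← mul_pow, h21, one_pow, one_mul]
    have h2 : Tendsto (fun N : ℕ => ∑ j ∈ Finset.range (m + 1 + 1), ((1 / 2 : ℂ) ^ N) ^ j * D j)
        atTop (𝓝 (∑ j ∈ Finset.range (m + 1 + 1), (0 : ℂ) ^ j * D j)) :=
      tendsto_finsetSum _ fun j _ => (hx.pow j).mul_const _
    have hD0 : D 0 = 0 := by
      have h3 := tendsto_nhds_unique h2 h1
      rw [Finset.sum_range_succ'] at h3
      simpa using h3
    have h4 := ih (fun j => D (j + 1)) (h.congr fun N => by
      rw [Finset.sum_range_succ', hD0, mul_zero, add_zero, pow_succ, mul_assoc, Finset.mul_sum]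
      congr 1
      refine Finset.sum_congr rfl fun j _ => ?_
      rw [pow_succ ((1 / 2 : ℂ) ^ N) j, mul_comm _ ((1 / 2 : ℂ) ^ N), mul_assoc, ← mul_assoc,
        mul_comm (2 ^ N), h21, one_mul])
    intro j hj
    rcases j with - | j
    · exact hD0
    · exact h4 j (by omega)

lemma subdiv_apply_sum (a : MFilter d r r) (k : Fin d → ℤ) : ∃ B : Finset (Fin d → ℤ),
    ∀ (v : (Fin d → ℤ) → Matrix (Fin 1) (Fin r) ℂ) l,
      subdiv a v k 0 l = 2 ^ d * ∑ z ∈ B, ∑ j, v z 0 j * a (k - 2 • z) j l := by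
  refine ⟨box d (⌈‖k‖⌉₊ + radius a), fun v l => ?_⟩
  rw [subdiv_eq_sum a v fun y hy => mem_box_of_mask_one (Nat.le_ceil _) hy, Matrix.smul_apply,
    Matrix.sum_apply, smul_eq_mul]
  congr 1

lemma subdiv_translate (a : MFilter d r r) (v : (Fin d → ℤ) → Matrix (Fin 1) (Fin r) ℂ)
    (k K : Fin d → ℤ) : subdiv a (fun z => v (z + K)) k = subdiv a v (k + 2 • K) := by
  rw [subdiv, subdiv]
  congr 1
  rw [← finsum_comp_equiv (Equiv.addRight K) (f := fun z => v z * a (k + 2 • K - 2 • z))]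
  refine finsum_congr fun z => ?_
  rw [Equiv.coe_addRight]
  congr 2
  rw [smul_add]
  abel

/-- The polynomial approximants of the masks satisfy a refinement relation. -/
lemma tendsto_subdivDefect {a : MFilter d r r} {m : ℕ} {y : MFilter d 1 r}
    (happ : ∀ ε > 0, ∀ᶠ N : ℕ in atTop, ∀ i l (K k : Fin d → ℤ),
      ‖mask a N (k + K) i l - polyConv y (fun t => taylorPoly (m + 1) (G i)
          ((1 / 2 : ℝ) ^ N • castVec K) ((1 / 2 : ℝ) ^ N • t)) k 0 l‖
        ≤ ε * ((1 / 2) ^ N) ^ m * (1 + ‖k‖) ^ (m + 1))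
    (i l : Fin r) (n₀ : ℕ) (K₀ k : Fin d → ℤ) :
    Tendsto (fun n : ℕ => ((2 : ℂ) ^ (n + n₀)) ^ m * subdivDefect a y k l
      (fun t => taylorPoly (m + 1) (G i) ((1 / 2 : ℝ) ^ n₀ • castVec K₀)
        ((1 / 2 : ℝ) ^ (n + n₀) • t))) atTop (𝓝 0) := by
  set P := taylorPoly (m + 1) (G i) ((1 / 2 : ℝ) ^ n₀ • castVec K₀) with hP
  set A : ℕ → (Fin d → ℤ) → Matrix (Fin 1) (Fin r) ℂ := fun n =>
    polyConv y fun t => P ((1 / 2 : ℝ) ^ (n + n₀) • t) with hA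
  -- All levels look at the same dyadic point, hence at the same Taylor polynomial P.
  have hpt : ∀ n : ℕ, (1 / 2 : ℝ) ^ (n + n₀) • castVec (2 ^ n • K₀)
      = (1 / 2 : ℝ) ^ n₀ • castVec K₀ := by
    intro n
    rw [castVec_two_pow_smul, smul_smul, pow_add, mul_right_comm, ← mul_pow]
    norm_num
  have hlim : ∀ z l, Tendsto (fun n : ℕ => ((2 : ℂ) ^ (n + n₀)) ^ m *
      (rowSeq a i (n + n₀) (z + 2 ^ n • K₀) 0 l - A n z 0 l)) atTop (𝓝 0) := by
    intro z l
    rw [Metric.nhds_basis_closedBall.tendsto_right_iff]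
    intro ε hε
    have h1 := (happ (ε / (1 + ‖z‖) ^ (m + 1)) (by positivity))
    filter_upwards [(tendsto_add_atTop_nat n₀).eventually h1] with n hn
    have h2 := hn i l (2 ^ n • K₀) z
    rw [hpt, ← hP] at h2
    rw [mem_closedBall_zero_iff, norm_mul, norm_pow, norm_pow, Complex.norm_ofNat, rowSeq_apply]
    refine (mul_le_mul_of_nonneg_left h2 (by positivity)).trans (le_of_eq ?_)
    have h3 : ((2 : ℝ) ^ (n + n₀)) ^ m * ((1 / 2) ^ (n + n₀)) ^ m = 1 := by
      rw [← mul_pow, ← mul_pow]; norm_num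
    have h4 : (1 + ‖z‖) ^ (m + 1) ≠ 0 := by positivity
    calc _ = (((2 : ℝ) ^ (n + n₀)) ^ m * ((1 / 2) ^ (n + n₀)) ^ m) *
          (ε / (1 + ‖z‖) ^ (m + 1) * (1 + ‖z‖) ^ (m + 1)) := by ring
      _ = ε := by rw [h3, one_mul, div_mul_cancel₀ _ h4]
  obtain ⟨B, hB⟩ := subdiv_apply_sum a k
  have hS : Tendsto (fun n : ℕ => ((2 : ℂ) ^ (n + n₀)) ^ m *
      (subdiv a (fun z => rowSeq a i (n + n₀) (z + 2 ^ n • K₀)) k 0 l - subdiv a (A n) k 0 l))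
      atTop (𝓝 0) := by
    have h1 : Tendsto (fun n : ℕ => (2 : ℂ) ^ d * ∑ z ∈ B, ∑ j, (((2 : ℂ) ^ (n + n₀)) ^ m *
        (rowSeq a i (n + n₀) (z + 2 ^ n • K₀) 0 j - A n z 0 j)) * a (k - 2 • z) j l) atTop
        (𝓝 ((2 : ℂ) ^ d * ∑ z ∈ B, ∑ j, 0 * a (k - 2 • z) j l)) :=
      Tendsto.const_mul _ (tendsto_finsetSum _ fun z _ => tendsto_finsetSum _ fun j _ =>
        (hlim z j).mul_const _)
    simp only [zero_mul, Finset.sum_const_zero, mul_zero] at h1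
    refine h1.congr fun n => ?_
    rw [hB, hB, ← mul_sub, mul_left_comm, ← Finset.sum_sub_distrib, Finset.mul_sum,
      Finset.mul_sum, Finset.mul_sum]
    refine Finset.sum_congr rfl fun z _ => ?_
    rw [← Finset.sum_sub_distrib, Finset.mul_sum, Finset.mul_sum, Finset.mul_sum]
    exact Finset.sum_congr rfl fun j _ => by ring
  -- Both the error at level n + 1 and the subdivided error at level n are negligible; since masks
  -- satisfy the recursion exactly, their difference is the subdivision defect of the rescaled P.
  have hN := ((hlim k l).comp (tendsto_add_atTop_nat 1)).const_mul ((1 / 2 : ℂ) ^ m)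
  have h5 := hN.sub hS
  rw [mul_zero, sub_zero] at h5
  refine h5.congr fun n => ?_
  have h6 : rowSeq a i (n + 1 + n₀) (k + 2 ^ (n + 1) • K₀) 0 l
      = subdiv a (fun z => rowSeq a i (n + n₀) (z + 2 ^ n • K₀)) k 0 l := by
    rw [subdiv_translate, ← rowSeq_succ, smul_smul, ← pow_succ', add_right_comm]
  have h7 : A (n + 1) = polyConv y fun x => P ((1 / 2 : ℝ) ^ (n + n₀) • ((1 / 2 : ℝ) • x)) := by
    simp only [hA, smul_smul, ← pow_succ, add_right_comm]
  have h8 : (1 / 2 : ℂ) ^ m * ((2 : ℂ) ^ (n + 1 + n₀)) ^ m = ((2 : ℂ) ^ (n + n₀)) ^ m := by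
    rw [← mul_pow, add_right_comm, pow_succ]
    congr 1
    ring
  simp only [Function.comp]
  rw [← mul_assoc, h8, h6, subdivDefect_apply, ← h7]
  ring

/-- The dual filter of a stable refinable vector is a matching filter. -/
theorem isMatchingFilter_of_approx {a : MFilter d r r} {m : ℕ} {y : MFilter d 1 r}
    (hG : SuppIn R G) (hm : ∀ j, ContDiff ℝ m (G j)) {i : Fin r} (hi : ∫ x, G i x ≠ 0)
    (hy0 : symbol y 0 ≠ 0)
    (happ : ∀ ε > 0, ∀ᶠ N : ℕ in atTop, ∀ i l (K k : Fin d → ℤ),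
      ‖mask a N (k + K) i l - polyConv y (fun t => taylorPoly (m + 1) (G i)
          ((1 / 2 : ℝ) ^ N • castVec K) ((1 / 2 : ℝ) ^ N • t)) k 0 l‖
        ≤ ε * ((1 / 2) ^ N) ^ m * (1 + ‖k‖) ^ (m + 1)) :
    IsMatchingFilter a (m + 1) y := by
  have hcd : ∀ μ ∈ orderLT d (m + 1), ContDiff ℝ (order μ) (G i) := fun μ hμ =>
    contDiff_nat_of_le (hm i) (Nat.lt_succ_iff.1 (mem_orderLT.1 hμ))
  suffices h : ∀ k l, ∀ μ ∈ orderLT d (m + 1), subdivDefect a y k l (mono μ) = 0 by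
    refine (isMatchingFilter_iff a (m + 1) y).2 ⟨hy0, fun p hp => ?_⟩
    ext k i' l
    obtain rfl : i' = 0 := Subsingleton.elim _ _
    have h1 : subdivDefect a y k l p = 0 :=
      Pl_induction (P := fun p => subdivDefect a y k l p = 0)
        (fun μ hμ => h k l μ (mem_orderLT.2 hμ)) (map_zero _)
        (fun f g hf hg => by rw [map_add, hf, hg, add_zero])
        (fun c f hf => by rw [map_smul, hf, smul_zero]) hp
    rw [subdivDefect_apply, sub_eq_zero] at h1
    exact h1
  intro k l
  -- The defect of the rescaled Taylor polynomial is a polynomial in 2^{-N} of degree at most m, so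
  -- being o(2^{-mN}) kills each homogeneous part separately.
  have hdyadic : ∀ j ≤ m, ∀ (n₀ : ℕ) (K₀ : Fin d → ℤ),
      ∑ μ ∈ orderLT d (m + 1) with order μ = j,
        partialDeriv μ (G i) ((1 / 2 : ℝ) ^ n₀ • castVec K₀) / mfact μ *
          subdivDefect a y k l (mono μ) = 0 := by
    intro j hj n₀ K₀
    refine eq_zero_of_tendsto_two_pow m (fun j => ∑ μ ∈ orderLT d (m + 1) with order μ = j,
        partialDeriv μ (G i) ((1 / 2 : ℝ) ^ n₀ • castVec K₀) / mfact μ *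
          subdivDefect a y k l (mono μ)) ((tendsto_add_atTop_iff_nat n₀).1
            ((tendsto_subdivDefect happ i l n₀ K₀ k).congr fun n => ?_)) j hj
    congr 1
    have h1 : (fun t => taylorPoly (m + 1) (G i) ((1 / 2 : ℝ) ^ n₀ • castVec K₀)
        ((1 / 2 : ℝ) ^ (n + n₀) • t)) = ∑ μ ∈ orderLT d (m + 1),
          (partialDeriv μ (G i) ((1 / 2 : ℝ) ^ n₀ • castVec K₀) / mfact μ *
            ((1 / 2 : ℂ) ^ (n + n₀)) ^ order μ) • mono μ := by
      ext t
      rw [taylorPoly, Finset.sum_apply, Finset.sum_apply]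
      refine Finset.sum_congr rfl fun μ _ => ?_
      have h2 := congrFun (mono_smul μ ((1 / 2 : ℝ) ^ (n + n₀))) t
      simp only [Pi.smul_apply, smul_eq_mul] at h2 ⊢
      rw [h2]
      push_cast
      ring
    rw [h1, map_sum]
    simp only [map_smul, smul_eq_mul, Finset.mul_sum]
    rw [← Finset.sum_fiberwise_of_maps_to (t := Finset.range (m + 1)) (g := order)
      fun μ hμ => Finset.mem_range.2 (mem_orderLT.1 hμ)]
    refine Finset.sum_congr rfl fun j _ => Finset.sum_congr rfl fun μ hμ => ?_
    rw [(Finset.mem_filter.1 hμ).2]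
    ring
  intro μ' hμ'
  have hall : (fun x => ∑ μ ∈ orderLT d (m + 1) with order μ = order μ',
      partialDeriv μ (G i) x / mfact μ * subdivDefect a y k l (mono μ)) = fun _ => 0 := by
    refine eq_of_dyadic ?_ continuous_const fun n₀ K₀ =>
      hdyadic _ (Nat.lt_succ_iff.1 (mem_orderLT.1 hμ')) n₀ K₀
    exact continuous_finsetSum _ fun μ hμ =>
      ((continuous_partialDeriv (hcd μ (Finset.mem_filter.1 hμ).1)).div_const _).mul_const _
  have hmono : ∀ n : ℕ, ContDiff ℝ n (mono μ') := fun n => contDiff_infty.1 (contDiff_mono μ') n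
  have hint : ∀ μ ∈ orderLT d (m + 1), Integrable fun x => partialDeriv μ (G i) x * mono μ' x :=
    fun μ hμ => by
      have hc := continuous_partialDeriv (hcd μ hμ)
      have hs := hasCompactSupport_partialDeriv (hG.hasCompactSupport i) (hcd μ hμ)
      exact (hc.mul (hmono 0).continuous).integrable_of_hasCompactSupport hs.mul_right
  -- Pairing with x^{μ'} and integrating by parts isolates a single multi-index: among orders equal
  -- to |μ'|, only ∂^{μ'} leaves a nonzero constant, multiplied by the nonzero integral of G_i.
  have h0 : ∫ x, (∑ μ ∈ orderLT d (m + 1) with order μ = order μ',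
      partialDeriv μ (G i) x / mfact μ * subdivDefect a y k l (mono μ)) * mono μ' x = 0 := by
    have := fun x => congrFun hall x
    simp only [this, zero_mul, integral_zero]
  have h1 : ∀ x, (∑ μ ∈ orderLT d (m + 1) with order μ = order μ',
      partialDeriv μ (G i) x / mfact μ * subdivDefect a y k l (mono μ)) * mono μ' x
      = ∑ μ ∈ orderLT d (m + 1) with order μ = order μ',
        (subdivDefect a y k l (mono μ) / mfact μ) * (partialDeriv μ (G i) x * mono μ' x) := by
    intro x
    rw [Finset.sum_mul]
    exact Finset.sum_congr rfl fun μ _ => by ring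
  simp only [h1] at h0
  rw [integral_finsetSum _ fun μ hμ => (hint μ (Finset.mem_filter.1 hμ).1).const_mul _,
    Finset.sum_eq_single μ'] at h0
  · rw [integral_const_mul, integral_partialDeriv_mul (hcd μ' hμ') (hG.hasCompactSupport i)
      (hmono _)] at h0
    simp only [partialDeriv_mono_of_order_eq rfl, if_true, integral_mul_const] at h0
    have hf := mfact_ne_zero μ'
    have hs : ((-1 : ℂ)) ^ order μ' ≠ 0 := pow_ne_zero _ (by norm_num)
    simpa [hf, hs, hi] using h0
  · intro μ hμ hne
    obtain ⟨hμ1, hμ2⟩ := Finset.mem_filter.1 hμ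
    rw [integral_const_mul, integral_partialDeriv_mul (hcd μ hμ1) (hG.hasCompactSupport i)
      (hmono _)]
    simp only [partialDeriv_mono_of_order_eq hμ2, if_neg hne, mul_zero, integral_zero]
  · intro h
    exact (h (Finset.mem_filter.2 ⟨hμ', rfl⟩)).elim

/-- Around each point the mask is a sequence p * y with deg p ≤ m, which w annihilates, plus an
error o(2^{-mN}) on the finite support of w. -/
lemma decays_of_approx {a : MFilter d r r} {m : ℕ} {y : MFilter d 1 r}
    (happ : ∀ ε > 0, ∀ᶠ N : ℕ in atTop, ∀ i l (K k : Fin d → ℤ),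
      ‖mask a N (k + K) i l - polyConv y (fun t => taylorPoly (m + 1) (G i)
          ((1 / 2 : ℝ) ^ N • castVec K) ((1 / 2 : ℝ) ^ N • t)) k 0 l‖
        ≤ ε * ((1 / 2) ^ N) ^ m * (1 + ‖k‖) ^ (m + 1))
    {w : MFilter d r 1} (hw : w ∈ vanishSub (m + 1) y) : Decays a m w := by
  intro ε hε
  set W := ∑ z ∈ w.support, ∑ l, (1 + ‖-z‖) ^ (m + 1) * ‖w z l 0‖ with hW
  have hW0 : 0 ≤ W := Finset.sum_nonneg fun z _ => Finset.sum_nonneg fun l _ => by positivity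
  filter_upwards [happ (ε / (W + 1)) (by positivity)] with N hN k i
  set q : (Fin d → ℝ) → ℂ := fun t => taylorPoly (m + 1) (G i)
    ((1 / 2 : ℝ) ^ N • castVec k) ((1 / 2 : ℝ) ^ N • t) with hq
  have hqP : q ∈ Pl d (m + 1) := scale_mem_Pl (taylorPoly_mem_Pl _ _ _) _
  have h0 := mem_vanishSub.1 hw q hqP
  rw [conv_apply_support, Matrix.sum_apply] at h0
  have h1 : conv (mask a N) w k i 0 = ∑ z ∈ w.support, ∑ l,
      (mask a N (-z + k) i l - polyConv y q (-z) 0 l) * w z l 0 := by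
    rw [conv_apply_support, Matrix.sum_apply, ← sub_zero (∑ c ∈ w.support, _), ← h0,
      ← Finset.sum_sub_distrib]
    refine Finset.sum_congr rfl fun z _ => ?_
    rw [Matrix.mul_apply, Matrix.mul_apply, ← Finset.sum_sub_distrib]
    refine Finset.sum_congr rfl fun l _ => ?_
    rw [zero_sub, sub_mul, neg_add_eq_sub]
  have h2 : ‖conv (mask a N) w k i 0‖ ≤ ε / (W + 1) * ((1 / 2) ^ N) ^ m * W := by
    rw [h1, hW, Finset.mul_sum]
    refine norm_sum_le_of_le _ fun z _ => ?_
    rw [Finset.mul_sum]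
    refine norm_sum_le_of_le _ fun l _ => ?_
    rw [norm_mul, ← mul_assoc]
    exact mul_le_mul_of_nonneg_right (hN i l k (-z)) (norm_nonneg _)
  have h3 : (2 : ℝ) ^ (m * N) * ((1 / 2) ^ N) ^ m = 1 := by
    rw [← pow_mul, mul_comm N, ← mul_pow]; norm_num
  have h4 : ε / (W + 1) * W ≤ ε := by
    rw [div_mul_eq_mul_div, div_le_iff₀ (by positivity)]
    nlinarith
  calc (2 : ℝ) ^ (m * N) * ‖conv (mask a N) w k i 0‖
      ≤ 2 ^ (m * N) * (ε / (W + 1) * ((1 / 2) ^ N) ^ m * W) := by gcongr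
    _ = ((2 : ℝ) ^ (m * N) * ((1 / 2) ^ N) ^ m) * (ε / (W + 1) * W) := by ring
    _ ≤ ε := by rw [h3, one_mul]; exact h4

/-- A `C^m` refinable vector with stable integer shifts has smoothness exponent above `m`. -/
theorem lt_smInf_of_stable {a : MFilter d r r} {υ : MFilter d 1 r} {φ : Fin r → CSDist d} {m : ℕ}
    (hφ : IsStdRefinable a υ φ) (hm : ∀ i, (φ i).IsCm m) (hst : HasStableShifts φ) :
    (m : EReal) < smInf a := by
  obtain ⟨R, G, hG, hGm, ha, hG1, hφG⟩ := hφ.exists_functions hm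
  have hc : ∀ j, Continuous (G j) := fun j => (hGm j).continuous
  have hg := torusEval_det_gram_ne_zero hG hc hφG hst
  obtain ⟨y, hy⟩ := exists_dual_filter hG hc hg m
  obtain ⟨i, hi⟩ : ∃ i, ∫ x, G i x ≠ 0 := by
    by_contra h
    push Not at h
    simp [h, dotProduct] at hG1
  have happ := fun ε (hε : (0 : ℝ) < ε) => eventually_mask_approx hG hGm ha hg hy hε
  have hy0 := dual_filter_symbol_ne_zero hG hg (hy 1 (one_mem_Pl (Nat.succ_pos m))) hi
  exact lt_smInf_of_decays (isMatchingFilter_of_approx hG hGm hi hy0 happ)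
    fun w hw => decays_of_approx happ hw

end Stable

end GHSD

end

theorem theorem4p3 {d r : ℕ} [NeZero d] [NeZero r] (m : ℕ) (ν : Fin r → Fin d → ℕ)
    (hν : ∀ l, order (ν l) ≤ m) (hν0 : ν 0 = 0)
    (a : MFilter d r r)
    (ha1 : (symbol a 0).charpoly.rootMultiplicity 1 = 1)
    (ha2 : ∀ n : ℕ, 1 ≤ n →
      ¬ Module.End.HasEigenvalue (Matrix.toLin' (symbol a 0)) ((2 : ℂ) ^ n))
    (υ : MFilter d 1 r) (hυ : IsMatchingFilter a (maxOrder ν + 1) υ) :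
    (∃! φ : Fin r → CSDist d, IsStdRefinable a υ φ) ∧
    ∀ φ : Fin r → CSDist d, IsStdRefinable a υ φ →
      (HermiteConvergent m ν a →
        0 < smInf a ∧ (∀ i, (φ i).IsCm m) ∧
        (∃ c : ℂ, c ≠ 0 ∧ HasHermiteForm ν (c • υ)) ∧
        (HasStableShifts φ → (m : EReal) < smInf a)) ∧
      ((maxOrder ν : EReal) < smInf a → (∀ i, (φ i).IsCm m) → HasHermiteForm ν υ →
        HermiteConvergent m ν a) := by
  refine ⟨existsUnique_isStdRefinable ha1 ha2 (Nat.succ_pos _) hυ, fun φ hφ => ⟨fun hconv => ?_,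
    fun hsm hm hH => hermiteConvergent_of_lt_smInf hν ha1 hυ hφ hsm hm hH⟩⟩
  obtain ⟨G, hG, hlim⟩ := hconv.exists_maskLimit
  have hCm := hlim.isCm hν0 ha1 ha2 hν hG hυ hφ
  exact ⟨hlim.smInf_pos hν0 hν hG hυ, hCm,
    ⟨_, inv_ne_zero (hlim.normalization_ne_zero hν0 hν hG hυ),
      hlim.hasHermiteForm hν0 hν hG hυ⟩, fun hst => lt_smInf_of_stable hφ hCm hst⟩
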